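/- **Setting.** Let $F$ be a nonarchimedean local field of characteristic $0$ with ring of integers $\mathfrak o$, maximal ideal $\mathfrak p$, prime element $\varpi$, residue field of order $q$, normalized absolute value $|\varpi|=q^{-1}$, and let $\psi$ be an additive character of $F$ trivial on $\mathfrak o$ but not on $\mathfrak p^{-1}$. Give $F$ and $F^\times$ the Haar measures with $\mathrm{vol}(\mathfrak o)=\mathrm{vol}(\mathfrak o^\times)=1$ and $\mathrm{Sym}_3(F)\cong F^6$ (the entries $z_{ij}$, $i\le j$) the product measure. For a quasi-character $\mu$ of $F^\times$ let $c(\mu)\ge 0$ be the smallest integer $n$ with $\mu$ trivial on $\mathfrak o^\times\cap(1+\mathfrak p^n)$, and $\varphi_\mu=\mu\cdot\mathbb I_{\mathfrak o^\times}$; put $\hat\varphi(y)=\int_F\varphi(z)\psi(zy)\,dz$. Put $\mathbf n(x)=\begin{pmatrix}1&x\\0&1\end{pmatrix}$, $\mathbf t(a)=\mathrm{diag}(a,1)$, $J_g=\begin{pmatrix}0&-\mathbf 1_g\\ \mathbf 1_g&0\end{pmatrix}$, $t_n=J_1^{-1}\mathrm{diag}(\varpi^n,\varpi^{-n})$, and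 let $\rho$ be right translation. $\mathrm{GSp}_6=\{g: gJ_3g^{\rm t}=\lambda(g)J_3\}$. For quasi-characters $\omega,\chi$, $I_3(\omega,\chi)$ is the space of smooth functions $f$ on $\mathrm{GSp}_6(F)$ with $$f\left(\begin{pmatrix}A&0\\0&\lambda (A^{\rm t})^{-1}\end{pmatrix}\begin{pmatrix}\mathbf 1&z\\0&\mathbf 1\end{pmatrix}g\right)=\omega(\lambda^{-2}\det A)\,\chi(\lambda^{-3}(\det A)^2)\,|\lambda^{-3}(\det A)^2|\,f(g)$$ for $A\in\mathrm{GL}_3(F)$, $\lambda\in F^\times$, $z\in\mathrm{Sym}_3(F)$. For a Schwartz function $\Phi$ on $\mathrm{Sym}_3(F)$, let $f_\Phi(\omega,\chi)\in I_3(\omega,\chi)$ be the function supported on the big cell with $f_\Phi\left(J_3\begin{pmatrix}\mathbf 1&z\\0&\mathbf 1\end{pmatrix}\right)=\Phi(z)$. For quasi-characters $\xi_1,\xi_2,\xi_3$ put $$\Phi_{\xi}(z)=\prod_{i=1}^3\widehat{\mathbb I_{\mathfrak p}}(z_{ii})\cdot\widehat{\varphi_{\xi_1}}(z_{23})\,\widehat{\varphi_{\xi_2}}(z_{13})\,\widehat{\varphi_{\xi_3}}(z_{12}).$$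 For $B\in\mathrm{Sym}_3(F)$ put $\mathcal W_B(f)=\int_{\mathrm{Sym}_3(F)}f\left(J_3\begin{pmatrix}\mathbf 1&z\\0&\mathbf 1\end{pmatrix}\right)\psi(-\mathrm{tr}(Bz))\,dz$, and $(y_1,y_2,y_3)=(b_{23},b_{13},b_{12})$. Let $\Xi_{\mathfrak p}$ be the set of $B\in \mathrm{Sym}_3(F)$ with $b_{ii}\in\mathfrak p$ and $2y_i\in\mathfrak o^\times$ for all $i$. Let $H=\{(g_1,g_2,g_3)\in\mathrm{GL}_2(F)^3:\det g_1=\det g_2=\det g_3\}$, $Z$ the group of scalar matrices (embedded diagonally in $H$), $U^0=\{(\mathbf n(x_1),\mathbf n(x_2),\mathbf n(x_3)):x_1+x_2+x_3=0\}$, and $\iota:H\to\mathrm{GSp}_6(F)$ the embedding placing the entries of $g_i=\begin{pmatrix}a_i&b_i\\c_i&d_i\end{pmatrix}$ in the diagonal positions $(i,i),(i,i+3),(i+3,i),(i+3,i+3)$. With $$\eta=\begin{pmatrix}0&0&0&-1&0&0\\0&1&0&0&0&0\\0&0&1&0&0&0\\1&1&1&0&0&0\\0&0&0&-1&1&0\\0&0&0&-1&0&1\end{pmatrix}$$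 set $$Z(W_1,W_2,W_3,f)=\int_{U^0Z\backslash H}W_1(g_1)W_2(g_2)W_3(g_3)f(\eta\,\iota(g_1,g_2,g_3))\,dg,$$ where $Z\backslash H$ carries the Haar measure for which the image of $H\cap\mathrm{GL}_2(\mathfrak o)^3$ has volume $1$, and $U^0\cong F^2$ (via $(x_2,x_3)$) the measure $dx_2\,dx_3$. For quasi-characters $\mu,\nu$ let $I(\mu,\nu)$ be the normalized principal series of $\mathrm{GL}_2(F)$: smooth functions with $f\left(\begin{pmatrix}a&b\\0&d\end{pmatrix}g\right)=\mu(a)\nu(d)|a/d|^{1/2}f(g)$. For an irreducible admissible infinite dimensional $\pi$ let $\mathscr W(\pi)$ be its $\psi$-Whittaker model ($W(\mathbf n(x)g)=\psi(x)W(g)$). $\gamma(s,\chi,\psi)$ is the Tate gamma factor, and $\gamma(s,\pi\otimes\chi,\psi)$ is the rational function of $q^{-s}$ with $$\gamma(s,\pi\otimes\chi,\psi)\int_{F^\times}W(\mathbf t(a))\chi(a)|a|^{s-\frac12}d^\times a=\int_{F^\times}W(\mathbf t(a)J_1^{-1})(\chi\omega_\pi)(a)^{-1}|a|^{\frac12-s}d^\times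 a\qquad(W\in\mathscr W(\pi)),$$ in the sense of analytic continuation, $\omega_\pi$ being the central character. Let $\pi_1,\pi_2,\pi_3$ be irreducible admissible infinite dimensional representations of $\mathrm{GL}_2(F)$ with central characters $\omega_i$, put $\hat\omega=\omega_1\omega_2\omega_3$, and let $\chi,\mu_i,\nu_i$ be quasi-characters of $F^\times$. **(A)** Suppose that $\pi_i$ is a quotient of $I(\mu_i,\nu_i)$ for $i=1,2,3$. Put $\xi_1=\chi\mu_1\nu_2\nu_3$, $\xi_2=\chi\nu_1\mu_2\nu_3$, $\xi_3=\chi\nu_1\nu_2\mu_3$, $\Phi=\Phi_\xi$ and $f_s=f_{\Phi}(\hat\omega,\chi|\cdot|^s)$. Then: 1. $f_s$ is a holomorphic section of $I_3(\hat\omega,\chi|\cdot|^s)$. 2. Let $n\ge\max\{1,c(\chi),c(\mu_i),c(\nu_i)\mid i=1,2,3\}$. Let $W_i^{\rm ord}\in\mathscr W(\pi_i)$ be the function with $W_i^{\rm ord}(\mathbf t(a))=\nu_i(a)|a|^{1/2}\mathbb I_{\mathfrak o}(a)$, and put $W_i^{(n)}=\rho(t_n)W_i^{\rm ord}$, $\alpha_i=\mu_i(\varpi)$,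 $\beta_i=\nu_i(\varpi)$. Then for $\mathrm{Re}\,s$ sufficiently large the integral $Z(W^{(n)}_1,W^{(n)}_2,W^{(n)}_3,f_s)$ converges absolutely and equals $$(1+q^{-1})^{-3}\prod_{j=1}^3\left(\frac{\beta_j}{q\alpha_j}\right)^n(\chi\nu_1\nu_2\nu_3)(-1)\,\gamma\left(s+\tfrac12,\pi_1\otimes\chi\nu_2\nu_3,\psi\right)^{-1}\prod_{i=2,3}\gamma\left(s+\tfrac12,\chi\nu_1\nu_i\mu_{5-i},\psi\right)^{-1},$$ a meromorphic function of $s\in\mathbf C$ (so that the identity holds for all $s$ by meromorphic continuation). 3. For all $s$ and all $B\in\mathrm{Sym}_3(F)$ the integral $\mathcal W_B(f_s)$ converges absolutely and $$\mathcal W_B(f_s)=\chi(8y_1y_2y_3)\prod_{i=1}^3\mu_i(2y_i)\,\mathbb I_{\mathfrak o^\times}(2y_i)\,\mathbb I_{\mathfrak p}(b_{ii})\prod_{j\neq i}\nu_j(2y_i)$$ (read as $0$ if some $y_i=0$); it is nonzero if and only if $B\in\Xi_{\mathfrak p}$. **(B)** Suppose that $\pi_i$ is a subrepresentation of $I(\mu_i,\nu_i)$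 with $\mu_i$ unramified for $i=1,2,3$. Put $\mathcal D=(\chi,\omega_1,\omega_2,\omega_3)$, $\Phi_{\mathcal D}=\Phi_{(\chi\omega_1,\chi\omega_2,\chi\omega_3)}$ and $f_{\mathcal D,s}=f_{\Phi_{\mathcal D}}(\hat\omega^{-1},\chi\hat\omega|\cdot|^s)$. Then: 1. $f_{\mathcal D,s}$ is a holomorphic section of $I_3(\hat\omega^{-1},\chi\hat\omega|\cdot|^s)$. 2. Let $n\ge\max\{1,c(\chi),c(\omega_i)\mid i=1,2,3\}$. If $g_i=\begin{pmatrix}a_i&b_i\\c_i&d_i\end{pmatrix}\in\mathrm{GL}_2(\mathfrak o)$ with $c_i\in\mathfrak p^{2n}$ ($i=1,2,3$) and $\det g_1=\det g_2=\det g_3$, then $\rho(\iota(g_1,g_2,g_3))f_{\mathcal D,s}=\omega_1(d_1)\omega_2(d_2)\omega_3(d_3)\,f_{\mathcal D,s}$ for all $s$. 3. For all $s$ and all $B\in\mathrm{Sym}_3(F)$ the integral $\mathcal W_B(f_{\mathcal D,s})$ converges absolutely, and it equals $\chi(8y_1y_2y_3)\,\omega_1(2y_1)\omega_2(2y_2)\omega_3(2y_3)$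 if $B\in\Xi_{\mathfrak p}$, and $0$ otherwise. 4. Let $n$ be as in 2, let $\breve W_i\in\mathscr W(\pi_i^\vee)$ be the function with $\breve W_i(\mathbf t(a))=\nu_i(a)^{-1}|a|^{1/2}\mathbb I_{\mathfrak o}(a)$, let $\zeta(s)=(1-q^{-s})^{-1}$, let $L(s,\pi_1\times\pi_2\times\pi_3\otimes\chi)$ be the triple product $L$-factor (that of the twisted tensor product of the Weil–Deligne representations of the $\pi_i$), and put $$Z^*_{\mathfrak p}(f_{\mathcal D,s})=\frac{Z(\rho(t_n)\breve W_1,\rho(t_n)\breve W_2,\rho(t_n)\breve W_3,f_{\mathcal D,s})}{L(s+\frac12,\pi_1\times\pi_2\times\pi_3\otimes\chi)}\prod_{i=1}^3\frac{\zeta(1)}{\zeta(2)}\left(\frac{\omega_i(\varpi)q}{\mu_i(\varpi)^2}\right)^n,$$ $$E_{\mathfrak p}(s,\pi_1\times\pi_2\times\pi_3\otimes\chi)^{-1}=L(s,\pi_1\times\pi_2\times\pi_3\otimes\chi)\,\gamma(s,\pi_1\otimes\chi\mu_2\mu_3,\psi)\prod_{i=2,3}\gamma(s,\chi\mu_1\mu_i\nu_{5-i},\psi).$$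 Then for $\mathrm{Re}\,s$ sufficiently large the zeta integral converges absolutely and $$Z^*_{\mathfrak p}(f_{\mathcal D,s})=\chi(-1)\,E_{\mathfrak p}\left(s+\tfrac12,\pi_1\times\pi_2\times\pi_3\otimes\chi\right),$$ where the right hand side is meromorphic on $\mathbf C$ (so that the identity holds for all $s$ by meromorphic continuation). -/

import Mathlib

noncomputable section

open MeasureTheory
open scoped Matrix MatrixGroups

namespace Garrett

/-! ### The local field, its measures and its quasi-characters

`F` is a nonarchimedean local field: a nontrivially normed, ultrametric, locally compact field.
The theorem assumes in addition that the norm is the normalized absolute value. -/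

/-- The order `q` of the residue field. -/
def resCard (F : Type*) [NontriviallyNormedField F] [IsUltrametricDist F] : ℕ :=
  Nat.card (IsLocalRing.ResidueField (NormedField.valuation (K := F)).valuationSubring)

/-- `ϖ` generates the maximal ideal of the ring of integers. -/
def IsUniformizer {F : Type*} [NontriviallyNormedField F] (ϖ : F) : Prop :=
  ϖ ≠ 0 ∧ ‖ϖ‖ < 1 ∧ ∀ x : F, ‖x‖ < 1 → ‖x‖ ≤ ‖ϖ‖

/-- The additive Haar measure on `F` which gives the ring of integers volume `1`. -/
def haarF (F : Type*) [NontriviallyNormedField F] [ProperSpace F] [MeasurableSpace F]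
    [BorelSpace F] : Measure F :=
  Measure.addHaarMeasure
    ⟨⟨Metric.closedBall 0 1, isCompact_closedBall 0 1⟩,
      ⟨0, Metric.ball_subset_interior_closedBall (Metric.mem_ball_self one_pos)⟩⟩

/-- The Haar measure `(1 - q⁻¹)⁻¹ da / |a|` on `Fˣ`, for which the units have volume `1`. -/
def haarFx (F : Type*) [NontriviallyNormedField F] [IsUltrametricDist F] [ProperSpace F]
    [MeasurableSpace F] [BorelSpace F] : Measure Fˣ :=
  ENNReal.ofReal (1 - (resCard F : ℝ)⁻¹)⁻¹ •
    ((haarF F).withDensity (fun x => ENNReal.ofReal ‖x‖⁻¹)).comap Units.val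

/-- Quasi-characters: continuous homomorphisms `Fˣ → ℂˣ`. -/
abbrev QuasiChar (F : Type*) [NontriviallyNormedField F] : Type _ := Fˣ →ₜ* ℂˣ

/-- The quasi-character `|·|^s`. -/
def absPow (F : Type*) [NontriviallyNormedField F] (s : ℂ) : QuasiChar F where
  toFun u := Units.mk0 (((‖(u : F)‖ : ℝ) : ℂ) ^ s)
    (by simp [Complex.cpow_eq_zero_iff])
  map_one' := by ext; simp
  map_mul' u v := by
    ext
    simp [Complex.mul_cpow_ofReal_nonneg (norm_nonneg _) (norm_nonneg _)]
  continuous_toFun := by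
    have h : Continuous fun u : Fˣ => (((‖(u : F)‖ : ℝ) : ℂ)) ^ s := by
      refine Continuous.cpow
        (Complex.continuous_ofReal.comp (continuous_norm.comp Units.continuous_val))
        continuous_const fun u => ?_
      exact Complex.ofReal_mem_slitPlane.2 (norm_pos_iff.2 u.ne_zero)
    rw [Units.continuous_iff]
    refine ⟨h, ?_⟩
    have h2 : (Units.val ∘ fun u : Fˣ => (Units.mk0 (((‖(u : F)‖ : ℝ) : ℂ) ^ s)
        (by simp [Complex.cpow_eq_zero_iff]))⁻¹) =
        fun u : Fˣ => ((((‖(u : F)‖ : ℝ) : ℂ)) ^ s)⁻¹ := by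
      ext u; simp
    exact h.inv₀ (fun u => by simp [Complex.cpow_eq_zero_iff])

open Classical in
/-- Extension by zero of a quasi-character to `F`. -/
def ext0 {F : Type*} [NontriviallyNormedField F] (χ : QuasiChar F) (x : F) : ℂ :=
  if h : x ≠ 0 then (χ (Units.mk0 x h) : ℂ) else 0

/-- The function `φ_χ(x) = χ(x)` on the units of the ring of integers, `0` elsewhere. -/
def unitPart {F : Type*} [NontriviallyNormedField F] (χ : QuasiChar F) : F → ℂ :=
  Set.indicator {x | ‖x‖ = 1} (ext0 χ)

/-- The smallest `n ≥ 0` such that `χ` is trivial on `𝔬ˣ ∩ (1 + 𝔭ⁿ)`. -/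
def charConductor {F : Type*} [NontriviallyNormedField F] [IsUltrametricDist F]
    (χ : QuasiChar F) : ℕ :=
  sInf {n : ℕ | ∀ u : Fˣ, ‖(u : F)‖ = 1 → ‖(u : F) - 1‖ ≤ ((resCard F : ℝ)⁻¹) ^ n → χ u = 1}

/-- `χ` is trivial on the units of the ring of integers. -/
def IsUnramified {F : Type*} [NontriviallyNormedField F] (χ : QuasiChar F) : Prop :=
  ∀ u : Fˣ, ‖(u : F)‖ = 1 → χ u = 1

/-- `ψ` is trivial on `𝔬` but not on `𝔭⁻¹`. -/
def HasOrderZero {F : Type*} [NontriviallyNormedField F] (ψ : AddChar F Circle) : Prop :=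
  (∀ x : F, ‖x‖ ≤ 1 → ψ x = 1) ∧ ∃ ϖ x : F, IsUniformizer ϖ ∧ ‖ϖ * x‖ ≤ 1 ∧ ψ x ≠ 1

/-- The Fourier transform on `F` with respect to `ψ`. -/
def fourier {F : Type*} [NontriviallyNormedField F] [ProperSpace F] [MeasurableSpace F]
    [BorelSpace F] (ψ : AddChar F Circle) (φ : F → ℂ) (y : F) : ℂ :=
  ∫ z, φ z * (ψ (z * y) : ℂ) ∂(haarF F)

/-! ### Gamma factors of `GL₁` -/

open Classical in
/-- The Tate `L`-factor `L(s, χ)`; `ϖ` is a prime element. -/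
def tateL {F : Type*} [NontriviallyNormedField F] [IsUltrametricDist F]
    (ϖ : Fˣ) (χ : QuasiChar F) (s : ℂ) : ℂ :=
  if IsUnramified χ then (1 - (χ ϖ : ℂ) * (resCard F : ℂ) ^ (-s))⁻¹ else 1

open Classical in
/-- The Tate `ε`-factor `ε(s, χ, ψ)` for `ψ` of order zero and the self-dual measure:
`1` if `χ` is unramified, and `∫ χ⁻¹(x) |x|^{-s} ψ(x) dx` over `|x| = q^{c(χ)}` otherwise. -/
def tateEps {F : Type*} [NontriviallyNormedField F] [IsUltrametricDist F] [ProperSpace F]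
    [MeasurableSpace F] [BorelSpace F] (ψ : AddChar F Circle) (χ : QuasiChar F) (s : ℂ) : ℂ :=
  if IsUnramified χ then 1 else
    ∫ x in {x : F | ‖x‖ = (resCard F : ℝ) ^ charConductor χ},
      ext0 (χ⁻¹ * absPow F (-s)) x * (ψ x : ℂ) ∂(haarF F)

/-- The Tate gamma factor `γ(s, χ, ψ) = ε(s, χ, ψ) L(1 - s, χ⁻¹) / L(s, χ)`. -/
def tateGamma {F : Type*} [NontriviallyNormedField F] [IsUltrametricDist F] [ProperSpace F]
    [MeasurableSpace F] [BorelSpace F] (ψ : AddChar F Circle) (ϖ : Fˣ) (χ : QuasiChar F)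
    (s : ℂ) : ℂ :=
  tateEps ψ χ s * tateL ϖ χ⁻¹ (1 - s) / tateL ϖ χ s

/-! ### Representations of `GL₂(F)` and Whittaker models -/

/-- A function on a topological group is (right) smooth if it is right invariant under an open
subgroup. -/
def IsSmooth {G : Type*} [Group G] [TopologicalSpace G] (f : G → ℂ) : Prop :=
  ∃ U : Subgroup G, IsOpen (U : Set G) ∧ ∀ k ∈ U, ∀ g, f (g * k) = f g

/-- Right translation on complex functions on a group. -/
def rightReg (G : Type*) [Group G] : Representation ℂ G (G → ℂ) where
  toFun g :=
    { toFun := fun f x => f (x * g)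
      map_add' := fun _ _ => rfl
      map_smul' := fun _ _ => rfl }
  map_one' := by ext; simp
  map_mul' g h := by ext; simp [mul_assoc]

theorem IsSmooth.add {G : Type*} [Group G] [TopologicalSpace G] {f f' : G → ℂ}
    (h : IsSmooth f) (h' : IsSmooth f') : IsSmooth (f + f') := by
  obtain ⟨U, hU, h⟩ := h
  obtain ⟨U', hU', h'⟩ := h'
  refine ⟨U ⊓ U', hU.inter hU', fun k hk g => ?_⟩
  simp [h k hk.1 g, h' k hk.2 g]

theorem IsSmooth.translate {G : Type*} [Group G] [TopologicalSpace G] [IsTopologicalGroup G]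
    {f : G → ℂ} (h : IsSmooth f) (x : G) : IsSmooth (rightReg G x f) := by
  obtain ⟨U, hU, h⟩ := h
  refine ⟨U.comap (MulAut.conj x⁻¹).toMonoidHom, ?_, fun k hk g => ?_⟩
  · have hc : Continuous fun k : G => x⁻¹ * k * x := by fun_prop
    have := hU.preimage hc
    convert this using 1
    ext k
    simp
  · have := h _ hk (g * x)
    simp only [rightReg, MonoidHom.coe_mk, OneHom.coe_mk, LinearMap.coe_mk, AddHom.coe_mk]
    rw [← this]
    congr 1
    simp [mul_assoc]

/-- The upper triangular matrix with diagonal `(a, d)` and upper right entry `b`. -/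
def borel {F : Type*} [NontriviallyNormedField F] (a d : Fˣ) (b : F) : GL (Fin 2) F :=
  Matrix.GeneralLinearGroup.mkOfDetNeZero !![(a : F), b; 0, (d : F)] (by simp)

/-- `𝐧(x)`, upper triangular unipotent. -/
def nU {F : Type*} [NontriviallyNormedField F] (x : F) : GL (Fin 2) F := borel 1 1 x

/-- `𝐧⁻(u)`, lower triangular unipotent. -/
def nL {F : Type*} [NontriviallyNormedField F] (u : F) : GL (Fin 2) F :=
  Matrix.GeneralLinearGroup.mkOfDetNeZero !![1, 0; u, 1] (by simp)

/-- `𝐭(a) = diag(a, 1)`. -/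
def tT {F : Type*} [NontriviallyNormedField F] (a : Fˣ) : GL (Fin 2) F := borel a 1 0

/-- `𝐦(a) = diag(a, a⁻¹)`. -/
def mT {F : Type*} [NontriviallyNormedField F] (a : Fˣ) : GL (Fin 2) F := borel a a⁻¹ 0

/-- `J₁`. -/
def J1 (F : Type*) [NontriviallyNormedField F] : GL (Fin 2) F :=
  Matrix.GeneralLinearGroup.mkOfDetNeZero !![0, -1; 1, 0] (by simp)

/-- The principal series `I(μ, ν)` (normalized induction), acting by right translation. -/
def principalSeries {F : Type*} [NontriviallyNormedField F] (μ ν : QuasiChar F) :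
    Subrepresentation (rightReg (GL (Fin 2) F)) where
  toSubmodule :=
    { carrier := {f | IsSmooth f ∧ ∀ (a d : Fˣ) (b : F) (g : GL (Fin 2) F),
        f (borel a d b * g) =
          (μ a : ℂ) * (ν d : ℂ) * ((‖(a : F) / (d : F)‖ ^ (1 / 2 : ℝ) : ℝ) : ℂ) * f g}
      add_mem' := by
        rintro f f' ⟨h1, h2⟩ ⟨h1', h2'⟩
        refine ⟨h1.add h1', fun a d b g => ?_⟩
        simp only [Pi.add_apply, h2, h2']
        ring
      zero_mem' := ⟨⟨⊤, isOpen_univ, fun _ _ _ => rfl⟩, fun _ _ _ _ => by simp⟩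
      smul_mem' := by
        rintro c f ⟨⟨U, hU, h1⟩, h2⟩
        refine ⟨⟨U, hU, fun k hk g => by simp [h1 k hk g]⟩, fun a d b g => ?_⟩
        simp only [Pi.smul_apply, h2, smul_eq_mul]
        ring }
  apply_mem_toSubmodule := by
    rintro x f ⟨h1, h2⟩
    refine ⟨h1.translate x, fun a d b g => ?_⟩
    have := h2 a d b (g * x)
    simpa [rightReg, mul_assoc] using this

/-- The contragredient: smooth linear functionals with the dual action. -/
def contragredient {G V : Type*} [Group G] [TopologicalSpace G] [IsTopologicalGroup G]
    [AddCommGroup V] [Module ℂ V] (π : Representation ℂ G V) : Subrepresentation π.dual where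
  toSubmodule :=
    { carrier := {l | ∃ U : Subgroup G, IsOpen (U : Set G) ∧ ∀ k ∈ U, π.dual k l = l}
      add_mem' := by
        rintro l l' ⟨U, hU, h⟩ ⟨U', hU', h'⟩
        exact ⟨U ⊓ U', hU.inter hU', fun k hk => by rw [map_add, h k hk.1, h' k hk.2]⟩
      zero_mem' := ⟨⊤, isOpen_univ, fun _ _ => map_zero _⟩
      smul_mem' := by
        rintro c l ⟨U, hU, h⟩
        exact ⟨U, hU, fun k hk => by rw [map_smul, h k hk]⟩ }
  apply_mem_toSubmodule := by
    rintro x l ⟨U, hU, h⟩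
    refine ⟨U.comap (MulAut.conj x⁻¹).toMonoidHom, ?_, fun k hk => ?_⟩
    · have hc : Continuous fun k : G => x⁻¹ * k * x := by fun_prop
      have := hU.preimage hc
      convert this using 1
      ext k
      simp
    · have h3 := h _ hk
      have h4 : k * x = x * (x⁻¹ * k * x) := by group
      have h5 : (MulAut.conj x⁻¹).toMonoidHom k = x⁻¹ * k * x := by simp
      rw [h5] at h3
      rw [← Module.End.mul_apply, ← map_mul, h4, map_mul, Module.End.mul_apply, h3]

/-- `π` is an irreducible infinite dimensional quotient of `I(μ, ν)`. -/
def IsQuotientOfPS {F : Type*} [NontriviallyNormedField F] {V : Type*} [AddCommGroup V]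
    [Module ℂ V] (π : Representation ℂ (GL (Fin 2) F) V) (μ ν : QuasiChar F) : Prop :=
  π.IsIrreducible ∧ ¬ FiniteDimensional ℂ V ∧
    ∃ T : Representation.IntertwiningMap (principalSeries μ ν).toRepresentation π,
      Function.Surjective T

/-- `π` is an irreducible infinite dimensional subrepresentation of `I(μ, ν)`. -/
def IsSubOfPS {F : Type*} [NontriviallyNormedField F] {V : Type*} [AddCommGroup V]
    [Module ℂ V] (π : Representation ℂ (GL (Fin 2) F) V) (μ ν : QuasiChar F) : Prop :=
  π.IsIrreducible ∧ ¬ FiniteDimensional ℂ V ∧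
    ∃ T : Representation.IntertwiningMap π (principalSeries μ ν).toRepresentation,
      Function.Injective T

/-- `ω` is the central character of `π`. -/
def HasCentralChar {F : Type*} [NontriviallyNormedField F] {V : Type*} [AddCommGroup V]
    [Module ℂ V] (π : Representation ℂ (GL (Fin 2) F) V) (ω : QuasiChar F) : Prop :=
  ∀ (z : Fˣ) (v : V), π (borel z z 0) v = (ω z : ℂ) • v

/-- The Whittaker model of `π` with respect to `ψ`: all functions `g ↦ ℓ(π(g) v)` where `ℓ` is a
`ψ`-Whittaker functional. (For irreducible `π` such functionals are unique up to scalars.) -/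
def whittakerModel {F : Type*} [NontriviallyNormedField F] {V : Type*} [AddCommGroup V]
    [Module ℂ V] (ψ : AddChar F Circle) (π : Representation ℂ (GL (Fin 2) F) V) :
    Set (GL (Fin 2) F → ℂ) :=
  {W | ∃ l : V →ₗ[ℂ] ℂ, (∀ (x : F) (v : V), l (π (nU x) v) = (ψ x : ℂ) * l v) ∧
    ∃ v : V, W = fun g => l (π g v)}

/-- The function `a ↦ ν(a) |a|^{1/2} 𝟙_𝔬(a)` on `Fˣ`. -/
def ordKirillov {F : Type*} [NontriviallyNormedField F] (ν : QuasiChar F) : Fˣ → ℂ :=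
  Set.indicator {a | ‖(a : F)‖ ≤ 1} (fun a => ((ν * absPow F (1 / 2)) a : ℂ))

/-! ### Gamma factors of `GL₂`

They are defined by the functional equation
`γ(s, π ⊗ χ, ψ) ∫ W(𝐭(a)) χ(a) |a|^{s-1/2} dˣa = ∫ W(𝐭(a) J₁⁻¹) (χω)⁻¹(a) |a|^{1/2-s} dˣa`,
where the left integral converges for `Re s ≫ 0`, the right one for `Re s ≪ 0`, and both are
continued as rational functions of `q^{-s}`. -/

/-- `R(q^{-s})` is the gamma factor `γ(s, π ⊗ χ, ψ)`, where `𝒲` is the Whittaker model of `π` and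
`ω` its central character. -/
def IsGammaGL2 {F : Type*} [NontriviallyNormedField F] [IsUltrametricDist F] [ProperSpace F]
    [MeasurableSpace F] [BorelSpace F] (𝒲 : Set (GL (Fin 2) F → ℂ)) (ω χ : QuasiChar F)
    (R : RatFunc ℂ) : Prop :=
  ∀ W ∈ 𝒲, ∃ P Q : RatFunc ℂ, R * P = Q ∧
    (∃ σ : ℝ, ∀ s : ℂ, σ < s.re →
      Integrable (fun a : Fˣ => W (tT a) * ((χ * absPow F (s - 1 / 2)) a : ℂ)) (haarFx F) ∧
      ∫ a : Fˣ, W (tT a) * ((χ * absPow F (s - 1 / 2)) a : ℂ) ∂(haarFx F) =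
        P.eval (RingHom.id ℂ) ((resCard F : ℂ) ^ (-s))) ∧
    (∃ σ : ℝ, ∀ s : ℂ, s.re < σ →
      Integrable (fun a : Fˣ => W (tT a * (J1 F)⁻¹) *
        (((χ * ω)⁻¹ * absPow F (1 / 2 - s)) a : ℂ)) (haarFx F) ∧
      ∫ a : Fˣ, W (tT a * (J1 F)⁻¹) * (((χ * ω)⁻¹ * absPow F (1 / 2 - s)) a : ℂ) ∂(haarFx F) =
        Q.eval (RingHom.id ℂ) ((resCard F : ℂ) ^ (-s)))

/-- The gamma factor `γ(s, π ⊗ χ, ψ)` of `π` with central character `ω`. -/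
def gammaGL2 {F : Type*} [NontriviallyNormedField F] [IsUltrametricDist F] [ProperSpace F]
    [MeasurableSpace F] [BorelSpace F] {V : Type*} [AddCommGroup V] [Module ℂ V]
    (ψ : AddChar F Circle) (π : Representation ℂ (GL (Fin 2) F) V) (ω χ : QuasiChar F)
    (s : ℂ) : ℂ :=
  (Classical.epsilon (IsGammaGL2 (whittakerModel ψ π) ω χ)).eval (RingHom.id ℂ)
    ((resCard F : ℂ) ^ (-s))

/-! ### The group `GSp₆` and the degenerate principal series -/

/-- The symplectic similitude group `GSp₆(F)`. -/
def GSp6 (F : Type*) [NontriviallyNormedField F] : Subgroup (GL (Fin 3 ⊕ Fin 3) F) where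
  carrier := {g | ∃ c : Fˣ, (g : Matrix (Fin 3 ⊕ Fin 3) (Fin 3 ⊕ Fin 3) F) *
    Matrix.J (Fin 3) F * (g : Matrix (Fin 3 ⊕ Fin 3) (Fin 3 ⊕ Fin 3) F)ᵀ =
      (c : F) • Matrix.J (Fin 3) F}
  one_mem' := ⟨1, by simp⟩
  mul_mem' := by
    rintro g h ⟨c, hc⟩ ⟨d, hd⟩
    refine ⟨c * d, ?_⟩
    rw [Units.val_mul, Matrix.transpose_mul]
    calc (g : Matrix (Fin 3 ⊕ Fin 3) (Fin 3 ⊕ Fin 3) F) * h * Matrix.J (Fin 3) F *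
          ((h : Matrix (Fin 3 ⊕ Fin 3) (Fin 3 ⊕ Fin 3) F)ᵀ *
            (g : Matrix (Fin 3 ⊕ Fin 3) (Fin 3 ⊕ Fin 3) F)ᵀ)
        = g * (h * Matrix.J (Fin 3) F * (h : Matrix (Fin 3 ⊕ Fin 3) (Fin 3 ⊕ Fin 3) F)ᵀ) *
            (g : Matrix (Fin 3 ⊕ Fin 3) (Fin 3 ⊕ Fin 3) F)ᵀ := by simp only [Matrix.mul_assoc]
      _ = _ := by
        rw [hd, Matrix.mul_smul, Matrix.smul_mul, hc, smul_smul, Units.val_mul, mul_comm]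
  inv_mem' := by
    rintro g ⟨c, hc⟩
    refine ⟨c⁻¹, ?_⟩
    have h1 : ((g⁻¹ : GL (Fin 3 ⊕ Fin 3) F) : Matrix (Fin 3 ⊕ Fin 3) (Fin 3 ⊕ Fin 3) F) * g = 1 :=
      by rw [← Units.val_mul, inv_mul_cancel, Units.val_one]
    set G : Matrix (Fin 3 ⊕ Fin 3) (Fin 3 ⊕ Fin 3) F :=
      (g : Matrix (Fin 3 ⊕ Fin 3) (Fin 3 ⊕ Fin 3) F) with hG
    set G' : Matrix (Fin 3 ⊕ Fin 3) (Fin 3 ⊕ Fin 3) F :=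
      ((g⁻¹ : GL (Fin 3 ⊕ Fin 3) F) : Matrix (Fin 3 ⊕ Fin 3) (Fin 3 ⊕ Fin 3) F) with hG'
    have h2 : Gᵀ * G'ᵀ = 1 := by rw [← Matrix.transpose_mul, h1, Matrix.transpose_one]
    have h3 : Matrix.J (Fin 3) F = (c : F) • (G' * Matrix.J (Fin 3) F * G'ᵀ) := by
      calc Matrix.J (Fin 3) F = (G' * G) * Matrix.J (Fin 3) F * (Gᵀ * G'ᵀ) := by
            rw [h1, h2, one_mul, mul_one]
        _ = G' * (G * Matrix.J (Fin 3) F * Gᵀ) * G'ᵀ := by simp only [Matrix.mul_assoc]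
        _ = _ := by rw [hc, Matrix.mul_smul, Matrix.smul_mul]
    conv_rhs => rw [h3]
    rw [smul_smul, Units.inv_mul, one_smul]

/-- The similitude character of `GSp₆`. -/
def similitude {F : Type*} [NontriviallyNormedField F] (g : GSp6 F) : Fˣ := g.2.choose

/-- The element of `GSp₆` given by a matrix with the defining property. -/
def GSp6.ofMatrix {F : Type*} [NontriviallyNormedField F]
    (M : Matrix (Fin 3 ⊕ Fin 3) (Fin 3 ⊕ Fin 3) F) (c : Fˣ)
    (h : M * Matrix.J (Fin 3) F * Mᵀ = (c : F) • Matrix.J (Fin 3) F) : GSp6 F :=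
  have h1 : M * (Matrix.J (Fin 3) F * Mᵀ * (-((c⁻¹ : Fˣ) : F) • Matrix.J (Fin 3) F)) = 1 := by
    rw [← Matrix.mul_assoc, ← Matrix.mul_assoc, h, Matrix.smul_mul, Matrix.mul_smul,
      Matrix.J_squared, smul_smul]
    simp
  ⟨⟨M, _, h1, mul_eq_one_comm.1 h1⟩, c, h⟩

/-- The Levi element `𝐦(A, c)`. -/
def siegelM {F : Type*} [NontriviallyNormedField F] (A : GL (Fin 3) F) (c : Fˣ) : GSp6 F :=
  GSp6.ofMatrix
    (Matrix.fromBlocks (A : Matrix (Fin 3) (Fin 3) F) 0 0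
      ((c : F) • ((A⁻¹ : GL (Fin 3) F) : Matrix (Fin 3) (Fin 3) F)ᵀ)) c (by
    have h1 : (A : Matrix (Fin 3) (Fin 3) F) * ((A⁻¹ : GL (Fin 3) F) : Matrix _ _ F) = 1 := by
      rw [← Units.val_mul, mul_inv_cancel, Units.val_one]
    have h2 : ((A⁻¹ : GL (Fin 3) F) : Matrix (Fin 3) (Fin 3) F)ᵀ *
        (A : Matrix (Fin 3) (Fin 3) F)ᵀ = 1 := by
      rw [← Matrix.transpose_mul, h1, Matrix.transpose_one]
    rw [Matrix.J, Matrix.fromBlocks_multiply, Matrix.fromBlocks_transpose,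
      Matrix.fromBlocks_multiply, Matrix.fromBlocks_smul]
    simp only [Matrix.mul_zero, Matrix.mul_one, Matrix.mul_neg, zero_add, add_zero,
      Matrix.transpose_zero, Matrix.transpose_smul, Matrix.transpose_transpose, Matrix.zero_mul,
      Matrix.neg_mul, Matrix.mul_smul, Matrix.smul_mul, h1, h2, smul_zero, neg_zero, smul_neg])

/-- The unipotent element `𝐧(z)` for symmetric `z`. -/
def siegelN {F : Type*} [NontriviallyNormedField F] (z : Matrix (Fin 3) (Fin 3) F)
    (hz : z.IsSymm) : GSp6 F :=
  GSp6.ofMatrix (Matrix.fromBlocks 1 z 0 1) 1 (by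
    rw [Matrix.J, Matrix.fromBlocks_multiply, Matrix.fromBlocks_transpose,
      Matrix.fromBlocks_multiply]
    simp [hz.eq])

/-- `J₃` as an element of `GSp₆`. -/
def J3 (F : Type*) [NontriviallyNormedField F] : GSp6 F :=
  GSp6.ofMatrix (Matrix.J (Fin 3) F) 1 (by
    rw [Matrix.J_transpose, Matrix.J_squared]
    simp)

/-- The element `η`. -/
def eta (F : Type*) [NontriviallyNormedField F] : GSp6 F :=
  GSp6.ofMatrix
    (Matrix.fromBlocks !![0, 0, 0; 0, 1, 0; 0, 0, 1] !![-1, 0, 0; 0, 0, 0; 0, 0, 0]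
      !![1, 1, 1; 0, 0, 0; 0, 0, 0] !![0, 0, 0; -1, 1, 0; -1, 0, 1]) 1 (by
    rw [Matrix.J, Matrix.fromBlocks_multiply, Matrix.fromBlocks_transpose,
      Matrix.fromBlocks_multiply]
    simp only [Units.val_one, one_smul]
    congr 1 <;> ext i j <;> fin_cases i <;> fin_cases j <;>
      simp [Matrix.mul_apply, Matrix.add_apply, Matrix.neg_apply, Fin.sum_univ_three,
        -Matrix.cons_mul])

/-- The group `H` of triples in `GL₂(F)` with equal determinants. -/
def groupH (F : Type*) [NontriviallyNormedField F] : Subgroup (Fin 3 → GL (Fin 2) F) where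
  carrier := {g | ∀ i j, Matrix.GeneralLinearGroup.det (g i) = Matrix.GeneralLinearGroup.det (g j)}
  one_mem' := fun _ _ => rfl
  mul_mem' := fun {g h} hg hh i j => by simp only [Pi.mul_apply, map_mul, hg i j, hh i j]
  inv_mem' := fun {g} hg i j => by simp only [Pi.inv_apply, map_inv, hg i j]

/-- The embedding `ι : H → GSp₆`. -/
def iota {F : Type*} [NontriviallyNormedField F] (h : groupH F) : GSp6 F :=
  GSp6.ofMatrix
    (Matrix.fromBlocks
      (Matrix.diagonal fun i => h.1 i 0 0) (Matrix.diagonal fun i => h.1 i 0 1)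
      (Matrix.diagonal fun i => h.1 i 1 0) (Matrix.diagonal fun i => h.1 i 1 1))
    (Matrix.GeneralLinearGroup.det (h.1 0)) (by
    have hd : ∀ i, h.1 i 0 0 * h.1 i 1 1 - h.1 i 0 1 * h.1 i 1 0 =
        (Matrix.GeneralLinearGroup.det (h.1 0) : F) := fun i => by
      rw [← h.2 i 0, Matrix.GeneralLinearGroup.val_det_apply, Matrix.det_fin_two]
    rw [Matrix.J, Matrix.fromBlocks_multiply, Matrix.fromBlocks_transpose,
      Matrix.fromBlocks_multiply, Matrix.fromBlocks_smul]
    simp only [Matrix.mul_zero, Matrix.mul_one, Matrix.mul_neg, zero_add, add_zero,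
      Matrix.diagonal_transpose, Matrix.diagonal_mul_diagonal, Matrix.neg_mul, smul_zero]
    congr 1 <;> ext i j <;> by_cases hij : i = j
    all_goals first
      | (subst hij; simp [← hd i]; ring)
      | simp [hij])

/-- `f` belongs to the degenerate principal series `I₃(ω, χ)`. For a nonarchimedean field,
right `K`-finiteness of `f` means right invariance under an open subgroup. -/
def IsDegeneratePS {F : Type*} [NontriviallyNormedField F] (ω χ : QuasiChar F)
    (f : GSp6 F → ℂ) : Prop :=
  IsSmooth f ∧
  ∀ (A : GL (Fin 3) F) (c : Fˣ) (z : Matrix (Fin 3) (Fin 3) F) (hz : z.IsSymm) (g : GSp6 F),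
    f (siegelM A c * siegelN z hz * g) =
      (ω (c⁻¹ ^ 2 * Matrix.GeneralLinearGroup.det A) : ℂ) *
      (χ (c⁻¹ ^ 3 * Matrix.GeneralLinearGroup.det A ^ 2) : ℂ) *
      ((‖((c⁻¹ ^ 3 * Matrix.GeneralLinearGroup.det A ^ 2 : Fˣ) : F)‖ : ℝ) : ℂ) * f g

/-- `f` is a holomorphic section of `I₃(ω, χ|·|^s)`. -/
def IsHolomorphicSection {F : Type*} [NontriviallyNormedField F] (ω χ : QuasiChar F)
    (f : ℂ → GSp6 F → ℂ) : Prop :=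
  (∃ U : Subgroup (GSp6 F), IsOpen (U : Set (GSp6 F)) ∧
    ∀ k ∈ U, ∀ s g, f s (g * k) = f s g) ∧
  (∀ s, IsDegeneratePS ω (χ * absPow F s) (f s)) ∧ ∀ g, Differentiable ℂ fun s => f s g

open Classical in
/-- The value of `bigCellSection` at an element with similitude `c` and lower blocks `C, D`. -/
def bigCellValue {F : Type*} [NontriviallyNormedField F] (ω χ : QuasiChar F)
    (Φ : Matrix (Fin 3) (Fin 3) F → ℂ) (c : Fˣ) (C D : Matrix (Fin 3) (Fin 3) F) : ℂ :=
  if h : C.det ≠ 0 then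
    (ω (c * (Units.mk0 C.det h)⁻¹) : ℂ) * (χ (c ^ 3 * (Units.mk0 C.det h)⁻¹ ^ 2) : ℂ) *
      ((‖((c ^ 3 * (Units.mk0 C.det h)⁻¹ ^ 2 : Fˣ) : F)‖ : ℝ) : ℂ) * Φ (C⁻¹ * D)
  else 0

/-- The section `f_Φ(χ)` of `I₃(ω, χ)` with `f_Φ(J₃ 𝐧(z)) = Φ(z)`, supported on the big cell
`𝒫₃ J₃ N₃`. If `g` has similitude `c` and lower blocks `C, D`, then `g` is in the big cell
if and only if `C` is invertible, and then `g ∈ 𝐦(A, c) N₃ J₃ 𝐧(C⁻¹ D)` with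
`det A = c³ / det C`. -/
def bigCellSection {F : Type*} [NontriviallyNormedField F] (ω χ : QuasiChar F)
    (Φ : Matrix (Fin 3) (Fin 3) F → ℂ) (g : GSp6 F) : ℂ :=
  bigCellValue ω χ Φ (similitude g)
    (Matrix.toBlocks₂₁ (g.1 : Matrix (Fin 3 ⊕ Fin 3) (Fin 3 ⊕ Fin 3) F))
    (Matrix.toBlocks₂₂ (g.1 : Matrix (Fin 3 ⊕ Fin 3) (Fin 3 ⊕ Fin 3) F))

/-- The symmetric matrix with diagonal `u` and off-diagonal entries `x`, where `x i` stands in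
the two positions not involving the index `i`. -/
def symMat {F : Type*} (u x : Fin 3 → F) : Matrix (Fin 3) (Fin 3) F :=
  !![u 0, x 2, x 1; x 2, u 1, x 0; x 1, x 0, u 2]

theorem symMat_isSymm {F : Type*} (u x : Fin 3 → F) : (symMat u x).IsSymm := by
  ext i j
  fin_cases i <;> fin_cases j <;> rfl

/-- The Schwartz function
`Φ(z) = ∏ᵢ (𝟙_𝔭)^(zᵢᵢ) · (φ_{ξ₁})^(z₂₃) (φ_{ξ₂})^(z₁₃) (φ_{ξ₃})^(z₁₂)` on `Sym₃(F)`. -/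
def schwartzPhi {F : Type*} [NontriviallyNormedField F] [ProperSpace F] [MeasurableSpace F]
    [BorelSpace F] (ψ : AddChar F Circle) (ξ : Fin 3 → QuasiChar F)
    (z : Matrix (Fin 3) (Fin 3) F) : ℂ :=
  (∏ i, fourier ψ (Set.indicator {x | ‖x‖ < 1} 1) (z i i)) *
    (fourier ψ (unitPart (ξ 0)) (z 1 2) * fourier ψ (unitPart (ξ 1)) (z 0 2) *
      fourier ψ (unitPart (ξ 2)) (z 0 1))

/-- The integrand of the degenerate Whittaker functional `𝒲_B`, as a function of the diagonal and
off-diagonal coordinates on `Sym₃(F)`. -/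
def degWhittakerIntegrand {F : Type*} [NontriviallyNormedField F] (ψ : AddChar F Circle)
    (B : Matrix (Fin 3) (Fin 3) F) (f : GSp6 F → ℂ) (p : (Fin 3 → F) × (Fin 3 → F)) : ℂ :=
  f (J3 F * siegelN (symMat p.1 p.2) (symMat_isSymm p.1 p.2)) *
    (ψ (-(B * symMat p.1 p.2).trace) : ℂ)

/-- The measure on `Sym₃(F)`, in the same coordinates. -/
def haarSym (F : Type*) [NontriviallyNormedField F] [ProperSpace F] [MeasurableSpace F]
    [BorelSpace F] : Measure ((Fin 3 → F) × (Fin 3 → F)) :=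
  (Measure.pi fun _ => haarF F).prod (Measure.pi fun _ => haarF F)

/-- The degenerate Whittaker functional `𝒲_B(f) = ∫ f(J₃ 𝐧(z)) ψ(-tr(Bz)) dz`. -/
def degWhittaker {F : Type*} [NontriviallyNormedField F] [ProperSpace F] [MeasurableSpace F]
    [BorelSpace F] (ψ : AddChar F Circle) (B : Matrix (Fin 3) (Fin 3) F)
    (f : GSp6 F → ℂ) : ℂ :=
  ∫ p, degWhittakerIntegrand ψ B f p ∂(haarSym F)

/-- The off-diagonal entries `(b₂₃, b₁₃, b₁₂)` of a symmetric matrix. -/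
def offDiag {F : Type*} (B : Matrix (Fin 3) (Fin 3) F) : Fin 3 → F := ![B 1 2, B 0 2, B 0 1]

/-- `Ξ_𝔭`: the symmetric matrices with diagonal entries in `𝔭` and off-diagonal entries
in `½ 𝔬ˣ`. -/
def XiSet (F : Type*) [NontriviallyNormedField F] : Set (Matrix (Fin 3) (Fin 3) F) :=
  {B | B.IsSymm ∧ (∀ i, ‖B i i‖ < 1) ∧ ∀ i j, i ≠ j → ‖2 * B i j‖ = 1}

/-- `𝒬_B(χ₀, χ₁, χ₂, χ₃)`. -/
def QB {F : Type*} [NontriviallyNormedField F] (B : Matrix (Fin 3) (Fin 3) F)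
    (χ₀ : QuasiChar F) (χ : Fin 3 → QuasiChar F) : ℂ :=
  Set.indicator (XiSet F)
    (fun B => ext0 χ₀ (8 * B 0 1 * B 1 2 * B 0 2) *
      (ext0 (χ 0) (2 * B 1 2) * ext0 (χ 1) (2 * B 0 2) * ext0 (χ 2) (2 * B 0 1))) B

/-! ### The zeta integral

The invariant integral over `U⁰Z \ H` is written in the coordinates
`(𝐧(x) 𝐭(a₁) 𝐧⁻(u₁), 𝐭(a₁) 𝐦(a₂) 𝐧⁻(u₂), 𝐭(a₁) 𝐦(a₃) 𝐧⁻(u₃))`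
on the open dense big cell, whose complement is a null set. The Haar measure on `Z \ H` is
normalized so that the image of `H ∩ GL₂(𝔬)³` has volume `1` (equivalently, `PGL₂(𝔬)` and
`SL₂(𝔬)` have volume `1`); it is
`(1 + q⁻¹)⁻³ |a₁|⁻³ |a₂|⁻² |a₃|⁻² du dˣa₁ dˣa₂ dˣa₃ du₁ du₂ du₃` on `U T 𝐧⁻(F)³`, and
`U⁰ ≅ F²` carries `dx₂ dx₃`. -/

/-- The point of `H` with coordinates `(x, a, u)`. -/
def pointH {F : Type*} [NontriviallyNormedField F] (x : F) (a : Fin 3 → Fˣ) (u : Fin 3 → F) :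
    groupH F :=
  ⟨![nU x * tT (a 0) * nL (u 0), tT (a 0) * mT (a 1) * nL (u 1),
      tT (a 0) * mT (a 2) * nL (u 2)], by
    have h : ∀ i, Matrix.GeneralLinearGroup.det
        ((![nU x * tT (a 0) * nL (u 0), tT (a 0) * mT (a 1) * nL (u 1),
          tT (a 0) * mT (a 2) * nL (u 2)] : Fin 3 → GL (Fin 2) F) i) = a 0 := by
      intro i
      have hb : ∀ (a d : Fˣ) (b : F), Matrix.GeneralLinearGroup.det (borel a d b) = a * d :=
        fun a d b => Units.ext (by
          rw [Matrix.GeneralLinearGroup.val_det_apply]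
          change Matrix.det !![(a : F), b; 0, (d : F)] = _
          simp [Matrix.det_fin_two])
      have hl : ∀ u : F, Matrix.GeneralLinearGroup.det (nL u) = 1 := fun u => Units.ext (by
          rw [Matrix.GeneralLinearGroup.val_det_apply]
          change Matrix.det !![(1 : F), 0; u, 1] = _
          simp [Matrix.det_fin_two])
      fin_cases i <;> simp [nU, tT, mT, hb, hl]
    intro i j
    rw [h i, h j]⟩

/-- The integrand of the zeta integral, with the density of the invariant measure. -/
def zetaIntegrand {F : Type*} [NontriviallyNormedField F]
    (W : Fin 3 → GL (Fin 2) F → ℂ) (f : GSp6 F → ℂ)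
    (p : F × (Fin 3 → Fˣ) × (Fin 3 → F)) : ℂ :=
  (∏ i, W i ((pointH p.1 p.2.1 p.2.2).1 i)) * f (eta F * iota (pointH p.1 p.2.1 p.2.2)) *
    (((‖(p.2.1 0 : F)‖ ^ 3 * ‖(p.2.1 1 : F)‖ ^ 2 * ‖(p.2.1 2 : F)‖ ^ 2)⁻¹ : ℝ) : ℂ)

/-- The product measure in the coordinates `(x, a, u)`. -/
def coordMeasure (F : Type*) [NontriviallyNormedField F] [IsUltrametricDist F] [ProperSpace F]
    [MeasurableSpace F] [BorelSpace F] : Measure (F × (Fin 3 → Fˣ) × (Fin 3 → F)) :=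
  (haarF F).prod ((Measure.pi fun _ => haarFx F).prod (Measure.pi fun _ => haarF F))

/-- The local zeta integral `Z(W₁, W₂, W₃, f)`. -/
def zetaIntegral {F : Type*} [NontriviallyNormedField F] [IsUltrametricDist F] [ProperSpace F]
    [MeasurableSpace F] [BorelSpace F] (W : Fin 3 → GL (Fin 2) F → ℂ) (f : GSp6 F → ℂ) : ℂ :=
  ((1 + (resCard F : ℂ)⁻¹) ^ 3)⁻¹ * ∫ p, zetaIntegrand W f p ∂(coordMeasure F)

/-- The right translate by `t_n = J₁⁻¹ 𝐦(ϖⁿ)` of a function on `GL₂(F)`. -/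
def ordTranslate {F : Type*} [NontriviallyNormedField F] (ϖ : Fˣ) (n : ℕ)
    (W : GL (Fin 2) F → ℂ) : GL (Fin 2) F → ℂ :=
  rightReg _ ((J1 F)⁻¹ * mT (ϖ ^ n)) W

/-- The group `K₀(𝔭ᵐ) ⊆ GL₂(𝔬)` of matrices whose lower left entry lies in `𝔭ᵐ`. -/
def K0 (F : Type*) [NontriviallyNormedField F] [IsUltrametricDist F] (m : ℕ) :
    Set (GL (Fin 2) F) :=
  {g | (∀ i j, ‖g i j‖ ≤ 1) ∧ ‖(Matrix.GeneralLinearGroup.det g : F)‖ = 1 ∧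
    ‖g 1 0‖ ≤ ((resCard F : ℝ)⁻¹) ^ m}

/-! ### The triple product `L`-factor

For a subrepresentation `π` of `I(μ, ν)` the Weil-Deligne representation is `μ ⊕ ν`, with nonzero
monodromy (sending the `ν`-line to the `μ`-line) exactly when `μ = ν |·|`, that is, when `π` is a
twist of the Steinberg representation. The triple product `L`-factor is that of the tensor product
of the three Weil-Deligne representations, twisted by `χ`: a space with basis `Fin 3 → Fin 2`. -/

/-- The quasi-character by which the Weil group acts on the basis vector `e`. -/
def wdChar {F : Type*} [NontriviallyNormedField F] (χ : QuasiChar F)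
    (μ ν : Fin 3 → QuasiChar F) (e : Fin 3 → Fin 2) : QuasiChar F :=
  χ * ∏ i, if e i = 0 then μ i else ν i

open Classical in
/-- The monodromy operator of the tensor product. -/
def wdN {F : Type*} [NontriviallyNormedField F] (μ ν : Fin 3 → QuasiChar F) :
    ((Fin 3 → Fin 2) → ℂ) →ₗ[ℂ] ((Fin 3 → Fin 2) → ℂ) where
  toFun v e := ∑ i, if e i = 0 ∧ μ i = ν i * absPow F 1 then v (Function.update e i 1) else 0
  map_add' v w := by
    ext e
    simp only [Pi.add_apply, ← Finset.sum_add_distrib]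
    exact Finset.sum_congr rfl fun i _ => by split_ifs <;> simp
  map_smul' c v := by
    ext e
    simp only [Pi.smul_apply, RingHom.id_apply, Finset.smul_sum]
    exact Finset.sum_congr rfl fun i _ => by split_ifs <;> simp

/-- The inertia invariants in the kernel of the monodromy operator. -/
def wdInvariants {F : Type*} [NontriviallyNormedField F] (χ : QuasiChar F)
    (μ ν : Fin 3 → QuasiChar F) : Submodule ℂ ((Fin 3 → Fin 2) → ℂ) :=
  LinearMap.ker (wdN μ ν) ⊓
    { carrier := {v | ∀ e, ¬ IsUnramified (wdChar χ μ ν e) → v e = 0}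
      add_mem' := fun {v w} hv hw e he => by simp [hv e he, hw e he]
      zero_mem' := fun _ _ => rfl
      smul_mem' := fun c v hv e he => by simp [hv e he] }

/-- The action of the (geometric) Frobenius corresponding to `ϖ`. -/
def wdFrob {F : Type*} [NontriviallyNormedField F] (ϖ : Fˣ) (χ : QuasiChar F)
    (μ ν : Fin 3 → QuasiChar F) : ((Fin 3 → Fin 2) → ℂ) →ₗ[ℂ] ((Fin 3 → Fin 2) → ℂ) where
  toFun v e := (wdChar χ μ ν e ϖ : ℂ) * v e
  map_add' v w := by ext e; simp [mul_add]
  map_smul' c v := by ext e; simp [mul_left_comm]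

theorem wdChar_update {F : Type*} [NontriviallyNormedField F] (χ : QuasiChar F)
    (μ ν : Fin 3 → QuasiChar F) (e : Fin 3 → Fin 2) (i : Fin 3) (he : e i = 0)
    (h : μ i = ν i * absPow F 1) :
    wdChar χ μ ν e = wdChar χ μ ν (Function.update e i 1) * absPow F 1 := by
  unfold wdChar
  rw [← Finset.mul_prod_erase Finset.univ _ (Finset.mem_univ i),
    ← Finset.mul_prod_erase Finset.univ
      (fun j => if Function.update e i 1 j = 0 then μ j else ν j) (Finset.mem_univ i)]
  have h2 : ∏ j ∈ Finset.univ.erase i, (if Function.update e i 1 j = 0 then μ j else ν j) =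
      ∏ j ∈ Finset.univ.erase i, (if e j = 0 then μ j else ν j) := by
    refine Finset.prod_congr rfl fun j hj => ?_
    rw [Function.update_of_ne (Finset.ne_of_mem_erase hj)]
  rw [h2, if_pos he, h]
  simp only [Function.update_self, one_ne_zero, if_false]
  rw [mul_right_comm (ν i), mul_assoc χ]

theorem wdFrob_mem {F : Type*} [NontriviallyNormedField F] (ϖ : Fˣ) (χ : QuasiChar F)
    (μ ν : Fin 3 → QuasiChar F) (v : (Fin 3 → Fin 2) → ℂ) (hv : v ∈ wdInvariants χ μ ν) :
    wdFrob ϖ χ μ ν v ∈ wdInvariants χ μ ν := by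
  obtain ⟨h1, h2⟩ := hv
  refine ⟨?_, fun e he => ?_⟩
  · have h1' : wdN μ ν v = 0 := h1
    change wdN μ ν (wdFrob ϖ χ μ ν v) = 0
    ext e
    have h3 : wdN μ ν (wdFrob ϖ χ μ ν v) e =
        (wdChar χ μ ν e ϖ : ℂ) * ((absPow F 1 ϖ : ℂˣ) : ℂ)⁻¹ * wdN μ ν v e := by
      simp only [wdN, wdFrob, LinearMap.coe_mk, AddHom.coe_mk, Finset.mul_sum]
      refine Finset.sum_congr rfl fun i _ => ?_
      split_ifs with hi
      · rw [wdChar_update χ μ ν e i hi.1 hi.2]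
        simp
      · simp
    rw [h3, h1']
    simp
  · change (wdChar χ μ ν e ϖ : ℂ) * v e = 0
    rw [h2 e he, mul_zero]

/-- The triple product `L`-factor `L(s, π₁ × π₂ × π₃ ⊗ χ)` for subrepresentations `πᵢ` of
`I(μᵢ, νᵢ)`. -/
def tripleL {F : Type*} [NontriviallyNormedField F] [IsUltrametricDist F] (ϖ : Fˣ)
    (χ : QuasiChar F) (μ ν : Fin 3 → QuasiChar F) (s : ℂ) : ℂ :=
  (LinearMap.det (LinearMap.id -
    (resCard F : ℂ) ^ (-s) • (wdFrob ϖ χ μ ν).restrict (wdFrob_mem ϖ χ μ ν)))⁻¹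

/-- The local zeta function `ζ(s) = (1 - q^{-s})⁻¹`. -/
def localZeta (F : Type*) [NontriviallyNormedField F] [IsUltrametricDist F] (s : ℂ) : ℂ :=
  (1 - (resCard F : ℂ) ^ (-s))⁻¹

/-- The modified Euler factor `E_𝔭(s, π₁ × π₂ × π₃ ⊗ χ)`, where `π₁` has central
character `ω₁`. -/
def modifiedEuler {F : Type*} [NontriviallyNormedField F] [IsUltrametricDist F] [ProperSpace F]
    [MeasurableSpace F] [BorelSpace F] {V : Type*} [AddCommGroup V] [Module ℂ V]
    (ψ : AddChar F Circle) (ϖ : Fˣ) (π₁ : Representation ℂ (GL (Fin 2) F) V)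
    (ω₁ χ : QuasiChar F) (μ ν : Fin 3 → QuasiChar F) (s : ℂ) : ℂ :=
  (tripleL ϖ χ μ ν s * gammaGL2 ψ π₁ ω₁ (χ * μ 1 * μ 2) s *
    (tateGamma ψ ϖ (χ * μ 0 * μ 1 * ν 2) s * tateGamma ψ ϖ (χ * μ 0 * μ 2 * ν 1) s))⁻¹

/-- The normalized zeta integral `Z*_𝔭(f)` at the point `s`, where `W` are the
functions `W̆ᵢ` and `f` is a section at `s`. -/
def zetaStar {F : Type*} [NontriviallyNormedField F] [IsUltrametricDist F] [ProperSpace F]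
    [MeasurableSpace F] [BorelSpace F] (ϖ : Fˣ) (n : ℕ) (χ : QuasiChar F)
    (μ ν ω : Fin 3 → QuasiChar F) (W : Fin 3 → GL (Fin 2) F → ℂ) (f : GSp6 F → ℂ)
    (s : ℂ) : ℂ :=
  zetaIntegral (fun i => ordTranslate ϖ n (W i)) f / tripleL ϖ χ μ ν (s + 1 / 2) *
    ∏ i, (localZeta F 1 / localZeta F 2 *
      ((ω i ϖ : ℂ) * (resCard F : ℂ) / (μ i ϖ : ℂ) ^ 2) ^ n)

end Garrett

end

open Garrett MeasureTheory
open scoped Matrix MatrixGroups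

noncomputable section

open MeasureTheory Filter Topology
open scoped Matrix MatrixGroups
open Set (indicator_of_mem indicator_of_notMem mem_ofPred_eq indicator_apply)
open Units (val_mul val_inv_eq_inv_val val_one mk0)
open ContinuousMonoidHom (mul_apply)
open Matrix (GeneralLinearGroup)
open Finset (prod_mul_distrib mem_univ prod_congr sum_congr)
open Fin (prod_univ_three)
open Complex (real_smul cpow_neg)

set_option linter.unusedSectionVars false

namespace Garrett

/-! ### Normalized local fields -/

/-- The norm of `F` is the normalized absolute value. -/
class NormalizedField (F : Type*) [NontriviallyNormedField F] [IsUltrametricDist F] : Prop where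
  exists_uniformizer : ∃ ϖ : Fˣ, IsUniformizer (ϖ : F) ∧ ‖(ϖ : F)‖ = (resCard F : ℝ)⁻¹

section Basics

variable {F : Type*} [NontriviallyNormedField F] [IsUltrametricDist F] [NormalizedField F]

variable (F) in
/-- A chosen prime element. -/
def unif : Fˣ := (NormalizedField.exists_uniformizer (F := F)).choose

theorem unif_isUniformizer : IsUniformizer (unif F : F) :=
  (NormalizedField.exists_uniformizer (F := F)).choose_spec.1

theorem norm_unif : ‖(unif F : F)‖ = (resCard F : ℝ)⁻¹ :=
  (NormalizedField.exists_uniformizer (F := F)).choose_spec.2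

variable (F) in
theorem one_lt_q : 1 < (resCard F : ℝ) := by
  have h1 := (unif_isUniformizer (F := F)).2.1
  have h0 : 0 < ‖(unif F : F)‖ := norm_pos_iff.2 (unif F).ne_zero
  rw [norm_unif] at h1 h0
  have := inv_pos.1 h0
  exact (inv_lt_one₀ this).1 h1

variable (F) in
theorem q_pos : 0 < (resCard F : ℝ) := zero_lt_one.trans (one_lt_q F)

variable (F) in
theorem q_ne_zero : (resCard F : ℝ) ≠ 0 := (q_pos F).ne'

variable (F) in
theorem qC_ne_zero : (resCard F : ℂ) ≠ 0 := by exact_mod_cast q_ne_zero F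

variable (F) in
theorem zpow_q_pos (k : ℤ) : 0 < (resCard F : ℝ) ^ k := zpow_pos (q_pos F) k

theorem zpow_q_le {j k : ℤ} : (resCard F : ℝ) ^ j ≤ (resCard F : ℝ) ^ k ↔ j ≤ k :=
  zpow_le_zpow_iff_right₀ (one_lt_q F)

theorem zpow_q_lt {j k : ℤ} : (resCard F : ℝ) ^ j < (resCard F : ℝ) ^ k ↔ j < k :=
  zpow_lt_zpow_iff_right₀ (one_lt_q F)

theorem zpow_q_inj {j k : ℤ} : (resCard F : ℝ) ^ j = (resCard F : ℝ) ^ k ↔ j = k :=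
  zpow_right_inj₀ (q_pos F) (one_lt_q F).ne'

theorem norm_unif_zpow (k : ℤ) : ‖((unif F ^ k : Fˣ) : F)‖ = (resCard F : ℝ) ^ (-k) := by
  rw [Units.val_zpow_eq_zpow_val, norm_zpow, norm_unif, inv_zpow, zpow_neg]

theorem exists_norm_eq_zpow {x : F} (hx : x ≠ 0) : ∃ k : ℤ, ‖x‖ = (resCard F : ℝ) ^ k := by
  obtain ⟨k, hk1, hk2⟩ := exists_mem_Ioc_zpow (norm_pos_iff.2 hx) (one_lt_q F)
  refine ⟨k + 1, le_antisymm hk2 ?_⟩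
  by_contra h
  push Not at h
  have h3 : ‖x * ((unif F ^ (k + 1) : Fˣ) : F)‖ < 1 := by
    rw [norm_mul, norm_unif_zpow, zpow_neg, ← div_eq_mul_inv, div_lt_one (zpow_q_pos F _)]
    exact h
  have h4 := unif_isUniformizer.2.2 _ h3
  rw [norm_mul, norm_unif_zpow, norm_unif, ← zpow_neg_one, zpow_neg, ← div_eq_mul_inv,
    div_le_iff₀ (zpow_q_pos F _), ← zpow_add₀ (q_ne_zero F)] at h4
  grind

/-- The exponent `k` with `‖u‖ = q ^ k`. -/
def lv (u : Fˣ) : ℤ := (exists_norm_eq_zpow u.ne_zero).choose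

theorem norm_eq_lv (u : Fˣ) : ‖(u : F)‖ = (resCard F : ℝ) ^ lv u :=
  (exists_norm_eq_zpow u.ne_zero).choose_spec

theorem lv_mul (u v : Fˣ) : lv (u * v) = lv u + lv v := by
  rw [← zpow_q_inj (F := F), ← norm_eq_lv, zpow_add₀ (q_ne_zero F), ← norm_eq_lv, ← norm_eq_lv,
    val_mul, norm_mul]

theorem lv_one : lv (1 : Fˣ) = 0 := by rw [← zpow_q_inj (F := F), ← norm_eq_lv]; simp

theorem lv_inv (u : Fˣ) : lv u⁻¹ = -lv u := by
  have := lv_mul u u⁻¹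
  rw [mul_inv_cancel, lv_one] at this
  omega

theorem lv_zpow (u : Fˣ) (k : ℤ) : lv (u ^ k) = k * lv u := by
  rw [← zpow_q_inj (F := F), ← norm_eq_lv, Units.val_zpow_eq_zpow_val, norm_zpow, norm_eq_lv,
    ← zpow_mul, mul_comm]

theorem lv_neg (u : Fˣ) : lv (-u) = lv u := by
  rw [← zpow_q_inj (F := F), ← norm_eq_lv, ← norm_eq_lv]; simp

theorem lv_of_isUniformizer {ϖ : Fˣ} (h : IsUniformizer (ϖ : F)) : lv ϖ = -1 := by
  rw [← zpow_q_inj (F := F), ← norm_eq_lv, zpow_neg_one, ← norm_unif]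
  exact le_antisymm (unif_isUniformizer.2.2 _ h.2.1) (h.2.2 _ unif_isUniformizer.2.1)

theorem lv_unif : lv (unif F) = -1 := lv_of_isUniformizer unif_isUniformizer

theorem lv_unif_zpow (k : ℤ) : lv (unif F ^ k) = -k := by rw [lv_zpow, lv_unif]; ring

theorem norm_le_zpow_iff (u : Fˣ) (k : ℤ) : ‖(u : F)‖ ≤ (resCard F : ℝ) ^ k ↔ lv u ≤ k := by
  rw [norm_eq_lv, zpow_q_le]

theorem norm_eq_zpow_iff (u : Fˣ) (k : ℤ) : ‖(u : F)‖ = (resCard F : ℝ) ^ k ↔ lv u = k := by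
  rw [norm_eq_lv, zpow_q_inj]

theorem norm_le_one_iff (u : Fˣ) : ‖(u : F)‖ ≤ 1 ↔ lv u ≤ 0 := by rw [← norm_le_zpow_iff, zpow_zero]

theorem norm_eq_one_iff (u : Fˣ) : ‖(u : F)‖ = 1 ↔ lv u = 0 := by rw [← norm_eq_zpow_iff, zpow_zero]

theorem norm_le_pred {x : F} {k : ℤ} (h : ‖x‖ < (resCard F : ℝ) ^ k) :
    ‖x‖ ≤ (resCard F : ℝ) ^ (k - 1) := by
  rcases eq_or_ne x 0 with rfl | hx
  · simpa using (zpow_q_pos F (k - 1)).le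
  · obtain ⟨j, hj⟩ := exists_norm_eq_zpow hx
    rw [hj, zpow_q_lt] at h
    rw [hj, zpow_q_le]
    omega

theorem norm_lt_iff_le_pred {x : F} {k : ℤ} :
    ‖x‖ < (resCard F : ℝ) ^ k ↔ ‖x‖ ≤ (resCard F : ℝ) ^ (k - 1) :=
  ⟨norm_le_pred, fun h => h.trans_lt (zpow_q_lt.2 (by omega))⟩

variable (F) in
/-- The ball of radius `q ^ k`. -/
def ball (k : ℤ) : AddSubgroup F where
  carrier := {x | ‖x‖ ≤ (resCard F : ℝ) ^ k}
  zero_mem' := by simpa using (zpow_q_pos F k).le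
  add_mem' := fun {x y} hx hy => (IsUltrametricDist.norm_add_le_max x y).trans (max_le hx hy)
  neg_mem' := fun {x} hx => by simp_all

theorem mem_ball {k : ℤ} {x : F} : x ∈ ball F k ↔ ‖x‖ ≤ (resCard F : ℝ) ^ k := Iff.rfl

theorem ball_mono {j k : ℤ} (h : j ≤ k) : ball F j ≤ ball F k :=
  fun _ hx => le_trans (mem_ball.1 hx) (zpow_q_le.2 h)

theorem mul_mem_ball {j k : ℤ} {x y : F} (hx : x ∈ ball F j) (hy : y ∈ ball F k) :
    x * y ∈ ball F (j + k) := by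
  rw [mem_ball, norm_mul, zpow_add₀ (q_ne_zero F)]
  exact mul_le_mul hx hy (norm_nonneg _) (zpow_q_pos F _).le

theorem units_mem_ball {u : Fˣ} {k : ℤ} : (u : F) ∈ ball F k ↔ lv u ≤ k := norm_le_zpow_iff u k

theorem unit_mul_mem_ball {u : Fˣ} {k : ℤ} {x : F} : (u : F) * x ∈ ball F k ↔
    x ∈ ball F (k - lv u) := by
  rw [mem_ball, mem_ball, norm_mul, norm_eq_lv, zpow_sub₀ (q_ne_zero F),
    le_div_iff₀' (zpow_q_pos F _)]

theorem ball_eq_closedBall (k : ℤ) : (ball F k : Set F) =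
    Metric.closedBall 0 ((resCard F : ℝ) ^ k) := by
  ext x; simp [mem_ball]

theorem isClopen_ball (k : ℤ) : IsClopen (ball F k : Set F) := by
  rw [ball_eq_closedBall]
  exact IsUltrametricDist.isClopen_closedBall _ (zpow_q_pos F k).ne'

theorem ball_mem_nhds (x : F) (k : ℤ) : {y | y - x ∈ ball F k} ∈ nhds x := by
  have h : Continuous fun y : F => y - x := by fun_prop
  exact ((isClopen_ball k).2.preimage h).mem_nhds (by simp)

theorem exists_mem_ball (x : F) : ∃ k : ℕ, x ∈ ball F k := by
  obtain ⟨k, hk⟩ := pow_unbounded_of_one_lt ‖x‖ (one_lt_q F)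
  exact ⟨k, by rw [mem_ball, zpow_natCast]; grind⟩

theorem exists_ball_subset {U : Set F} (hU : U ∈ nhds (0 : F)) :
    ∃ k : ℕ, ∀ x ∈ ball F (-(k : ℤ)), x ∈ U := by
  obtain ⟨ε, hε, h⟩ := Metric.mem_nhds_iff.1 hU
  obtain ⟨k, hk⟩ := exists_pow_lt_of_lt_one hε (inv_lt_one_of_one_lt₀ (one_lt_q F))
  refine ⟨k, fun x hx => h ?_⟩
  rw [mem_ball, zpow_neg, zpow_natCast, ← inv_pow] at hx
  simpa using hx.trans_lt hk

theorem norm_add_eq_of_lt {x y : F} (h : ‖y‖ < ‖x‖) : ‖x + y‖ = ‖x‖ := by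
  rw [add_comm]
  exact IsUltrametricDist.norm_add_eq_max_of_norm_ne_norm h.ne |>.trans (max_eq_right h.le)

end Basics

section Measure

variable {F : Type*} [NontriviallyNormedField F] [IsUltrametricDist F]
    [ProperSpace F] [MeasurableSpace F] [BorelSpace F]

local notation "𝒪" => Valuation.valuationSubring (NormedField.valuation (K := F))

instance haarF_isAddHaar : (haarF F).IsAddHaarMeasure := by unfold haarF; infer_instance

instance borelSpace_units : BorelSpace Fˣ := ⟨by
    change MeasurableSpace.comap Units.val _ = _
    rw [BorelSpace.measurable_eq (α := F)]
    exact borel_comap.symm.trans (congrArg (@_root_.borel Fˣ)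
      (Units.isOpenEmbedding_val (R := F)).eq_induced.symm)⟩

instance secondCountable_units : SecondCountableTopology Fˣ :=
  (Units.isOpenEmbedding_val (R := F)).isEmbedding.secondCountableTopology

theorem eq_smul_haarF (ρ : Measure F) [SigmaFinite ρ] [ρ.IsAddLeftInvariant] :
    ρ = ρ (Metric.closedBall 0 1) • haarF F :=
  Measure.addHaarMeasure_unique ρ ⟨⟨Metric.closedBall 0 1, isCompact_closedBall 0 1⟩,
    ⟨0, Metric.ball_subset_interior_closedBall (Metric.mem_ball_self one_pos)⟩⟩

variable [NormalizedField F]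

theorem haarF_ball_zero : haarF F (ball F 0) = 1 := by
  rw [ball_eq_closedBall, zpow_zero]
  exact Measure.addHaarMeasure_self

theorem measurableSet_ball (k : ℤ) : MeasurableSet (ball F k : Set F) :=
  (isClopen_ball k).1.measurableSet

theorem isCompact_ball (k : ℤ) : IsCompact (ball F k : Set F) := by
  rw [ball_eq_closedBall]; exact isCompact_closedBall _ _

theorem haarF_ball_lt_top (k : ℤ) : haarF F (ball F k) < ⊤ := (isCompact_ball k).measure_lt_top

theorem haarF_ball_index : haarF F (ball F 0) = resCard F * haarF F (ball F (-1)) := by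
  have hq : Nat.card (IsLocalRing.ResidueField 𝒪)
      ≠ 0 := by
    have := q_ne_zero F
    simpa [resCard] using this
  have : Finite (IsLocalRing.ResidueField 𝒪) := (Nat.card_ne_zero.1 hq).2
  have := Fintype.ofFinite
    (IsLocalRing.ResidueField 𝒪)
  have hsurj := IsLocalRing.residue_surjective
    (R := 𝒪)
  choose r hr using hsurj
  have hmem : ∀ x : F, x ∈ 𝒪 ↔ x ∈ ball F 0 := by
    intro x
    rw [mem_ball, zpow_zero]
    rfl
  have hres : ∀ x : 𝒪, IsLocalRing.residue _ x = 0 ↔ (x : F) ∈ ball F (-1) := by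
    intro x
    rw [IsLocalRing.residue_eq_zero_iff, IsLocalRing.mem_maximalIdeal, mem_nonunits_iff, mem_ball,
        ← zero_sub, ← norm_lt_iff_le_pred, zpow_zero]
    have h1 : ‖(x : F)‖ ≤ 1 := by
      have := (hmem x).1 x.2
      rwa [mem_ball, zpow_zero] at this
    have h2 : IsUnit x ↔ ‖(x : F)‖ = 1 := by
      constructor
      · intro h
        obtain ⟨y, hy⟩ := h.exists_right_inv
        have hy1 : ‖(y : F)‖ ≤ 1 := by
          have := (hmem y).1 y.2
          rwa [mem_ball, zpow_zero] at this
        have hy2 : ‖(x : F)‖ * ‖(y : F)‖ = 1 := by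
          rw [← norm_mul]
          have := congrArg (fun z : 𝒪 => ‖(z : F)‖) hy
          simpa using this
        refine le_antisymm h1 ?_
        rw [← hy2]
        exact mul_le_of_le_one_right (norm_nonneg _) hy1
      · intro h
        have hx0 : (x : F) ≠ 0 := by
          intro h0
          simp_all
        refine IsUnit.of_mul_eq_one ⟨(x : F)⁻¹, (hmem _).2 ?_⟩ (Subtype.ext (mul_inv_cancel₀ hx0))
        rw [mem_ball, zpow_zero, norm_inv, h, inv_one]
    grind
  have hunion : (ball F 0 : Set F) = ⋃ i, (fun x =>
      ((r i : _) : F) + x) '' (ball F (-1) : Set F) := by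
    ext x
    simp only [Set.mem_iUnion, Set.mem_image]
    constructor
    · intro hx
      refine ⟨IsLocalRing.residue _ ⟨x, (hmem x).2 hx⟩, x - _, ?_, add_sub_cancel _ _⟩
      have := (hres (⟨x, (hmem x).2 hx⟩ - r (IsLocalRing.residue _ ⟨x, (hmem x).2 hx⟩))).1
        (by grind)
      simp_all
    · rintro ⟨i, y, hy, rfl⟩
      exact (ball F 0).add_mem ((hmem _).1 (r i).2) (ball_mono (by norm_num) hy)
  rw [hunion, measure_iUnion]
  · simp only [Set.image_add_left, measure_preimage_add]
    rw [tsum_fintype, Finset.sum_const, nsmul_eq_mul, Finset.card_univ, ← Nat.card_eq_fintype_card]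
    rfl
  · intro i j hij
    rw [Function.onFun, Set.disjoint_left]
    rintro _ ⟨y, hy, rfl⟩ ⟨z, hz, hzy⟩
    apply hij
    have h1 : ((r i - r j : 𝒪) : F) ∈ ball F (-1) := by
      have : ((r i - r j : 𝒪) : F) = z - y := by
        push_cast
        grind
      rw [this]
      exact (ball F (-1)).sub_mem hz hy
    grind
  · intro i
    rw [Set.image_add_left]
    exact (measurable_const_add _) (measurableSet_ball _)

theorem map_mul_haarF_aux (a : Fˣ) :
    (haarF F).map (fun x => (a : F) * x) = haarF F (ball F (-lv a)) • haarF F := by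
  have hm : Measurable fun x : F => (a : F) * x := measurable_const_mul _
  have : ((haarF F).map (fun x => (a : F) * x)).IsAddLeftInvariant := by
    refine ⟨fun y => ?_⟩
    rw [Measure.map_map (measurable_const_add _) hm]
    have h1 : (fun x => y + x) ∘ (fun x => (a : F) * x) =
        (fun x => (a : F) * x) ∘ (fun x => ((a⁻¹ : Fˣ) : F) * y + x) := by
      ext x
      simp [mul_add]
    rw [h1, ← Measure.map_map hm (measurable_const_add _), map_add_left_eq_self]
  have : SigmaFinite ((haarF F).map (fun x => (a : F) * x)) :=
    (MeasurableEquiv.mulLeft₀ (a : F) a.ne_zero).sigmaFinite_map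
  conv_lhs => rw [eq_smul_haarF ((haarF F).map (fun x => (a : F) * x))]
  congr 1
  rw [Measure.map_apply hm measurableSet_closedBall]
  congr 1
  ext x
  have := unit_mul_mem_ball (u := a) (k := 0) (x := x)
  rw [mem_ball, zpow_zero, zero_sub] at this
  simp_all

theorem haarF_ball (k : ℤ) : haarF F (ball F k) = ENNReal.ofReal ((resCard F : ℝ) ^ k) := by
  have h1 : ∀ k : ℤ, haarF F (ball F (k + 1)) = haarF F (ball F 1) * haarF F (ball F k) := by
    intro k
    have h := congrArg (fun ρ => ρ (ball F k : Set F)) (map_mul_haarF_aux (unif F))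
    rw [lv_unif, neg_neg] at h
    simp only [Measure.smul_apply, smul_eq_mul] at h
    rw [← h, Measure.map_apply (measurable_const_mul _) (measurableSet_ball _)]
    congr 1
    ext x
    change _ ↔ (unif F : F) * x ∈ ball F k
    rw [unit_mul_mem_ball, lv_unif, sub_neg_eq_add]
    rfl
  have h2 : haarF F (ball F 1) = resCard F := by
    have h3 := h1 (-1)
    rw [neg_add_cancel, haarF_ball_index] at h3
    have h4 : haarF F (ball F (-1)) ≠ 0 := by
      intro h
      have := haarF_ball_index (F := F)
      rw [h, mul_zero, haarF_ball_zero] at this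
      simp_all
    exact ((ENNReal.mul_left_inj h4 (haarF_ball_lt_top _).ne).1 h3).symm
  have hq : (resCard F : ENNReal) = ENNReal.ofReal (resCard F : ℝ) := by simp
  induction k using Int.induction_on with
  | zero => simp [haarF_ball_zero]
  | succ k ih =>
    rw [h1, h2, ih, hq, ← ENNReal.ofReal_mul (q_pos F).le, zpow_add_one₀ (q_ne_zero F), mul_comm]
  | pred k ih =>
    have h3 := h1 (-(k : ℤ) - 1)
    rw [sub_add_cancel, ih, h2, hq] at h3
    have h4 : (resCard F : ℝ) ^ (-(k : ℤ)) = resCard F * (resCard F : ℝ) ^ (-(k : ℤ) - 1) := by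
      rw [mul_comm, ← zpow_add_one₀ (q_ne_zero F), sub_add_cancel]
    rw [h4, ENNReal.ofReal_mul (q_pos F).le] at h3
    exact ((ENNReal.mul_right_inj (ENNReal.ofReal_pos.2 (q_pos F)).ne' ENNReal.ofReal_ne_top).1 h3).symm

theorem haarF_real_ball (k : ℤ) : (haarF F).real (ball F k) = (resCard F : ℝ) ^ k := by
  rw [Measure.real, haarF_ball, ENNReal.toReal_ofReal (zpow_q_pos F k).le]

theorem map_mul_haarF (a : Fˣ) :
    (haarF F).map (fun x => (a : F) * x) = ENNReal.ofReal (‖(a : F)‖⁻¹) • haarF F := by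
  rw [map_mul_haarF_aux, haarF_ball, norm_eq_lv, zpow_neg]

theorem integral_mul_haarF {E : Type*} [NormedAddCommGroup E] [NormedSpace ℝ E] (a : Fˣ)
    (f : F → E) : ∫ x, f (a * x) ∂haarF F = ‖(a : F)‖⁻¹ • ∫ x, f x ∂haarF F := by
  have h := MeasurableEmbedding.integral_map (μ := haarF F)
    (MeasurableEquiv.mulLeft₀ (a : F) a.ne_zero).measurableEmbedding f
  change ∫ y, f y ∂((haarF F).map fun x => (a : F) * x) = ∫ x, f (a * x) ∂haarF F at h
  rw [← h, map_mul_haarF, integral_smul_measure, ENNReal.toReal_ofReal (by simp)]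

theorem lintegral_mul_haarF (a : Fˣ) (f : F → ENNReal) :
    ∫⁻ x, f (a * x) ∂haarF F = ENNReal.ofReal ‖(a : F)‖⁻¹ * ∫⁻ x, f x ∂haarF F := by
  have h := lintegral_map_equiv (μ := haarF F) f (MeasurableEquiv.mulLeft₀ (a : F) a.ne_zero)
  change ∫⁻ y, f y ∂((haarF F).map fun x => (a : F) * x) = ∫⁻ x, f (a * x) ∂haarF F at h
  rw [← h, map_mul_haarF, lintegral_smul_measure, smul_eq_mul]

/-! ### The multiplicative measure -/

theorem measurableEmbedding_unitsVal : MeasurableEmbedding (Units.val : Fˣ → F) :=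
  (Units.isOpenEmbedding_val (R := F)).measurableEmbedding

variable (F) in
/-- The volume `1 - q⁻¹` of the units for the additive measure. -/
def volUnits : ℝ := 1 - (resCard F : ℝ)⁻¹

variable (F) in
theorem volUnits_pos : 0 < volUnits F := sub_pos.2 (inv_lt_one_of_one_lt₀ (one_lt_q F))

theorem range_unitsVal : Set.range (Units.val : Fˣ → F) = {0}ᶜ := by
  ext x
  simp only [Set.mem_range, Set.mem_compl_iff, Set.mem_singleton_iff]
  exact ⟨fun ⟨u, hu⟩ => hu ▸ u.ne_zero, fun h => ⟨mk0 x h, rfl⟩⟩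

theorem ae_ne_zero : ∀ᵐ x ∂haarF F, x ≠ 0 := by
  rw [ae_iff]
  simp

theorem lintegral_haarFx (f : F → ENNReal) (hf : Measurable f) : ∫⁻ u : Fˣ, f u ∂haarFx F =
      ENNReal.ofReal (volUnits F)⁻¹ * ∫⁻ x, ENNReal.ofReal ‖x‖⁻¹ * f x ∂haarF F := by
  rw [haarFx, lintegral_smul_measure, smul_eq_mul]
  congr 1
  rw [← measurableEmbedding_unitsVal.lintegral_map, measurableEmbedding_unitsVal.map_comap,
    range_unitsVal, restrict_withDensity (measurableSet_singleton 0).compl,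
    lintegral_withDensity_eq_lintegral_mul]
  · simp
  · fun_prop
  grind

theorem lintegral_haarFx' (g : Fˣ → ENNReal) (hg : Measurable g) :
    ∫⁻ u, g u ∂haarFx F = ENNReal.ofReal (volUnits F)⁻¹ *
      ∫⁻ x, ENNReal.ofReal ‖x‖⁻¹ * Function.extend Units.val g 0 x ∂haarF F := by
  rw [← lintegral_haarFx _ (measurableEmbedding_unitsVal.measurable_extend hg measurable_zero)]
  simp [Units.val_injective.extend_apply]

instance haarFx_isMulLeftInvariant : (haarFx F).IsMulLeftInvariant := by
  refine ⟨fun a => Measure.ext_of_lintegral _ fun g hg => ?_⟩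
  rw [lintegral_map hg (measurable_const_mul a), lintegral_haarFx' _ hg,
    lintegral_haarFx' (fun u => g (a * u)) (hg.comp (measurable_const_mul a))]
  congr 1
  have h := lintegral_mul_haarF a (fun x : F => ENNReal.ofReal ‖x‖⁻¹ *
      Function.extend Units.val g 0 x)
  have h1 : ∀ x : F, Function.extend Units.val g 0 (a * x) =
      Function.extend Units.val (fun u => g (a * u)) 0 x := by
    intro x
    by_cases hx : x = 0
    · simp_all
    · obtain ⟨u, rfl⟩ : ∃ u : Fˣ, (u : F) = x := ⟨mk0 x hx, rfl⟩
      rw [← val_mul, Units.val_injective.extend_apply, Units.val_injective.extend_apply]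
  have h0 : 0 < ‖(a : F)‖ := norm_pos_iff.2 a.ne_zero
  have h2 : ENNReal.ofReal ‖(a : F)‖⁻¹ ≠ 0 := by simp
  have h3 : ∀ x : F, ENNReal.ofReal ‖(a : F) * x‖⁻¹ = ENNReal.ofReal ‖(a : F)‖⁻¹ *
      ENNReal.ofReal ‖x‖⁻¹ := by
    intro x
    rw [norm_mul, mul_inv, ENNReal.ofReal_mul (by simp)]
  simp only [h1, h3, mul_assoc] at h
  rw [lintegral_const_mul' _ _ ENNReal.ofReal_ne_top,
    ENNReal.mul_right_inj h2 ENNReal.ofReal_ne_top] at h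
  exact h

theorem haarF_shell (k : ℤ) :
    haarF F {x | ‖x‖ = (resCard F : ℝ) ^ k} = ENNReal.ofReal ((resCard F : ℝ) ^ k *
        volUnits F) := by
  have h1 : {x : F | ‖x‖ = (resCard F : ℝ) ^ k} = (ball F k : Set F) \ ball F (k - 1) := by
    ext x
    change _ ↔ x ∈ ball F k ∧ ¬ x ∈ ball F (k - 1)
    rw [mem_ball, mem_ball, ← norm_lt_iff_le_pred, not_lt]
    grind
  rw [h1, measure_sdiff (ball_mono (by omega)) (measurableSet_ball _).nullMeasurableSet
    (haarF_ball_lt_top _).ne, haarF_ball, haarF_ball, ← ENNReal.ofReal_sub _ (zpow_q_pos F _).le,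
    zpow_sub_one₀ (q_ne_zero F), volUnits]
  grind

theorem measurable_lv : Measurable (lv : Fˣ → ℤ) := by
  refine measurable_to_countable' fun k => ?_
  have : lv ⁻¹' {k} = {u : Fˣ | ‖(u : F)‖ = (resCard F : ℝ) ^ k} := by
    ext u; simp [norm_eq_zpow_iff]
  rw [this]
  exact (measurable_norm.comp Units.continuous_val.measurable) (measurableSet_singleton _)

theorem measurableSet_lv (s : Set ℤ) : MeasurableSet {u : Fˣ | lv u ∈ s} :=
  measurable_lv (MeasurableSet.of_discrete (s := s))

theorem haarFx_shell (k : ℤ) : haarFx F {u | lv u = k} = 1 := by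
  have hm : MeasurableSet {x : F | ‖x‖ = (resCard F : ℝ) ^ k} :=
    measurable_norm (measurableSet_singleton _)
  have h := lintegral_haarFx ({x : F | ‖x‖ = (resCard F : ℝ) ^ k}.indicator 1)
    (measurable_one.indicator hm)
  have h1 : (fun u : Fˣ => ({x : F | ‖x‖ = (resCard F : ℝ) ^ k}.indicator 1 (u : F) : ENNReal)) =
      {u : Fˣ | lv u = k}.indicator 1 := by
    ext u
    simp [indicator_apply, norm_eq_zpow_iff]
  rw [h1, lintegral_indicator_one (show MeasurableSet {u : Fˣ | lv u =
      k} from measurableSet_lv {k})] at h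
  rw [h]
  have h2 : ∀ x : F, ENNReal.ofReal ‖x‖⁻¹ * {x : F | ‖x‖ = (resCard F : ℝ) ^ k}.indicator 1 x =
      {x : F | ‖x‖ = (resCard F : ℝ) ^ k}.indicator
        (fun _ => ENNReal.ofReal ((resCard F : ℝ) ^ k)⁻¹) x := by
    intro x
    by_cases hx : ‖x‖ = (resCard F : ℝ) ^ k <;> simp [hx]
  simp only [h2]
  have hp := zpow_q_pos F k
  have hv := volUnits_pos F
  rw [lintegral_indicator_const hm, haarF_shell, ← ENNReal.ofReal_mul (by positivity),
    ← ENNReal.ofReal_mul (by positivity), ENNReal.ofReal_eq_one]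
  field_simp

theorem isCompact_lv_zero : IsCompact {u : Fˣ | lv u = 0} := by
  rw [(Units.isOpenEmbedding_val (R := F)).isEmbedding.isInducing.isCompact_iff]
  have : Units.val '' {u : Fˣ | lv u = 0} = Metric.sphere (0 : F) 1 := by
    ext x
    simp only [Set.mem_image, mem_ofPred_eq, mem_sphere_zero_iff_norm]
    constructor
    · rintro ⟨u, hu, rfl⟩
      exact (norm_eq_one_iff u).2 hu
    · intro hx
      refine ⟨mk0 x ?_, (norm_eq_one_iff _).1 hx, rfl⟩
      rintro rfl
      simp at hx
  rw [this]
  exact isCompact_sphere _ _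

theorem continuous_lv : Continuous (lv : Fˣ → ℤ) := by
  rw [continuous_discrete_rng]
  intro k
  have : lv ⁻¹' {k} = Units.val ⁻¹' ((ball F k : Set F) \ ball F (k - 1)) := by
    ext u
    change lv u = k ↔ (u : F) ∈ ball F k ∧ ¬ (u : F) ∈ ball F (k - 1)
    rw [units_mem_ball, units_mem_ball]
    omega
  rw [this]
  exact ((isClopen_ball k).2.sdiff (isClopen_ball (k - 1)).1).preimage Units.continuous_val

theorem isOpen_lv (s : Set ℤ) : IsOpen {u : Fˣ | lv u ∈ s} :=
  (isOpen_discrete s).preimage continuous_lv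

instance haarFx_isHaarMeasure : (haarFx F).IsHaarMeasure := by
  have h := haarFx_shell (F := F) 0
  refine Measure.isHaarMeasure_of_isCompact_nonempty_interior _ {u : Fˣ | lv u = 0}
    isCompact_lv_zero ⟨1, ?_⟩ (by simp_all) (by simp_all)
  rw [(show IsOpen {u : Fˣ | lv u = 0} from isOpen_lv {0}).interior_eq]
  exact lv_one

instance locallyCompact_units : LocallyCompactSpace Fˣ :=
  (Units.isOpenEmbedding_val (R := F)).locallyCompactSpace

instance haarFx_isInvInvariant : (haarFx F).IsInvInvariant := inferInstance

theorem integral_haarFx {E : Type*} [NormedAddCommGroup E] [NormedSpace ℝ E] (f : F → E) :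
    ∫ u : Fˣ, f u ∂haarFx F = (volUnits F)⁻¹ • ∫ x, ‖x‖⁻¹ • f x ∂haarF F := by
  rw [haarFx, integral_smul_measure, ← measurableEmbedding_unitsVal.integral_map,
    measurableEmbedding_unitsVal.map_comap, range_unitsVal,
    restrict_withDensity (measurableSet_singleton 0).compl]
  have hv := volUnits_pos F
  rw [ENNReal.toReal_ofReal (by unfold volUnits at hv; positivity)]
  congr 1
  rw [integral_withDensity_eq_integral_toReal_smul (by fun_prop) (by simp)]
  simp

theorem integrable_haarFx {E : Type*} [NormedAddCommGroup E] [NormedSpace ℝ E] (f : F → E) :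
    Integrable (fun u : Fˣ => f u) (haarFx F) ↔ Integrable (fun x => ‖x‖⁻¹ • f x) (haarF F) := by
  have hv := volUnits_pos F
  have hv' : ENNReal.ofReal (1 - (resCard F : ℝ)⁻¹)⁻¹ ≠ 0 := by unfold volUnits at hv; simp_all
  rw [haarFx, integrable_smul_measure hv' ENNReal.ofReal_ne_top]
  change Integrable (f ∘ Units.val) _ ↔ _
  rw [← measurableEmbedding_unitsVal.integrable_map_iff,
    measurableEmbedding_unitsVal.map_comap, range_unitsVal,
    restrict_withDensity (measurableSet_singleton 0).compl,
    integrable_withDensity_iff_integrable_smul' (by fun_prop) (by simp)]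
  simp

theorem integral_haarF {E : Type*} [NormedAddCommGroup E] [NormedSpace ℝ E] (f : F → E) :
    ∫ x, f x ∂haarF F = volUnits F • ∫ u : Fˣ, ‖(u : F)‖ • f u ∂haarFx F := by
  have hv := volUnits_pos F
  rw [integral_haarFx (fun x => ‖x‖ • f x), smul_smul, mul_inv_cancel₀ hv.ne', one_smul]
  refine integral_congr_ae ?_
  filter_upwards [ae_ne_zero] with x hx
  simp_all

theorem integrable_haarF {E : Type*} [NormedAddCommGroup E] [NormedSpace ℝ E] (f : F → E) :
    Integrable f (haarF F) ↔ Integrable (fun u : Fˣ => ‖(u : F)‖ • f u) (haarFx F) := by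
  rw [integrable_haarFx (fun x => ‖x‖ • f x)]
  refine integrable_congr ?_
  filter_upwards [ae_ne_zero] with x hx
  simp_all

end Measure

section Chars

variable {F : Type*} [NontriviallyNormedField F] [IsUltrametricDist F] [NormalizedField F]

/-! ### Quasi-characters -/

theorem qc_inv (χ : QuasiChar F) (u : Fˣ) : χ⁻¹ u = (χ u)⁻¹ := rfl

theorem absPow_apply (s : ℂ) (u : Fˣ) : ((absPow F s u : ℂˣ) : ℂ) = ((‖(u : F)‖ : ℝ) : ℂ) ^ s := rfl

/-- `χ` is trivial on the units congruent to `1` modulo `𝔭ⁿ`. -/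
def TrivialMod (χ : QuasiChar F) (n : ℕ) : Prop :=
  ∀ u : Fˣ, lv u = 0 → (u : F) - 1 ∈ ball F (-(n : ℤ)) → χ u = 1

theorem TrivialMod.mono {χ : QuasiChar F} {m n : ℕ} (h : TrivialMod χ m) (hmn : m ≤ n) :
    TrivialMod χ n :=
  fun u hu hu1 => h u hu (ball_mono (by omega) hu1)

theorem TrivialMod.mul {χ χ' : QuasiChar F} {n : ℕ} (h : TrivialMod χ n) (h' : TrivialMod χ' n) :
    TrivialMod (χ * χ') n := fun u hu hu1 => by
  rw [mul_apply, h u hu hu1, h' u hu hu1, one_mul]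

theorem TrivialMod.inv {χ : QuasiChar F} {n : ℕ} (h : TrivialMod χ n) :
    TrivialMod χ⁻¹ n := fun u hu hu1 => by
  rw [qc_inv, h u hu hu1, inv_one]

theorem TrivialMod.absPow (s : ℂ) (n : ℕ) : TrivialMod (absPow F s) n := fun u hu _ => by
  ext
  rw [absPow_apply, (norm_eq_one_iff u).2 hu]
  simp

theorem continuous_quasiChar (χ : QuasiChar F) : Continuous fun u : Fˣ => (χ u : ℂ) :=
  Units.continuous_val.comp χ.continuous_toFun

theorem lv_eq_zero_of_sub_one_mem {u : Fˣ} {n : ℕ} (hn : 1 ≤ n)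
    (h : (u : F) - 1 ∈ ball F (-(n : ℤ))) : lv u = 0 := by
  rw [← norm_eq_one_iff]
  have h1 : ‖(u : F) - 1‖ < ‖(1 : F)‖ := by
    rw [norm_one]
    refine (mem_ball.1 h).trans_lt ?_
    rw [← zpow_zero (resCard F : ℝ), zpow_q_lt]
    omega
  have := norm_add_eq_of_lt h1
  simp_all

theorem exists_trivialMod (χ : QuasiChar F) : ∃ n : ℕ, 1 ≤ n ∧ TrivialMod χ n := by
  have h1 : ∀ᶠ u in nhds (1 : Fˣ), ‖(χ u : ℂ) - 1‖ < 1 / 2 := by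
    have h : Filter.Tendsto (fun u : Fˣ => ‖(χ u : ℂ) - 1‖) (nhds 1) (nhds 0) := by
      have h0 : Continuous fun u : Fˣ => ‖(χ u : ℂ) - 1‖ :=
        ((continuous_quasiChar χ).sub continuous_const).norm
      simpa using h0.tendsto 1
    exact h.eventually_lt_const (by norm_num)
  have h2 : ∃ n : ℕ, 1 ≤ n ∧ ∀ u : Fˣ, (u : F) - 1 ∈ ball F (-(n : ℤ)) → ‖(χ u : ℂ) -
      1‖ < 1 / 2 := by
    have hcomap : nhds (1 : Fˣ) = Filter.comap Units.val (nhds ((1 : Fˣ) : F)) := by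
      rw [← Topology.IsInducing.nhds_eq_comap]
      refine ⟨?_⟩
      exact (Units.isEmbedding_val₀ (G₀ := F)).eq_induced
    rw [hcomap, Filter.eventually_comap, val_one] at h1
    have h3 : {x : F | ∀ a : Fˣ, (a : F) = x + 1 → ‖(χ a : ℂ) - 1‖ < 1 / 2} ∈ nhds (0 : F) := by
      have hc : Filter.Tendsto (fun x : F => x + 1) (nhds 0) (nhds 1) := by
        have : Continuous fun x : F => x + 1 := by fun_prop
        simpa using this.tendsto 0
      exact hc.eventually h1
    obtain ⟨k, hk⟩ := exists_ball_subset h3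
    refine ⟨k + 1, by omega, fun u hu => ?_⟩
    exact hk _ (ball_mono (by simp) hu) u (by ring)
  obtain ⟨n, hn, h⟩ := h2
  refine ⟨n, hn, fun u hu0 hu => ?_⟩
  have h3 : ∀ j : ℕ, ((u ^ 2 ^ j : Fˣ) : F) - 1 ∈ ball F (-(n : ℤ)) := by
    intro j
    induction j with
    | zero => simp_all
    | succ j ih =>
      rw [pow_succ, pow_mul, sq, val_mul]
      have h4 : ((u ^ 2 ^ j : Fˣ) : F) ∈ ball F 0 := by
        rw [units_mem_ball, lv_eq_zero_of_sub_one_mem hn ih]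
      have h5 := mul_mem_ball h4 ih
      rw [zero_add] at h5
      convert (ball F (-(n : ℤ))).add_mem h5 ih using 1
      ring
  have h6 : ∀ j : ℕ, (3 / 2 : ℝ) ^ j * ‖(χ u : ℂ) - 1‖ ≤ ‖(χ (u ^ 2 ^ j) : ℂ) - 1‖ := by
    intro j
    induction j with
    | zero => simp
    | succ j ih =>
      have h7 := h _ (h3 j)
      rw [pow_succ, pow_succ, pow_mul, map_pow, Units.val_pow_eq_pow_val]
      have h8 : (χ (u ^ 2 ^ j) : ℂ) ^ 2 - 1 =
          ((χ (u ^ 2 ^ j) : ℂ) - 1) * (2 + ((χ (u ^ 2 ^ j) : ℂ) - 1)) := by ring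
      rw [h8, norm_mul]
      have h9 : 3 / 2 ≤ ‖2 + ((χ (u ^ 2 ^ j) : ℂ) - 1)‖ := by
        have := norm_sub_le_norm_add (2 : ℂ) ((χ (u ^ 2 ^ j) : ℂ) - 1)
        have h10 : ‖(2 : ℂ)‖ = 2 := by simp
        linarith
      nlinarith [norm_nonneg ((χ (u ^ 2 ^ j) : ℂ) - 1)]
  have h11 : ‖(χ u : ℂ) - 1‖ = 0 := by
    by_contra hne
    have hpos : 0 < ‖(χ u : ℂ) - 1‖ := lt_of_le_of_ne (norm_nonneg _) (Ne.symm hne)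
    obtain ⟨j, hj⟩ := pow_unbounded_of_one_lt (1 / ‖(χ u : ℂ) - 1‖) (by norm_num : (1 : ℝ) < 3 / 2)
    rw [div_lt_iff₀ hpos] at hj
    grind
  ext
  simpa [sub_eq_zero] using h11

theorem trivialMod_of_charConductor_le {χ : QuasiChar F} {n : ℕ} (h : charConductor χ ≤ n) :
    TrivialMod χ n := by
  have hne : {n : ℕ | ∀ u : Fˣ, ‖(u : F)‖ = 1 → ‖(u : F) - 1‖ ≤ ((resCard F : ℝ)⁻¹) ^ n →
      χ u = 1}.Nonempty := by
    obtain ⟨m, -, hm⟩ := exists_trivialMod χ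
    refine ⟨m, fun u hu hu1 => hm u ((norm_eq_one_iff u).1 hu) ?_⟩
    rwa [mem_ball, zpow_neg, zpow_natCast, ← inv_pow]
  have h1 := Nat.sInf_mem hne
  refine TrivialMod.mono (m := charConductor χ) (fun u hu hu1 => ?_) h
  refine h1 u ((norm_eq_one_iff u).2 hu) ?_
  rw [mem_ball, zpow_neg, zpow_natCast, ← inv_pow] at hu1
  exact hu1

theorem charConductor_le_of_trivialMod {χ : QuasiChar F} {n : ℕ} (h : TrivialMod χ n) :
    charConductor χ ≤ n := by
  refine Nat.sInf_le fun u hu hu1 => h u ((norm_eq_one_iff u).1 hu) ?_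
  rwa [mem_ball, zpow_neg, zpow_natCast, ← inv_pow]

theorem isUnramified_iff {χ : QuasiChar F} : IsUnramified χ ↔ ∀ u : Fˣ, lv u = 0 → χ u = 1 := by
  simp only [IsUnramified, norm_eq_one_iff]

theorem IsUnramified.trivialMod {χ : QuasiChar F} (h : IsUnramified χ) (n : ℕ) :
    TrivialMod χ n := fun u hu _ => isUnramified_iff.1 h u hu

theorem isUnramified_iff_trivialMod_zero {χ : QuasiChar F} : IsUnramified χ ↔ TrivialMod χ 0 := by
  refine ⟨fun h => h.trivialMod 0, fun h => isUnramified_iff.2 fun u hu => h u hu ?_⟩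
  exact (ball F _).sub_mem (units_mem_ball.2 (by simp [hu])) (by simp [mem_ball])

/-- Multiplying the argument by a unit close to `1` does not change the value. -/
theorem TrivialMod.eq_of_sub_mem {χ : QuasiChar F} {n : ℕ} (hn : 1 ≤ n) (h : TrivialMod χ n)
    {u v : Fˣ} (huv : (v : F) - u ∈ ball F (lv u - n)) : χ v = χ u := by
  have h1 : ((u⁻¹ * v : Fˣ) : F) - 1 ∈ ball F (-(n : ℤ)) := by
    have h2 : ((u⁻¹ * v : Fˣ) : F) - 1 = ((u⁻¹ : Fˣ) : F) * ((v : F) - u) := by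
      rw [mul_sub, Units.inv_mul, val_mul]
    rw [h2, unit_mul_mem_ball, lv_inv]
    grind
  have h3 := h _ (lv_eq_zero_of_sub_one_mem hn h1) h1
  rw [map_mul, map_inv, inv_mul_eq_one] at h3
  grind

theorem norm_quasiChar_eq_one [ProperSpace F] (χ : QuasiChar F) {u : Fˣ} (hu : lv u = 0) :
    ‖(χ u : ℂ)‖ = 1 := by
  borelize F
  obtain ⟨C, hC⟩ := (isCompact_lv_zero (F := F)).exists_bound_of_continuousOn
    (continuous_quasiChar χ).continuousOn
  have key : ∀ v : Fˣ, lv v = 0 → ‖(χ v : ℂ)‖ ≤ 1 := by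
    intro v hv
    by_contra! h
    obtain ⟨k, hk⟩ := pow_unbounded_of_one_lt C h
    have h1 := hC (v ^ k) (by
      change lv (v ^ k) = 0
      have := lv_zpow v k
      simp_all)
    rw [map_pow, Units.val_pow_eq_pow_val, norm_pow] at h1
    linarith
  refine le_antisymm (key u hu) ?_
  have h := key u⁻¹ (by rw [lv_inv, hu, neg_zero])
  rw [map_inv, val_inv_eq_inv_val, norm_inv] at h
  have hpos : 0 < ‖(χ u : ℂ)‖ := by simp
  exact (inv_le_one₀ hpos).1 h

/-- The absolute value of `χ` at a prime element. -/
def absAt (χ : QuasiChar F) : ℝ := ‖(χ (unif F) : ℂ)‖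

theorem absAt_pos (χ : QuasiChar F) : 0 < absAt χ := by simp [absAt]

theorem norm_quasiChar [ProperSpace F] (χ : QuasiChar F) (u : Fˣ) :
    ‖(χ u : ℂ)‖ = absAt χ ^ (-lv u) := by
  have h : lv (u * unif F ^ lv u) = 0 := by rw [lv_mul, lv_unif_zpow]; ring
  have h1 := norm_quasiChar_eq_one χ h
  rw [map_mul, map_zpow, val_mul, norm_mul, Units.val_zpow_eq_zpow_val, norm_zpow] at h1
  rw [zpow_neg]
  exact eq_inv_of_mul_eq_one_left h1

theorem absAt_mul (χ χ' : QuasiChar F) : absAt (χ * χ') = absAt χ * absAt χ' := by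
  simp [absAt]

theorem absAt_inv (χ : QuasiChar F) : absAt χ⁻¹ = (absAt χ)⁻¹ := by
  simp [absAt, qc_inv]

theorem absPow_unif (s : ℂ) : ((absPow F s (unif F) : ℂˣ) : ℂ) = (resCard F : ℂ) ^ (-s) := by
  rw [absPow_apply, norm_unif, Complex.ofReal_inv, Complex.inv_cpow, cpow_neg]
  · simp
  · rw [Complex.ofReal_natCast, Complex.natCast_arg]
    exact Real.pi_pos.ne

theorem absAt_absPow (s : ℂ) : absAt (absPow F s) = (resCard F : ℝ) ^ (-s.re) := by
  rw [absAt, absPow_apply, norm_unif, Complex.norm_cpow_eq_rpow_re_of_pos (inv_pos.2 (q_pos F)),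
    Real.inv_rpow (q_pos F).le, Real.rpow_neg (q_pos F).le]

theorem absPow_add (s t : ℂ) : absPow F (s + t) = absPow F s * absPow F t := by
  ext u
  have : ((‖(u : F)‖ : ℝ) : ℂ) ≠ 0 := by simp
  simp only [mul_apply, val_mul, absPow_apply, Complex.cpow_add _ _ this]

theorem absPow_neg (s : ℂ) : absPow F (-s) = (absPow F s)⁻¹ := by
  ext u
  simp only [qc_inv, val_inv_eq_inv_val, absPow_apply, cpow_neg]

theorem absPow_one_apply (u : Fˣ) : ((absPow F 1 u : ℂˣ) : ℂ) = ((‖(u : F)‖ : ℝ) : ℂ) := by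
  rw [absPow_apply, Complex.cpow_one]

theorem absPow_half_apply (u : Fˣ) :
    ((absPow F (1 / 2) u : ℂˣ) : ℂ) = ((‖(u : F)‖ ^ (1 / 2 : ℝ) : ℝ) : ℂ) := by
  rw [absPow_apply, Complex.ofReal_cpow (norm_nonneg _)]
  norm_num

theorem ext0_units (χ : QuasiChar F) (u : Fˣ) : ext0 χ (u : F) = χ u := by
  rw [ext0, dif_pos u.ne_zero]
  simp

theorem ext0_zero (χ : QuasiChar F) : ext0 χ (0 : F) = 0 := by
  rw [ext0, dif_neg (by simp)]

theorem ext0_mul (χ : QuasiChar F) (x y : F) : ext0 χ (x * y) = ext0 χ x * ext0 χ y := by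
  rcases eq_or_ne x 0 with rfl | hx
  · rw [zero_mul, ext0_zero, zero_mul]
  rcases eq_or_ne y 0 with rfl | hy
  · rw [mul_zero, ext0_zero, mul_zero]
  have := ext0_units χ (mk0 x hx * mk0 y hy)
  rw [map_mul, val_mul, val_mul, ← ext0_units, ← ext0_units] at this
  exact this

theorem ext0_mul_char (χ χ' : QuasiChar F) (x : F) : ext0 (χ * χ') x = ext0 χ x * ext0 χ' x := by
  rcases eq_or_ne x 0 with rfl | hx
  · rw [ext0_zero, ext0_zero, zero_mul]
  obtain ⟨u, rfl⟩ : ∃ u : Fˣ, (u : F) = x := ⟨mk0 x hx, rfl⟩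
  simp [ext0_units]

end Chars

section Integrals

variable {F : Type*} [NontriviallyNormedField F] [IsUltrametricDist F] [ProperSpace F]
  [MeasurableSpace F] [BorelSpace F]

theorem integral_eq_zero_of_add {j : F → ℂ} (t : F) {c : ℂ} (hc : c ≠ 1)
    (h : ∀ x, j (x + t) = c * j x) : ∫ x, j x ∂haarF F = 0 := by
  have h1 := integral_add_right_eq_self (μ := haarF F) j t
  simp only [h] at h1
  rw [integral_const_mul] at h1
  grind

variable [NormalizedField F]

theorem integral_eq_zero_of_mul {j : Fˣ → ℂ} (t : Fˣ) {c : ℂ} (hc : c ≠ 1)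
    (h : ∀ x, j (t * x) = c * j x) : ∫ x, j x ∂haarFx F = 0 := by
  have h1 := integral_mul_left_eq_self (μ := haarFx F) j t
  simp only [h] at h1
  rw [integral_const_mul] at h1
  grind

/-! ### Locally constant functions of compact support -/

/-- `h` vanishes outside the ball of radius `q ^ k` and is invariant under the ball of
radius `q ^ m`. -/
structure BallFun (h : F → ℂ) (k m : ℤ) : Prop where
  supp : ∀ x, x ∉ ball F k → h x = 0
  inv : ∀ x, ∀ t ∈ ball F m, h (x + t) = h x

theorem continuous_of_inv {h : F → ℂ} {m : ℤ} (hinv : ∀ x, ∀ t ∈ ball F m, h (x + t) = h x) :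
    Continuous h := by
  rw [continuous_iff_continuousAt]
  intro x
  refine continuousAt_const.congr (f := fun _ => h x) ?_
  filter_upwards [ball_mem_nhds x m] with y hy
  have := hinv x (y - x) hy
  simp_all

theorem BallFun.continuous {h : F → ℂ} {k m : ℤ} (hh : BallFun h k m) : Continuous h :=
  continuous_of_inv hh.inv

theorem BallFun.hasCompactSupport {h : F → ℂ} {k m : ℤ} (hh : BallFun h k m) :
    HasCompactSupport h :=
  HasCompactSupport.intro (isCompact_ball k) fun x hx => hh.supp x hx

theorem BallFun.integrable {h : F → ℂ} {k m : ℤ} (hh : BallFun h k m) : Integrable h (haarF F) :=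
  hh.continuous.integrable_of_hasCompactSupport hh.hasCompactSupport

theorem BallFun.const_mul {h : F → ℂ} {k m : ℤ} (hh : BallFun h k m) (c : ℂ) :
    BallFun (fun x => c * h x) k m :=
  ⟨fun x hx => by rw [hh.supp x hx, mul_zero], fun x t ht => by rw [hh.inv x t ht]⟩

/-- Cutting an invariant function off to a ball. -/
theorem ballFun_indicator {h : F → ℂ} {k m : ℤ} (hmk : m ≤ k)
    (hinv : ∀ x ∈ ball F k, ∀ t ∈ ball F m, h (x + t) = h x) :
    BallFun ((ball F k : Set F).indicator h) k m := by
  refine ⟨fun x hx => indicator_of_notMem hx _, fun x t ht => ?_⟩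
  have htk := ball_mono hmk ht
  by_cases hx : x ∈ ball F k
  · rw [indicator_of_mem ((ball F k).add_mem hx htk), indicator_of_mem hx, hinv x hx t ht]
  · rw [indicator_of_notMem hx, indicator_of_notMem]
    intro h1
    apply hx
    have := (ball F k).sub_mem h1 htk
    simp_all

theorem exists_ball_reps {m k : ℤ} (hmk : m ≤ k) : ∃ R : Finset F, (∀ r ∈ R, r ∈ ball F k) ∧
    ∀ x ∈ ball F k, ∃! r, r ∈ R ∧ x - r ∈ ball F m := by
  classical
  let rep : F → F := fun x => Quotient.out (QuotientAddGroup.mk x : F ⧸ ball F m)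
  have hrep : ∀ x, x - rep x ∈ ball F m := by
    intro x
    have h1 : (QuotientAddGroup.mk (rep x) : F ⧸ ball F m) = QuotientAddGroup.mk x :=
      Quotient.out_eq _
    have := QuotientAddGroup.eq.1 h1
    rwa [neg_add_eq_sub] at this
  have heq : ∀ x y, x - y ∈ ball F m → rep x = rep y := by
    intro x y hxy
    have : (QuotientAddGroup.mk x : F ⧸ ball F m) = QuotientAddGroup.mk y := by
      rw [eq_comm, QuotientAddGroup.eq, neg_add_eq_sub]; exact hxy
    grind
  have hmem : ∀ x ∈ ball F k, rep x ∈ ball F k := by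
    intro x hx
    have := (ball F k).sub_mem hx (ball_mono hmk (hrep x))
    simp_all
  obtain ⟨t, -, ht⟩ := (isCompact_ball (F := F) k).elim_nhds_subcover
    (fun x => {y | y - x ∈ ball F m}) (fun x _ => ball_mem_nhds x m)
  have hfin : (rep '' (ball F k : Set F)).Finite := by
    refine (t.finite_toSet.image rep).subset ?_
    rintro _ ⟨x, hx, rfl⟩
    obtain ⟨y, hy, hxy⟩ := Set.mem_iUnion₂.1 (ht hx)
    grind
  refine ⟨hfin.toFinset, fun r hr => ?_, fun x hx => ⟨rep x, ⟨?_, hrep x⟩, ?_⟩⟩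
  · obtain ⟨x, hx, rfl⟩ := hfin.mem_toFinset.1 hr
    simp_all
  · exact hfin.mem_toFinset.2 ⟨x, hx, rfl⟩
  · rintro r ⟨hr, hxr⟩
    obtain ⟨y, hy, rfl⟩ := hfin.mem_toFinset.1 hr
    grind

theorem integral_ball_eq_sum {m k : ℤ} {R : Finset F} (hmk : m ≤ k) (hR : ∀ r ∈ R, r ∈ ball F k)
    (hR' : ∀ x ∈ ball F k, ∃! r, r ∈ R ∧ x - r ∈ ball F m) {j : F → ℂ}
    (hj : ∀ x ∈ ball F k, ∀ t ∈ ball F m, j (x + t) = j x) :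
    ∫ x in (ball F k : Set F), j x ∂haarF F = (resCard F : ℂ) ^ m * ∑ r ∈ R, j r := by
  have h1 : (ball F k : Set F).indicator j = fun x => ∑ r ∈ R,
      j r * (ball F m : Set F).indicator (fun _ => (1 : ℂ)) (x - r) := by
    ext x
    by_cases hx : x ∈ ball F k
    · rw [indicator_of_mem hx]
      obtain ⟨r, ⟨hr, hxr⟩, huniq⟩ := hR' x hx
      rw [Finset.sum_eq_single_of_mem r hr]
      · rw [indicator_of_mem hxr, mul_one]
        have := hj r (hR r hr) _ hxr
        simp_all
      · intro r' hr' hne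
        rw [indicator_of_notMem, mul_zero]
        exact fun h => hne (huniq r' ⟨hr', h⟩)
    · rw [indicator_of_notMem hx, Finset.sum_eq_zero]
      intro r hr
      rw [indicator_of_notMem, mul_zero]
      intro h
      apply hx
      have := (ball F k).add_mem (ball_mono hmk h) (hR r hr)
      simp_all
  have h2 : ∫ x, (ball F m : Set F).indicator (fun _ => (1 : ℂ)) x ∂haarF F =
      (resCard F : ℂ) ^ m := by
    rw [integral_indicator (measurableSet_ball m), setIntegral_const, haarF_real_ball]
    simp
  have h3 : Integrable ((ball F m : Set F).indicator (fun _ => (1 : ℂ))) (haarF F) :=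
    (ballFun_indicator le_rfl (fun _ _ _ _ => rfl)).integrable
  rw [← integral_indicator (measurableSet_ball k), h1, integral_finsetSum]
  · rw [Finset.mul_sum]
    refine sum_congr rfl fun r _ => ?_
    rw [integral_const_mul,
      integral_sub_right_eq_self (μ := haarF F) ((ball F m : Set F).indicator fun _ => (1 : ℂ)) r,
      h2, mul_comm]
  · exact fun r _ => (h3.comp_sub_right r).const_mul _

/-! ### The additive character -/

variable {ψ : AddChar F Circle}

theorem HasOrderZero.apply_ball (hψ : HasOrderZero ψ) {x : F} (hx : x ∈ ball F 0) :
    (ψ x : ℂ) = 1 := by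
  rw [hψ.1 x (by simpa [mem_ball] using hx), Circle.coe_one]

theorem HasOrderZero.exists_ne_one (hψ : HasOrderZero ψ) :
    ∃ x : Fˣ, lv x = 1 ∧ (ψ (x : F) : ℂ) ≠ 1 := by
  obtain ⟨ϖ, x, hϖ, hx, hne⟩ := hψ.2
  have hx0 : x ≠ 0 := by rintro rfl; simp at hne
  refine ⟨mk0 x hx0, ?_, ?_⟩
  · have h1 : lv (mk0 ϖ hϖ.1) = -1 := lv_of_isUniformizer hϖ
    have h2 : lv (mk0 ϖ hϖ.1 * mk0 x hx0) ≤ 0 := (norm_le_one_iff _).1 hx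
    rw [lv_mul, h1] at h2
    by_contra h3
    refine hne (hψ.1 x ?_)
    exact (norm_le_one_iff (mk0 x hx0)).2 (by omega)
  · intro h
    exact hne (Circle.ext h)

theorem psi_add (ψ : AddChar F Circle) (x y : F) : (ψ (x + y) : ℂ) = ψ x * ψ y := by
  rw [AddChar.map_add_eq_mul, Circle.coe_mul]

theorem psi_ne_zero (ψ : AddChar F Circle) (x : F) : (ψ x : ℂ) ≠ 0 := Circle.coe_ne_zero _

theorem psi_neg (ψ : AddChar F Circle) (x : F) : (ψ (-x) : ℂ) = (ψ x : ℂ)⁻¹ := by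
  rw [AddChar.map_neg_eq_inv, Circle.coe_inv]

theorem norm_psi (ψ : AddChar F Circle) (x : F) : ‖(ψ x : ℂ)‖ = 1 := Circle.norm_coe _

theorem HasOrderZero.add_ball (hψ : HasOrderZero ψ) (x : F) {t : F} (ht : t ∈ ball F 0) :
    (ψ (x + t) : ℂ) = ψ x := by
  rw [psi_add, hψ.apply_ball ht, mul_one]

theorem HasOrderZero.continuous (hψ : HasOrderZero ψ) : Continuous fun x : F => (ψ x : ℂ) :=
  continuous_of_inv (m := 0) fun x _ ht => hψ.add_ball x ht

theorem HasOrderZero.measurable (hψ : HasOrderZero ψ) : Measurable fun x : F => (ψ x : ℂ) :=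
  hψ.continuous.measurable

theorem HasOrderZero.exists_mul_ne_one (hψ : HasOrderZero ψ) {a : F} {k : ℤ}
    (ha : a ∉ ball F (-k)) : ∃ t ∈ ball F k, (ψ (t * a) : ℂ) ≠ 1 := by
  have ha0 : a ≠ 0 := by rintro rfl; simp_all
  obtain ⟨u, rfl⟩ : ∃ u : Fˣ, (u : F) = a := ⟨mk0 a ha0, rfl⟩
  rw [units_mem_ball] at ha
  obtain ⟨x, hx, hne⟩ := hψ.exists_ne_one
  refine ⟨((x * u⁻¹ : Fˣ) : F), units_mem_ball.2 ?_, ?_⟩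
  · rw [lv_mul, lv_inv]; omega
  simp_all

open Classical in
theorem HasOrderZero.integral_ball (hψ : HasOrderZero ψ) (a : F) (k : ℤ) :
    ∫ x in (ball F k : Set F), (ψ (x * a) : ℂ) ∂haarF F =
      if a ∈ ball F (-k) then (resCard F : ℂ) ^ k else 0 := by
  split_ifs with ha
  · have h1 : ∀ x ∈ (ball F k : Set F), (ψ (x * a) : ℂ) = 1 := by
      intro x hx
      have := mul_mem_ball hx ha
      rw [add_neg_cancel] at this
      exact hψ.apply_ball this
    rw [setIntegral_congr_fun (measurableSet_ball k) h1, setIntegral_const, haarF_real_ball]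
    simp
  · obtain ⟨t, ht, hne⟩ := hψ.exists_mul_ne_one ha
    rw [← integral_indicator (measurableSet_ball k)]
    refine integral_eq_zero_of_add t hne fun x => ?_
    have hiff : x + t ∈ (ball F k : Set F) ↔ x ∈ (ball F k : Set F) :=
      (ball F k).add_mem_cancel_right ht
    by_cases hx : x ∈ (ball F k : Set F)
    · rw [indicator_of_mem (hiff.2 hx), indicator_of_mem hx, add_mul, psi_add, mul_comm]
    simp_all

theorem BallFun.fourier (hψ : HasOrderZero ψ) {h : F → ℂ} {k m : ℤ} (hh : BallFun h k m) :
    BallFun (fourier ψ h) (-m) (-k) := by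
  constructor
  · intro y hy
    obtain ⟨t, ht, hne⟩ := hψ.exists_mul_ne_one hy
    refine integral_eq_zero_of_add t hne fun x => ?_
    rw [hh.inv x t ht, add_mul, psi_add]
    ring
  · intro y t ht
    refine integral_congr_ae (.of_forall fun x => ?_)
    by_cases hx : x ∈ ball F k
    · have := mul_mem_ball hx ht
      rw [add_neg_cancel] at this
      change h x * (ψ (x * (y + t)) : ℂ) = h x * ψ (x * y)
      rw [mul_add, hψ.add_ball _ this]
    · change h x * (ψ (x * (y + t)) : ℂ) = h x * ψ (x * y)
      rw [hh.supp x hx, zero_mul, zero_mul]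

/-- Fourier inversion for locally constant functions of compact support. -/
theorem fourier_inversion (hψ : HasOrderZero ψ) {h : F → ℂ} {k m : ℤ} (hh : BallFun h k m)
    (w : F) : ∫ y, Garrett.fourier ψ h y * (ψ (-(w * y)) : ℂ) ∂haarF F = h w := by
  have hf := hh.fourier hψ
  have h1 : ∫ y, Garrett.fourier ψ h y * (ψ (-(w * y)) : ℂ) ∂haarF F =
      ∫ y in (ball F (-m) : Set F), ∫ z, h z * (ψ (y * (z - w)) : ℂ) ∂haarF F ∂haarF F := by
    rw [← integral_indicator (measurableSet_ball _)]
    refine integral_congr_ae (.of_forall fun y => ?_)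
    by_cases hy : y ∈ (ball F (-m) : Set F)
    · rw [indicator_of_mem hy]
      change (∫ z, h z * (ψ (z * y) : ℂ) ∂haarF F) * (ψ (-(w * y)) : ℂ) = _
      rw [← integral_mul_const]
      refine integral_congr_ae (.of_forall fun z => ?_)
      change h z * (ψ (z * y) : ℂ) * (ψ (-(w * y)) : ℂ) = h z * (ψ (y * (z - w)) : ℂ)
      rw [mul_assoc, ← psi_add]
      congr 3
      ring
    · rw [indicator_of_notMem hy]
      change Garrett.fourier ψ h y * _ = 0
      rw [hf.supp y hy, zero_mul]
  have hfin : IsFiniteMeasure ((haarF F).restrict (ball F (-m) : Set F)) :=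
    ⟨by rw [Measure.restrict_apply_univ]; exact haarF_ball_lt_top _⟩
  rw [h1, integral_integral_swap]
  · have h2 : ∀ z, ∫ y in (ball F (-m) : Set F), h z * (ψ (y * (z - w)) : ℂ) ∂haarF F =
        h w * ((resCard F : ℂ) ^ (-m) * (ball F m : Set F).indicator (fun _ => (1 : ℂ)) (z -
            w)) := by
      intro z
      rw [integral_const_mul, hψ.integral_ball, neg_neg]
      split_ifs with hz
      · rw [indicator_of_mem hz, mul_one]
        have := hh.inv w _ hz
        simp_all
      simp_all
    simp only [h2]
    rw [integral_const_mul, integral_const_mul,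
      integral_sub_right_eq_self (μ := haarF F) ((ball F m : Set F).indicator fun _ => (1 : ℂ)) w,
      integral_indicator (measurableSet_ball m), setIntegral_const, haarF_real_ball]
    have := qC_ne_zero F
    simp only [real_smul, mul_one]
    push_cast
    rw [← zpow_add₀ this, neg_add_cancel, zpow_zero, mul_one]
  · have h3 : Integrable (fun p : F × F => (1 : ℂ) * h p.2)
        (((haarF F).restrict (ball F (-m) : Set F)).prod (haarF F)) :=
      (integrable_const (1 : ℂ)).mul_prod hh.integrable
    have hc := hh.continuous
    have hp := hψ.continuous
    refine h3.mono (Continuous.aestronglyMeasurable ?_) (.of_forall fun p => ?_)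
    · exact (hc.comp continuous_snd).mul (hp.comp (by fun_prop : Continuous fun p : F × F =>
        p.1 * (p.2 - w)))
    · simp [Function.uncurry, norm_psi]

theorem exists_unit_eq_one_add {n : ℕ} (hn : 1 ≤ n) {t : F} (ht : t ∈ ball F (-(n : ℤ))) :
    ∃ w : Fˣ, (w : F) = 1 + t := by
  refine ⟨mk0 (1 + t) ?_, rfl⟩
  intro h
  have h1 : ‖t‖ < ‖(1 : F)‖ := by
    rw [norm_one]
    refine (mem_ball.1 ht).trans_lt ?_
    rw [← zpow_zero (resCard F : ℝ), zpow_q_lt]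
    omega
  have := norm_add_eq_of_lt h1
  simp_all

/-- A multiplicative character integrates to zero against an oscillating additive character. -/
theorem integral_char_mul_psi_eq_zero (hψ : HasOrderZero ψ) {χ : QuasiChar F} {n : ℕ} (hn : 1 ≤ n)
    (hχ : TrivialMod χ n) (X : Fˣ) {S : Set Fˣ} (hS : MeasurableSet S)
    (hinv : ∀ u ∈ S, ∀ w : Fˣ, (w : F) - 1 ∈ ball F (-(n : ℤ)) → w * u ∈ S)
    (hbig : ∀ u ∈ S, (n : ℤ) < lv u + lv X) :
    ∫ u in S, (χ u : ℂ) * (ψ (X * u) : ℂ) ∂haarFx F = 0 := by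
  rw [← integral_indicator hS]
  set j : Fˣ → ℂ := S.indicator fun u => (χ u : ℂ) * (ψ ((X : F) * u) : ℂ) with hj
  by_cases hint : Integrable j (haarFx F)
  swap
  · exact integral_undef hint
  have h1 : ∀ t ∈ (ball F (-(n : ℤ)) : Set F),
      ∫ u, j u * (ψ (t * ((X * u : Fˣ) : F)) : ℂ) ∂haarFx F = ∫ u, j u ∂haarFx F := by
    intro t ht
    obtain ⟨w, hw⟩ := exists_unit_eq_one_add hn ht
    have hw1 : (w : F) - 1 ∈ ball F (-(n : ℤ)) := by simp_all
    have hw2 : ((w⁻¹ : Fˣ) : F) - 1 ∈ ball F (-(n : ℤ)) := by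
      have h2 : ((w⁻¹ : Fˣ) : F) - 1 = ((w⁻¹ : Fˣ) : F) * (-((w : F) - 1)) := by
        rw [mul_neg, mul_sub, Units.inv_mul, mul_one]; ring
      rw [h2, unit_mul_mem_ball, lv_inv, lv_eq_zero_of_sub_one_mem hn hw1]
      simp_all
    rw [← integral_mul_left_eq_self (μ := haarFx F) j w]
    refine integral_congr_ae (.of_forall fun u => ?_)
    change j u * (ψ (t * ((X * u : Fˣ) : F)) : ℂ) = j (w * u)
    by_cases hu : u ∈ S
    · rw [hj, indicator_of_mem hu, indicator_of_mem (hinv u hu w hw1), map_mul χ,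
        hχ w (lv_eq_zero_of_sub_one_mem hn hw1) hw1, one_mul, mul_assoc, ← psi_add]
      congr 3
      push_cast
      grind
    · rw [hj, indicator_of_notMem hu, indicator_of_notMem, zero_mul]
      intro h
      have := hinv _ h w⁻¹ hw2
      simp_all
  have hfin : IsFiniteMeasure ((haarF F).restrict (ball F (-(n : ℤ)) : Set F)) :=
    ⟨by rw [Measure.restrict_apply_univ]; exact haarF_ball_lt_top _⟩
  have h2 := setIntegral_congr_fun (μ := haarF F) (measurableSet_ball (F := F) (-(n : ℤ))) h1
  rw [setIntegral_const, haarF_real_ball, integral_integral_swap] at h2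
  · have h3 : ∀ u, ∫ t in (ball F (-(n : ℤ)) : Set F), j u * (ψ (t * ((X * u : Fˣ) : F)) : ℂ)
        ∂haarF F = 0 := by
      intro u
      by_cases hu : u ∈ S
      · rw [integral_const_mul, hψ.integral_ball, if_neg, mul_zero]
        rw [neg_neg, units_mem_ball, lv_mul]
        grind
      · simp [hj, indicator_of_notMem hu]
    simp only [h3, integral_zero] at h2
    have h4 := smul_eq_zero.1 h2.symm
    exact h4.resolve_left (zpow_q_pos F _).ne'
  · have h5 : Integrable (fun p : F × Fˣ => (1 : ℂ) * j p.2)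
        (((haarF F).restrict (ball F (-(n : ℤ)) : Set F)).prod (haarFx F)) :=
      (integrable_const (1 : ℂ)).mul_prod hint
    have hc : Continuous fun p : F × Fˣ => (ψ (p.1 * ((X * p.2 : Fˣ) : F)) : ℂ) :=
      hψ.continuous.comp (by fun_prop)
    simp only [one_mul] at h5
    refine h5.mono (h5.aestronglyMeasurable.mul hc.aestronglyMeasurable)
      (.of_forall fun p => ?_)
    simp [Function.uncurry, norm_psi]

end Integrals

section LocalField

variable {F : Type*} [NontriviallyNormedField F] [IsUltrametricDist F] [ProperSpace F]
  [MeasurableSpace F] [BorelSpace F] [NormalizedField F]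
  {ψ : AddChar F Circle} {ϖ : Fˣ}

local notation "M₃(" R ")" => Matrix (Fin 3) (Fin 3) R
local notation "M₂(" R ")" => Matrix (Fin 2) (Fin 2) R
local notation "M₆(" R ")" => Matrix (Fin 3 ⊕ Fin 3) (Fin 3 ⊕ Fin 3) R
local notation "GL₂(" R ")" => GL (Fin 2) R
local notation "𝔮" => (resCard F : ℂ)
local notation "𝔮ᵣ" => (resCard F : ℝ)
local notation "𝓧" => QuasiChar F

section Schwartz

/-! ### The local Schwartz function -/

theorem mem_ball_neg_one {x : F} : x ∈ ball F (-1) ↔ ‖x‖ < 1 := by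
  rw [mem_ball, ← zero_sub, ← norm_lt_iff_le_pred, zpow_zero]

theorem ballFun_maximalIdeal : BallFun (Set.indicator {x : F | ‖x‖ < 1} (1 : F → ℂ)) (-1) (-1) := by
  have h : {x : F | ‖x‖ < 1} = (ball F (-1) : Set F) := by
    ext x; exact mem_ball_neg_one.symm
  rw [h]
  exact ballFun_indicator le_rfl fun _ _ _ _ => rfl

theorem unitPart_units (χ : 𝓧) (u : Fˣ) :
    unitPart χ (u : F) = if lv u = 0 then (χ u : ℂ) else 0 := by
  simp only [unitPart, indicator_apply, mem_ofPred_eq, norm_eq_one_iff, ext0_units]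

theorem unitPart_zero (χ : 𝓧) : unitPart χ (0 : F) = 0 := indicator_of_notMem (by simp) _

theorem unitPart_eq_zero (χ : 𝓧) {x : F} (hx : ‖x‖ ≠ 1) : unitPart χ x = 0 :=
  indicator_of_notMem (s := {x : F | ‖x‖ = 1}) hx _

theorem ballFun_unitPart {χ : 𝓧} {n : ℕ} (hn : 1 ≤ n) (hχ : TrivialMod χ n) :
    BallFun (unitPart χ) 0 (-(n : ℤ)) := by
  constructor
  · intro x hx
    refine unitPart_eq_zero χ fun h => hx ?_
    rw [mem_ball, h, zpow_zero]
  · intro x t ht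
    have ht1 : ‖t‖ < 1 := mem_ball_neg_one.1 (ball_mono (by omega) ht)
    by_cases hx : ‖x‖ = 1
    · have hxt : ‖x + t‖ = 1 := by rw [norm_add_eq_of_lt (by rwa [hx]), hx]
      obtain ⟨u, rfl⟩ : ∃ u : Fˣ, (u : F) = x := ⟨mk0 x (by grind), rfl⟩
      obtain ⟨v, hv⟩ : ∃ v : Fˣ, (v : F) = u + t := ⟨mk0 _ (by intro h; simp_all), rfl⟩
      rw [← hv, norm_eq_one_iff] at hxt
      rw [norm_eq_one_iff] at hx
      rw [← hv, unitPart_units, unitPart_units, if_pos hx, if_pos hxt,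
        hχ.eq_of_sub_mem hn (u := u) (v := v)]
      grind
    · rw [unitPart_eq_zero χ hx, unitPart_eq_zero χ]
      intro h
      apply hx
      have := norm_add_eq_of_lt (x := x + t) (y := -t) (by simp_all)
      simp_all

theorem unitPart_mul_unit (χ : 𝓧) {u : Fˣ} (hu : lv u = 0) (x : F) :
    unitPart χ (u * x) = (χ u : ℂ) * unitPart χ x := by
  rcases eq_or_ne x 0 with rfl | hx
  · rw [mul_zero, unitPart_zero, mul_zero]
  · obtain ⟨v, rfl⟩ : ∃ v : Fˣ, (v : F) = x := ⟨mk0 x hx, rfl⟩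
    rw [← val_mul, unitPart_units, unitPart_units, lv_mul, hu, zero_add]
    simp

theorem fourier_mul_unit {h : F → ℂ} {u : Fˣ} (hu : lv u = 0) {c : ℂ} (hc : c ≠ 0)
    (hh : ∀ x, h (u * x) = c * h x) (y : F) : fourier ψ h (u * y) = c⁻¹ * fourier ψ h y := by
  have h1 := integral_mul_haarF u fun x => h x * (ψ (x * y) : ℂ)
  rw [(norm_eq_one_iff u).2 hu, inv_one, one_smul] at h1
  rw [fourier, fourier, ← h1, ← integral_const_mul]
  refine integral_congr_ae (.of_forall fun x => ?_)
  change h x * (ψ (x * (u * y)) : ℂ) = c⁻¹ * (h (u * x) * (ψ (u * x * y) : ℂ))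
  rw [hh, mul_assoc, inv_mul_cancel_left₀ hc]
  congr 3
  ring

theorem fourier_unitPart_mul_unit (χ : 𝓧) {u : Fˣ} (hu : lv u = 0) (y : F) :
    fourier ψ (unitPart χ) (u * y) = (χ u : ℂ)⁻¹ * fourier ψ (unitPart χ) y :=
  fourier_mul_unit hu (Units.ne_zero _) (unitPart_mul_unit χ hu) y

theorem fourier_maximalIdeal_mul_unit {u : Fˣ} (hu : lv u = 0) (y : F) :
    fourier ψ (Set.indicator {x : F | ‖x‖ < 1} 1) (u * y) =
      fourier ψ (Set.indicator {x : F | ‖x‖ < 1} 1) y := by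
  have := fourier_mul_unit (ψ := ψ) (h := Set.indicator {x : F | ‖x‖ < 1} 1) hu one_ne_zero
    (fun x => ?_) y
  · grind
  · simp [indicator_apply, (norm_eq_one_iff u).2 hu]

/-! ### The degenerate Whittaker functional -/

theorem trace_mul_symMat {B : M₃(F)} (hB : B.IsSymm) (u x : Fin 3 → F) :
    (B * symMat u x).trace = ∑ i, B i i * u i + ∑ i, 2 * offDiag B i * x i := by
  have h1 := hB.apply 0 1
  have h2 := hB.apply 0 2
  have h3 := hB.apply 1 2
  simp only [Matrix.trace, Matrix.diag, Matrix.mul_apply, Fin.sum_univ_three, symMat, offDiag,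
    Matrix.of_apply, Matrix.cons_val, h1, h2, h3]
  ring

theorem schwartzPhi_symMat (ξ : Fin 3 → 𝓧) (u x : Fin 3 → F) : schwartzPhi ψ ξ (symMat u x) =
      (∏ i, fourier ψ (Set.indicator {x | ‖x‖ < 1} 1) (u i)) *
        ∏ i, fourier ψ (unitPart (ξ i)) (x i) := by
  simp [schwartzPhi, symMat, prod_univ_three]

theorem psi_sum {ι : Type*} (s : Finset ι) (f : ι → F) :
    (ψ (∑ i ∈ s, f i) : ℂ) = ∏ i ∈ s, (ψ (f i) : ℂ) := by
  classical
  induction s using Finset.induction_on with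
  | empty => simp
  | insert a s ha ih => rw [Finset.sum_insert ha, Finset.prod_insert ha, psi_add, ih]

theorem degWhittaker_eq (hψ : HasOrderZero ψ) (ξ : Fin 3 → 𝓧) {f : GSp6 F → ℂ}
    (hf : ∀ (z : M₃(F)) (hz : z.IsSymm), f (J3 F * siegelN z hz) = schwartzPhi ψ ξ z)
    {B : M₃(F)} (hB : B.IsSymm) :
    Integrable (degWhittakerIntegrand ψ B f) (haarSym F) ∧
    degWhittaker ψ B f = (∏ i, Set.indicator {x : F | ‖x‖ < 1} (1 : F → ℂ) (B i i)) *
      ∏ i, unitPart (ξ i) (2 * offDiag B i) := by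
  have h1 : ∀ i, ∃ n : ℕ, 1 ≤ n ∧ TrivialMod (ξ i) n := fun i => exists_trivialMod (ξ i)
  choose n hn hξ using h1
  set j1 : Fin 3 → F → ℂ := fun i u =>
    fourier ψ (Set.indicator {x : F | ‖x‖ < 1} 1) u * (ψ (-(B i i * u)) : ℂ) with hj1
  set j2 : Fin 3 → F → ℂ := fun i u =>
    fourier ψ (unitPart (ξ i)) u * (ψ (-(2 * offDiag B i * u)) : ℂ) with hj2
  have hint : ∀ {h : F → ℂ} {k m : ℤ}, BallFun h k m → ∀ w : F,
      Integrable (fun y => fourier ψ h y * (ψ (-(w * y)) : ℂ)) (haarF F) := by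
    intro h k m hh w
    have hf := (hh.fourier hψ)
    refine Continuous.integrable_of_hasCompactSupport
      (hf.continuous.mul (hψ.continuous.comp (by fun_prop))) (hf.hasCompactSupport.mul_right)
  have h2 : degWhittakerIntegrand ψ B f = fun p => (∏ i, j1 i (p.1 i)) * ∏ i, j2 i (p.2 i) := by
    ext p
    rw [degWhittakerIntegrand, hf, schwartzPhi_symMat, trace_mul_symMat hB, neg_add, psi_add,
      ← Finset.sum_neg_distrib, ← Finset.sum_neg_distrib, psi_sum, psi_sum, hj1, hj2]
    simp only [prod_mul_distrib]
    ring
  rw [degWhittaker, h2, haarSym]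
  constructor
  · exact (Integrable.fintype_prod fun i => hint ballFun_maximalIdeal _).mul_prod
      (Integrable.fintype_prod fun i => hint (ballFun_unitPart (hn i) (hξ i)) _)
  · refine (integral_prod_mul (μ := Measure.pi fun _ : Fin 3 => haarF F)
      (ν := Measure.pi fun _ : Fin 3 => haarF F) (fun u : Fin 3 → F => ∏ i, j1 i (u i))
      (fun u : Fin 3 → F => ∏ i, j2 i (u i))).trans ?_
    rw [integral_fintype_prod_eq_prod, integral_fintype_prod_eq_prod]
    congr 1
    · exact prod_congr rfl fun i _ => fourier_inversion hψ ballFun_maximalIdeal _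
    · exact prod_congr rfl fun i _ =>
        fourier_inversion hψ (ballFun_unitPart (hn i) (hξ i)) _

end Schwartz

section BigCell

/-! ### Blocks of elements of `GSp₆` -/

theorem J_ne_zero_entry : Matrix.J (Fin 3) F (Sum.inr 0) (Sum.inl 0) = 1 := by
  simp [Matrix.J]

theorem similitude_eq {g : GSp6 F} {c : Fˣ} (h : (g.1 : M₆(F)) * Matrix.J (Fin 3) F *
      (g.1 : M₆(F))ᵀ = (c : F) • Matrix.J (Fin 3) F) :
    similitude g = c := by
  have h1 := g.2.choose_spec
  have h2 := congrFun (congrFun (h.symm.trans h1) (Sum.inr 0)) (Sum.inl 0)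
  simp only [Matrix.smul_apply, J_ne_zero_entry, smul_eq_mul, mul_one] at h2
  exact (Units.ext h2).symm

theorem similitude_spec (g : GSp6 F) : (g.1 : M₆(F)) * Matrix.J (Fin 3) F *
      (g.1 : M₆(F))ᵀ = (similitude g : F) • Matrix.J (Fin 3) F :=
  g.2.choose_spec

theorem similitude_ofMatrix (M : M₆(F)) (c : Fˣ)
    (h : M * Matrix.J (Fin 3) F * Mᵀ = (c : F) • Matrix.J (Fin 3) F) :
    similitude (GSp6.ofMatrix M c h) = c := similitude_eq h

theorem similitude_mul (g h : GSp6 F) : similitude (g * h) = similitude g * similitude h := by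
  apply similitude_eq
  have h1 := similitude_spec g
  have h2 := similitude_spec h
  have h3 : ((g * h).1 : M₆(F)) = (g.1 : M₆(F)) * (h.1 : M₆(F)) := rfl
  rw [h3]
  generalize (g.1 : M₆(F)) = M at h1 ⊢
  generalize (h.1 : M₆(F)) = N at h2 ⊢
  rw [Matrix.transpose_mul]
  calc M * N * Matrix.J (Fin 3) F * (Nᵀ * Mᵀ) = M * (N * Matrix.J (Fin 3) F * Nᵀ) * Mᵀ := by
        simp only [Matrix.mul_assoc]
    _ = _ := by
      rw [h2, Matrix.mul_smul, Matrix.smul_mul, h1, smul_smul, val_mul, mul_comm]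

/-- The upper left block. -/
def blkA (g : GSp6 F) : M₃(F) := Matrix.toBlocks₁₁ (g.1 : M₆(F))

/-- The upper right block. -/
def blkB (g : GSp6 F) : M₃(F) := Matrix.toBlocks₁₂ (g.1 : M₆(F))

/-- The lower left block. -/
def blkC (g : GSp6 F) : M₃(F) := Matrix.toBlocks₂₁ (g.1 : M₆(F))

/-- The lower right block. -/
def blkD (g : GSp6 F) : M₃(F) := Matrix.toBlocks₂₂ (g.1 : M₆(F))

theorem fromBlocks_blk (g : GSp6 F) : (g.1 : M₆(F)) =
    Matrix.fromBlocks (blkA g) (blkB g) (blkC g) (blkD g) :=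
  (Matrix.fromBlocks_toBlocks _).symm

theorem mul_blocks (g h : GSp6 F) : ((g * h).1 : M₆(F)) =
      Matrix.fromBlocks (blkA g * blkA h + blkB g * blkC h) (blkA g * blkB h + blkB g * blkD h)
        (blkC g * blkA h + blkD g * blkC h) (blkC g * blkB h + blkD g * blkD h) := by
  rw [← Matrix.fromBlocks_multiply, ← fromBlocks_blk, ← fromBlocks_blk]
  rfl

theorem blkC_mul (g h : GSp6 F) : blkC (g * h) = blkC g * blkA h + blkD g * blkC h := by
  rw [blkC, mul_blocks, Matrix.toBlocks_fromBlocks₂₁]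

theorem blkD_mul (g h : GSp6 F) : blkD (g * h) = blkC g * blkB h + blkD g * blkD h := by
  rw [blkD, mul_blocks, Matrix.toBlocks_fromBlocks₂₂]

theorem blkD_mul_transpose (g : GSp6 F) : blkD g * (blkC g)ᵀ = blkC g * (blkD g)ᵀ := by
  have h := similitude_spec g
  rw [fromBlocks_blk, Matrix.J, Matrix.fromBlocks_multiply, Matrix.fromBlocks_transpose,
    Matrix.fromBlocks_multiply, Matrix.fromBlocks_smul] at h
  have h1 := (Matrix.fromBlocks_inj.1 h).2.2.2
  simp only [Matrix.mul_zero, Matrix.mul_one, Matrix.mul_neg, zero_add, add_zero, smul_zero,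
    Matrix.neg_mul] at h1
  grind

theorem isSymm_inv_mul (g : GSp6 F) (h : (blkC g).det ≠ 0) : ((blkC g)⁻¹ * blkD g).IsSymm := by
  have hu : IsUnit (blkC g).det := isUnit_iff_ne_zero.2 h
  have h1 := blkD_mul_transpose g
  have hu' : IsUnit (blkC g)ᵀ.det := by simp_all
  rw [Matrix.IsSymm, Matrix.transpose_mul]
  have h2 : (blkC g)⁻¹ * blkD g * (blkC g)ᵀ = (blkD g)ᵀ := by
    rw [Matrix.mul_assoc, h1, ← Matrix.mul_assoc, Matrix.nonsing_inv_mul _ hu, Matrix.one_mul]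
  rw [← h2, Matrix.mul_assoc, Matrix.transpose_nonsing_inv, Matrix.mul_nonsing_inv _ hu',
    Matrix.mul_one]

theorem bigCellSection_eq (ω χ : 𝓧) (Φ : M₃(F) → ℂ) (g : GSp6 F) :
    bigCellSection ω χ Φ g = bigCellValue ω χ Φ (similitude g) (blkC g) (blkD g) := rfl

/-- The factor of automorphy of the big cell section. -/
def cellFactor (ω χ : 𝓧) (c d : Fˣ) : ℂ :=
  (ω (c * d⁻¹) : ℂ) * (χ (c ^ 3 * d⁻¹ ^ 2) : ℂ) * ((‖((c ^ 3 * d⁻¹ ^ 2 : Fˣ) : F)‖ : ℝ) : ℂ)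

theorem cellFactor_mul (ω χ : 𝓧) (c d c' d' : Fˣ) :
    cellFactor ω χ (c * c') (d * d') = cellFactor ω χ c d * cellFactor ω χ c' d' := by
  have h1 : c * c' * (d * d')⁻¹ = (c * d⁻¹) * (c' * d'⁻¹) := by
    rw [mul_inv]; grind
  have h2 : (c * c') ^ 3 * (d * d')⁻¹ ^ 2 = (c ^ 3 * d⁻¹ ^ 2) * (c' ^ 3 * d'⁻¹ ^ 2) := by
    rw [mul_inv, mul_pow, mul_pow]; grind
  rw [cellFactor, h1, h2, cellFactor, cellFactor, map_mul ω (c * d⁻¹),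
    map_mul χ (c ^ 3 * d⁻¹ ^ 2), val_mul, val_mul, val_mul, norm_mul, Complex.ofReal_mul]
  ring

theorem bigCellValue_of_det (ω χ : 𝓧) (Φ : M₃(F) → ℂ) (c d : Fˣ)
    {C : M₃(F)} (D : M₃(F)) (hC : C.det = d) :
    bigCellValue ω χ Φ c C D = cellFactor ω χ c d * Φ (C⁻¹ * D) := by
  have h : C.det ≠ 0 := by simp_all
  have h1 : mk0 C.det h = d := Units.ext hC
  rw [bigCellValue, dif_pos h, h1, cellFactor]

theorem bigCellValue_of_det_eq_zero (ω χ : 𝓧) (Φ : M₃(F) → ℂ) (c : Fˣ)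
    {C : M₃(F)} (D : M₃(F)) (hC : C.det = 0) :
    bigCellValue ω χ Φ c C D = 0 := by
  rw [bigCellValue, dif_neg (by grind)]

theorem exists_unit_det {C : M₃(F)} (h : C.det ≠ 0) : ∃ d : Fˣ, C.det = d := ⟨mk0 _ h, rfl⟩

/-- The effect of right translation on the big cell section. -/
theorem bigCellSection_mul_of_ne_zero {ω χ : 𝓧} {Φ : M₃(F) → ℂ} {h : GSp6 F} {κ : ℂ}
    (hh : ∀ z : M₃(F), z.IsSymm → Φ z ≠ 0 → ∃ d : Fˣ, (blkA h + z * blkC h).det = d ∧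
      cellFactor ω χ (similitude h) d * Φ ((blkA h + z * blkC h)⁻¹ * (blkB h + z * blkD h)) =
        κ * Φ z)
    {g : GSp6 F} (hg : bigCellSection ω χ Φ g ≠ 0) :
    bigCellSection ω χ Φ (g * h) = κ * bigCellSection ω χ Φ g := by
  have hdet : (blkC g).det ≠ 0 := by
    intro h0
    exact hg (bigCellValue_of_det_eq_zero _ _ _ _ _ h0)
  obtain ⟨d, hd⟩ := exists_unit_det hdet
  have hu : IsUnit (blkC g).det := isUnit_iff_ne_zero.2 hdet
  rw [bigCellSection_eq, bigCellValue_of_det _ _ _ _ _ _ hd] at hg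
  obtain ⟨d', hd', h2⟩ := hh _ (isSymm_inv_mul g hdet) (right_ne_zero_of_mul hg)
  have hC : blkC (g * h) = blkC g * (blkA h + (blkC g)⁻¹ * blkD g * blkC h) := by
    rw [blkC_mul, Matrix.mul_add, ← Matrix.mul_assoc, ← Matrix.mul_assoc,
      Matrix.mul_nonsing_inv _ hu, Matrix.one_mul]
  have hD : blkD (g * h) = blkC g * (blkB h + (blkC g)⁻¹ * blkD g * blkD h) := by
    rw [blkD_mul, Matrix.mul_add, ← Matrix.mul_assoc, ← Matrix.mul_assoc,
      Matrix.mul_nonsing_inv _ hu, Matrix.one_mul]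
  rw [bigCellSection_eq, bigCellSection_eq, bigCellValue_of_det _ _ _ _ _ _ hd,
    bigCellValue_of_det _ _ _ _ (d * d') _ (by simp_all),
    similitude_mul, cellFactor_mul, hC, hD, Matrix.mul_inv_rev, Matrix.mul_assoc,
    ← Matrix.mul_assoc (blkC g)⁻¹, Matrix.nonsing_inv_mul _ hu, Matrix.one_mul, mul_assoc, h2]
  ring

theorem bigCellSection_mul {ω χ : 𝓧} {Φ : M₃(F) → ℂ} {h : GSp6 F} {κ κ' : ℂ} (hκ' : κ' ≠ 0)
    (hh : ∀ z : M₃(F), z.IsSymm → Φ z ≠ 0 → ∃ d : Fˣ, (blkA h + z * blkC h).det = d ∧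
      cellFactor ω χ (similitude h) d * Φ ((blkA h + z * blkC h)⁻¹ * (blkB h + z * blkD h)) =
        κ * Φ z)
    (hh' : ∀ z : M₃(F), z.IsSymm → Φ z ≠ 0 → ∃ d : Fˣ, (blkA h⁻¹ + z * blkC h⁻¹).det = d ∧
      cellFactor ω χ (similitude h⁻¹) d *
        Φ ((blkA h⁻¹ + z * blkC h⁻¹)⁻¹ * (blkB h⁻¹ + z * blkD h⁻¹)) = κ' * Φ z)
    (g : GSp6 F) : bigCellSection ω χ Φ (g * h) = κ * bigCellSection ω χ Φ g := by
  by_cases hg : bigCellSection ω χ Φ g = 0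
  · rw [hg, mul_zero]
    by_contra h1
    have h2 := bigCellSection_mul_of_ne_zero hh' h1
    simp_all
  · exact bigCellSection_mul_of_ne_zero hh hg

theorem bigCellSection_J3_mul (ω χ : 𝓧) (Φ : M₃(F) → ℂ) (z : M₃(F)) (hz : z.IsSymm) :
    bigCellSection ω χ Φ (J3 F * siegelN z hz) = Φ z := by
  have hC : blkC (J3 F * siegelN z hz) = 1 := by
    rw [blkC_mul]
    simp [blkC, blkA, blkD, J3, siegelN, GSp6.ofMatrix, Matrix.J]
  have hD : blkD (J3 F * siegelN z hz) = z := by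
    rw [blkD_mul]
    simp [blkC, blkB, blkD, J3, siegelN, GSp6.ofMatrix, Matrix.J]
  have hs : similitude (J3 F * siegelN z hz) = 1 := by
    rw [similitude_mul, J3, siegelN, similitude_ofMatrix, similitude_ofMatrix, mul_one]
  rw [bigCellSection_eq, hs, hC, hD, bigCellValue_of_det ω χ Φ 1 1 z (by simp)]
  simp [cellFactor]

theorem bigCellSection_left (ω χ : 𝓧) (Φ : M₃(F) → ℂ)
    (A : GL (Fin 3) F) (c : Fˣ) (z : M₃(F)) (hz : z.IsSymm) (g : GSp6 F) :
    bigCellSection ω χ Φ (siegelM A c * siegelN z hz * g) =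
      (ω (c⁻¹ ^ 2 * GeneralLinearGroup.det A) : ℂ) *
      (χ (c⁻¹ ^ 3 * GeneralLinearGroup.det A ^ 2) : ℂ) *
      ((‖((c⁻¹ ^ 3 * GeneralLinearGroup.det A ^ 2 : Fˣ) : F)‖ : ℝ) : ℂ) *
        bigCellSection ω χ Φ g := by
  set M : M₃(F) := (c : F) • ((A⁻¹ : GL (Fin 3) F) : M₃(F))ᵀ with hM
  have hc0 : blkC (siegelM A c * siegelN z hz) = 0 := by
    rw [blkC_mul]
    simp [blkC, blkA, blkD, siegelM, siegelN, GSp6.ofMatrix]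
  have hd0 : blkD (siegelM A c * siegelN z hz) = M := by
    rw [blkD_mul]
    simp [blkC, blkB, blkD, siegelM, siegelN, GSp6.ofMatrix, hM]
  have hs : similitude (siegelM A c * siegelN z hz) = c := by
    rw [similitude_mul, siegelM, siegelN, similitude_ofMatrix, similitude_ofMatrix, mul_one]
  have hC : blkC (siegelM A c * siegelN z hz * g) = M * blkC g := by
    rw [blkC_mul, hc0, hd0, Matrix.zero_mul, zero_add]
  have hD : blkD (siegelM A c * siegelN z hz * g) = M * blkD g := by
    rw [blkD_mul, hc0, hd0, Matrix.zero_mul, zero_add]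
  have hMdet : M.det = ((c ^ 3 * (GeneralLinearGroup.det A)⁻¹ : Fˣ) : F) := by simp_all
  have hMu : IsUnit M.det := by rw [hMdet]; exact Units.isUnit _
  rw [bigCellSection_eq, bigCellSection_eq, similitude_mul, hs, hC, hD]
  by_cases h0 : (blkC g).det = 0
  · rw [bigCellValue_of_det_eq_zero _ _ _ _ _ h0, bigCellValue_of_det_eq_zero, mul_zero]
    simp_all
  · obtain ⟨d, hd⟩ := exists_unit_det h0
    rw [bigCellValue_of_det _ _ _ _ _ _ hd, bigCellValue_of_det _ _ _ _
      (c ^ 3 * (GeneralLinearGroup.det A)⁻¹ * d) _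
      (by rw [Matrix.det_mul, hMdet, hd, val_mul _ d]), cellFactor_mul, Matrix.mul_inv_rev,
      Matrix.mul_assoc, ← Matrix.mul_assoc M⁻¹, Matrix.nonsing_inv_mul _ hMu, Matrix.one_mul,
      ← mul_assoc]
    congr 2
    have e1 : c * (c ^ 3 * (GeneralLinearGroup.det A)⁻¹)⁻¹ =
        c⁻¹ ^ 2 * GeneralLinearGroup.det A := by
      rw [mul_inv, inv_inv, ← mul_assoc]; congr 1; group
    have e2 : c ^ 3 * (c ^ 3 * (GeneralLinearGroup.det A)⁻¹)⁻¹ ^ 2 =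
        c⁻¹ ^ 3 * GeneralLinearGroup.det A ^ 2 := by
      rw [mul_inv, inv_inv, mul_pow, ← mul_assoc]; congr 1; group
    rw [cellFactor, e1, e2]

end BigCell

section Smoothness

/-! ### Smoothness and equivariance of the big cell sections -/

/-- All entries of the matrix lie in a given ball. -/
def MatBall (k : ℤ) (M : M₃(F)) : Prop := ∀ i j, M i j ∈ ball F k

theorem MatBall.mono {j k : ℤ} {M : M₃(F)} (h : MatBall j M) (hjk : j ≤ k) :
    MatBall k M := fun i i' => ball_mono hjk (h i i')

theorem MatBall.add {k : ℤ} {M N : M₃(F)} (h : MatBall k M) (h' : MatBall k N) :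
    MatBall k (M + N) := fun i j => (ball F k).add_mem (h i j) (h' i j)

theorem MatBall.sub {k : ℤ} {M N : M₃(F)} (h : MatBall k M) (h' : MatBall k N) :
    MatBall k (M - N) := fun i j => (ball F k).sub_mem (h i j) (h' i j)

theorem MatBall.mul {j k : ℤ} {M N : M₃(F)} (h : MatBall j M)
    (h' : MatBall k N) : MatBall (j + k) (M * N) := fun i i' => by
  rw [Matrix.mul_apply]
  exact (ball F (j + k)).sum_mem fun l _ => mul_mem_ball (h i l) (h' l i')

theorem exists_matBall (M : M₃(F)) : ∃ k : ℕ, MatBall k M := by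
  choose k hk using fun p : Fin 3 × Fin 3 => exists_mem_ball (M p.1 p.2)
  refine ⟨Finset.univ.sup k, fun i j => ball_mono ?_ (hk (i, j))⟩
  exact_mod_cast Finset.le_sup (mem_univ (i, j))

theorem matBall_diagonal {d : Fin 3 → Fˣ} (hd : ∀ i, lv (d i) = 0) :
    MatBall 0 (Matrix.diagonal fun i => (d i : F)) := fun i j => by
  by_cases h : i = j
  · subst h
    rw [Matrix.diagonal_apply_eq, units_mem_ball, hd]
  simp_all

theorem MatBall.of_add_mul {k : ℤ} {N Z : M₃(F)} (hN : MatBall (-1) N)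
    (h : MatBall k (Z + N * Z)) : MatBall k Z := by
  have key : ∀ m : ℕ, MatBall (k + m) Z → MatBall k Z := by
    intro m
    induction m with
    | zero => simp
    | succ m ih =>
      intro hZ
      apply ih
      have h1 : MatBall (k + m) (N * Z) := (hN.mul hZ).mono (by push_cast; omega)
      have h2 := (h.mono (show k ≤ k + m by omega)).sub h1
      simp_all
  obtain ⟨m, hm⟩ := exists_matBall Z
  refine key (m + k.natAbs) (hm.mono ?_)
  push_cast
  have := neg_abs_le k
  omega

theorem det_one_add_sub_one_mem {n : ℕ} {N : M₃(F)}
    (hN : MatBall (-(n : ℤ)) N) : (1 + N).det - 1 ∈ ball F (-(n : ℤ)) := by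
  have h2 : ∀ {x y : F}, x ∈ ball F (-(n : ℤ)) → y ∈ ball F (-(n : ℤ)) →
      x * y ∈ ball F (-(n : ℤ)) := fun hx hy => ball_mono (by omega) (mul_mem_ball hx hy)
  have e : (1 + N).det - 1 = N 0 0 + N 1 1 + N 2 2 + N 0 0 * N 1 1 + N 0 0 * N 2 2 + N 1 1 * N 2 2
      + N 0 0 * N 1 1 * N 2 2 - N 1 2 * N 2 1 - N 0 0 * (N 1 2 * N 2 1) - N 0 1 * N 1 0
      - N 0 1 * N 1 0 * N 2 2 + N 0 1 * (N 1 2 * N 2 0) + N 0 2 * (N 1 0 * N 2 1)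
      - N 0 2 * N 2 0 - N 0 2 * N 2 0 * N 1 1 := by
    rw [Matrix.det_fin_three]
    simp only [Matrix.add_apply, Matrix.one_apply, Fin.isValue, if_true]
    simp
    ring
  rw [e]
  have h := hN
  repeat' first
    | exact h _ _
    | apply h2
    | apply AddSubgroup.add_mem
    | apply AddSubgroup.sub_mem

theorem matBall_of_schwartzPhi_ne_zero (hψ : HasOrderZero ψ) {ξ : Fin 3 → 𝓧} {n : ℕ}
    (hn : 1 ≤ n) (hξ : ∀ i, TrivialMod (ξ i) n) {z : M₃(F)} (hz : z.IsSymm)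
    (h : schwartzPhi ψ ξ z ≠ 0) : MatBall n z := by
  have hU : ∀ i {x : F}, fourier ψ (unitPart (ξ i)) x ≠ 0 → x ∈ ball F n := fun i x hx => by
    by_contra h1
    exact hx (((ballFun_unitPart hn (hξ i)).fourier hψ).supp x (by simp_all))
  have hD : ∀ {x : F}, fourier ψ (Set.indicator {x : F | ‖x‖ < 1} 1) x ≠ 0 → x ∈ ball F n :=
    fun {x} hx => by
    by_contra h1
    exact hx ((ballFun_maximalIdeal.fourier hψ).supp x
      fun h2 => h1 (ball_mono (by simp_all) h2))
  have h1 := left_ne_zero_of_mul h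
  have h2 := right_ne_zero_of_mul h
  have h3 : ∀ i, z i i ∈ ball F n := fun i => hD (Finset.prod_ne_zero_iff.1 h1 i (mem_univ i))
  have h12 := hU 0 (left_ne_zero_of_mul (left_ne_zero_of_mul h2))
  have h02 := hU 1 (right_ne_zero_of_mul (left_ne_zero_of_mul h2))
  have h01 := hU 2 (right_ne_zero_of_mul h2)
  have e1 := hz.apply 0 1
  have e2 := hz.apply 0 2
  have e3 := hz.apply 1 2
  intro i j
  fin_cases i <;> fin_cases j <;> simp_all

theorem schwartzPhi_add (hψ : HasOrderZero ψ) {ξ : Fin 3 → 𝓧} {z E : M₃(F)} (hE : MatBall 0 E) :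
    schwartzPhi ψ ξ (z + E) = schwartzPhi ψ ξ z := by
  have hU : ∀ i {x t : F}, t ∈ ball F 0 →
      fourier ψ (unitPart (ξ i)) (x + t) = fourier ψ (unitPart (ξ i)) x := fun i x t ht => by
    obtain ⟨n, hn, hξ⟩ := exists_trivialMod (ξ i)
    exact ((ballFun_unitPart hn hξ).fourier hψ).inv x t (by simp_all)
  have hD : ∀ {x t : F}, t ∈ ball F 0 → fourier ψ (Set.indicator {x : F | ‖x‖ < 1} 1) (x + t) =
      fourier ψ (Set.indicator {x : F | ‖x‖ < 1} 1) x := fun {x t} ht =>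
    (ballFun_maximalIdeal.fourier hψ).inv x t (ball_mono (by norm_num) ht)
  simp only [schwartzPhi, Matrix.add_apply, hU _ (hE _ _), hD (hE _ _)]

theorem schwartzPhi_diagonal_mul (ξ : Fin 3 → 𝓧) {α δ : Fin 3 → Fˣ}
    (hα : ∀ i, lv (α i) = 0) (hδ : ∀ i, lv (δ i) = 0) (z : M₃(F)) :
    schwartzPhi ψ ξ (Matrix.diagonal (fun i => (α i : F)) * z *
        Matrix.diagonal fun i => (δ i : F)) =
      ((ξ 0 (α 1 * δ 2) : ℂ) * (ξ 1 (α 0 * δ 2) : ℂ) * (ξ 2 (α 0 * δ 1) : ℂ))⁻¹ *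
        schwartzPhi ψ ξ z := by
  have e : ∀ i j, (Matrix.diagonal (fun i => (α i : F)) * z *
      Matrix.diagonal fun i => (δ i : F)) i j = ((α i * δ j : Fˣ) : F) * z i j := fun i j => by
    rw [Matrix.mul_diagonal, Matrix.diagonal_mul, val_mul]; ring
  have hl : ∀ i j, lv (α i * δ j) = 0 := fun i j => by rw [lv_mul, hα, hδ, zero_add]
  simp only [schwartzPhi, e, fourier_unitPart_mul_unit _ (hl _ _),
    fourier_maximalIdeal_mul_unit (hl _ _), mul_inv]
  ring

/-- Elements of `GSp₆` close to the diagonal torus. -/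
structure NearDiagonal (n : ℕ) (h : GSp6 F) (δ : Fin 3 → Fˣ) : Prop where
  sim : lv (similitude h) = 0
  unit : ∀ i, lv (δ i) = 0
  A : MatBall (-(2 * n : ℤ)) (blkA h - Matrix.diagonal fun i => ((similitude h * (δ i)⁻¹ : Fˣ) : F))
  B : MatBall 0 (blkB h)
  C : MatBall (-(2 * n : ℤ)) (blkC h)
  D : MatBall (-(2 * n : ℤ)) (blkD h - Matrix.diagonal fun i => (δ i : F))

theorem cellFactor_unit {ω χ : 𝓧} {n : ℕ} (hω : TrivialMod ω n) (hχ : TrivialMod χ n)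
    {c d w : Fˣ} (hc : lv c = 0) (hd : lv d = 0) (hw : (w : F) - 1 ∈ ball F (-(n : ℤ)))
    (hn : 1 ≤ n) : cellFactor ω χ c (d * w) = (ω (c * d⁻¹) : ℂ) * (χ (c ^ 3 * d⁻¹ ^ 2) : ℂ) := by
  have hw0 := lv_eq_zero_of_sub_one_mem hn hw
  have h1 : ∀ η : 𝓧, TrivialMod η n → η w = 1 := fun η hη => by
    have := hη.eq_of_sub_mem hn (u := 1) (v := w) (by rw [lv_one, zero_sub]; exact hw)
    simp_all
  have e1 : c * (d * w)⁻¹ = c * d⁻¹ * w⁻¹ := by rw [mul_inv, mul_assoc]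
  have e2 : c ^ 3 * (d * w)⁻¹ ^ 2 = c ^ 3 * d⁻¹ ^ 2 * (w⁻¹) ^ 2 := by
    rw [mul_inv, mul_pow, mul_assoc]
  have e3 : ‖((c ^ 3 * (d * w)⁻¹ ^ 2 : Fˣ) : F)‖ = 1 := by
    rw [norm_eq_one_iff, lv_mul, ← zpow_natCast, ← zpow_natCast, lv_zpow, lv_zpow, lv_inv, lv_mul,
      hc, hd, hw0]
    simp
  rw [cellFactor, e3, e1, e2, map_mul ω (c * d⁻¹), map_mul χ (c ^ 3 * d⁻¹ ^ 2), map_inv ω,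
    map_pow χ, map_inv χ w, h1 ω hω, h1 χ hχ]
  simp

/-- The factor by which elements close to the diagonal torus act on the big cell sections. -/
def nearFactor (ω χ : 𝓧) (ξ : Fin 3 → 𝓧) (h : GSp6 F) (δ : Fin 3 → Fˣ) : ℂ :=
  (ω (similitude h * (∏ i, similitude h * (δ i)⁻¹)⁻¹) : ℂ) *
    (χ (similitude h ^ 3 * (∏ i, similitude h * (δ i)⁻¹)⁻¹ ^ 2) : ℂ) *
  ((ξ 0 ((similitude h)⁻¹ * δ 1 * δ 2) : ℂ) * (ξ 1 ((similitude h)⁻¹ * δ 0 * δ 2) : ℂ) *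
    (ξ 2 ((similitude h)⁻¹ * δ 0 * δ 1) : ℂ))⁻¹

theorem NearDiagonal.bigCell (hψ : HasOrderZero ψ) {ω χ : 𝓧} {ξ : Fin 3 → 𝓧}
    {n : ℕ} (hn : 1 ≤ n) (hω : TrivialMod ω n) (hχ : TrivialMod χ n) (hξ : ∀ i, TrivialMod (ξ i) n)
    {h : GSp6 F} {δ : Fin 3 → Fˣ} (hh : NearDiagonal n h δ) {z : M₃(F)}
    (hz : z.IsSymm) (hΦ : schwartzPhi ψ ξ z ≠ 0) : ∃ d : Fˣ, (blkA h + z * blkC h).det = d ∧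
      cellFactor ω χ (similitude h) d *
          schwartzPhi ψ ξ ((blkA h + z * blkC h)⁻¹ * (blkB h + z * blkD h)) =
        nearFactor ω χ ξ h δ * schwartzPhi ψ ξ z := by
  have hzn := matBall_of_schwartzPhi_ne_zero hψ hn hξ hz hΦ
  set c := similitude h with hc
  set α : Fin 3 → Fˣ := fun i => c * (δ i)⁻¹ with hα
  have hα0 : ∀ i, lv (α i) = 0 := fun i => by rw [hα, lv_mul, lv_inv, hh.sim, hh.unit]; rfl
  have hαi : ∀ i, lv (α i)⁻¹ = 0 := fun i => by rw [lv_inv, hα0]; rfl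
  set a : M₃(F) := Matrix.diagonal fun i => (α i : F) with ha
  set a' : M₃(F) := Matrix.diagonal fun i => ((α i)⁻¹ : Fˣ) with ha'
  set dd : M₃(F) := Matrix.diagonal fun i => (δ i : F) with hdd
  have haa : a * a' = 1 := by simp [ha, ha']
  have haa' : a' * a = 1 := by simp [ha, ha']
  have hA : MatBall (-(2 * n : ℤ)) (blkA h - a) := hh.A
  have hD : MatBall (-(2 * n : ℤ)) (blkD h - dd) := hh.D
  set N : M₃(F) := a' * ((blkA h - a) + z * blkC h) with hN
  have hNb : MatBall (-(n : ℤ)) N := ((matBall_diagonal hαi).mul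
    (MatBall.add (k := -n) (hA.mono (by omega)) ((hzn.mul hh.C).mono (by omega)))).mono (by omega)
  have hP : blkA h + z * blkC h = a * (1 + N) := by
    rw [hN, Matrix.mul_add, ← Matrix.mul_assoc, haa, Matrix.one_mul, Matrix.mul_one]
    abel
  obtain ⟨w, hw⟩ := exists_unit_eq_one_add hn (det_one_add_sub_one_mem hNb)
  have hw' : (1 + N).det = w := by rw [hw]; ring
  have hdet : (blkA h + z * blkC h).det = (((∏ i, α i) * w : Fˣ) : F) := by simp_all
  have hprod : lv (∏ i, α i) = 0 := by
    rw [prod_univ_three, lv_mul, lv_mul, hα0, hα0, hα0]; rfl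
  refine ⟨(∏ i, α i) * w, hdet, ?_⟩
  rw [nearFactor]
  have hwb : (w : F) - 1 ∈ ball F (-(n : ℤ)) := by
    rw [hw, add_sub_cancel_left]; exact det_one_add_sub_one_mem hNb
  rw [cellFactor_unit hω hχ hh.sim hprod hwb hn]
  set Z := (blkA h + z * blkC h)⁻¹ * (blkB h + z * blkD h) with hZ
  have hu : IsUnit (blkA h + z * blkC h).det := by rw [hdet]; exact Units.isUnit _
  set z0 := a' * z * dd with hz0
  have hz0b : MatBall n z0 :=
    (((matBall_diagonal hαi).mul hzn).mul (matBall_diagonal hh.unit)).mono (by omega)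
  set E := a' * (blkB h + z * (blkD h - dd)) with hE
  have hEb : MatBall 0 E := ((matBall_diagonal hαi).mul
    (hh.B.add ((hzn.mul hD).mono (by omega)))).mono (by omega)
  have hZe : Z + N * Z = z0 + E := by
    have h1 : (blkA h + z * blkC h) * Z = blkB h + z * blkD h := by simp_all
    have h2 : a' * ((blkA h + z * blkC h) * Z) = Z + N * Z := by
      generalize Z = Z' at h1 ⊢
      rw [hP, Matrix.mul_assoc a, ← Matrix.mul_assoc a', haa', Matrix.one_mul, Matrix.add_mul,
        Matrix.one_mul]
    rw [← h2, h1, hz0, hE, Matrix.mul_sub, Matrix.mul_assoc a' z dd, ← Matrix.mul_add]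
    congr 1
    abel
  have hZb : MatBall n Z := .of_add_mul (hNb.mono (by omega))
    (hZe ▸ hz0b.add (hEb.mono (by omega)))
  have hZz : Z = z0 + (E - N * Z) := by
    rw [← add_sub_assoc, ← hZe, add_sub_cancel_right]
  rw [hZz, schwartzPhi_add hψ (hEb.sub ((hNb.mul hZb).mono (by omega))), hz0,
    schwartzPhi_diagonal_mul ξ hαi hh.unit]
  have e : ∀ i, (α i)⁻¹ = c⁻¹ * δ i := fun i => by rw [hα]; simp [mul_comm]
  rw [e, e]
  ring

theorem similitude_entry (g : GSp6 F) :
    blkD g * (blkA g)ᵀ - blkC g * (blkB g)ᵀ = (similitude g : F) • 1 := by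
  have h := similitude_spec g
  rw [fromBlocks_blk, Matrix.J, Matrix.fromBlocks_multiply, Matrix.fromBlocks_transpose,
    Matrix.fromBlocks_multiply, Matrix.fromBlocks_smul] at h
  have h1 := (Matrix.fromBlocks_inj.1 h).2.2.1
  simp only [Matrix.mul_zero, Matrix.mul_one, Matrix.mul_neg, zero_add, add_zero,
    Matrix.neg_mul] at h1
  rw [← h1]
  abel

theorem nearDiagonal_of_sub_one {n : ℕ} (hn : 1 ≤ n) {k : GSp6 F}
    (hk : ∀ i j, (k.1 : M₆(F)) i j - (1 : Matrix _ _ F) i j ∈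
      ball F (-(2 * n : ℤ))) :
    (similitude k : F) - 1 ∈ ball F (-((2 * n : ℕ) : ℤ)) ∧ NearDiagonal n k fun _ => 1 := by
  have hA : MatBall (-(2 * n : ℤ)) (blkA k - 1) := fun i j => by
    simpa [Matrix.one_apply, blkA, Matrix.toBlocks₁₁] using hk (.inl i) (.inl j)
  have hB : MatBall (-(2 * n : ℤ)) (blkB k) := fun i j => by
    simpa [Matrix.one_apply, blkB, Matrix.toBlocks₁₂] using hk (.inl i) (.inr j)
  have hC : MatBall (-(2 * n : ℤ)) (blkC k) := fun i j => by
    simpa [Matrix.one_apply, blkC, Matrix.toBlocks₂₁] using hk (.inr i) (.inl j)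
  have hD : MatBall (-(2 * n : ℤ)) (blkD k - 1) := fun i j => by
    simpa [Matrix.one_apply, blkD, Matrix.toBlocks₂₂] using hk (.inr i) (.inr j)
  have hT : ∀ {k : ℤ} {M : M₃(F)}, MatBall k M → MatBall k Mᵀ :=
    fun h i j => h j i
  have hs : MatBall (-(2 * n : ℤ)) (((similitude k : F) - 1) • (1 : M₃(F))) := by
    have e : ((similitude k : F) - 1) • (1 : M₃(F)) =
        (blkD k - 1) * (blkA k - 1)ᵀ + (blkD k - 1) + (blkA k - 1)ᵀ - blkC k * (blkB k)ᵀ := by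
      rw [sub_smul, one_smul, ← similitude_entry, Matrix.transpose_sub, Matrix.transpose_one,
        Matrix.sub_mul, Matrix.mul_sub, Matrix.mul_one, Matrix.one_mul]
      abel
    rw [e]
    exact ((((hD.mul (hT hA)).mono (by omega)).add hD).add (hT hA)).sub
      ((hC.mul (hT hB)).mono (by omega))
  have hs1 : (similitude k : F) - 1 ∈ ball F (-((2 * n : ℕ) : ℤ)) := by
    have := hs 0 0
    simp_all
  refine ⟨hs1, lv_eq_zero_of_sub_one_mem (by omega) hs1, fun _ => lv_one, ?_, hB.mono (by omega),
      hC, ?_⟩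
  · have e : (blkA k - Matrix.diagonal fun _ => ((similitude k * (1 : Fˣ)⁻¹ : Fˣ) : F)) =
        (blkA k - 1) - ((similitude k : F) - 1) • (1 : M₃(F)) := by
      rw [sub_smul, one_smul, sub_sub_sub_cancel_right, Matrix.smul_one_eq_diagonal]
      simp
    rw [e]
    exact hA.sub hs
  simp_all

theorem NearDiagonal.bigCellSection_mul (hψ : HasOrderZero ψ) {ω χ : 𝓧}
    {ξ : Fin 3 → 𝓧} {n : ℕ} (hn : 1 ≤ n) (hω : TrivialMod ω n) (hχ : TrivialMod χ n)
    (hξ : ∀ i, TrivialMod (ξ i) n) {h : GSp6 F} {δ δ' : Fin 3 → Fˣ} (hh : NearDiagonal n h δ)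
    (hh' : NearDiagonal n h⁻¹ δ') (g : GSp6 F) :
    bigCellSection ω χ (schwartzPhi ψ ξ) (g * h) = nearFactor ω χ ξ h δ *
      bigCellSection ω χ (schwartzPhi ψ ξ) g :=
  Garrett.bigCellSection_mul
    (κ' := nearFactor ω χ ξ h⁻¹ δ')
    (by simp only [nearFactor, ne_eq, mul_eq_zero, inv_eq_zero, Units.ne_zero, or_self,
        not_false_eq_true])
    (fun _ hz hΦ => hh.bigCell hψ hn hω hχ hξ hz hΦ)
    (fun _ hz hΦ => hh'.bigCell hψ hn hω hχ hξ hz hΦ) g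

theorem bigCellSection_isOpen_stabilizer (hψ : HasOrderZero ψ) (ω χ : 𝓧)
    (ξ : Fin 3 → 𝓧) : ∃ U : Subgroup (GSp6 F), IsOpen (U : Set (GSp6 F)) ∧
      ∀ k ∈ U, ∀ s g, bigCellSection ω (χ * absPow F s) (schwartzPhi ψ ξ) (g * k) =
        bigCellSection ω (χ * absPow F s) (schwartzPhi ψ ξ) g := by
  obtain ⟨n0, h0, hω0⟩ := exists_trivialMod ω
  obtain ⟨n1, h1, hχ1⟩ := exists_trivialMod χ
  choose m hm hξm using fun i => exists_trivialMod (ξ i)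
  set n := n0 + n1 + (m 0 + m 1 + m 2) with hn
  have hn1 : 1 ≤ n := by omega
  have hξ : ∀ i, TrivialMod (ξ i) n := fun i => (hξm i).mono (by fin_cases i <;> simp [hn] <;> omega)
  have hω := hω0.mono (show n0 ≤ n by omega)
  have hχ := hχ1.mono (show n1 ≤ n by omega)
  let U : Subgroup (GSp6 F) :=
    { carrier := {k | ∀ s g, bigCellSection ω (χ * absPow F s) (schwartzPhi ψ ξ) (g * k) =
        bigCellSection ω (χ * absPow F s) (schwartzPhi ψ ξ) g}
      one_mem' := fun s g => by simp
      mul_mem' := fun {a b} ha hb s g => by rw [← mul_assoc, hb, ha]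
      inv_mem' := fun {a} ha s g => by rw [← ha s (g * a⁻¹), inv_mul_cancel_right] }
  refine ⟨U, ?_, fun k hk => hk⟩
  have hnb : ∀ᶠ k : GSp6 F in nhds 1, ∀ i j, (k.1 : M₆(F)) i j - (1 : Matrix _ _ F) i j ∈
      ball F (-(2 * n : ℤ)) := by
    rw [Filter.eventually_all]; intro i
    rw [Filter.eventually_all]; intro j
    have hc : Continuous fun k : GSp6 F => (k.1 : M₆(F)) i j :=
      (Units.continuous_val.comp continuous_subtype_val).matrix_elem i j
    exact hc.continuousAt.eventually (ball_mem_nhds _ _)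
  have hnb' := (continuous_inv (G := GSp6 F)).tendsto 1
  rw [inv_one] at hnb'
  refine Subgroup.isOpen_of_mem_nhds U (g := 1) ?_
  filter_upwards [hnb, hnb'.eventually hnb] with k hk hk' s g
  obtain ⟨h1, h2⟩ := nearDiagonal_of_sub_one hn1 hk
  have h3 := (nearDiagonal_of_sub_one hn1 hk').2
  have h4 : ∀ η : 𝓧, TrivialMod η n → η (similitude k) = 1 := fun η hη => by
    have := hη.eq_of_sub_mem hn1 (u := 1) (v := similitude k)
      (by rw [lv_one, zero_sub]; exact ball_mono (by push_cast; omega) h1)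
    rwa [map_one] at this
  rw [h2.bigCellSection_mul hψ hn1 hω (hχ.mul (.absPow s n)) hξ h3]
  simp only [nearFactor, inv_one, mul_one, Finset.prod_const, map_mul ω, map_mul (χ * absPow F s),
      map_pow,
    map_inv, h4 _ hω, h4 _ (hχ.mul (.absPow s n)), h4 _ (hξ _)]
  simp

theorem isHolomorphicSection_bigCellSection (hψ : HasOrderZero ψ) (ω χ : 𝓧)
    (ξ : Fin 3 → 𝓧) : IsHolomorphicSection ω χ
      fun s => bigCellSection ω (χ * absPow F s) (schwartzPhi ψ ξ) := by
  obtain ⟨U, hU, h⟩ := bigCellSection_isOpen_stabilizer hψ ω χ ξ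
  refine ⟨⟨U, hU, h⟩, fun s => ⟨⟨U, hU, fun k hk => h k hk s⟩, bigCellSection_left _ _ _⟩,
    fun g => ?_⟩
  by_cases h0 : (blkC g).det = 0
  · have : ∀ s, bigCellSection ω (χ * absPow F s) (schwartzPhi ψ ξ) g = 0 := fun s =>
      bigCellValue_of_det_eq_zero _ _ _ _ _ h0
    simp_all
  · obtain ⟨d, hd⟩ := exists_unit_det h0
    have : ∀ s, bigCellSection ω (χ * absPow F s) (schwartzPhi ψ ξ) g = _ := fun s =>
      bigCellValue_of_det _ _ _ _ _ _ hd
    simp only [this, cellFactor, mul_apply, val_mul, absPow_apply]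
    refine (((differentiable_const _).mul ((differentiable_const _).mul ?_)).mul
      (differentiable_const _)).mul (differentiable_const _)
    refine fun s => (differentiableAt_id.const_cpow (Or.inl ?_))
    simp

theorem iota_mul (g h : groupH F) : iota (g * h) = iota g * iota h := by
  apply Subtype.ext
  apply Units.ext
  change _ = Matrix.fromBlocks _ _ _ _ * Matrix.fromBlocks _ _ _ _
  rw [Matrix.fromBlocks_multiply]
  simp only [Matrix.diagonal_mul_diagonal, Matrix.diagonal_add]
  change Matrix.fromBlocks _ _ _ _ = _
  have e : ∀ i a b, (g * h).1 i a b = g.1 i a 0 * h.1 i 0 b + g.1 i a 1 * h.1 i 1 b := by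
    intro i a b
    change ((g.1 i : M₂(F)) * (h.1 i : M₂(F))) a b = _
    rw [Matrix.mul_apply, Fin.sum_univ_two]
  simp only [e]

theorem iota_inv (h : groupH F) : (iota h)⁻¹ = iota h⁻¹ := by
  symm
  apply eq_inv_of_mul_eq_one_left
  have h1 : iota (1 : groupH F) * iota 1 = iota (1 : groupH F) * 1 := by
    rw [← iota_mul, mul_one, mul_one]
  rw [← iota_mul, inv_mul_cancel, mul_left_cancel h1]

theorem K0_inv {m : ℕ} {g : GL₂(F)} (hg : g ∈ K0 F m) : g⁻¹ ∈ K0 F m := by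
  obtain ⟨h1, h2, h3⟩ := hg
  have hd : ‖((GeneralLinearGroup.det g)⁻¹ : Fˣ).val‖ = 1 := by simp_all
  have e : ((g⁻¹ : GL₂(F)) : M₂(F)) =
      (((GeneralLinearGroup.det g)⁻¹ : Fˣ) : F) • !![g 1 1, -g 0 1; -g 1 0, g 0 0] := by
    rw [Matrix.coe_units_inv, Matrix.inv_def, Matrix.adjugate_fin_two, Ring.inverse_eq_inv']
    simp
  refine ⟨fun i j => ?_, by rw [map_inv]; exact hd, ?_⟩
  · rw [e, Matrix.smul_apply, smul_eq_mul, norm_mul, hd, one_mul]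
    fin_cases i <;> fin_cases j <;> simp [h1]
  · rw [e, Matrix.smul_apply, smul_eq_mul, norm_mul, hd, one_mul]
    simpa using h3

theorem nearDiagonal_iota {n : ℕ} (hn : 1 ≤ n) {h : groupH F} (hh : ∀ i, h.1 i ∈ K0 F (2 * n)) :
    ∃ δ : Fin 3 → Fˣ, (∀ i, (δ i : F) = h.1 i 1 1) ∧ NearDiagonal n (iota h) δ := by
  have hsim : similitude (iota h) = GeneralLinearGroup.det (h.1 0) := similitude_ofMatrix _ _ _
  set c := GeneralLinearGroup.det (h.1 0) with hc
  have hc0 : lv c = 0 := (norm_eq_one_iff c).1 (hh 0).2.1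
  have hdet : ∀ i, h.1 i 0 0 * h.1 i 1 1 - h.1 i 0 1 * h.1 i 1 0 = c := fun i => by
    rw [hc, ← h.2 i 0, GeneralLinearGroup.val_det_apply, Matrix.det_fin_two]
  have hlow : ∀ i, h.1 i 1 0 ∈ ball F (-(2 * n : ℤ)) := fun i => by
    have := (hh i).2.2
    rw [inv_pow, ← zpow_natCast, ← zpow_neg] at this
    rw [mem_ball]
    simp_all
  have hent : ∀ i a b, h.1 i a b ∈ ball F 0 := fun i a b => by
    rw [mem_ball, zpow_zero]; exact (hh i).1 a b
  have hbc : ∀ i, h.1 i 0 1 * h.1 i 1 0 ∈ ball F (-(2 * n : ℤ)) := fun i => by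
    have := mul_mem_ball (hent i 0 1) (hlow i)
    simp_all
  have hd1 : ∀ i, ‖h.1 i 1 1‖ = 1 := fun i => by
    have h1 : ‖h.1 i 0 1 * h.1 i 1 0‖ < 1 := by
      refine (mem_ball.1 (hbc i)).trans_lt ?_
      rw [← zpow_zero 𝔮ᵣ, zpow_q_lt]
      omega
    have h3 : ‖h.1 i 0 0 * h.1 i 1 1‖ = 1 := by
      have h4 := norm_add_eq_of_lt (x := (c : F)) (y := h.1 i 0 1 * h.1 i 1 0)
        (by rwa [(norm_eq_one_iff c).2 hc0])
      rwa [← hdet i, sub_add_cancel, hdet, (norm_eq_one_iff c).2 hc0] at h4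
    rw [norm_mul] at h3
    nlinarith [(hh i).1 0 0, (hh i).1 1 1, norm_nonneg (h.1 i 0 0), norm_nonneg (h.1 i 1 1)]
  set δ : Fin 3 → Fˣ := fun i => mk0 (h.1 i 1 1)
    (by intro h0; have := hd1 i; simp_all) with hδ
  have hδ0 : ∀ i, lv (δ i) = 0 := fun i => (norm_eq_one_iff (δ i)).1 (hd1 i)
  have hA : blkA (iota h) = .diagonal fun i => h.1 i 0 0 := Matrix.toBlocks_fromBlocks₁₁ ..
  have hB : blkB (iota h) = .diagonal fun i => h.1 i 0 1 := Matrix.toBlocks_fromBlocks₁₂ ..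
  have hC : blkC (iota h) = .diagonal fun i => h.1 i 1 0 := Matrix.toBlocks_fromBlocks₂₁ ..
  have hD : blkD (iota h) = .diagonal fun i => h.1 i 1 1 := Matrix.toBlocks_fromBlocks₂₂ ..
  have hdiag : ∀ {k : ℤ} {d : Fin 3 → F}, (∀ i, d i ∈ ball F k) → MatBall k (Matrix.diagonal d) :=
    fun {k d} hd i j => by
      by_cases hij : i = j <;> simp_all
  refine ⟨δ, fun _ => rfl, by rw [hsim]; exact hc0, hδ0, ?_, ?_, ?_, ?_⟩
  · rw [hA, Matrix.diagonal_sub]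
    refine hdiag fun i => ?_
    have e : h.1 i 0 0 - ((similitude (iota h) * (δ i)⁻¹ : Fˣ) : F) =
        (((δ i)⁻¹ : Fˣ) : F) * (h.1 i 0 1 * h.1 i 1 0) := by
      rw [hsim, val_mul, ← hdet i, val_inv_eq_inv_val, ← show (δ i : F) = h.1 i 1 1 from rfl]
      field_simp
      ring
    rw [e, unit_mul_mem_ball, lv_inv, hδ0]
    simpa using hbc i
  · simp_all
  · simp_all
  · rw [hD]
    exact fun i j => by rw [Matrix.sub_apply]; simp [hδ]

theorem bigCellSection_mul_iota (hψ : HasOrderZero ψ) {n : ℕ} (hn : 1 ≤ n) {χ : 𝓧}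
    {ω : Fin 3 → 𝓧} (hχ : TrivialMod χ n) (hω : ∀ i, TrivialMod (ω i) n) (s : ℂ)
    {h : groupH F} (hh : ∀ i, h.1 i ∈ K0 F (2 * n)) (g : GSp6 F) :
    bigCellSection (∏ i, ω i)⁻¹ (χ * (∏ i, ω i) * absPow F s) (schwartzPhi ψ fun i => χ * ω i)
        (g * iota h) =
      bigCellSection (∏ i, ω i)⁻¹ (χ * (∏ i, ω i) * absPow F s) (schwartzPhi ψ fun i => χ * ω i) g *
        ∏ i, ext0 (ω i) (h.1 i 1 1) := by
  obtain ⟨δ, hδ, h1⟩ := nearDiagonal_iota hn hh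
  obtain ⟨δ', hδ', h2⟩ := nearDiagonal_iota hn (h := h⁻¹) fun i => K0_inv (hh i)
  rw [← iota_inv] at h2
  have hp : TrivialMod (∏ i, ω i) n := by
    rw [prod_univ_three]; exact ((hω 0).mul (hω 1)).mul (hω 2)
  rw [h1.bigCellSection_mul hψ hn hp.inv ((hχ.mul hp).mul (.absPow s n))
    (fun i => hχ.mul (hω i)) h2, mul_comm]
  congr 1
  have hs : ∀ u : Fˣ, lv u = 0 → absPow F s u = 1 := fun u hu => by
    ext; rw [absPow_apply, (norm_eq_one_iff u).2 hu]; simp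
  have hl : lv (similitude (iota h) ^ 3 * (∏ i, similitude (iota h) * (δ i)⁻¹)⁻¹ ^ 2) = 0 := by
    rw [prod_univ_three, ← zpow_natCast, ← zpow_natCast]
    simp only [lv_mul, lv_zpow, lv_inv, h1.sim, h1.unit]
    norm_num
  simp only [← hδ, ext0_units]
  rw [nearFactor, mul_apply (χ * ∏ i, ω i), hs _ hl]
  simp only [prod_univ_three, mul_apply, qc_inv, map_mul, map_pow, map_inv, val_mul,
    val_inv_eq_inv_val, Units.val_pow_eq_pow_val, val_one]
  have hne : ∀ (η : 𝓧) (u : Fˣ), (η u : ℂ) ≠ 0 := fun η u => (η u).ne_zero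
  field_simp [hne]

end Smoothness

section Gauss

/-! ### Integrals of quasi-characters over unions of shells -/

theorem measurableSet_lv_le (N : ℤ) : MeasurableSet {a : Fˣ | lv a ≤ N} :=
    measurableSet_lv (Set.Iic N)

theorem measurableSet_lv_eq (N : ℤ) : MeasurableSet {a : Fˣ | lv a = N} := measurableSet_lv {N}

theorem integrableOn_shell {E : Type*} [NormedAddCommGroup E] {f : Fˣ → E} (hf : Continuous f)
    (k : ℤ) : IntegrableOn f {a : Fˣ | lv a = k} (haarFx F) := by
  refine hf.continuousOn.integrableOn_compact ?_
  have h := (isCompact_lv_zero (F := F)).image (continuous_const_mul (unif F ^ (-k)))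
  convert h using 1
  ext a
  simp only [Set.mem_image, mem_ofPred_eq]
  constructor
  · intro ha
    refine ⟨(unif F ^ (-k))⁻¹ * a, ?_, by simp⟩
    rw [lv_mul, lv_inv, lv_unif_zpow, ha]; ring
  · rintro ⟨b, hb, rfl⟩
    rw [lv_mul, lv_unif_zpow, hb]; ring

theorem continuous_pow_lv (r : ℝ) : Continuous fun a : Fˣ => r ^ (-lv a) :=
  (continuous_of_discreteTopology (f := fun k : ℤ => r ^ (-k))).comp continuous_lv

theorem setIntegral_const_shell (c : ℂ) (k : ℤ) : ∫ _ in {a : Fˣ | lv a = k}, c ∂haarFx F = c := by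
  rw [setIntegral_const, Measure.real, haarFx_shell]; simp

theorem integrableOn_pow_lv {r : ℝ} (hr : 0 < r) (hr1 : r < 1) (N : ℤ) :
    IntegrableOn (fun a : Fˣ => r ^ (-lv a)) {a : Fˣ | lv a ≤ N} (haarFx F) := by
  have hU : {a : Fˣ | lv a ≤ N} = ⋃ n : ℕ, {a : Fˣ | lv a = N - n} := by
    ext a
    simp only [Set.mem_iUnion, mem_ofPred_eq]
    exact ⟨fun h => ⟨(N - lv a).toNat, by omega⟩, fun ⟨n, hn⟩ => by omega⟩
  rw [hU]
  refine integrableOn_iUnion_of_summable_integral_norm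
    (fun n => integrableOn_shell (continuous_pow_lv r) _) ?_
  have h1 : ∀ n : ℕ, ∫ a in {a : Fˣ | lv a = N - n}, ‖r ^ (-lv a)‖ ∂haarFx F = r ^ (-N) *
      r ^ n := by
    intro n
    rw [setIntegral_congr_fun (g := fun _ => r ^ (-N) * r ^ n) (measurableSet_lv_eq _),
      setIntegral_const, Measure.real, haarFx_shell]
    · simp
    · intro a ha
      rw [mem_ofPred_eq] at ha
      simp only
      rw [ha, Real.norm_of_nonneg (zpow_pos hr _).le, ← zpow_natCast, ← zpow_add₀ hr.ne']
      grind
  simp only [h1]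
  exact (summable_geometric_of_lt_one hr.le hr1).mul_left _

theorem integrableOn_char_mul {χ : 𝓧} (hχ : absAt χ < 1) (N : ℤ) {g : Fˣ → ℂ}
    (hg : Measurable g) {C : ℝ} (hC : ∀ a, ‖g a‖ ≤ C) :
    IntegrableOn (fun a : Fˣ => (χ a : ℂ) * g a) {a : Fˣ | lv a ≤ N} (haarFx F) := by
  refine Integrable.mono' ((integrableOn_pow_lv (absAt_pos χ) hχ N).mul_const C)
    ((continuous_quasiChar χ).measurable.mul hg).aestronglyMeasurable
    (.of_forall fun a => ?_)
  rw [norm_mul, norm_quasiChar]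
  exact mul_le_mul_of_nonneg_left (hC a) (zpow_pos (absAt_pos χ) _).le

theorem integral_shell {E : Type*} [NormedAddCommGroup E] [NormedSpace ℝ E] (f : F → E) (k : ℤ) :
    ∫ a : Fˣ in {a : Fˣ | lv a = k}, f a ∂haarFx F = ((volUnits F)⁻¹ * 𝔮ᵣ ^ (-k)) •
        ∫ x in {x : F | ‖x‖ = 𝔮ᵣ ^ k}, f x ∂haarF F := by
  have hm : MeasurableSet {x : F | ‖x‖ = 𝔮ᵣ ^ k} := measurable_norm (measurableSet_singleton _)
  have h := integral_haarFx ({x : F | ‖x‖ = 𝔮ᵣ ^ k}.indicator f)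
  rw [← integral_indicator (measurableSet_lv_eq k), ← integral_indicator hm, mul_smul,
    ← integral_smul]
  refine Eq.trans ?_ (h.trans ?_)
  · refine integral_congr_ae (.of_forall fun a => ?_)
    simp only [indicator_apply, mem_ofPred_eq, norm_eq_zpow_iff]
  · congr 1
    refine integral_congr_ae (.of_forall fun x => ?_)
    simp only [indicator_apply, mem_ofPred_eq]
    simp_all

theorem setIntegral_mul_left {E : Type*} [NormedAddCommGroup E] [NormedSpace ℝ E] (b : Fˣ)
    (f : Fˣ → E) {S T : Set Fˣ} (hS : MeasurableSet S) (hT : MeasurableSet T)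
    (hST : ∀ a, b * a ∈ S ↔ a ∈ T) :
    ∫ a in T, f (b * a) ∂haarFx F = ∫ a in S, f a ∂haarFx F := by
  rw [← integral_indicator hS, ← integral_indicator hT,
    ← integral_mul_left_eq_self (S.indicator f) b]
  refine integral_congr_ae (.of_forall fun a => ?_)
  by_cases ha : a ∈ T
  · simp_all
  simp_all

theorem setIntegral_eq_zero_of_mul {j : Fˣ → ℂ} {S : Set Fˣ} (hS : MeasurableSet S) (t : Fˣ)
    {c : ℂ} (hc : c ≠ 1) (hSt : ∀ a, t * a ∈ S ↔ a ∈ S) (h : ∀ a ∈ S, j (t * a) = c * j a) :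
    ∫ a in S, j a ∂haarFx F = 0 := by
  rw [← integral_indicator hS]
  refine integral_eq_zero_of_mul t hc fun a => ?_
  by_cases ha : a ∈ S
  · simp_all
  simp_all

/-! ### Gauss integrals -/

theorem psi_integral_shell_one (hψ : HasOrderZero ψ) :
    ∫ a in {a : Fˣ | lv a = 1}, (ψ (-(a : F)) : ℂ) ∂haarFx F = -((volUnits F : ℂ)⁻¹ * 𝔮⁻¹) := by
  rw [integral_shell (fun x : F => (ψ (-x) : ℂ))]
  have h1 : {x : F | ‖x‖ = 𝔮ᵣ ^ (1 : ℤ)} = (ball F 1 : Set F) \ ball F 0 := by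
    ext x
    simp only [mem_ofPred_eq, Set.mem_sdiff, SetLike.mem_coe, mem_ball, not_le]
    constructor
    · intro h; rw [h]; exact ⟨le_rfl, zpow_q_lt.2 (by norm_num)⟩
    · rintro ⟨h2, h3⟩
      refine le_antisymm h2 (not_lt.1 fun h4 => absurd h3 (not_lt.2 ?_))
      have := norm_le_pred h4
      grind
  have hint : ∀ k, IntegrableOn (fun x : F => (ψ (-x) : ℂ)) (ball F k) (haarF F) := fun k =>
    (hψ.continuous.comp continuous_neg).continuousOn.integrableOn_compact (isCompact_ball k)
  have h2 := hψ.integral_ball (-1) 1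
  have h3 := hψ.integral_ball (-1) 0
  have e : ∀ x : F, x * -1 = -x := fun x => by ring
  simp only [e] at h2 h3
  rw [if_neg (by rw [mem_ball]; simpa using inv_lt_one_of_one_lt₀ (one_lt_q F))] at h2
  rw [if_pos (by rw [mem_ball]; simp)] at h3
  rw [h1, setIntegral_sdiff (measurableSet_ball 0) (hint 1) (ball_mono (by norm_num)), h2, h3]
  simp [real_smul]

theorem integral_unramified {χ : 𝓧} (hχ : absAt χ < 1) (hur : IsUnramified χ) :
    ∫ a in {a : Fˣ | lv a ≤ 0}, (χ a : ℂ) ∂haarFx F = (1 - (χ (unif F) : ℂ))⁻¹ := by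
  have hint : IntegrableOn (fun a : Fˣ => (χ a : ℂ)) {a : Fˣ | lv a ≤ 0} (haarFx F) := by
    have := integrableOn_char_mul hχ 0 (g := fun _ => 1) measurable_const (C := 1) (by simp)
    grind
  have hne : (1 - (χ (unif F) : ℂ)) ≠ 0 := by
    intro h
    rw [sub_eq_zero] at h
    have : absAt χ = 1 := by rw [absAt, ← h, norm_one]
    grind
  have h1 : ∫ a in {a : Fˣ | lv a ≤ -1}, (χ a : ℂ) ∂haarFx F =
      (χ (unif F) : ℂ) * ∫ a in {a : Fˣ | lv a ≤ 0}, (χ a : ℂ) ∂haarFx F := by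
    rw [← integral_const_mul, ← setIntegral_mul_left (unif F) (fun a => (χ a : ℂ))
      (T := {a : Fˣ | lv a ≤ 0}) (measurableSet_lv_le _) (measurableSet_lv_le _)]
    · simp
    · intro a
      simp only [mem_ofPred_eq, lv_mul, lv_unif]
      omega
  have h2 : ∫ a in {a : Fˣ | lv a = 0}, (χ a : ℂ) ∂haarFx F = 1 := by
    rw [setIntegral_congr_fun (g := fun _ => (1 : ℂ)) (measurableSet_lv_eq 0)
      (fun a ha => by rw [isUnramified_iff.1 hur a ha]; rfl), setIntegral_const_shell]
  have h3 : {a : Fˣ | lv a ≤ 0} = {a : Fˣ | lv a ≤ -1} ∪ {a : Fˣ | lv a = 0} := by ext a; grind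
  have h4 := setIntegral_union (μ := haarFx F) (f := fun a : Fˣ => (χ a : ℂ))
    (s := {a : Fˣ | lv a ≤ -1}) (t := {a : Fˣ | lv a = 0})
    (Set.disjoint_left.2 fun a h h' => by grind) (measurableSet_lv_eq 0)
    (hint.mono_set (h3 ▸ Set.subset_union_left)) (hint.mono_set (h3 ▸ Set.subset_union_right))
  grind

theorem TrivialMod.exists_ne_one {χ : 𝓧} {c : ℕ} (hc : charConductor χ = c + 1) :
    ∃ t : Fˣ, lv t = 0 ∧ (t : F) - 1 ∈ ball F (-(c : ℤ)) ∧ χ t ≠ 1 := by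
  by_contra! h
  have : TrivialMod χ c := by
    intro u hu hu'
    grind
  have := charConductor_le_of_trivialMod this
  omega

/-- Below the conductor, the integrals of a ramified quasi-character against `ψ` vanish. -/
theorem integral_char_psi_below (hψ : HasOrderZero ψ) {χ : 𝓧} {c : ℕ}
    (hc : charConductor χ = c + 1) (X : Fˣ) {S : Set ℤ} (hS : ∀ k ∈ S, k + lv X ≤ c) :
    ∫ a in {a : Fˣ | lv a ∈ S}, (χ a : ℂ) * (ψ (X * a) : ℂ) ∂haarFx F = 0 := by
  obtain ⟨t, ht, ht1, hχt⟩ := TrivialMod.exists_ne_one hc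
  refine setIntegral_eq_zero_of_mul (measurableSet_lv S) t (c := (χ t : ℂ))
    (by simp_all) (fun a => by simp [lv_mul, ht]) fun a ha => ?_
  have e : (X : F) * ((t * a : Fˣ) : F) = X * a + ((X * a : Fˣ) : F) * ((t : F) - 1) := by
    push_cast; ring
  rw [e, hψ.add_ball _ (unit_mul_mem_ball.2 (ball_mono ?_ ht1)), map_mul χ, val_mul, mul_assoc]
  have := hS _ ha
  rw [lv_mul]
  omega

theorem integral_char_psi_above (hψ : HasOrderZero ψ) {χ : 𝓧} {n : ℕ} (hn : 1 ≤ n)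
    (hχ : TrivialMod χ n) (X : Fˣ) {S : Set ℤ} (hS : ∀ k ∈ S, (n : ℤ) < k + lv X) :
    ∫ a in {a : Fˣ | lv a ∈ S}, (χ a : ℂ) * (ψ (X * a) : ℂ) ∂haarFx F = 0 :=
  integral_char_mul_psi_eq_zero hψ hn hχ X (measurableSet_lv S)
    (fun u hu w hw => by
      simp only [mem_ofPred_eq, lv_mul, lv_eq_zero_of_sub_one_mem hn hw, zero_add]; exact hu)
    (fun u hu => hS _ hu)

theorem fourier_unitPart_units (χ : 𝓧) (u : Fˣ) : fourier ψ (unitPart χ) u =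
      (volUnits F : ℂ) * ∫ a in {a : Fˣ | lv a = 0}, (χ a : ℂ) * (ψ (u * a) : ℂ) ∂haarFx F := by
  rw [fourier, integral_haarF, real_smul, ← integral_indicator (measurableSet_lv_eq 0)]
  congr 1
  refine integral_congr_ae (.of_forall fun a => ?_)
  simp only [unitPart_units, indicator_apply, mem_ofPred_eq]
  split_ifs with h
  · rw [(norm_eq_one_iff a).2 h, one_smul, mul_comm (a : F)]
  · simp

theorem integral_char_psi_scale (χ : 𝓧) (u : Fˣ) (k : ℤ) :
    ∫ a in {a : Fˣ | lv a = k}, (χ a : ℂ) * (ψ (u * a) : ℂ) ∂haarFx F =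
      (χ u : ℂ)⁻¹ * ∫ a in {a : Fˣ | lv a = k + lv u}, (χ a : ℂ) * (ψ (a : F) : ℂ) ∂haarFx F := by
  rw [← setIntegral_mul_left (E := ℂ) u (fun a => (χ a : ℂ) * (ψ (a : F) : ℂ)) (T :=
      {a : Fˣ | lv a = k})
    (measurableSet_lv_eq _) (measurableSet_lv_eq _) (fun a => by
      simp only [mem_ofPred_eq, lv_mul]; omega), ← integral_const_mul]
  refine integral_congr_ae (.of_forall fun a => ?_)
  simp only [map_mul χ, val_mul]
  field_simp [(χ u).ne_zero]

/-- The product formula for Gauss sums of ramified quasi-characters. -/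
theorem gauss_mul_gauss (hψ : HasOrderZero ψ) {χ : 𝓧} {c : ℕ} (hc : charConductor χ = c + 1) :
    (volUnits F : ℂ) ^ 2 * 𝔮 ^ (c + 1 : ℤ) *
      (∫ a in {a : Fˣ | lv a = c + 1}, (χ a : ℂ) * (ψ (a : F) : ℂ) ∂haarFx F) *
      (∫ a in {a : Fˣ | lv a = c + 1}, (χ⁻¹ a : ℂ) * (ψ (-(a : F)) : ℂ) ∂haarFx F) = 1 := by
  have hT : TrivialMod χ (c + 1) := trivialMod_of_charConductor_le hc.le
  have h1 := fourier_inversion hψ (ballFun_unitPart (by omega) hT) 1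
  have h2 : unitPart χ (1 : F) = 1 := by
    rw [← val_one, unitPart_units, lv_one, if_pos rfl, map_one, val_one]
  rw [h2, integral_haarF, real_smul] at h1
  refine Eq.trans ?_ h1
  set A := ∫ a in {a : Fˣ | lv a = c + 1}, (χ a : ℂ) * (ψ (a : F) : ℂ) ∂haarFx F with hA
  rw [← integral_indicator (E := ℂ) (measurableSet_lv_eq (c + 1 : ℤ)) (f := fun a : Fˣ =>
    (χ⁻¹ a : ℂ) * (ψ (-(a : F)) : ℂ)), ← integral_const_mul (_ * A),
    ← integral_const_mul (volUnits F : ℂ)]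
  refine integral_congr_ae (.of_forall fun u => ?_)
  simp only [indicator_apply, mem_ofPred_eq, one_mul]
  rw [fourier_unitPart_units]
  split_ifs with h
  · rw [integral_char_psi_scale, h, zero_add, norm_eq_lv, h, qc_inv, val_inv_eq_inv_val, real_smul]
    push_cast
    ring
  · have h3 : ∫ a in {a : Fˣ | lv a = 0}, (χ a : ℂ) * (ψ (u * a) : ℂ) ∂haarFx F = 0 := by
      rcases lt_or_gt_of_ne h with h4 | h4
      · exact integral_char_psi_below hψ hc u (S := {0}) fun k hk => by grind
      · exact integral_char_psi_above hψ (by omega) hT u (S := {0}) fun k hk => by grind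
    rw [h3]; simp

/-! ### The Tate gamma factor -/

theorem unramified_uniformizer {χ : 𝓧} (hϖ : IsUniformizer (ϖ : F)) (h : IsUnramified χ) :
    χ ϖ = χ (unif F) := by
  have h1 := isUnramified_iff.1 h (ϖ * (unif F)⁻¹)
    (by rw [lv_mul, lv_inv, lv_unif, lv_of_isUniformizer hϖ]; rfl)
  rwa [map_mul, map_inv, mul_inv_eq_one] at h1

theorem charConductor_congr {χ χ' : 𝓧} (h : ∀ u : Fˣ, lv u = 0 → χ u = χ' u) :
    charConductor χ = charConductor χ' := by
  unfold charConductor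
  congr 1
  ext n
  exact forall₃_congr fun u hu _ => by rw [h u ((norm_eq_one_iff u).1 hu)]

theorem isUnramified_congr {χ χ' : 𝓧} (h : ∀ u : Fˣ, lv u = 0 → χ u = χ' u) :
    IsUnramified χ ↔ IsUnramified χ' :=
  forall₂_congr fun u hu => by rw [h u ((norm_eq_one_iff u).1 hu)]

theorem absPow_unit {u : Fˣ} (hu : lv u = 0) (s : ℂ) : absPow F s u = 1 := by
  ext; rw [absPow_apply, (norm_eq_one_iff u).2 hu]; simp

theorem mul_absPow_unit (χ : 𝓧) (s : ℂ) (u : Fˣ) (hu : lv u = 0) :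
    (χ * absPow F s) u = χ u := by rw [mul_apply, absPow_unit hu, mul_one]

theorem absPow_uniformizer (hϖ : IsUniformizer (ϖ : F)) (s : ℂ) :
    ((absPow F s ϖ : ℂˣ) : ℂ) = 𝔮 ^ (-s) := by
  rw [← absPow_unif]
  have : absPow F s ϖ = absPow F s (unif F) := unramified_uniformizer hϖ
    (isUnramified_iff.2 fun u hu => absPow_unit hu s)
  rw [this]

theorem IsUnramified.apply_eq {χ : 𝓧} (h : IsUnramified χ) (u : Fˣ) :
    χ u = χ (unif F) ^ (-lv u) := by
  have h1 := isUnramified_iff.1 h (u * unif F ^ lv u) (by rw [lv_mul, lv_unif_zpow]; ring)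
  rw [map_mul, map_zpow] at h1
  rw [zpow_neg]
  exact eq_inv_of_mul_eq_one_left h1

theorem absPow_eq_zpow (s : ℂ) (u : Fˣ) : ((absPow F s u : ℂˣ) : ℂ) = (𝔮 ^ (-s)) ^ (-lv u) := by
  rw [IsUnramified.apply_eq (isUnramified_iff.2 fun u hu => absPow_unit hu s) u,
    Units.val_zpow_eq_zpow_val, absPow_unif]

theorem qc_mul_inv (χ χ' : 𝓧) : (χ * χ')⁻¹ = χ⁻¹ * χ'⁻¹ := by
  ext u
  simp only [qc_inv, mul_apply, mul_inv]

theorem qc_inv_inv (χ : 𝓧) : χ⁻¹⁻¹ = χ := by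
  ext u
  simp only [qc_inv, inv_inv]

theorem tateL_of_isUnramified {χ : 𝓧} (h : IsUnramified χ) (s : ℂ) :
    tateL ϖ χ s = (1 - (χ ϖ : ℂ) * 𝔮 ^ (-s))⁻¹ := if_pos h

theorem tateL_of_not_isUnramified {χ : 𝓧} (h : ¬ IsUnramified χ) (s : ℂ) :
    tateL ϖ χ s = 1 := if_neg h

theorem tateGamma_absPow (hϖ : IsUniformizer (ϖ : F)) (χ : 𝓧) (s t : ℂ) :
    tateGamma ψ ϖ (χ * absPow F t) s = tateGamma ψ ϖ χ (s + t) := by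
  have hq := qC_ne_zero F
  have hu := isUnramified_congr (mul_absPow_unit χ t)
  have hu' : IsUnramified (χ * absPow F t)⁻¹ ↔ IsUnramified χ⁻¹ := isUnramified_congr fun u h => by
    rw [qc_inv, qc_inv, mul_absPow_unit χ t u h]
  have hc : (χ * absPow F t)⁻¹ * absPow F (-s) = χ⁻¹ * absPow F (-(s + t)) := by
    rw [qc_mul_inv, neg_add, add_comm (-s), absPow_add, absPow_neg t, mul_assoc]
  have h1 : tateEps ψ (χ * absPow F t) s = tateEps ψ χ (s + t) := by
    unfold tateEps
    by_cases h : IsUnramified χ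
    · grind
    · rw [if_neg h, if_neg (mt hu.1 h), charConductor_congr (mul_absPow_unit χ t), hc]
  have h2 : tateL ϖ (χ * absPow F t) s = tateL ϖ χ (s + t) := by
    by_cases h : IsUnramified χ
    · rw [tateL_of_isUnramified h, tateL_of_isUnramified (hu.2 h), mul_apply,
        val_mul, absPow_uniformizer hϖ, mul_assoc, ← Complex.cpow_add _ _ hq, neg_add,
        add_comm (-s)]
    · rw [tateL_of_not_isUnramified h, tateL_of_not_isUnramified (mt hu.1 h)]
  have h3 : tateL ϖ (χ * absPow F t)⁻¹ (1 - s) = tateL ϖ χ⁻¹ (1 - (s + t)) := by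
    by_cases h : IsUnramified χ⁻¹
    · rw [tateL_of_isUnramified h, tateL_of_isUnramified (hu'.2 h), qc_inv,
        qc_inv, mul_apply, mul_inv, val_mul,
        val_inv_eq_inv_val, val_inv_eq_inv_val, absPow_uniformizer hϖ, mul_assoc,
        ← cpow_neg, ← Complex.cpow_add _ _ hq,
        show - -t + -(1 - s) = -(1 - (s + t)) by ring]
    · rw [tateL_of_not_isUnramified h, tateL_of_not_isUnramified (mt hu'.1 h)]
  rw [tateGamma, tateGamma, h1, h2, h3]

theorem tateEps_ramified {χ : 𝓧} (h : ¬ IsUnramified χ) {c : ℕ}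
    (hc : charConductor χ = c + 1) (s : ℂ) : tateEps ψ χ s =
      (volUnits F : ℂ) * (𝔮 ^ (-s)) ^ (c + 1) * 𝔮 ^ (c + 1 : ℤ) *
        ∫ a in {a : Fˣ | lv a = c + 1}, (χ⁻¹ a : ℂ) * (ψ (a : F) : ℂ) ∂haarFx F := by
  have hv : (volUnits F : ℂ) ≠ 0 := by exact_mod_cast (volUnits_pos F).ne'
  have hq := qC_ne_zero F
  rw [tateEps, if_neg h, hc]
  have h1 := integral_shell (fun x : F => ext0 (χ⁻¹ * absPow F (-s)) x * (ψ x : ℂ)) (c + 1)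
  have h2 : {x : F | ‖x‖ = 𝔮ᵣ ^ (c + 1)} = {x : F | ‖x‖ = 𝔮ᵣ ^ (c + 1 : ℤ)} := by
    ext x; simp only [mem_ofPred_eq]; rw [← zpow_natCast]; norm_cast
  rw [h2]
  set I := ∫ x in {x : F | ‖x‖ = 𝔮ᵣ ^ (c + 1 : ℤ)},
    ext0 (χ⁻¹ * absPow F (-s)) x * (ψ x : ℂ) ∂haarF F with hI
  have h3 : ∫ a : Fˣ in {a : Fˣ | lv a = c + 1},
      ext0 (χ⁻¹ * absPow F (-s)) (a : F) * (ψ (a : F) : ℂ) ∂haarFx F =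
      (𝔮 ^ (-s)) ^ (c + 1) *
        ∫ a in {a : Fˣ | lv a = c + 1}, (χ⁻¹ a : ℂ) * (ψ (a : F) : ℂ) ∂haarFx F := by
    rw [← integral_const_mul]
    refine setIntegral_congr_fun (measurableSet_lv_eq _) fun a ha => ?_
    rw [mem_ofPred_eq] at ha
    change ext0 (χ⁻¹ * absPow F (-s)) (a : F) * (ψ (a : F) : ℂ) = _ *
        ((χ⁻¹ a : ℂ) * (ψ (a : F) : ℂ))
    rw [ext0_units, mul_apply, val_mul, absPow_eq_zpow, ha, neg_neg,
      cpow_neg _ s, ← inv_zpow', ← zpow_natCast]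
    grind
  rw [h1, real_smul] at h3
  have h4 : I = (volUnits F : ℂ) * 𝔮 ^ (c + 1 : ℤ) *
      ((((volUnits F)⁻¹ * 𝔮ᵣ ^ (-(c + 1 : ℤ)) : ℝ) : ℂ) * I) := by
    push_cast
    rw [zpow_neg]
    field_simp
  grind

theorem integral_le_eq_of_vanish {f : Fˣ → ℂ} {N M : ℤ} (hNM : N ≤ M)
    (hf : IntegrableOn f {a : Fˣ | lv a ≤ M} (haarFx F))
    (h : ∫ a in {a : Fˣ | lv a ∈ Set.Ioc N M}, f a ∂haarFx F = 0) :
    ∫ a in {a : Fˣ | lv a ≤ M}, f a ∂haarFx F = ∫ a in {a : Fˣ | lv a ≤ N}, f a ∂haarFx F := by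
  have h3 : {a : Fˣ | lv a ≤ M} = {a : Fˣ | lv a ≤ N} ∪ {a : Fˣ | lv a ∈ Set.Ioc N M} := by
    ext a; grind
  have h4 := setIntegral_union (μ := haarFx F) (f := f)
    (s := {a : Fˣ | lv a ≤ N}) (t := {a : Fˣ | lv a ∈ Set.Ioc N M})
    (Set.disjoint_left.2 fun a h h' => by grind) (measurableSet_lv _)
    (hf.mono_set (h3 ▸ Set.subset_union_left)) (hf.mono_set (h3 ▸ Set.subset_union_right))
  grind

theorem integrableOn_char_psi (hψ : HasOrderZero ψ) {χ : 𝓧} (hχ : absAt χ < 1) (X : F) (N : ℤ) :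
    IntegrableOn (fun a : Fˣ => (χ a : ℂ) * (ψ (X * a) : ℂ)) {a : Fˣ | lv a ≤ N} (haarFx F) :=
  integrableOn_char_mul hχ N (g := fun a : Fˣ => (ψ (X * a) : ℂ))
    (hψ.continuous.comp (continuous_const.mul Units.continuous_val)).measurable
    (C := 1) fun _ => (norm_psi _ _).le

/-- The Tate integral of `ψ⁻¹`, cut off at a large radius, is the inverse of the gamma factor. -/
theorem gauss_integral (hψ : HasOrderZero ψ) (hϖ : IsUniformizer (ϖ : F)) {χ : 𝓧}
    (hχ : absAt χ < 1) {n : ℕ} (hn : 1 ≤ n) (hT : TrivialMod χ n) :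
    ∫ a in {a : Fˣ | lv a ≤ n}, (χ a : ℂ) * (ψ (-(a : F)) : ℂ) ∂haarFx F =
      (volUnits F : ℂ)⁻¹ * (tateGamma ψ ϖ χ 0)⁻¹ := by
  have hv : (volUnits F : ℂ) ≠ 0 := by exact_mod_cast (volUnits_pos F).ne'
  have hq := qC_ne_zero F
  have hint := fun N => integrableOn_char_psi hψ hχ (-1) N
  have e : ∀ a : Fˣ, (-1 : F) * a = -(a : F) := fun a => by ring
  simp only [e] at hint
  have hneg : ∀ a : Fˣ, ((-1 : Fˣ) : F) * a = -(a : F) := fun a => by simp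
  by_cases hur : IsUnramified χ
  · have h1 : ∫ a in {a : Fˣ | lv a ≤ n}, (χ a : ℂ) * (ψ (-(a : F)) : ℂ) ∂haarFx F =
        ∫ a in {a : Fˣ | lv a ≤ 1}, (χ a : ℂ) * (ψ (-(a : F)) : ℂ) ∂haarFx F := by
      refine integral_le_eq_of_vanish (by omega) (hint _) ?_
      have := integral_char_psi_above hψ le_rfl (hur.trivialMod 1) (-1) (S := Set.Ioc 1 (n : ℤ))
        fun k hk => by rw [lv_neg, lv_one]; grind
      grind
    have h3 : {a : Fˣ | lv a ≤ 1} = {a : Fˣ | lv a ≤ 0} ∪ {a : Fˣ | lv a = 1} := by ext a; grind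
    have h4 := setIntegral_union (μ := haarFx F) (f := fun a : Fˣ => (χ a : ℂ) * (ψ (-(a : F)) : ℂ))
      (s := {a : Fˣ | lv a ≤ 0}) (t := {a : Fˣ | lv a = 1})
      (Set.disjoint_left.2 fun a h h' => by grind) (measurableSet_lv_eq _)
      (hint _) ((hint 1).mono_set (h3 ▸ Set.subset_union_right))
    have h5 : ∫ a in {a : Fˣ | lv a ≤ 0}, (χ a : ℂ) * (ψ (-(a : F)) : ℂ) ∂haarFx F =
        (1 - (χ (unif F) : ℂ))⁻¹ := by
      rw [← integral_unramified hχ hur]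
      refine setIntegral_congr_fun (measurableSet_lv_le 0) fun a ha => ?_
      rw [hψ.apply_ball ((ball F 0).neg_mem (units_mem_ball.2 ha)), mul_one]
    have h6 : ∫ a in {a : Fˣ | lv a = 1}, (χ a : ℂ) * (ψ (-(a : F)) : ℂ) ∂haarFx F =
        (χ (unif F) : ℂ)⁻¹ * -((volUnits F : ℂ)⁻¹ * 𝔮⁻¹) := by
      rw [← psi_integral_shell_one hψ, ← integral_const_mul]
      refine setIntegral_congr_fun (measurableSet_lv_eq 1) fun a ha => ?_
      have h7 : χ (a * unif F) = 1 := isUnramified_iff.1 hur _ (by rw [lv_mul, lv_unif]; grind)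
      rw [map_mul] at h7
      change (χ a : ℂ) * (ψ (-(a : F)) : ℂ) = _ * (ψ (-(a : F)) : ℂ)
      rw [eq_inv_of_mul_eq_one_left h7, val_inv_eq_inv_val]
    rw [h1, h3, h4, h5, h6]
    have hur' : IsUnramified χ⁻¹ := fun u hu => by rw [qc_inv, hur u hu, inv_one]
    rw [tateGamma, tateEps, if_pos hur, tateL, if_pos hur', tateL, if_pos hur, qc_inv,
      unramified_uniformizer hϖ hur]
    have h8 : (χ (unif F) : ℂ) ≠ 0 := Units.ne_zero _
    have hne : (1 - (χ (unif F) : ℂ)) ≠ 0 := by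
      intro h
      rw [sub_eq_zero] at h
      have : absAt χ = 1 := by rw [absAt, ← h, norm_one]
      grind
    have hvq : (volUnits F : ℂ) = 1 - 𝔮⁻¹ := by simp [volUnits]
    rw [hvq] at hv ⊢
    have hv2 : 𝔮 - 1 ≠ 0 := by grind
    simp only [neg_zero, sub_zero, Complex.cpow_zero, mul_one, one_mul, Complex.cpow_neg_one,
      val_inv_eq_inv_val, div_inv_eq_mul]
    grind
  · obtain ⟨c, hc⟩ : ∃ c, charConductor χ = c + 1 := by
      refine Nat.exists_eq_succ_of_ne_zero fun h => hur ?_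
      exact isUnramified_iff_trivialMod_zero.2 (trivialMod_of_charConductor_le h.le)
    have hcn : c + 1 ≤ n := hc ▸ charConductor_le_of_trivialMod hT
    have hTc : TrivialMod χ (c + 1) := trivialMod_of_charConductor_le hc.le
    have h1 : ∫ a in {a : Fˣ | lv a ≤ n}, (χ a : ℂ) * (ψ (-(a : F)) : ℂ) ∂haarFx F =
        ∫ a in {a : Fˣ | lv a ≤ c + 1}, (χ a : ℂ) * (ψ (-(a : F)) : ℂ) ∂haarFx F := by
      refine integral_le_eq_of_vanish (by omega) (hint _) ?_
      have := integral_char_psi_above hψ (by omega) hTc (-1) (S := Set.Ioc (c + 1 : ℤ) (n : ℤ))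
        fun k hk => by rw [lv_neg, lv_one]; grind
      grind
    have h3 : {a : Fˣ | lv a ≤ c + 1} = {a : Fˣ | lv a ≤ c} ∪ {a : Fˣ | lv a = c + 1} := by
      ext a; grind
    have h4 := setIntegral_union (μ := haarFx F) (f := fun a : Fˣ => (χ a : ℂ) * (ψ (-(a : F)) : ℂ))
      (s := {a : Fˣ | lv a ≤ c}) (t := {a : Fˣ | lv a = c + 1})
      (Set.disjoint_left.2 fun a h h' => by grind) (measurableSet_lv_eq _)
      (hint _) ((hint _).mono_set (h3 ▸ Set.subset_union_right))
    have h5 : ∫ a in {a : Fˣ | lv a ≤ c}, (χ a : ℂ) * (ψ (-(a : F)) : ℂ) ∂haarFx F = 0 := by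
      have := integral_char_psi_below hψ hc (-1) (S := Set.Iic (c : ℤ))
        fun k hk => by rw [lv_neg, lv_one]; grind
      simp_all
    have hur' : ¬ IsUnramified χ⁻¹ := fun h => hur fun u hu => by
      have := h u hu
      rwa [qc_inv, inv_eq_one] at this
    have hc' : charConductor χ⁻¹ = c + 1 := by
      rw [← hc]
      unfold charConductor
      simp only [qc_inv, inv_eq_one]
    rw [h1, h3, h4, h5, zero_add, tateGamma, tateL, if_neg hur', tateL, if_neg hur, div_one,
        mul_one,
      tateEps_ramified hur hc]
    have h6 := gauss_mul_gauss hψ hc'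
    rw [qc_inv_inv] at h6
    simp only [neg_zero, Complex.cpow_zero, one_pow, mul_one]
    grind

end Gauss

section Rational

/-! ### Rational functions of `q^{-s}` -/

/-- The filter of `Re s → +∞`. -/
def rightF : Filter ℂ := comap Complex.re atTop

/-- The filter of `Re s → -∞`. -/
def leftF : Filter ℂ := comap Complex.re atBot

theorem eventually_rightF {p : ℂ → Prop} :
    (∀ᶠ s in rightF, p s) ↔ ∃ σ : ℝ, ∀ s : ℂ, σ < s.re → p s := by
  rw [rightF, eventually_comap]
  constructor
  · intro h
    obtain ⟨σ, hσ⟩ := eventually_atTop.1 h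
    exact ⟨σ, fun s hs => hσ _ hs.le s rfl⟩
  · rintro ⟨σ, hσ⟩
    exact (eventually_gt_atTop σ).mono fun x hx s hs => hσ s (hs ▸ hx)

theorem eventually_leftF {p : ℂ → Prop} :
    (∀ᶠ s in leftF, p s) ↔ ∃ σ : ℝ, ∀ s : ℂ, s.re < σ → p s := by
  rw [leftF, eventually_comap]
  constructor
  · intro h
    obtain ⟨σ, hσ⟩ := eventually_atBot.1 h
    exact ⟨σ, fun s hs => hσ _ hs.le s rfl⟩
  · rintro ⟨σ, hσ⟩
    exact (eventually_lt_atBot σ).mono fun x hx s hs => hσ s (hs ▸ hx)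

instance rightF_neBot : rightF.NeBot :=
  comap_neBot_iff_frequently.2 (Frequently.of_forall fun x => ⟨(x : ℂ), Complex.ofReal_re x⟩)

instance leftF_neBot : leftF.NeBot :=
  comap_neBot_iff_frequently.2 (Frequently.of_forall fun x => ⟨(x : ℂ), Complex.ofReal_re x⟩)

variable (F) in
theorem norm_cpow_q (s : ℂ) : ‖𝔮 ^ s‖ = 𝔮ᵣ ^ s.re := by
  have := Complex.norm_cpow_eq_rpow_re_of_pos (q_pos F) s
  simp_all

variable (F) in
theorem tendsto_cpow_right : Tendsto (fun s : ℂ => 𝔮 ^ (-s)) rightF (𝓝[≠] 0) := by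
  refine tendsto_nhdsWithin_iff.2 ⟨?_, .of_forall fun s => ?_⟩
  · rw [tendsto_zero_iff_norm_tendsto_zero]
    simp only [norm_cpow_q, Complex.neg_re]
    exact ((tendsto_rpow_atBot_of_base_gt_one 𝔮ᵣ (one_lt_q F)).comp
      tendsto_neg_atTop_atBot).comp tendsto_comap
  · simp [Complex.cpow_eq_zero_iff, qC_ne_zero F]

variable (F) in
theorem tendsto_cpow_left : Tendsto (fun s : ℂ => 𝔮 ^ (-s)) leftF (Bornology.cobounded ℂ) := by
  rw [← tendsto_norm_atTop_iff_cobounded]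
  simp only [norm_cpow_q, Complex.neg_re]
  have h := (tendsto_rpow_atTop_of_base_gt_one 𝔮ᵣ (one_lt_q F)).comp
    tendsto_neg_atBot_atTop
  exact h.comp tendsto_comap

variable (F) in
/-- Both half planes together. -/
theorem tendsto_cpow_cofinite {l : Filter ℂ} (hl : l ≤ rightF ⊔ leftF) :
    Tendsto (fun s : ℂ => 𝔮 ^ (-s)) l cofinite :=
  (tendsto_sup.2 ⟨(tendsto_cpow_right F).mono_right (nhdsNE_le_cofinite _),
    (tendsto_cpow_left F).mono_right (Bornology.le_cofinite ℂ)⟩).mono_left hl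

variable (F) in
theorem eventually_eval_ne_zero {l : Filter ℂ} (hl : l ≤ rightF ⊔ leftF) {p : Polynomial ℂ}
    (hp : p ≠ 0) : ∀ᶠ s in l, p.eval (𝔮 ^ (-s)) ≠ 0 := by
  have : {x | p.eval x = 0}.Finite := by
    refine p.roots.toFinset.finite_toSet.subset fun x hx => ?_
    simp_all
  exact (tendsto_cpow_cofinite F hl).eventually (p := fun x => p.eval x ≠ 0) this.compl_mem_cofinite

variable (F) in
/-- The value of a rational function at `q^{-s}`. -/
def evq (R : RatFunc ℂ) (s : ℂ) : ℂ := R.eval (RingHom.id ℂ) (𝔮 ^ (-s))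

variable (F) in
/-- `R(q^{-s})` represents `f` along the filter `l`. -/
def Represents (l : Filter ℂ) (f : ℂ → ℂ) (R : RatFunc ℂ) : Prop := ∀ᶠ s in l, evq F R s = f s

variable (F) in
theorem eventually_denom_ne_zero {l : Filter ℂ} (hl : l ≤ rightF ⊔ leftF) (R : RatFunc ℂ) :
    ∀ᶠ s in l, Polynomial.eval₂ (RingHom.id ℂ) (𝔮 ^ (-s)) R.denom ≠ 0 := by
  have := eventually_eval_ne_zero F hl R.denom_ne_zero
  simp_all

section Closure

variable {l : Filter ℂ} {f f' : ℂ → ℂ} {R R' : RatFunc ℂ}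

theorem Represents.add (hl : l ≤ rightF ⊔ leftF) (h : Represents F l f R)
    (h' : Represents F l f' R') : Represents F l (fun s => f s + f' s) (R + R') := by
  filter_upwards [h, h', eventually_denom_ne_zero F hl R, eventually_denom_ne_zero F hl R']
    with s h1 h2 h3 h4
  rw [← h1, ← h2, evq, RatFunc.eval_add _ _ h3 h4]; rfl

theorem Represents.mul (hl : l ≤ rightF ⊔ leftF) (h : Represents F l f R)
    (h' : Represents F l f' R') : Represents F l (fun s => f s * f' s) (R * R') := by
  filter_upwards [h, h', eventually_denom_ne_zero F hl R, eventually_denom_ne_zero F hl R']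
    with s h1 h2 h3 h4
  rw [← h1, ← h2, evq, RatFunc.eval_mul _ _ h3 h4]; rfl

theorem represents_const (c : ℂ) : Represents F l (fun _ => c) (RatFunc.C c) :=
  .of_forall fun s => by simp [evq]

theorem represents_X : Represents F l (fun s => 𝔮 ^ (-s)) RatFunc.X :=
  .of_forall fun s => by simp [evq]

theorem Represents.inv (hl : l ≤ rightF ⊔ leftF) (h : Represents F l f R) :
    Represents F l (fun s => (f s)⁻¹) R⁻¹ := by
  rcases eq_or_ne R 0 with rfl | hR
  · filter_upwards [h] with s h1
    rw [← h1, inv_zero]; simp [evq]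
  · filter_upwards [h, eventually_denom_ne_zero F hl R, eventually_denom_ne_zero F hl R⁻¹]
      with s h1 h3 h4
    rw [← h1, evq, evq]
    refine eq_inv_of_mul_eq_one_left ?_
    rw [← RatFunc.eval_mul _ _ h4 h3, inv_mul_cancel₀ hR, RatFunc.eval_one]

theorem Represents.pow (hl : l ≤ rightF ⊔ leftF) (h : Represents F l f R) (n : ℕ) :
    Represents F l (fun s => f s ^ n) (R ^ n) := by
  induction n with
  | zero => simpa using represents_const (F := F) (l := l) 1
  | succ n ih => simpa only [pow_succ] using ih.mul hl h

theorem Represents.zpow (hl : l ≤ rightF ⊔ leftF) (h : Represents F l f R) (n : ℤ) :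
    Represents F l (fun s => f s ^ n) (R ^ n) := by
  cases n with
  | ofNat n => simpa using h.pow hl n
  | negSucc n => simpa only [zpow_negSucc] using (h.pow hl (n + 1)).inv hl

theorem Represents.sum (hl : l ≤ rightF ⊔ leftF) {ι : Type*} (t : Finset ι) {f : ι → ℂ → ℂ}
    {R : ι → RatFunc ℂ} (h : ∀ i ∈ t, Represents F l (f i) (R i)) :
    Represents F l (fun s => ∑ i ∈ t, f i s) (∑ i ∈ t, R i) := by
  classical
  induction t using Finset.induction_on with
  | empty => simpa using represents_const (F := F) (l := l) 0
  | insert a t ha ih =>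
    simp only [Finset.sum_insert ha]
    exact (h a (Finset.mem_insert_self a t)).add hl
      (ih fun i hi => h i (Finset.mem_insert_of_mem hi))

theorem Represents.congr (h : Represents F l f R) (hf : ∀ᶠ s in l, f s = f' s) :
    Represents F l f' R := by
  filter_upwards [h, hf] with s h1 h2
  grind

theorem Represents.unique [l.NeBot] (hl : l ≤ rightF ⊔ leftF) (h : Represents F l f R)
    (h' : Represents F l f R') : R = R' := by
  by_contra hne
  have h1 : R + RatFunc.C (-1) * R' ≠ 0 := by grind
  have h2 := h.add hl ((represents_const (-1)).mul hl h')
  have h3 := h2.mul hl (h2.inv hl)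
  rw [mul_inv_cancel₀ h1] at h3
  obtain ⟨s, hs⟩ := h3.exists
  simp [evq] at hs

end Closure

/-- The Tate gamma factor is a rational function of `q^{-s}`. -/
theorem exists_represents_tateGamma (χ : 𝓧) :
    ∃ R : RatFunc ℂ, Represents F (rightF ⊔ leftF) (tateGamma ψ ϖ χ) R := by
  have hq := qC_ne_zero F
  have hL : ∀ χ : 𝓧, ∃ R, Represents F (rightF ⊔ leftF) (tateL ϖ χ) R := fun χ => by
    by_cases h : IsUnramified χ
    · refine ⟨_, (((represents_const 1).add le_rfl ((represents_const (-(χ ϖ : ℂ))).mul le_rfl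
        represents_X)).inv le_rfl).congr (.of_forall fun s => ?_)⟩
      rw [tateL_of_isUnramified h]; ring
    · exact ⟨_, (represents_const 1).congr
        (.of_forall fun s => (tateL_of_not_isUnramified h s).symm)⟩
  have hL' : ∀ χ : 𝓧, ∃ R, Represents F (rightF ⊔ leftF) (fun s => tateL ϖ χ (1 - s)) R :=
    fun χ => by
    by_cases h : IsUnramified χ
    · refine ⟨_, (((represents_const 1).add le_rfl
        ((represents_const (-(χ ϖ : ℂ) * 𝔮⁻¹)).mul le_rfl
        (represents_X.inv le_rfl))).inv le_rfl).congr (.of_forall fun s => ?_)⟩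
      rw [tateL_of_isUnramified h, cpow_neg _ s, inv_inv, neg_sub, Complex.cpow_sub _ _ hq,
        Complex.cpow_one]
      grind
    · exact ⟨_, (represents_const 1).congr
        (.of_forall fun s => (tateL_of_not_isUnramified h _).symm)⟩
  have hE : ∃ R, Represents F (rightF ⊔ leftF) (tateEps ψ χ) R := by
    by_cases h : IsUnramified χ
    · exact ⟨_, (represents_const 1).congr (.of_forall fun s => (if_pos h).symm)⟩
    · obtain ⟨c, hc⟩ : ∃ c, charConductor χ = c + 1 := by
        refine Nat.exists_eq_succ_of_ne_zero fun h' => h ?_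
        exact isUnramified_iff_trivialMod_zero.2 (trivialMod_of_charConductor_le h'.le)
      refine ⟨_, ((represents_const ((volUnits F : ℂ) * 𝔮 ^ (c + 1 : ℤ) *
          ∫ a in {a : Fˣ | lv a = c + 1}, (χ⁻¹ a : ℂ) * (ψ (a : F) : ℂ) ∂haarFx F)).mul le_rfl
          (represents_X.pow le_rfl (c + 1))).congr (.of_forall fun s => ?_)⟩
      rw [tateEps_ramified h hc]; ring
  obtain ⟨R1, h1⟩ := hE
  obtain ⟨R2, h2⟩ := hL' χ⁻¹
  obtain ⟨R3, h3⟩ := hL χ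
  exact ⟨_, (h1.mul le_rfl h2).mul le_rfl (h3.inv le_rfl)⟩

/-- The functional equation of the Tate gamma factor. -/
theorem tateGamma_mul_tateGamma (hψ : HasOrderZero ψ) (χ : 𝓧) :
    ∀ᶠ s in rightF ⊔ leftF, tateGamma ψ ϖ χ s * tateGamma ψ ϖ χ⁻¹ (1 - s) = (χ (-1) : ℂ) := by
  have hq := qC_ne_zero F
  by_cases hur : IsUnramified χ
  · have hur' : IsUnramified χ⁻¹ := fun u hu => by rw [qc_inv, hur u hu, inv_one]
    have h1 : ∀ a : ℂ, a ≠ 0 → ∀ᶠ s in rightF ⊔ leftF, 1 - a * 𝔮 ^ (-s) ≠ 0 := by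
      intro a ha
      have hp : (Polynomial.C (-a) * Polynomial.X + Polynomial.C 1) ≠ 0 :=
        Polynomial.ne_zero_of_natDegree_gt (n := 0) (by
          rw [Polynomial.natDegree_linear (neg_ne_zero.2 ha)]; norm_num)
      filter_upwards [eventually_eval_ne_zero F le_rfl hp] with s hs
      simp only [Polynomial.eval_add, Polynomial.eval_mul, Polynomial.eval_C,
        Polynomial.eval_X] at hs
      grind
    have hχ := (χ ϖ).ne_zero
    filter_upwards [h1 _ hχ, h1 _ (mul_ne_zero hχ hq)] with s hs1 hs2
    have e2 : 1 - ((χ⁻¹ ϖ : ℂˣ) : ℂ) * 𝔮 ^ (-(1 - s)) ≠ 0 := by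
      intro h0
      apply hs2
      rw [qc_inv, val_inv_eq_inv_val, neg_sub, Complex.cpow_sub _ _ hq,
        Complex.cpow_one, sub_eq_zero] at h0
      rw [cpow_neg, sub_eq_zero]
      grind
    rw [tateGamma, tateGamma, tateEps, if_pos hur, tateEps, if_pos hur', qc_inv_inv,
      sub_sub_cancel, hur (-1) (by simp), tateL_of_isUnramified hur, tateL_of_isUnramified hur']
    rw [val_one]
    field_simp
  · refine .of_forall fun s => ?_
    obtain ⟨c, hc⟩ : ∃ c, charConductor χ = c + 1 := by
      refine Nat.exists_eq_succ_of_ne_zero fun h => hur ?_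
      exact isUnramified_iff_trivialMod_zero.2 (trivialMod_of_charConductor_le h.le)
    have hur' : ¬ IsUnramified χ⁻¹ := fun h => hur fun u hu => by
      have := h u hu
      rwa [qc_inv, inv_eq_one] at this
    have hc' : charConductor χ⁻¹ = c + 1 := by
      rw [← hc]
      unfold charConductor
      simp only [qc_inv, inv_eq_one]
    have h1 := gauss_mul_gauss hψ hc
    have h2 : ∫ a in {a : Fˣ | lv a = c + 1}, (χ⁻¹ a : ℂ) * (ψ (-(a : F)) : ℂ) ∂haarFx F =
        (χ (-1) : ℂ) * ∫ a in {a : Fˣ | lv a = c + 1}, (χ⁻¹ a : ℂ) * (ψ (a : F) : ℂ) ∂haarFx F := by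
      rw [← setIntegral_mul_left (E := ℂ) (-1) (fun a => (χ⁻¹ a : ℂ) * (ψ (a : F) : ℂ))
        (T := {a : Fˣ | lv a = c + 1}) (measurableSet_lv_eq _) (measurableSet_lv_eq _) (fun a => by
        simp only [mem_ofPred_eq, neg_one_mul, lv_neg]), ← integral_const_mul]
      refine integral_congr_ae (.of_forall fun a => ?_)
      have h3 : (χ (-1) : ℂ) * (χ⁻¹ (-1) : ℂ) = 1 := by
        rw [qc_inv, ← val_mul, mul_inv_cancel, val_one]
      change _ = (χ (-1) : ℂ) * ((χ⁻¹ (-1 * a) : ℂ) * (ψ ((-1 * a : Fˣ) : F) : ℂ))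
      rw [map_mul χ⁻¹, val_mul, neg_one_mul, Units.val_neg]
      grind
    have h3 : (χ (-1) : ℂ) * (χ (-1) : ℂ) = 1 := by
      rw [← val_mul, ← map_mul χ, neg_mul_neg, one_mul, map_one, val_one]
    have hX : 𝔮 ^ (-s) ≠ 0 := by simp_all
    have e : 𝔮 ^ (-(1 - s)) = (𝔮 ^ (-s))⁻¹ * 𝔮⁻¹ := by
      rw [neg_sub, Complex.cpow_sub _ _ hq, Complex.cpow_one, cpow_neg, inv_inv, div_eq_mul_inv]
    rw [tateGamma, tateGamma, tateL_of_not_isUnramified hur, tateL_of_not_isUnramified hur',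
      qc_inv_inv, tateL_of_not_isUnramified hur, div_one, mul_one, div_one, mul_one,
      tateEps_ramified hur hc, tateEps_ramified hur' hc', qc_inv_inv, e]
    rw [h2] at h1
    set A := ∫ a in {a : Fˣ | lv a = c + 1}, (χ a : ℂ) * (ψ (a : F) : ℂ) ∂haarFx F
    set B := ∫ a in {a : Fˣ | lv a = c + 1}, (χ⁻¹ a : ℂ) * (ψ (a : F) : ℂ) ∂haarFx F
    have h4 : ((𝔮 ^ (-s))⁻¹ * 𝔮⁻¹) ^ (c + 1) * (𝔮 ^ (-s)) ^ (c + 1) * 𝔮 ^ (c + 1 : ℤ) = 1 := by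
      have : 𝔮 ^ (c + 1 : ℤ) = 𝔮 ^ (c + 1) := by
        rw [← zpow_natCast]; norm_cast
      rw [this, ← mul_pow, ← mul_pow]
      field_simp
      simp
    grind

/-! ### Comparison of gamma factors of `GL₂` -/

theorem isGammaGL2_unique {𝒲 : Set (GL₂(F) → ℂ)} {ω χ : 𝓧} {R R' : RatFunc ℂ}
    (h : IsGammaGL2 𝒲 ω χ R) (h' : IsGammaGL2 𝒲 ω χ R')
    (hne : ∃ W ∈ 𝒲, ∃ᶠ s in rightF,
      ∫ a : Fˣ, W (tT a) * ((χ * absPow F (s - 1 / 2)) a : ℂ) ∂(haarFx F) ≠ 0) : R = R' := by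
  obtain ⟨W, hW, hne⟩ := hne
  obtain ⟨P, Q, h1, h2, h3⟩ := h W hW
  obtain ⟨P', Q', h1', h2', h3'⟩ := h' W hW
  rw [← eventually_rightF] at h2 h2'
  rw [← eventually_leftF] at h3 h3'
  have hP : P = P' := Represents.unique (F := F) (l := rightF) le_sup_left
    (h2.mono fun s hs => hs.2.symm) (h2'.mono fun s hs => hs.2.symm)
  have hQ : Q = Q' := Represents.unique (F := F) (l := leftF) le_sup_right
    (h3.mono fun s hs => hs.2.symm) (h3'.mono fun s hs => hs.2.symm)
  have hP0 : P ≠ 0 := by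
    rintro rfl
    refine hne (h2.mono fun s hs h0 => h0 ?_)
    rw [hs.2]; simp
  grind

theorem gammaGL2_eq {V : Type*} [AddCommGroup V] [Module ℂ V]
    {π : Representation ℂ (GL₂(F)) V} {ω χ : 𝓧} {R : RatFunc ℂ}
    (h : IsGammaGL2 (whittakerModel ψ π) ω χ R)
    (hne : ∃ W ∈ whittakerModel ψ π, ∃ᶠ s in rightF,
      ∫ a : Fˣ, W (tT a) * ((χ * absPow F (s - 1 / 2)) a : ℂ) ∂(haarFx F) ≠ 0) :
    gammaGL2 ψ π ω χ = evq F R := by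
  have := isGammaGL2_unique (Classical.epsilon_spec ⟨R, h⟩) h hne
  ext s
  rw [gammaGL2, this, evq]

variable (F) in
theorem meromorphic_evq (R : RatFunc ℂ) (c : ℂ) : Meromorphic fun s => evq F R (s + c) := by
  have hq := qC_ne_zero F
  have h1 : ∀ p : Polynomial ℂ, Differentiable ℂ fun s : ℂ => p.eval (𝔮 ^ (-(s + c))) :=
    fun p => p.differentiable.comp fun s =>
      ((differentiable_id.add_const c).neg s).const_cpow (Or.inl hq)
  have h2 : ∀ p : Polynomial ℂ, Meromorphic fun s : ℂ => p.eval (𝔮 ^ (-(s + c))) :=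
    fun p x => ((h1 p).analyticAt x).meromorphicAt
  simp only [evq, RatFunc.eval, Polynomial.eval₂_id]
  exact fun x => (h2 _ x).div (h2 _ x)

theorem meromorphic_tateGamma (χ : 𝓧) (c : ℂ) : Meromorphic fun s => tateGamma ψ ϖ χ (s + c) := by
  have hq := qC_ne_zero F
  have h0 : ∀ f : ℂ → ℂ, Differentiable ℂ f → Meromorphic f := fun f hf x =>
    (hf.analyticAt x).meromorphicAt
  have hp : ∀ g : ℂ → ℂ, Differentiable ℂ g → Differentiable ℂ fun s => 𝔮 ^ g s :=
    fun g hg s => (hg s).const_cpow (Or.inl hq)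
  have hL : ∀ (χ : 𝓧) (g : ℂ → ℂ), Differentiable ℂ g →
      Meromorphic fun s => tateL ϖ χ (g s) := fun χ g hg => by
    by_cases h : IsUnramified χ
    · simp only [tateL_of_isUnramified h]
      refine fun x => (h0 _ ?_ x).inv
      simp_all
    · simp only [tateL_of_not_isUnramified h]
      simp_all
  have hE : Meromorphic fun s => tateEps ψ χ (s + c) := by
    by_cases h : IsUnramified χ
    · simp only [tateEps, if_pos h]
      simp_all
    · obtain ⟨c, hc⟩ : ∃ c, charConductor χ = c + 1 := by
        refine Nat.exists_eq_succ_of_ne_zero fun h' => h ?_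
        exact isUnramified_iff_trivialMod_zero.2 (trivialMod_of_charConductor_le h'.le)
      simp only [tateEps_ramified h hc]
      refine h0 _ ?_
      refine ((Differentiable.mul (differentiable_const _) ?_).mul (differentiable_const _)).mul
        (differentiable_const _)
      exact (hp _ (by fun_prop)).pow _
  exact fun x => ((hE x).mul (hL _ (fun s => 1 - (s + c)) (by fun_prop) x)).div
    (hL _ (fun s => s + c) (by fun_prop) x)

end Rational

section Asymptotic

/-! ### Fourier transforms of asymptotically homogeneous functions -/

/-- `h` is invariant under the ball of radius `q^m`, and equal to `κ η` outside the ball of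
radius `q^N`. -/
structure Asymp (h : F → ℂ) (η : 𝓧) (κ : ℂ) (m N : ℤ) : Prop where
  inv : ∀ x, ∀ t ∈ ball F m, h (x + t) = h x
  asymp : ∀ u : Fˣ, N < lv u → h u = κ * (η u : ℂ)

theorem Asymp.continuous {h : F → ℂ} {η : 𝓧} {κ : ℂ} {m N : ℤ} (hh : Asymp h η κ m N) :
    Continuous h := continuous_of_inv hh.inv

theorem BallFun.asymp {h : F → ℂ} {k m : ℤ} (hh : BallFun h k m) (η : 𝓧) : Asymp h η 0 m k :=
  ⟨hh.inv, fun u hu => by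
    rw [zero_mul]; exact hh.supp u (by rw [units_mem_ball]; omega)⟩

/-- The Fourier transform with a cutoff. -/
def ballFT (ψ : AddChar F Circle) (h : F → ℂ) (M : ℤ) (a : F) : ℂ :=
  ∫ y in (ball F M : Set F), h y * (ψ (-(a * y)) : ℂ) ∂haarF F

/-- The regularized Fourier transform. -/
def limFT (ψ : AddChar F Circle) (h : F → ℂ) (a : F) : ℂ :=
  limUnder atTop fun M : ℕ => ballFT ψ h M a

theorem ballFT_units (h : F → ℂ) (M : ℤ) (a : F) : ballFT ψ h M a = (volUnits F : ℂ) *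
      ∫ y in {y : Fˣ | lv y ≤ M}, h y * ((‖(y : F)‖ : ℝ) : ℂ) * (ψ (-(a * y)) : ℂ) ∂haarFx F := by
  rw [ballFT, ← integral_indicator (measurableSet_ball M), integral_haarF, real_smul,
    ← integral_indicator (measurableSet_lv_le M)]
  congr 1
  refine integral_congr_ae (.of_forall fun y => ?_)
  by_cases hy : lv y ≤ M
  · simp only [indicator_of_mem (show y ∈ {y : Fˣ | lv y ≤ M} from hy),
      indicator_of_mem (show (y : F) ∈ (ball F M : Set F) from units_mem_ball.2 hy),
      real_smul]
    ring
  · simp only [indicator_of_notMem (show y ∉ {y : Fˣ | lv y ≤ M} from hy),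
      indicator_of_notMem (show (y : F) ∉ (ball F M : Set F) from mt units_mem_ball.1 hy),
      smul_zero]

theorem ballFT_eq_zero (hψ : HasOrderZero ψ) {h : F → ℂ} {m M : ℤ}
    (hinv : ∀ x, ∀ t ∈ ball F m, h (x + t) = h x) (hmM : m ≤ M) {a : F} (ha : a ∉ ball F (-m)) :
    ballFT ψ h M a = 0 := by
  obtain ⟨t, ht, ht1⟩ := hψ.exists_mul_ne_one ha
  rw [ballFT, ← integral_indicator (measurableSet_ball M)]
  refine integral_eq_zero_of_add t (c := (ψ (-(t * a)) : ℂ)) ?_ fun x => ?_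
  · rw [psi_neg]; grind
  · by_cases hx : x ∈ ball F M
    · rw [indicator_of_mem (show x ∈ (ball F M : Set F) from hx), indicator_of_mem
        (show x + t ∈ (ball F M : Set F) from (ball F M).add_mem hx (ball_mono hmM ht)),
        hinv x t ht, mul_add, neg_add, psi_add, mul_comm a t]
      ring
    · rw [indicator_of_notMem (show x ∉ (ball F M : Set F) from hx), indicator_of_notMem, mul_zero]
      intro hxt
      apply hx
      have := (ball F M).sub_mem hxt (ball_mono hmM ht)
      simp_all

theorem integrableOn_lv_Ioc {f : Fˣ → ℂ} (hf : Continuous f) (M N : ℤ) :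
    IntegrableOn f {a : Fˣ | lv a ∈ Set.Ioc M N} (haarFx F) := by
  have : {a : Fˣ | lv a ∈ Set.Ioc M N} = ⋃ k ∈ Finset.Ioc M N, {a : Fˣ | lv a = k} := by
    ext a; simp
  rw [this, integrableOn_finset_iUnion]
  exact fun k _ => integrableOn_shell hf k

theorem Asymp.ballFT_stable (hψ : HasOrderZero ψ) {h : F → ℂ} {η : 𝓧} {κ : ℂ} {m N : ℤ}
    (hh : Asymp h η κ m N) {n : ℕ} (hn : 1 ≤ n) (hη : TrivialMod η n) (a : Fˣ) {M M' : ℤ}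
    (hN : N ≤ M) (hM : n - lv a ≤ M) (hMM : M ≤ M') : ballFT ψ h M' a = ballFT ψ h M a := by
  have hint : IntegrableOn (fun y : F => h y * (ψ (-((a : F) * y)) : ℂ)) (ball F M') (haarF F) :=
    (hh.continuous.mul (hψ.continuous.comp (by fun_prop))).continuousOn.integrableOn_compact
      (isCompact_ball M')
  rw [← sub_eq_zero, ballFT, ballFT, ← setIntegral_sdiff (measurableSet_ball M) hint (ball_mono hMM),
    ← integral_indicator ((measurableSet_ball M').diff (measurableSet_ball M)), integral_haarF]
  have h1 := integral_char_psi_above hψ hn (hη.mul (.absPow 1 n)) (-a) (S := Set.Ioc M M')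
    fun k hk => by rw [lv_neg]; grind
  rw [← integral_indicator (measurableSet_lv _)] at h1
  refine smul_eq_zero_of_right _ ?_
  rw [← mul_zero κ, ← h1, ← integral_const_mul]
  refine integral_congr_ae (.of_forall fun y => ?_)
  by_cases hy : lv y ∈ Set.Ioc M M'
  · have h2 : (y : F) ∈ (ball F M' : Set F) \ ball F M :=
      ⟨units_mem_ball.2 hy.2, fun h3 => absurd (units_mem_ball.1 h3) (not_le.2 hy.1)⟩
    simp only [indicator_of_mem (show y ∈ {y : Fˣ | lv y ∈ Set.Ioc M M'} from hy),
      indicator_of_mem h2, real_smul]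
    rw [hh.asymp y (hN.trans_lt hy.1), mul_apply, val_mul, absPow_one_apply, Units.val_neg, neg_mul]
    ring
  · have h2 : (y : F) ∉ (ball F M' : Set F) \ ball F M := fun h3 =>
      hy ⟨not_le.1 fun h4 => h3.2 (units_mem_ball.2 h4), units_mem_ball.1 h3.1⟩
    simp_all

theorem Asymp.limFT_eq (hψ : HasOrderZero ψ) {h : F → ℂ} {η : 𝓧} {κ : ℂ} {m N : ℤ}
    (hh : Asymp h η κ m N) {n : ℕ} (hn : 1 ≤ n) (hη : TrivialMod η n) (a : Fˣ) {M : ℤ}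
    (hN : N ≤ M) (hM : n - lv a ≤ M) : limFT ψ h a = ballFT ψ h M a := by
  refine Tendsto.limUnder_eq (tendsto_const_nhds.congr' ?_)
  filter_upwards [eventually_ge_atTop M.toNat] with k hk
  exact (hh.ballFT_stable hψ hn hη a hN hM (by omega)).symm

theorem BallFun.limFT_eq {h : F → ℂ} {k m : ℤ} (hh : BallFun h k m) (a : F) :
    limFT ψ h a = Garrett.fourier ψ h (-a) := by
  refine Tendsto.limUnder_eq (tendsto_const_nhds.congr' ?_)
  filter_upwards [eventually_ge_atTop k.toNat] with M hM
  rw [ballFT, Garrett.fourier]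
  have e : ∀ z, h z * (ψ (z * -a) : ℂ) = h z * (ψ (-(a * z)) : ℂ) := fun z => by
    rw [mul_neg, mul_comm z]
  simp only [e]
  symm
  refine setIntegral_eq_integral_of_forall_compl_eq_zero fun x hx => ?_
  rw [hh.supp x fun h' => hx (ball_mono (by omega) h'), zero_mul]

theorem integrableOn_char_mul' {χ : 𝓧} (hχ : 1 < absAt χ) (N : ℤ) {g : Fˣ → ℂ}
    (hg : Measurable g) {C : ℝ} (hC : ∀ a, ‖g a‖ ≤ C) :
    IntegrableOn (fun a : Fˣ => (χ a : ℂ) * g a) {a : Fˣ | N ≤ lv a} (haarFx F) := by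
  have h1 := integrableOn_char_mul (χ := χ⁻¹) (by rw [absAt_inv]; exact inv_lt_one_of_one_lt₀ hχ)
    (-N) (hg.comp measurable_inv) (C := C) fun a => hC _
  rw [← integrable_indicator_iff (measurableSet_lv_le _)] at h1
  rw [← integrable_indicator_iff
    (show MeasurableSet {a : Fˣ | N ≤ lv a} from measurableSet_lv (Set.Ici N))]
  refine h1.comp_inv.congr (.of_forall fun a => ?_)
  have e : a⁻¹ ∈ {a : Fˣ | lv a ≤ -N} ↔ a ∈ {a : Fˣ | N ≤ lv a} := by
    simp only [mem_ofPred_eq, lv_inv]; omega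
  change Set.indicator {a : Fˣ | lv a ≤ -N} (fun a => (χ⁻¹ a : ℂ) * (g ∘ Inv.inv) a) a⁻¹ = _
  by_cases ha : a ∈ {a : Fˣ | N ≤ lv a}
  · rw [indicator_of_mem ha, indicator_of_mem (e.2 ha), Function.comp, inv_inv,
      qc_inv, map_inv, inv_inv]
  simp_all

theorem Asymp.integrable_mellin {h : F → ℂ} {η : 𝓧} {κ : ℂ} {m N : ℤ}
    (hh : Asymp h η κ m N) (h0 : h 0 = 0) {θ : 𝓧}
    (hη : κ = 0 ∨ 1 < absAt (η * θ)) : Integrable (fun y : Fˣ => h y * (θ y : ℂ)) (haarFx F) := by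
  have hc : Continuous fun y : Fˣ => h y * (θ y : ℂ) :=
    (hh.continuous.comp Units.continuous_val).mul (continuous_quasiChar θ)
  have hA : IntegrableOn (fun y : Fˣ => h y * (θ y : ℂ)) {y | lv y ≤ m} (haarFx F) := by
    refine integrableOn_zero.congr_fun (fun y hy => ?_) (measurableSet_lv_le m)
    have := hh.inv 0 y (units_mem_ball.2 hy)
    simp_all
  have hC : IntegrableOn (fun y : Fˣ => h y * (θ y : ℂ)) {y | N + 1 ≤ lv y} (haarFx F) := by
    have hm : MeasurableSet {y : Fˣ | N + 1 ≤ lv y} := measurableSet_lv (Set.Ici (N + 1))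
    have e : Set.EqOn (fun y : Fˣ => κ * ((η * θ) y : ℂ)) (fun y : Fˣ => h y * (θ y : ℂ))
        {y | N + 1 ≤ lv y} := fun y hy => by
      change κ * ((η * θ) y : ℂ) = h y * (θ y : ℂ)
      rw [hh.asymp y (by grind), mul_apply, val_mul, mul_assoc]
    refine IntegrableOn.congr_fun ?_ e hm
    rcases hη with rfl | hη
    · simp
    · have := integrableOn_char_mul' hη (N + 1) (g := fun _ => κ) measurable_const (C := ‖κ‖)
        fun _ => le_rfl
      simpa only [mul_comm] using this
  have hB := integrableOn_lv_Ioc hc m N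
  rw [← integrableOn_univ]
  refine ((hA.union hB).union hC).mono_set fun y _ => ?_
  grind

/-- The Mellin transform of the regularized Fourier transform. -/
theorem Asymp.mellin_limFT (hψ : HasOrderZero ψ) (hϖ : IsUniformizer (ϖ : F)) {h : F → ℂ}
    {η : 𝓧} {κ : ℂ} {m N : ℤ} (hh : Asymp h η κ m N) (h0 : h 0 = 0) {θ : 𝓧}
    (hθ : absAt θ < 1) (hη : κ = 0 ∨ 1 < absAt (η * (absPow F 1 * θ⁻¹))) :
    Integrable (fun a : Fˣ => limFT ψ h a * (θ a : ℂ)) (haarFx F) ∧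
    ∫ a : Fˣ, limFT ψ h a * (θ a : ℂ) ∂haarFx F =
      (tateGamma ψ ϖ θ 0)⁻¹ * ∫ y : Fˣ, h y * ((absPow F 1 * θ⁻¹) y : ℂ) ∂haarFx F := by
  have hv : (volUnits F : ℂ) ≠ 0 := by exact_mod_cast (volUnits_pos F).ne'
  obtain ⟨n1, hn1, hT1⟩ := exists_trivialMod η
  obtain ⟨n2, hn2, hT2⟩ := exists_trivialMod θ
  set n := n1 + n2 with hn
  have hTη := hT1.mono (show n1 ≤ n by omega)
  have hTθ := hT2.mono (show n2 ≤ n by omega)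
  obtain ⟨K, hK1, hK2⟩ : ∃ K : ℕ, n ≤ K ∧ N - m ≤ K := ⟨n + (N - m).toNat, by omega, by omega⟩
  have hKθ := hTθ.mono hK1
  set f : Fˣ → ℂ := fun y => h y * ((absPow F 1 * θ⁻¹) y : ℂ) with hf
  have hfi : Integrable f (haarFx F) := hh.integrable_mellin h0 hη
  set g : Fˣ → ℂ := {a : Fˣ | lv a ≤ K}.indicator fun a => (θ a : ℂ) * (ψ (-(a : F)) : ℂ) with hg
  have hgi : Integrable g (haarFx F) := by
    rw [hg, integrable_indicator_iff (measurableSet_lv_le _)]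
    have := integrableOn_char_psi hψ hθ (-1) K
    simp_all
  have hfg := (measurePreserving_prod_mul (haarFx F) (haarFx F)).integrable_comp_of_integrable
    (hfi.mul_prod hgi)
  have hFT : ∀ a : Fˣ, ∫ y : Fˣ, f y * g (y * a) ∂haarFx F =
      (volUnits F : ℂ)⁻¹ * (limFT ψ h a * (θ a : ℂ)) := by
    intro a
    have h1 : limFT ψ h a = ballFT ψ h (K - lv a) a := by
      by_cases ha : lv a ≤ -m
      · exact hh.limFT_eq hψ (by omega) hTη a (by omega) (by omega)
      · have ha' : (a : F) ∉ ball F (-m) := mt units_mem_ball.1 ha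
        rw [hh.limFT_eq hψ (by omega) hTη a (M := max (max N m) (n - lv a)) (by omega) (by omega),
          ballFT_eq_zero hψ hh.inv (by omega) ha']
        by_cases hKm : m ≤ K - lv a
        · rw [ballFT_eq_zero hψ hh.inv hKm ha']
        · rw [ballFT, setIntegral_eq_zero_of_forall_eq_zero]
          intro x hx
          have := hh.inv 0 x (ball_mono (by omega) hx)
          simp_all
    rw [h1, ballFT_units, mul_assoc, inv_mul_cancel_left₀ hv, ← integral_mul_const,
      ← integral_indicator (measurableSet_lv_le _)]
    refine integral_congr_ae (.of_forall fun y => ?_)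
    have e : y * a ∈ {a : Fˣ | lv a ≤ K} ↔ y ∈ {y : Fˣ | lv y ≤ K - lv a} := by
      simp only [mem_ofPred_eq, lv_mul]; omega
    by_cases hy : y ∈ {y : Fˣ | lv y ≤ K - lv a}
    · simp only [hf, hg, indicator_of_mem hy, indicator_of_mem (e.2 hy)]
      rw [mul_apply, val_mul, absPow_one_apply, qc_inv,
        map_mul θ, val_inv_eq_inv_val, val_mul, val_mul, mul_comm (y : F)]
      field_simp [(θ y).ne_zero]
    simp_all
  constructor
  · have h1 := hfg.integral_prod_right
    have h2 := h1.const_mul (volUnits F : ℂ)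
    grind
  · have h1 := integral_integral_swap (f := fun y a : Fˣ => f y * g (y * a)) hfg
    simp only [hFT, integral_const_mul] at h1
    have h2 : ∀ y, ∫ a, g (y * a) ∂haarFx F = ∫ a, g a ∂haarFx F := fun y =>
      integral_mul_left_eq_self g y
    simp only [h2, integral_mul_const] at h1
    have h3 : ∫ a, g a ∂haarFx F = (volUnits F : ℂ)⁻¹ * (tateGamma ψ ϖ θ 0)⁻¹ := by
      rw [hg, integral_indicator (measurableSet_lv_le _)]
      exact gauss_integral hψ hϖ hθ (by omega) hKθ
    grind

end Asymptotic

section GL2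

/-! ### Matrix identities in `GL₂` -/

theorem gl2_ext {g h : GL₂(F)} (h00 : g 0 0 = h 0 0) (h01 : g 0 1 = h 0 1)
    (h10 : g 1 0 = h 1 0) (h11 : g 1 1 = h 1 1) : g = h := by
  ext i j
  fin_cases i <;> fin_cases j <;> assumption

theorem gl2_mul (g h : GL₂(F)) (i j : Fin 2) : (g * h) i j = g i 0 * h 0 j + g i 1 * h 1 j := by
  rw [Matrix.GeneralLinearGroup.coe_mul, Matrix.mul_apply, Fin.sum_univ_two]

@[simp] theorem borel_00 (a d : Fˣ) (b : F) : borel a d b 0 0 = a := rfl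
@[simp] theorem borel_01 (a d : Fˣ) (b : F) : borel a d b 0 1 = b := rfl
@[simp] theorem borel_10 (a d : Fˣ) (b : F) : borel a d b 1 0 = 0 := rfl
@[simp] theorem borel_11 (a d : Fˣ) (b : F) : borel a d b 1 1 = d := rfl
@[simp] theorem nL_00 (u : F) : nL u 0 0 = 1 := rfl
@[simp] theorem nL_01 (u : F) : nL u 0 1 = 0 := rfl
@[simp] theorem nL_10 (u : F) : nL u 1 0 = u := rfl
@[simp] theorem nL_11 (u : F) : nL u 1 1 = 1 := rfl
@[simp] theorem J1_00 : J1 F 0 0 = 0 := rfl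
@[simp] theorem J1_01 : J1 F 0 1 = -1 := rfl
@[simp] theorem J1_10 : J1 F 1 0 = 1 := rfl
@[simp] theorem J1_11 : J1 F 1 1 = 0 := rfl

theorem J1_inv : (J1 F)⁻¹ = borel (-1) (-1) 0 * J1 F := by
  rw [eq_comm, ← mul_eq_one_iff_eq_inv]
  apply gl2_ext <;> simp [gl2_mul]

@[simp] theorem J1_inv_00 : (J1 F)⁻¹ 0 0 = 0 := by simp [J1_inv, gl2_mul]
@[simp] theorem J1_inv_01 : (J1 F)⁻¹ 0 1 = 1 := by simp [J1_inv, gl2_mul]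
@[simp] theorem J1_inv_10 : (J1 F)⁻¹ 1 0 = -1 := by simp [J1_inv, gl2_mul]
@[simp] theorem J1_inv_11 : (J1 F)⁻¹ 1 1 = 0 := by simp [J1_inv, gl2_mul]

theorem borel_mul (a d a' d' : Fˣ) (b b' : F) :
    borel a d b * borel a' d' b' = borel (a * a') (d * d') (a * b' + b * d') := by
  apply gl2_ext <;> simp [gl2_mul]

theorem nU_add (x y : F) : nU (x + y) = nU x * nU y := by simp [nU, borel_mul, add_comm]

theorem nU_zero : nU (0 : F) = 1 := by apply gl2_ext <;> simp [nU]

theorem bruhat {g : GL₂(F)} {c : Fˣ} (hc : g 1 0 = c) :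
    g = borel (GeneralLinearGroup.det g * c⁻¹) c (g 0 0) *
      (J1 F * nU (g 1 1 * ((c⁻¹ : Fˣ) : F))) := by
  have hd : (GeneralLinearGroup.det g : F) = g 0 0 * g 1 1 - g 0 1 * g 1 0 := by
    rw [GeneralLinearGroup.val_det_apply, Matrix.det_fin_two]
  apply gl2_ext <;> simp [gl2_mul, nU, hd, hc]
  · field_simp; ring
  · field_simp

theorem eq_borel {g : GL₂(F)} (hc : g 1 0 = 0) : ∃ a d : Fˣ, g = borel a d (g 0 1) := by
  have hd : (GeneralLinearGroup.det g : F) = g 0 0 * g 1 1 := by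
    rw [GeneralLinearGroup.val_det_apply, Matrix.det_fin_two, hc, mul_zero, sub_zero]
  have h0 : g 0 0 * g 1 1 ≠ 0 := hd ▸ Units.ne_zero _
  exact ⟨mk0 _ (left_ne_zero_of_mul h0), mk0 _ (right_ne_zero_of_mul h0), gl2_ext rfl rfl hc rfl⟩

theorem J1_mul_nU_units (u : Fˣ) : J1 F * nU (u : F) = borel u⁻¹ u (-1) * nL ((u⁻¹ : Fˣ) : F) := by
  apply gl2_ext <;> simp [gl2_mul, nU]

theorem J1_mul_nU_mul_borel (x : F) (a d : Fˣ) (b : F) :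
    J1 F * nU x * borel a d b = borel d a 0 * (J1 F * nU ((b + x * d) * ((a⁻¹ : Fˣ) : F))) := by
  apply gl2_ext <;> simp [gl2_mul, nU]
  field_simp

theorem J1_mul_nU_mul_J1_inv (x : F) : J1 F * nU x * (J1 F)⁻¹ = nL (-x) := by
  apply gl2_ext <;> simp [gl2_mul, nU]

theorem J1_mul_nU_mul_J1_inv_units (u : Fˣ) : J1 F * nU (u : F) * (J1 F)⁻¹ =
    borel (-u)⁻¹ (-u) 1 * (J1 F * nU (((-u)⁻¹ : Fˣ) : F)) := by
  rw [J1_mul_nU_mul_J1_inv]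
  apply gl2_ext <;> simp [gl2_mul, nU]

theorem continuous_nU : Continuous (nU : F → GL₂(F)) := by
  rw [Units.continuous_iff]
  have h : ∀ x : F, ((nU x)⁻¹ : GL₂(F)) = nU (-x) := fun x => by
    rw [inv_eq_iff_mul_eq_one, ← nU_add, add_neg_cancel, nU_zero]
  constructor
  · change Continuous fun x : F => (!![(1 : F), x; 0, 1] : M₂(F))
    exact continuous_matrix fun i j => by fin_cases i <;> fin_cases j <;> simp <;> fun_prop
  · change Continuous fun x : F => (((nU x)⁻¹ : GL₂(F)) : M₂(F))
    simp only [h]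
    change Continuous fun x : F => (!![(1 : F), -x; 0, 1] : M₂(F))
    exact continuous_matrix fun i j => by fin_cases i <;> fin_cases j <;> simp <;> fun_prop

theorem continuous_nL : Continuous (nL : F → GL₂(F)) := by
  have h : (nL : F → GL₂(F)) = fun x => J1 F * nU (-x) * (J1 F)⁻¹ := by
    ext1 x; rw [J1_mul_nU_mul_J1_inv, neg_neg]
  rw [h]
  exact (continuous_const.mul (continuous_nU.comp continuous_neg)).mul continuous_const

/-! ### The principal series -/

/-- `μ |·|^{1/2}`. -/
def upHalf (μ : 𝓧) : 𝓧 := μ * absPow F (1 / 2)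

/-- `ν |·|^{-1/2}`. -/
def downHalf (ν : 𝓧) : 𝓧 := ν * absPow F (-(1 / 2))

/-- The restriction of a function on `GL₂(F)` to the big cell. -/
def bigCell (φ : GL₂(F) → ℂ) (x : F) : ℂ := φ (J1 F * nU x)

variable {μ ν : QuasiChar F} {φ φ' : GL₂(F) → ℂ}

theorem halves_apply (μ ν : 𝓧) (a d : Fˣ) : (μ a : ℂ) * (ν d : ℂ) *
    ((‖(a : F) / (d : F)‖ ^ (1 / 2 : ℝ) : ℝ) : ℂ) = (upHalf μ a : ℂ) * (downHalf ν d : ℂ) := by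
  rw [upHalf, downHalf, mul_apply, mul_apply, val_mul, val_mul, absPow_half_apply]
  have h : ((absPow F (-(1 / 2)) d : ℂˣ) : ℂ) = (((‖(d : F)‖ ^ (1 / 2 : ℝ) : ℝ) : ℂ))⁻¹ := by
    rw [← absPow_half_apply, absPow_apply, absPow_apply, cpow_neg]
  rw [h, norm_div, Real.div_rpow (norm_nonneg _) (norm_nonneg _)]
  push_cast
  ring

variable (μ ν) in
/-- The space of the principal series. -/
abbrev psMod : Submodule ℂ (GL₂(F) → ℂ) := (principalSeries μ ν).toSubmodule

theorem mem_ps_iff : φ ∈ psMod μ ν ↔ IsSmooth φ ∧ ∀ (a d : Fˣ) (b : F) (g : GL₂(F)),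
      φ (borel a d b * g) = (upHalf μ a : ℂ) * (downHalf ν d : ℂ) * φ g := by
  simp only [← halves_apply]
  rfl

theorem ps_apply (h : φ ∈ psMod μ ν) (a d : Fˣ) (b : F)
    (g : GL₂(F)) : φ (borel a d b * g) = (upHalf μ a : ℂ) * (downHalf ν d : ℂ) * φ g :=
  (mem_ps_iff.1 h).2 a d b g

theorem ps_ext (h : φ ∈ psMod μ ν) (h' : φ' ∈ psMod μ ν) (h1 : φ 1 = φ' 1)
    (h2 : ∀ x, bigCell φ x = bigCell φ' x) : φ = φ' := by
  ext g
  by_cases hc : g 1 0 = 0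
  · obtain ⟨a, d, e⟩ := eq_borel hc
    rw [e, ← mul_one (borel _ _ _), ps_apply h, ps_apply h', h1]
  · rw [bruhat (c := mk0 _ hc) rfl, ps_apply h, ps_apply h']
    exact congrArg _ (h2 _)

theorem ps_translate (h : φ ∈ psMod μ ν) (g : GL₂(F)) : rightReg _ g φ ∈ psMod μ ν :=
  (principalSeries μ ν).apply_mem_toSubmodule g h

theorem rightReg_apply {G : Type*} [Group G] (g x : G) (f : G → ℂ) : rightReg G g f x = f (x * g) :=
  rfl

theorem rightReg_mul {G : Type*} [Group G] (g h : G) (f : G → ℂ) :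
    rightReg G (g * h) f = rightReg G g (rightReg G h f) := by simp

theorem bigCell_nU (x y : F) : bigCell (rightReg _ (nU x) φ) y = bigCell φ (y + x) := by
  rw [bigCell, bigCell, rightReg_apply, nU_add, mul_assoc]

theorem bigCell_borel (h : φ ∈ psMod μ ν) (a d : Fˣ) (b y : F) :
    bigCell (rightReg _ (borel a d b) φ) y = (upHalf μ d : ℂ) * (downHalf ν a : ℂ) *
      bigCell φ ((b + y * d) * ((a⁻¹ : Fˣ) : F)) := by
  rw [bigCell, rightReg_apply, J1_mul_nU_mul_borel, ps_apply h, bigCell]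

/-- The quasi-character by which functions in `I(μ, ν)` grow on the big cell. -/
def etaChar (μ ν : 𝓧) : 𝓧 := (upHalf μ)⁻¹ * downHalf ν

theorem bigCell_J1_inv (h : φ ∈ psMod μ ν) (u : Fˣ) : bigCell (rightReg _ (J1 F)⁻¹ φ) u =
      (upHalf μ (-1) : ℂ) * (downHalf ν (-1) : ℂ) * (etaChar μ ν u : ℂ) *
        bigCell φ (((-u)⁻¹ : Fˣ) : F) := by
  have e : -u = -1 * u := by simp
  rw [bigCell, rightReg_apply, J1_mul_nU_mul_J1_inv_units, ps_apply h, bigCell, etaChar,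
    mul_apply, qc_inv, map_inv, e, map_mul (upHalf μ),
    map_mul (downHalf ν)]
  have h1 : ((upHalf μ (-1))⁻¹ : ℂˣ) = upHalf μ (-1) := by
    rw [inv_eq_iff_mul_eq_one, ← map_mul]; simp
  rw [mul_inv, h1]
  push_cast
  ring

theorem bigCell_J1_inv_zero : bigCell (rightReg _ (J1 F)⁻¹ φ) 0 = φ 1 := by
  rw [bigCell, rightReg_apply, nU_zero, mul_one, mul_inv_cancel]

theorem J1_inv_at_one (h : φ ∈ psMod μ ν) :
    rightReg _ (J1 F)⁻¹ φ 1 = (upHalf μ (-1) : ℂ) * (downHalf ν (-1) : ℂ) * bigCell φ 0 := by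
  rw [rightReg_apply, one_mul, J1_inv, ps_apply h, bigCell, nU_zero, mul_one]

theorem upHalf_mul_downHalf_neg_one (μ ν : 𝓧) :
    (upHalf μ (-1) : ℂ) * (downHalf ν (-1) : ℂ) = ((μ * ν) (-1) : ℂ) := by
  have h := halves_apply μ ν (-1) (-1)
  simp_all

/-- Uniform asymptotics of the functions in `I(μ, ν)` fixed by an open subgroup. -/
theorem exists_asymp (μ ν : 𝓧) {U : Subgroup (GL₂(F))}
    (hU : IsOpen (U : Set (GL₂(F)))) : ∃ m N : ℤ, m ≤ N ∧ ∀ φ ∈ psMod μ ν,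
      (∀ k ∈ U, ∀ g, φ (g * k) = φ g) → Asymp (bigCell φ) (etaChar μ ν) (φ 1) m N := by
  have h1 : nU ⁻¹' (U : Set (GL₂(F))) ∈ 𝓝 (0 : F) :=
    (hU.preimage continuous_nU).mem_nhds (by simp [nU_zero, U.one_mem])
  have h2 : nL ⁻¹' (U : Set (GL₂(F))) ∈ 𝓝 (0 : F) := (hU.preimage continuous_nL).mem_nhds (by
      have : nL (0 : F) = 1 := by apply gl2_ext <;> simp
      simp_all)
  obtain ⟨m, hm⟩ := exists_ball_subset h1
  obtain ⟨N, hN⟩ := exists_ball_subset h2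
  refine ⟨-m, N, by omega, fun φ hφ hk => ⟨fun x t ht => ?_, fun u hu => ?_⟩⟩
  · rw [bigCell, nU_add, ← mul_assoc, hk _ (hm t ht), bigCell]
  · rw [bigCell, J1_mul_nU_units, ps_apply hφ]
    have := hk _ (hN ((u⁻¹ : Fˣ) : F) (units_mem_ball.2 (by rw [lv_inv]; omega))) 1
    rw [one_mul] at this
    rw [this, etaChar, mul_apply, qc_inv, val_mul, map_inv]
    ring

theorem ps_asymp (h : φ ∈ psMod μ ν) :
    ∃ m N : ℤ, m ≤ N ∧ Asymp (bigCell φ) (etaChar μ ν) (φ 1) m N := by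
  obtain ⟨U, hU, hk⟩ := (mem_ps_iff.1 h).1
  obtain ⟨m, N, hmN, h1⟩ := exists_asymp μ ν hU
  grind

/-! ### The ordinary vector of the principal series -/

open Classical in
/-- The function in `I(μ, ν)` whose restriction to the big cell is the characteristic function
of the ring of integers. -/
def psOrd (μ ν : 𝓧) (g : GL₂(F)) : ℂ := if h : g 1 0 ≠ 0 then
    if ‖g 1 1‖ ≤ ‖g 1 0‖ then
      (upHalf μ (GeneralLinearGroup.det g * (mk0 _ h)⁻¹) : ℂ) * (downHalf ν (mk0 _ h) : ℂ)
    else 0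
  else 0

theorem psOrd_of_eq (μ ν : 𝓧) {g : GL₂(F)} {c : Fˣ} (hc : g 1 0 = c) :
    psOrd μ ν g = if ‖g 1 1‖ ≤ ‖(c : F)‖ then
      (upHalf μ (GeneralLinearGroup.det g * c⁻¹) : ℂ) * (downHalf ν c : ℂ) else 0 := by
  have h : g 1 0 ≠ 0 := by simp_all
  have e : mk0 _ h = c := Units.ext hc
  rw [psOrd, dif_pos h, e, hc]

theorem psOrd_of_eq_zero (μ ν : 𝓧) {g : GL₂(F)} (hc : g 1 0 = 0) :
    psOrd μ ν g = 0 := by rw [psOrd, dif_neg (by grind)]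

theorem det_borel (a d : Fˣ) (b : F) : GeneralLinearGroup.det (borel a d b) = a * d :=
  Units.ext (by rw [GeneralLinearGroup.val_det_apply, Matrix.det_fin_two]; simp)

theorem det_J1 : GeneralLinearGroup.det (J1 F) = 1 :=
  Units.ext (by rw [GeneralLinearGroup.val_det_apply, Matrix.det_fin_two]; simp)

theorem psOrd_borel (μ ν : 𝓧) (a d : Fˣ) (b : F) (g : GL₂(F)) :
    psOrd μ ν (borel a d b * g) = (upHalf μ a : ℂ) * (downHalf ν d : ℂ) * psOrd μ ν g := by
  have h1 : ∀ j, (borel a d b * g) 1 j = d * g 1 j := fun j => by rw [gl2_mul]; simp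
  by_cases hc : g 1 0 = 0
  · rw [psOrd_of_eq_zero _ _ hc, psOrd_of_eq_zero _ _ (by grind), mul_zero]
  · have hc' : g 1 0 = (mk0 _ hc : Fˣ) := rfl
    generalize mk0 _ hc = c at hc'
    have hle : ‖(borel a d b * g) 1 1‖ ≤ ‖((d * c : Fˣ) : F)‖ ↔ ‖g 1 1‖ ≤ ‖(c : F)‖ := by simp_all
    rw [psOrd_of_eq _ _ hc', psOrd_of_eq _ _ (c := d * c) (by simp_all),
      map_mul GeneralLinearGroup.det, det_borel, if_congr hle rfl rfl]
    split_ifs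
    · have e : a * d * GeneralLinearGroup.det g * (d * c)⁻¹ =
          a * (GeneralLinearGroup.det g * c⁻¹) := by
        rw [mul_inv, mul_comm a, mul_assoc d, mul_mul_mul_comm d, mul_inv_cancel, one_mul,
            mul_assoc]
      rw [e, map_mul (upHalf μ), map_mul (downHalf ν)]
      push_cast
      ring
    simp

theorem bigCell_psOrd (μ ν : 𝓧) :
    bigCell (psOrd μ ν) = (ball F 0 : Set F).indicator fun _ => 1 := by
  ext x
  have h1 : (J1 F * nU x) 1 0 = (1 : Fˣ) := by simp [gl2_mul, nU]
  have h2 : (J1 F * nU x) 1 1 = x := by simp [gl2_mul, nU]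
  rw [bigCell, psOrd_of_eq _ _ h1, h2, map_mul GeneralLinearGroup.det, det_J1, nU, det_borel]
  by_cases hx : x ∈ ball F 0
  · rw [indicator_of_mem (show x ∈ (ball F 0 : Set F) from hx),
      if_pos (by simpa [mem_ball] using hx)]
    simp
  · rw [indicator_of_notMem (show x ∉ (ball F 0 : Set F) from hx),
      if_neg (by simpa [mem_ball] using hx)]

/-- Matrices `k` for which right translation by `k` and by its inverse does not shrink the support
of the ordinary vector. -/
structure NearIwahori (n : ℕ) (k : GL₂(F)) : Prop where
  e00 : k 0 0 - 1 ∈ ball F (-(n : ℤ))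
  e01 : k 0 1 ∈ ball F 0
  e10 : k 1 0 ∈ ball F (-(n : ℤ))
  e11 : k 1 1 - 1 ∈ ball F (-(n : ℤ))

theorem NearIwahori.psOrd_mul {n : ℕ} (hn : 1 ≤ n) (hμ : TrivialMod μ n) (hν : TrivialMod ν n)
    {k : GL₂(F)} (hk : NearIwahori n k) {g : GL₂(F)} (hg : psOrd μ ν g ≠ 0) :
    psOrd μ ν (g * k) = psOrd μ ν g := by
  have hu : TrivialMod (upHalf μ) n := hμ.mul (.absPow _ n)
  have hd : TrivialMod (downHalf ν) n := hν.mul (.absPow _ n)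
  by_cases hc : g 1 0 = 0
  · exact absurd (psOrd_of_eq_zero _ _ hc) hg
  obtain ⟨c, hc'⟩ : ∃ c : Fˣ, g 1 0 = c := ⟨mk0 _ hc, rfl⟩
  rw [psOrd_of_eq _ _ hc'] at hg ⊢
  have hle : ‖g 1 1‖ ≤ ‖(c : F)‖ := by grind
  set d := g 1 1 * ((c⁻¹ : Fˣ) : F) with hd0
  have hgd : g 1 1 = c * d := by rw [hd0, mul_left_comm, Units.mul_inv, mul_one]
  have hdb : d ∈ ball F 0 := by
    rw [mem_ball, zpow_zero, hd0, norm_mul, val_inv_eq_inv_val, norm_inv]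
    exact mul_inv_le_one_of_le₀ hle (norm_nonneg _)
  have h1 : k 0 0 + d * k 1 0 - 1 ∈ ball F (-(n : ℤ)) := by
    have := (ball F (-(n : ℤ))).add_mem hk.e00 (by simpa using mul_mem_ball hdb hk.e10)
    grind
  obtain ⟨w, hw⟩ := exists_unit_eq_one_add hn h1
  rw [add_sub_cancel] at hw
  have hw0 : lv w = 0 := lv_eq_zero_of_sub_one_mem hn (by grind)
  have hw1 : ∀ η : 𝓧, TrivialMod η n → η w = 1 := fun η hη =>
    hη w hw0 (by grind)
  have hc2 : (g * k) 1 0 = (c * w : Fˣ) := by rw [gl2_mul, hc', hgd, val_mul, hw]; ring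
  have hn0 : (-(n : ℤ)) ≤ 0 := by omega
  have one_mem : (1 : F) ∈ ball F 0 := by simp [mem_ball]
  have h11 : k 1 1 ∈ ball F 0 := by
    have := (ball F 0).add_mem (ball_mono hn0 hk.e11) one_mem
    grind
  have hdet : ((GeneralLinearGroup.det k : Fˣ) : F) - 1 ∈ ball F (-(n : ℤ)) := by
    rw [GeneralLinearGroup.val_det_apply, Matrix.det_fin_two]
    have e : k 0 0 * k 1 1 - k 0 1 * k 1 0 - 1 =
        (k 0 0 - 1) * k 1 1 + (k 1 1 - 1) - k 0 1 * k 1 0 := by ring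
    rw [e]
    exact (ball F _).sub_mem ((ball F _).add_mem (by simpa using mul_mem_ball hk.e00 h11) hk.e11)
      (by simpa using mul_mem_ball hk.e01 hk.e10)
  have hdet1 : upHalf μ (GeneralLinearGroup.det k) = 1 :=
    hu _ (lv_eq_zero_of_sub_one_mem hn hdet) hdet
  have hle2 : ‖(g * k) 1 1‖ ≤ ‖((c * w : Fˣ) : F)‖ := by
    have h3 : (g * k) 1 1 = c * (k 0 1 + d * k 1 1) := by rw [gl2_mul, hc', hgd]; ring
    rw [h3, val_mul, norm_mul, norm_mul, (norm_eq_one_iff w).2 hw0]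
    refine mul_le_mul_of_nonneg_left ?_ (norm_nonneg _)
    have := (ball F 0).add_mem hk.e01 (by simpa using mul_mem_ball hdb h11)
    simpa [mem_ball] using this
  rw [psOrd_of_eq _ _ hc2, if_pos hle, if_pos hle2, map_mul (downHalf ν), hw1 _ hd, mul_one,
    map_mul GeneralLinearGroup.det, mul_inv, mul_mul_mul_comm, map_mul (upHalf μ),
    map_mul (upHalf μ) (GeneralLinearGroup.det k), hdet1, one_mul, map_inv, hw1 _ hu, inv_one,
    mul_one]

theorem psOrd_mul_of_near {n : ℕ} (hn : 1 ≤ n) (hμ : TrivialMod μ n) (hν : TrivialMod ν n)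
    {k : GL₂(F)} (hk : NearIwahori n k) (hk' : NearIwahori n k⁻¹) (g : GL₂(F)) :
    psOrd μ ν (g * k) = psOrd μ ν g := by
  by_cases hg : psOrd μ ν g = 0
  · by_contra h
    have h1 : psOrd μ ν (g * k) ≠ 0 := fun h0 => h (h0.trans hg.symm)
    have := hk'.psOrd_mul hn hμ hν h1
    simp_all
  · exact hk.psOrd_mul hn hμ hν hg

theorem psOrd_mul_nL {n : ℕ} (hn : 1 ≤ n) (hμ : TrivialMod μ n) (hν : TrivialMod ν n)
    {v : F} (hv : v ∈ ball F (-(n : ℤ))) (g : GL₂(F)) :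
    psOrd μ ν (g * nL v) = psOrd μ ν g := by
  have h : ∀ v ∈ ball F (-(n : ℤ)), NearIwahori n (nL v) := fun v hv =>
    ⟨by simp, by simp, by simpa,
      by simp⟩
  have e : (nL v)⁻¹ = nL (-v) := by rw [inv_eq_iff_mul_eq_one]; apply gl2_ext <;> simp [gl2_mul]
  exact psOrd_mul_of_near hn hμ hν (h v hv) (e ▸ h _ ((ball F _).neg_mem hv)) g

theorem psOrd_mem (μ ν : 𝓧) : psOrd μ ν ∈ psMod μ ν := by
  refine mem_ps_iff.2 ⟨?_, psOrd_borel μ ν⟩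
  obtain ⟨n1, hn1, hμ⟩ := exists_trivialMod μ
  obtain ⟨n2, hn2, hν⟩ := exists_trivialMod ν
  have hμ := hμ.mono (show n1 ≤ n1 + n2 by omega)
  have hν := hν.mono (show n2 ≤ n1 + n2 by omega)
  set n := n1 + n2
  let U : Subgroup (GL₂(F)) :=
    { carrier := {k | ∀ g, psOrd μ ν (g * k) = psOrd μ ν g}
      one_mem' := fun g => by simp
      mul_mem' := fun {a b} ha hb g => by grind
      inv_mem' := fun {a} ha g => by rw [← ha (g * a⁻¹), inv_mul_cancel_right] }
  refine ⟨U, ?_, fun k hk => hk⟩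
  have hnb : ∀ᶠ k : GL₂(F) in nhds 1, ∀ i j, k i j - (1 : GL₂(F)) i j ∈
      ball F (-(n : ℤ)) := by
    rw [Filter.eventually_all]; intro i
    rw [Filter.eventually_all]; intro j
    have hc : Continuous fun k : GL₂(F) => k i j := Units.continuous_val.matrix_elem i j
    exact hc.continuousAt.eventually (ball_mem_nhds _ _)
  have hnb' := (continuous_inv (G := GL₂(F))).tendsto 1
  rw [inv_one] at hnb'
  have key : ∀ k : GL₂(F), (∀ i j, k i j - (1 : GL₂(F)) i j ∈ ball F (-(n : ℤ))) →
      NearIwahori n k := fun k h =>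
    ⟨by simp_all, ball_mono (show -(n : ℤ) ≤ 0 by omega) (by simp_all), by simp_all,
      by simp_all⟩
  refine Subgroup.isOpen_of_mem_nhds U (g := 1) ?_
  filter_upwards [hnb, hnb'.eventually hnb] with k hk hk' g
  exact psOrd_mul_of_near (by omega) hμ hν (key k hk) (key _ hk') g

theorem psOrd_one (μ ν : 𝓧) : psOrd μ ν 1 = 0 := psOrd_of_eq_zero _ _ (by simp)

/-! ### The Whittaker functional on the principal series -/

/-- The Whittaker functional on functions on `GL₂(F)`. -/
def whit (ψ : AddChar F Circle) (φ : GL₂(F) → ℂ) : ℂ := limFT ψ (bigCell φ) 1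

theorem ps_limFT (hψ : HasOrderZero ψ) (h : φ ∈ psMod μ ν) (a : Fˣ) :
    ∃ M₀ : ℤ, ∀ M, M₀ ≤ M → limFT ψ (bigCell φ) a = ballFT ψ (bigCell φ) M a := by
  obtain ⟨m, N, -, hA⟩ := ps_asymp h
  obtain ⟨n, hn, hη⟩ := exists_trivialMod (etaChar μ ν)
  exact ⟨max N (n - lv a), fun M hM => hA.limFT_eq hψ hn hη a (by omega) (by omega)⟩

theorem ps_continuous (h : φ ∈ psMod μ ν) : Continuous (bigCell φ) :=
  (ps_asymp h).choose_spec.choose_spec.2.continuous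

theorem ps_integrableOn (hψ : HasOrderZero ψ) (h : φ ∈ psMod μ ν) (a : F)
    (M : ℤ) : IntegrableOn (fun y => bigCell φ y * (ψ (-(a * y)) : ℂ)) (ball F M) (haarF F) :=
  ((ps_continuous h).mul (hψ.continuous.comp (by fun_prop))).continuousOn.integrableOn_compact
    (isCompact_ball M)

theorem limFT_add (hψ : HasOrderZero ψ) (h : φ ∈ psMod μ ν) (h' : φ' ∈ psMod μ ν) (a : Fˣ) :
    limFT ψ (bigCell (φ + φ')) a = limFT ψ (bigCell φ) a + limFT ψ (bigCell φ') a := by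
  obtain ⟨M1, h1⟩ := ps_limFT hψ h a
  obtain ⟨M2, h2⟩ := ps_limFT hψ h' a
  obtain ⟨M3, h3⟩ := ps_limFT hψ (add_mem h h') a
  set M := max M1 (max M2 M3)
  rw [h1 M (by omega), h2 M (by omega), h3 M (by omega), ballFT, ballFT, ballFT,
    ← integral_add (ps_integrableOn hψ h _ _) (ps_integrableOn hψ h' _ _)]
  simp only [bigCell, Pi.add_apply, add_mul]

theorem limFT_smul (hψ : HasOrderZero ψ) (h : φ ∈ psMod μ ν) (c : ℂ)
    (a : Fˣ) : limFT ψ (bigCell (c • φ)) a = c * limFT ψ (bigCell φ) a := by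
  obtain ⟨M1, h1⟩ := ps_limFT hψ h a
  obtain ⟨M2, h2⟩ := ps_limFT hψ (Submodule.smul_mem _ c h) a
  set M := max M1 M2
  rw [h1 M (by omega), h2 M (by omega), ballFT, ballFT, ← integral_const_mul]
  simp only [bigCell, Pi.smul_apply, smul_eq_mul, mul_assoc]

theorem limFT_sub (hψ : HasOrderZero ψ) (h : φ ∈ psMod μ ν) (h' : φ' ∈ psMod μ ν) (a : Fˣ) :
    limFT ψ (bigCell (φ - φ')) a = limFT ψ (bigCell φ) a - limFT ψ (bigCell φ') a := by
  rw [show φ - φ' = φ + (-1 : ℂ) • φ' by rw [neg_one_smul, sub_eq_add_neg],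
    limFT_add hψ h (Submodule.smul_mem _ _ h'), limFT_smul hψ h']
  ring

theorem limFT_nU (hψ : HasOrderZero ψ) (h : φ ∈ psMod μ ν) (x : F)
    (a : Fˣ) : limFT ψ (bigCell (rightReg _ (nU x) φ)) a = (ψ (a * x) : ℂ) *
        limFT ψ (bigCell φ) a := by
  obtain ⟨M1, h1⟩ := ps_limFT hψ h a
  obtain ⟨M2, h2⟩ := ps_limFT hψ (ps_translate h (nU x)) a
  obtain ⟨M3, h3⟩ := exists_mem_ball x
  set M := max M1 (max M2 M3)
  have hx : x ∈ ball F M := ball_mono (by omega) h3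
  rw [h1 M (by omega), h2 M (by omega), ballFT, ballFT, ← integral_const_mul,
    ← integral_indicator (measurableSet_ball _), ← integral_indicator (measurableSet_ball _),
    eq_comm, ← integral_add_right_eq_self _ x]
  refine integral_congr_ae (.of_forall fun y => ?_)
  beta_reduce
  by_cases hy : y ∈ ball F M
  · rw [indicator_of_mem (show y ∈ (ball F M : Set F) from hy), indicator_of_mem
      (show y + x ∈ (ball F M : Set F) from (ball F M).add_mem hy hx), bigCell_nU, mul_add,
      neg_add, psi_add, psi_neg ψ (a * x)]
    field_simp [psi_ne_zero ψ]
  · rw [indicator_of_notMem (show y ∉ (ball F M : Set F) from hy), indicator_of_notMem]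
    intro h5
    apply hy
    have := (ball F M).sub_mem h5 hx
    simp_all

theorem whit_nU (hψ : HasOrderZero ψ) (h : φ ∈ psMod μ ν) (x : F) :
    whit ψ (rightReg _ (nU x) φ) = (ψ x : ℂ) * whit ψ φ := by
  have := limFT_nU hψ h x 1
  rwa [val_one, one_mul] at this

theorem whit_borel (hψ : HasOrderZero ψ) (h : φ ∈ psMod μ ν) (a d : Fˣ) :
    whit ψ (rightReg _ (borel a d 0) φ) = (downHalf μ d : ℂ) * (upHalf ν a : ℂ) *
      limFT ψ (bigCell φ) ((a * d⁻¹ : Fˣ) : F) := by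
  obtain ⟨M1, h1⟩ := ps_limFT hψ h (a * d⁻¹)
  obtain ⟨M2, h2⟩ := ps_limFT hψ (ps_translate h (borel a d 0)) 1
  set M := max (M1 + lv (a * d⁻¹)) M2
  have hc : (downHalf μ d : ℂ) * (upHalf ν a : ℂ) = (upHalf μ d : ℂ) * (downHalf ν a : ℂ) *
      ((‖((a * d⁻¹ : Fˣ) : F)‖ : ℝ) : ℂ) := by
    rw [← absPow_one_apply, map_mul (absPow F 1), map_inv, downHalf, upHalf, upHalf, downHalf]
    simp only [mul_apply, val_mul, val_inv_eq_inv_val]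
    have e1 : (absPow F (1 / 2) a : ℂ) = (absPow F (-(1 / 2)) a : ℂ) * (absPow F 1 a : ℂ) := by
      rw [← val_mul, ← mul_apply, ← absPow_add]; norm_num
    have e2 : (absPow F (1 / 2) d : ℂ) = (absPow F (-(1 / 2)) d : ℂ) * (absPow F 1 d : ℂ) := by
      rw [← val_mul, ← mul_apply, ← absPow_add]; norm_num
    rw [e1, e2]
    field_simp [(absPow F 1 d).ne_zero]
  rw [whit, ← val_one, h2 M (by omega), h1 (M - lv (a * d⁻¹)) (by omega), ballFT, ballFT,
    ← integral_indicator (measurableSet_ball _), ← integral_indicator (measurableSet_ball _), hc]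
  have h3 := fun H : F → ℂ => integral_mul_haarF (E := ℂ) (a * d⁻¹) H
  have h4 : ∀ H : F → ℂ, ∫ x, H x ∂haarF F = ((‖((a * d⁻¹ : Fˣ) : F)‖ : ℝ) : ℂ) *
      ∫ x, H (((a * d⁻¹ : Fˣ) : F) * x) ∂haarF F := fun H => by
    have : ‖((a * d⁻¹ : Fˣ) : F)‖ ≠ 0 := norm_ne_zero_iff.2 (Units.ne_zero _)
    rw [h3, real_smul, ← mul_assoc, ← Complex.ofReal_mul, mul_inv_cancel₀ this,
      Complex.ofReal_one, one_mul]
  rw [h4]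
  refine Eq.trans (congrArg _ ?_) (mul_left_comm ((‖((a * d⁻¹ : Fˣ) : F)‖ : ℝ) : ℂ) _ _ |>.trans
    (mul_assoc _ _ _).symm)
  rw [← integral_const_mul]
  refine (integral_congr_ae (.of_forall fun y => ?_))
  beta_reduce
  by_cases hy : y ∈ ball F (M - lv (a * d⁻¹))
  · rw [indicator_of_mem (show y ∈ (ball F (M - lv (a * d⁻¹)) : Set F) from hy),
      indicator_of_mem (show ((a * d⁻¹ : Fˣ) : F) * y ∈ (ball F M : Set F) from
        unit_mul_mem_ball.2 hy), bigCell_borel h, val_one, one_mul, zero_add]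
    have e : ((a * d⁻¹ : Fˣ) : F) * y * d * ((a⁻¹ : Fˣ) : F) = y := by
      simp only [val_mul, val_inv_eq_inv_val]; field_simp
    grind
  · rw [indicator_of_notMem (show y ∉ (ball F (M - lv (a * d⁻¹)) : Set F) from hy),
      indicator_of_notMem (show ((a * d⁻¹ : Fˣ) : F) * y ∉ (ball F M : Set F) from
        mt unit_mul_mem_ball.1 hy), mul_zero]

end GL2

section FunctionalEquation

variable {μ ν χ : QuasiChar F} {φ φ' : GL₂(F) → ℂ}

/-! ### The functional equation for the principal series -/

theorem etaChar_eq (μ ν : 𝓧) : etaChar μ ν = μ⁻¹ * ν * (absPow F 1)⁻¹ := by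
  have e : absPow F 1 = absPow F (1 / 2) * absPow F (1 / 2) := by rw [← absPow_add]; norm_num
  ext u
  rw [etaChar, upHalf, downHalf, e, absPow_neg]
  simp only [mul_apply, qc_inv, val_mul, val_inv_eq_inv_val]
  grind

theorem absPow_one_sub (s : ℂ) : absPow F (1 - s) = absPow F 1 * (absPow F s)⁻¹ := by
  rw [sub_eq_add_neg, absPow_add, absPow_neg]

theorem eventually_absAt_right (χ : 𝓧) : ∀ᶠ s in rightF, absAt (χ * absPow F s) < 1 := by
  have h : Tendsto (fun x : ℝ => absAt χ * 𝔮ᵣ ^ (-x)) atTop (𝓝 (absAt χ * 0)) :=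
    ((tendsto_rpow_atBot_of_base_gt_one _ (one_lt_q F)).comp tendsto_neg_atTop_atBot).const_mul _
  rw [mul_zero] at h
  refine (eventually_comap.2 ((h.eventually_lt_const one_pos).mono fun x hx s hs => ?_))
  rwa [absAt_mul, absAt_absPow, hs]

theorem tendsto_one_sub_left : Tendsto (fun s : ℂ => 1 - s) leftF rightF := by
  rw [rightF, tendsto_comap_iff]
  have : Complex.re ∘ (fun s : ℂ => 1 - s) = (fun x : ℝ => 1 - x) ∘ Complex.re := by ext; simp
  rw [this]
  refine Tendsto.comp ?_ tendsto_comap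
  simp only [sub_eq_add_neg]
  exact tendsto_atTop_add_const_left _ _ tendsto_neg_atBot_atTop

theorem eventually_absAt_left (χ : 𝓧) : ∀ᶠ s in leftF, absAt (χ * absPow F (1 - s)) < 1 :=
  tendsto_one_sub_left.eventually (eventually_absAt_right χ)

open Classical in
/-- The Mellin transform of the characteristic function of the ring of integers. -/
def ordL (ϖ : Fˣ) (χ : 𝓧) (s : ℂ) : ℂ := if IsUnramified χ then tateL ϖ χ s else 0

theorem integrableOn_char {χ : 𝓧} (hχ : absAt χ < 1) :
    IntegrableOn (fun a : Fˣ => (χ a : ℂ)) {a : Fˣ | lv a ≤ 0} (haarFx F) := by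
  simpa using integrableOn_char_mul hχ 0 (g := fun _ => 1) measurable_const (C := 1) (by simp)

theorem integral_ord (hϖ : IsUniformizer (ϖ : F)) {χ : 𝓧} {s : ℂ}
    (hχ : absAt (χ * absPow F s) < 1) :
    ∫ a in {a : Fˣ | lv a ≤ 0}, ((χ * absPow F s) a : ℂ) ∂haarFx F = ordL ϖ χ s := by
  have hu := isUnramified_congr (mul_absPow_unit χ s)
  rw [ordL]
  split_ifs with h
  · rw [integral_unramified hχ (hu.2 h), tateL_of_isUnramified h, unramified_uniformizer hϖ h,
      mul_apply, val_mul, absPow_unif]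
  · obtain ⟨t, ht, hne⟩ : ∃ t : Fˣ, lv t = 0 ∧ χ t ≠ 1 := by
      by_contra! h'; exact h (isUnramified_iff.2 h')
    refine setIntegral_eq_zero_of_mul (measurableSet_lv_le _) t (c := (χ t : ℂ)) (by simp_all)
      (fun a => by simp only [mem_ofPred_eq, lv_mul, ht, zero_add]) fun a _ => ?_
    rw [map_mul (χ * absPow F s), mul_absPow_unit χ s t ht, val_mul]

theorem tateL_ne_zero (χ : 𝓧) : ∀ᶠ s in rightF ⊔ leftF, tateL ϖ χ s ≠ 0 := by
  by_cases h : IsUnramified χ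
  · have hp : (1 - Polynomial.C (χ ϖ : ℂ) * Polynomial.X : Polynomial ℂ) ≠ 0 := by
      intro h0
      have := congrArg (Polynomial.eval 0) h0
      simp at this
    filter_upwards [eventually_eval_ne_zero F le_rfl hp] with s hs
    rw [tateL_of_isUnramified h]
    simp_all
  · exact .of_forall fun s => by rw [tateL_of_not_isUnramified h]; simp

theorem tateGamma_mul_ordL (χ : 𝓧) : ∀ᶠ s in rightF ⊔ leftF,
    tateGamma ψ ϖ χ s * ordL ϖ χ s = ordL ϖ χ⁻¹ (1 - s) := by
  have hu : IsUnramified χ⁻¹ ↔ IsUnramified χ := forall₂_congr fun u _ => by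
    rw [qc_inv, inv_eq_one]
  filter_upwards [tateL_ne_zero (ϖ := ϖ) χ] with s hs
  by_cases h : IsUnramified χ
  · rw [ordL, ordL, if_pos h, if_pos (hu.2 h), tateGamma, tateEps, if_pos h, one_mul,
      div_mul_cancel₀ _ hs]
  · rw [ordL, ordL, if_neg h, if_neg (mt hu.1 h), mul_zero]

theorem exists_represents_ordL (χ : 𝓧) : ∃ R, Represents F (rightF ⊔ leftF) (ordL ϖ χ) R := by
  by_cases h : IsUnramified χ
  · refine ⟨_, (((represents_const 1).add le_rfl ((represents_const (-(χ ϖ : ℂ))).mul le_rfl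
      represents_X)).inv le_rfl).congr (.of_forall fun s => ?_)⟩
    rw [ordL, if_pos h, tateL_of_isUnramified h]; ring
  · exact ⟨_, (represents_const 0).congr (.of_forall fun s => (if_neg h).symm)⟩

theorem limFT_psOrd (hψ : HasOrderZero ψ) (a : Fˣ) :
    limFT ψ (bigCell (psOrd μ ν)) a = if lv a ≤ 0 then 1 else 0 := by
  rw [bigCell_psOrd, (ballFun_indicator (k := 0) (m := 0) le_rfl fun _ _ _ _ => rfl).limFT_eq,
    fourier]
  have h := hψ.integral_ball (-(a : F)) 0
  rw [← integral_indicator (measurableSet_ball _)] at h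
  rw [neg_mem_iff, neg_zero, units_mem_ball, zpow_zero] at h
  refine Eq.trans (integral_congr_ae (.of_forall fun x => ?_)) (h.trans (by congr))
  by_cases hx : x ∈ (ball F 0 : Set F)
  · simp_all
  simp_all

theorem mellin_psOrd (hψ : HasOrderZero ψ) (hϖ : IsUniformizer (ϖ : F)) {χ : 𝓧} {s : ℂ}
    (hχ : absAt (χ * absPow F s) < 1) :
    Integrable (fun a : Fˣ => limFT ψ (bigCell (psOrd μ ν)) a *
        ((χ * absPow F s) a : ℂ)) (haarFx F) ∧
    ∫ a : Fˣ, limFT ψ (bigCell (psOrd μ ν)) a * ((χ * absPow F s) a : ℂ) ∂haarFx F =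
        ordL ϖ χ s := by
  have e : (fun a : Fˣ => limFT ψ (bigCell (psOrd μ ν)) a * ((χ * absPow F s) a : ℂ)) =
      {a : Fˣ | lv a ≤ 0}.indicator fun a => ((χ * absPow F s) a : ℂ) := by
    ext a
    rw [limFT_psOrd hψ]
    by_cases ha : lv a ≤ 0
    · simp_all
    simp_all
  rw [e, integrable_indicator_iff (measurableSet_lv_le _),
      integral_indicator (measurableSet_lv_le _)]
  exact ⟨integrableOn_char hχ, integral_ord hϖ hχ⟩

theorem ps_mellin (hψ : HasOrderZero ψ) (hϖ : IsUniformizer (ϖ : F))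
    (h : φ ∈ psMod μ ν) (h0 : bigCell φ 0 = 0) {θ : 𝓧} {s : ℂ}
    (hθ : absAt (θ * absPow F s) < 1)
    (hη : φ 1 = 0 ∨ absAt (μ * ν⁻¹ * θ * absPow F s) < 1) :
    Integrable (fun a : Fˣ => limFT ψ (bigCell φ) a * ((θ * absPow F s) a : ℂ)) (haarFx F) ∧
    ∫ a : Fˣ, limFT ψ (bigCell φ) a * ((θ * absPow F s) a : ℂ) ∂haarFx F = (tateGamma ψ ϖ θ s)⁻¹ *
        ∫ y : Fˣ, bigCell φ y * ((θ⁻¹ * absPow F (1 - s)) y : ℂ) ∂haarFx F := by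
  obtain ⟨m, N, -, hA⟩ := ps_asymp h
  have h1 := hA.mellin_limFT hψ hϖ h0 hθ (hη.imp_right fun h2 => by
    rw [etaChar_eq, absAt_mul, absAt_mul, absAt_mul, absAt_mul, absAt_inv, absAt_inv, absAt_inv]
    rw [absAt_mul, absAt_mul (μ * ν⁻¹), absAt_mul μ, absAt_inv] at h2
    have p := fun χ : 𝓧 => absAt_pos χ
    have e : (absAt μ)⁻¹ * absAt ν * (absAt (absPow F 1))⁻¹ *
        (absAt (absPow F 1) * (absAt (θ * absPow F s))⁻¹) =
        (absAt μ * (absAt ν)⁻¹ * absAt θ * absAt (absPow F s))⁻¹ := by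
      rw [absAt_mul]
      grind
    rw [e]
    have := p μ; have := p ν; have := p θ; have := p (absPow F s)
    exact one_lt_inv_iff₀.2 ⟨by positivity, h2⟩)
  rw [tateGamma_absPow hϖ, zero_add] at h1
  have e : absPow F 1 * (θ * absPow F s)⁻¹ = θ⁻¹ * absPow F (1 - s) := by
    rw [absPow_one_sub, qc_mul_inv]
    rw [← mul_assoc, ← mul_assoc, mul_comm (absPow F 1) θ⁻¹]
  grind

theorem integral_inv_haarFx (f : Fˣ → ℂ) : ∫ u : Fˣ, f ((-u)⁻¹) ∂haarFx F = ∫ u, f u ∂haarFx F := by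
  rw [← integral_inv_eq_self f, ← integral_mul_left_eq_self (fun u => f u⁻¹) (-1)]
  simp

theorem neg_one_mul_self (χ : 𝓧) : ((χ (-1) : ℂˣ) : ℂ) * (χ (-1) : ℂ) = 1 := by
  rw [← val_mul, ← map_mul]; simp

theorem ps_mellin_J1_inv (h : φ ∈ psMod μ ν) (θ : 𝓧) (s : ℂ) :
    ∫ y : Fˣ, bigCell (rightReg _ (J1 F)⁻¹ φ) y * ((θ⁻¹ * absPow F (1 - s)) y : ℂ) ∂haarFx F =
      (θ (-1) : ℂ) * ∫ y : Fˣ, bigCell φ y * ((μ * ν⁻¹ * θ * absPow F s) y : ℂ) ∂haarFx F := by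
  rw [← integral_inv_haarFx, ← integral_const_mul]
  refine integral_congr_ae (.of_forall fun u => ?_)
  beta_reduce
  have e : (-(-u)⁻¹)⁻¹ = u := by simp
  rw [bigCell_J1_inv h, e, upHalf_mul_downHalf_neg_one, etaChar_eq, absPow_one_sub]
  have e2 : (-u)⁻¹ = -1 * u⁻¹ := by simp
  have h1 : absPow F 1 (-1) = 1 := by ext; rw [absPow_apply]; simp
  have hs : absPow F s (-1) = 1 := by ext; rw [absPow_apply]; simp
  rw [e2]
  simp only [mul_apply, qc_inv, map_mul, map_inv, h1, hs, val_mul, val_inv_eq_inv_val, val_one]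
  have a1 := neg_one_mul_self μ
  have a2 := neg_one_mul_self ν
  have a3 := neg_one_mul_self θ
  have b1 : ((μ (-1) : ℂˣ) : ℂ)⁻¹ = μ (-1) := inv_eq_of_mul_eq_one_right a1
  have b3 : ((θ (-1) : ℂˣ) : ℂ)⁻¹ = θ (-1) := inv_eq_of_mul_eq_one_right a3
  rw [b1, b3]
  have n1 := (absPow F 1 u).ne_zero
  grind

theorem ev_right {p : ℂ → Prop} (h : ∀ᶠ s in rightF ⊔ leftF, p s) : ∀ᶠ s in rightF, p s :=
  (eventually_sup.1 h).1

theorem ev_left {p : ℂ → Prop} (h : ∀ᶠ s in rightF ⊔ leftF, p s) : ∀ᶠ s in leftF, p s :=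
  (eventually_sup.1 h).2

variable (ψ μ ν χ) in
/-- The functional equation for the function `φ` in `I(μ, ν)`. -/
def HasFE (R : RatFunc ℂ) (φ : GL₂(F) → ℂ) : Prop := ∃ P : RatFunc ℂ,
    (∀ᶠ s in rightF, Integrable (fun a : Fˣ => limFT ψ (bigCell φ) a * ((ν * χ * absPow F s) a : ℂ))
        (haarFx F) ∧
      evq F P s = ∫ a : Fˣ, limFT ψ (bigCell φ) a * ((ν * χ * absPow F s) a : ℂ) ∂haarFx F) ∧
    (∀ᶠ s in leftF, Integrable (fun a : Fˣ => limFT ψ (bigCell (rightReg _ (J1 F)⁻¹ φ)) a *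
        (((μ * χ)⁻¹ * absPow F (1 - s)) a : ℂ)) (haarFx F) ∧
      evq F (R * P) s = ∫ a : Fˣ, limFT ψ (bigCell (rightReg _ (J1 F)⁻¹ φ)) a *
        (((μ * χ)⁻¹ * absPow F (1 - s)) a : ℂ) ∂haarFx F)

theorem HasFE.add (hψ : HasOrderZero ψ) {R : RatFunc ℂ} (hφ : φ ∈ psMod μ ν)
    (hφ' : φ' ∈ psMod μ ν) (h : HasFE ψ μ ν χ R φ)
    (h' : HasFE ψ μ ν χ R φ') : HasFE ψ μ ν χ R (φ + φ') := by
  obtain ⟨P, h1, h2⟩ := h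
  obtain ⟨P', h1', h2'⟩ := h'
  have hP : Represents F (rightF ⊔ leftF) (evq F P) P := .of_forall fun _ => rfl
  have hP' : Represents F (rightF ⊔ leftF) (evq F P') P' := .of_forall fun _ => rfl
  have hQ : Represents F (rightF ⊔ leftF) (evq F (R * P)) (R * P) := .of_forall fun _ => rfl
  have hQ' : Represents F (rightF ⊔ leftF) (evq F (R * P')) (R * P') := .of_forall fun _ => rfl
  refine ⟨P + P', ?_, ?_⟩
  · filter_upwards [h1, h1', ev_right (hP.add le_rfl hP')] with s a b c
    simp only [limFT_add hψ hφ hφ', add_mul]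
    exact ⟨a.1.add b.1, by rw [integral_add a.1 b.1, ← a.2, ← b.2]; exact c⟩
  · rw [mul_add]
    filter_upwards [h2, h2', ev_left (hQ.add le_rfl hQ')] with s a b c
    simp only [map_add, limFT_add hψ (ps_translate hφ _) (ps_translate hφ' _), add_mul]
    exact ⟨a.1.add b.1, by rw [integral_add a.1 b.1, ← a.2, ← b.2]; exact c⟩

theorem HasFE.smul (hψ : HasOrderZero ψ) {R : RatFunc ℂ}
    (hφ : φ ∈ psMod μ ν) (h : HasFE ψ μ ν χ R φ) (c : ℂ) :
    HasFE ψ μ ν χ R (c • φ) := by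
  obtain ⟨P, h1, h2⟩ := h
  have hP : Represents F (rightF ⊔ leftF) (evq F P) P := .of_forall fun _ => rfl
  have hQ : Represents F (rightF ⊔ leftF) (evq F (R * P)) (R * P) := .of_forall fun _ => rfl
  refine ⟨RatFunc.C c * P, ?_, ?_⟩
  · filter_upwards [h1, ev_right ((represents_const c).mul le_rfl hP)] with s a b
    simp only [limFT_smul hψ hφ, mul_assoc c]
    exact ⟨a.1.const_mul c, by rw [integral_const_mul, ← a.2]; exact b⟩
  · rw [mul_left_comm]
    filter_upwards [h2, ev_left ((represents_const c).mul le_rfl hQ)] with s a b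
    simp only [map_smul, limFT_smul hψ (ps_translate hφ _), mul_assoc c]
    exact ⟨a.1.const_mul c, by rw [integral_const_mul, ← a.2]; exact b⟩

/-- Criterion for the functional equation. -/
theorem hasFE_of {R : RatFunc ℂ} {f g r : ℂ → ℂ} {P : RatFunc ℂ}
    (hR : Represents F (rightF ⊔ leftF) r R) (hP : Represents F (rightF ⊔ leftF) f P)
    (hfg : ∀ᶠ s in leftF, r s * f s = g s)
    (h1 : ∀ᶠ s in rightF, Integrable (fun a : Fˣ => limFT ψ (bigCell φ) a *
        ((ν * χ * absPow F s) a : ℂ)) (haarFx F) ∧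
      ∫ a : Fˣ, limFT ψ (bigCell φ) a * ((ν * χ * absPow F s) a : ℂ) ∂haarFx F = f s)
    (h2 : ∀ᶠ s in leftF, Integrable (fun a : Fˣ => limFT ψ (bigCell (rightReg _ (J1 F)⁻¹ φ)) a *
        (((μ * χ)⁻¹ * absPow F (1 - s)) a : ℂ)) (haarFx F) ∧
      ∫ a : Fˣ, limFT ψ (bigCell (rightReg _ (J1 F)⁻¹ φ)) a *
        (((μ * χ)⁻¹ * absPow F (1 - s)) a : ℂ) ∂haarFx F = g s) :
    HasFE ψ μ ν χ R φ := by
  refine ⟨P, ?_, ?_⟩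
  · filter_upwards [h1, ev_right hP] with s a b
    grind
  · filter_upwards [h2, ev_left (hR.mul le_rfl hP), hfg] with s a b c
    grind

theorem exists_represents_mellin {j : Fˣ → ℂ} (hj : Continuous j) {m N : ℤ}
    (hs : ∀ u, lv u ∉ Set.Ioc m N → j u = 0) :
    ∃ R, Represents F (rightF ⊔ leftF)
      (fun s => ∫ u : Fˣ, j u * (absPow F (1 - s) u : ℂ) ∂haarFx F) R := by
  refine ⟨_, (Represents.sum le_rfl (Finset.Ioc m N) fun k _ =>
    (represents_const (∫ u in {u : Fˣ | lv u = k}, j u *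
        ((‖(u : F)‖ : ℝ) : ℂ) ∂haarFx F)).mul le_rfl
      ((represents_X (F := F)).zpow le_rfl k)).congr (.of_forall fun s => ?_)⟩
  have h1 : ∫ u : Fˣ, j u * (absPow F (1 - s) u : ℂ) ∂haarFx F =
      ∫ u in {u : Fˣ | lv u ∈ Set.Ioc m N}, j u * (absPow F (1 - s) u : ℂ) ∂haarFx F := by
    refine (setIntegral_eq_integral_of_forall_compl_eq_zero fun u hu => ?_).symm
    grind
  have hU : {u : Fˣ | lv u ∈ Set.Ioc m N} = ⋃ k ∈ Finset.Ioc m N, {u : Fˣ | lv u = k} := by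
    ext a; simp
  rw [h1, hU, integral_biUnion_finset _ (fun k _ => measurableSet_lv_eq k)
    (fun k _ l _ hkl => Set.disjoint_left.2 fun u hu hu' => hkl (hu.symm.trans hu'))
    fun k _ => integrableOn_shell (f := fun u => j u * (absPow F (1 - s) u : ℂ))
      (hj.mul (continuous_quasiChar _)) k]
  refine sum_congr rfl fun k _ => ?_
  rw [← integral_mul_const]
  refine setIntegral_congr_fun (measurableSet_lv_eq k) fun u hu => ?_
  rw [absPow_one_sub, mul_apply, val_mul, absPow_one_apply,
    qc_inv, val_inv_eq_inv_val, absPow_eq_zpow, show lv u = k from hu, zpow_neg,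
    inv_inv, mul_assoc]

theorem hasFE_of_mem (hψ : HasOrderZero ψ) (hϖ : IsUniformizer (ϖ : F)) {R : RatFunc ℂ}
    (hR : Represents F (rightF ⊔ leftF)
      (fun s => tateGamma ψ ϖ (μ * χ) s * tateGamma ψ ϖ (ν * χ) s) R)
    (h : φ ∈ psMod μ ν) : HasFE ψ μ ν χ R φ := by
  have hc : μ * ν⁻¹ * (ν * χ) = μ * χ := by simp
  have hc' : μ * ν⁻¹ * (μ * χ)⁻¹ = (ν * χ)⁻¹ := by
    ext u
    simp only [mul_apply, qc_inv, val_mul, val_inv_eq_inv_val]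
    field_simp [(ν u).ne_zero, (μ u).ne_zero, (χ u).ne_zero]
  have hFE := tateGamma_mul_tateGamma (ϖ := ϖ) hψ (μ * χ)
  have hFE' := tateGamma_mul_tateGamma (ϖ := ϖ) hψ (ν * χ)
  have hinv : ∀ s, tateGamma ψ ϖ (μ * χ) s * tateGamma ψ ϖ (μ * χ)⁻¹ (1 - s) = ((μ * χ) (-1) : ℂ) →
      (tateGamma ψ ϖ (μ * χ)⁻¹ (1 - s))⁻¹ * ((μ * χ)⁻¹ (-1) : ℂ) = tateGamma ψ ϖ (μ * χ) s := by
    intro s a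
    have h0 : tateGamma ψ ϖ (μ * χ)⁻¹ (1 - s) ≠ 0 := fun h0 =>
      ((μ * χ) (-1)).ne_zero (by grind)
    have h1 := neg_one_mul_self (μ * χ)
    rw [qc_inv, val_inv_eq_inv_val, inv_eq_of_mul_eq_one_right h1]
    grind
  have sgn : ∀ η : 𝓧, (η (-1) : ℂ) ≠ 0 := fun η => (η (-1)).ne_zero
  have hJ : ∀ φ : GL₂(F) → ℂ, φ ∈ psMod μ ν →
      rightReg _ (J1 F)⁻¹ (rightReg _ (J1 F)⁻¹ φ) = ((μ * ν) (-1) : ℂ) • φ := fun φ h => by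
    ext g
    have e : g * (J1 F)⁻¹ * (J1 F)⁻¹ = borel (-1) (-1) 0 * g := by apply gl2_ext <;> simp [gl2_mul]
    rw [rightReg_apply, rightReg_apply, e, ps_apply h, upHalf_mul_downHalf_neg_one]
    rfl
  set φs := rightReg _ (J1 F)⁻¹ (psOrd μ ν) with hφs
  have hO := psOrd_mem (F := F) μ ν
  have hOs : φs ∈ psMod μ ν := ps_translate hO _
  have hOs0 : bigCell φs 0 = 0 := by rw [hφs, bigCell_J1_inv_zero, psOrd_one]
  have hO0 : bigCell (psOrd μ ν) 0 = (1 : ℂ) := by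
    rw [bigCell_psOrd, indicator_of_mem (ball F 0).zero_mem]
  have hOs1 : φs 1 = ((μ * ν) (-1) : ℂ) := by
    rw [hφs, J1_inv_at_one hO, upHalf_mul_downHalf_neg_one, hO0, mul_one]
  have hJO : ∀ θ : 𝓧, ∀ s, absAt (μ * ν⁻¹ * θ * absPow F s) < 1 →
      ∫ y : Fˣ, bigCell φs y * ((θ⁻¹ * absPow F (1 - s)) y : ℂ) ∂haarFx F =
        (θ (-1) : ℂ) * ordL ϖ (μ * ν⁻¹ * θ) s := fun θ s hs => by
    rw [hφs, ps_mellin_J1_inv hO, ← integral_ord hϖ hs,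
        ← integral_indicator (measurableSet_lv_le _)]
    congr 2
    ext y
    rw [bigCell_psOrd]
    by_cases hy : lv y ≤ 0
    · rw [indicator_of_mem (show (y : F) ∈ (ball F 0 : Set F) from units_mem_ball.2 hy),
        indicator_of_mem (show y ∈ {a : Fˣ | lv a ≤ 0} from hy), one_mul]
    · rw [indicator_of_notMem (show (y : F) ∉ (ball F 0 : Set F) from mt units_mem_ball.1 hy),
        indicator_of_notMem (show y ∉ {a : Fˣ | lv a ≤ 0} from hy), zero_mul]
  have F1 : HasFE ψ μ ν χ R (psOrd μ ν) := by
    obtain ⟨P, hP⟩ := exists_represents_ordL (ϖ := ϖ) (ν * χ)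
    refine hasFE_of hR hP (g := fun s => (tateGamma ψ ϖ (μ * χ)⁻¹ (1 - s))⁻¹ *
      (((μ * χ)⁻¹ (-1) : ℂ) * ordL ϖ (ν * χ)⁻¹ (1 - s))) ?_ ?_ ?_
    · filter_upwards [ev_left hFE, ev_left (tateGamma_mul_ordL (ψ := ψ) (ϖ := ϖ) (ν *
        χ))] with s a b
      grind
    · filter_upwards [eventually_absAt_right (ν * χ)] with s hs
      exact mellin_psOrd hψ hϖ hs
    · filter_upwards [eventually_absAt_left (μ * χ)⁻¹,
        eventually_absAt_left (ν * χ)⁻¹] with s hs hs'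
      rw [← hc'] at hs' ⊢
      rw [← hJO _ _ hs']
      exact ps_mellin hψ hϖ hOs hOs0 hs (Or.inr hs')
  have F2 : HasFE ψ μ ν χ R φs := by
    obtain ⟨P1, hP1⟩ := exists_represents_ordL (ϖ := ϖ) (μ * χ)
    obtain ⟨P2, hP2⟩ := exists_represents_tateGamma (ψ := ψ) (ϖ := ϖ) (ν * χ)
    refine hasFE_of hR ((hP2.inv le_rfl).mul le_rfl
      ((represents_const ((ν * χ) (-1) : ℂ)).mul le_rfl hP1))
      (g := fun s => ((μ * ν) (-1) : ℂ) * ordL ϖ (μ * χ)⁻¹ (1 - s)) ?_ ?_ ?_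
    · filter_upwards [ev_left hFE', ev_left (tateGamma_mul_ordL (ψ := ψ) (ϖ := ϖ) (μ * χ))]
        with s a b
      have h0 : tateGamma ψ ϖ (ν * χ) s ≠ 0 := fun h0 => sgn (ν * χ) (by grind)
      rw [← b]
      by_cases hur : IsUnramified (μ * χ)
      · have h2 : (μ * χ) (-1) = 1 := isUnramified_iff.1 hur _ (by rw [← norm_eq_one_iff]; simp)
        have h3 : ((μ * ν) (-1) : ℂ) = ((ν * χ) (-1) : ℂ) := by
          have h4 := congrArg Units.val h2
          have h5 := neg_one_mul_self χ
          simp only [mul_apply, val_mul, val_one] at h4 ⊢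
          grind
        grind
      · rw [ordL, if_neg hur]; ring
    · filter_upwards [eventually_absAt_right (ν * χ), eventually_absAt_right (μ * χ)] with s hs hs'
      rw [← hc] at hs' ⊢
      rw [← hJO _ _ hs']
      exact ps_mellin hψ hϖ hOs hOs0 hs (Or.inr hs')
    · filter_upwards [eventually_absAt_left (μ * χ)⁻¹] with s hs
      have := mellin_psOrd (μ := μ) (ν := ν) hψ hϖ hs
      rw [hJ _ hO]
      simp only [limFT_smul hψ hO, mul_assoc]
      exact ⟨this.1.const_mul _, by rw [integral_const_mul, this.2]⟩
  have F3 : ∀ φ ∈ psMod μ ν, bigCell φ 0 = 0 → φ 1 = 0 → HasFE ψ μ ν χ R φ := by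
    intro φ h h0 h1
    have hs0 : bigCell (rightReg _ (J1 F)⁻¹ φ) 0 = 0 := by rw [bigCell_J1_inv_zero, h1]
    have hs1 : rightReg _ (J1 F)⁻¹ φ 1 = 0 := by rw [J1_inv_at_one h, h0, mul_zero]
    obtain ⟨m, N, hmN, hA⟩ := ps_asymp h
    obtain ⟨P1, hP1⟩ := exists_represents_mellin (m := m) (N := N)
      (((ps_continuous h).comp Units.continuous_val).mul (continuous_quasiChar (ν * χ)⁻¹))
      fun u hu => by
        have : bigCell φ u = 0 := by
          by_cases hu1 : lv u ≤ m
          · have := hA.inv 0 u (units_mem_ball.2 hu1)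
            rwa [zero_add, h0] at this
          · rw [hA.asymp u (by grind), h1, zero_mul]
        change bigCell φ u * _ = 0
        grind
    obtain ⟨P2, hP2⟩ := exists_represents_tateGamma (ψ := ψ) (ϖ := ϖ) (ν * χ)
    have e : ∀ s, ∫ u : Fˣ, (bigCell φ ∘ Units.val * fun u => ((ν * χ)⁻¹ u : ℂ)) u *
        (absPow F (1 - s) u : ℂ) ∂haarFx F = ∫ u : Fˣ, bigCell φ u *
            (((ν * χ)⁻¹ * absPow F (1 - s)) u : ℂ) ∂haarFx F :=
      fun s => by
        simp only [mul_apply (ν * χ)⁻¹, val_mul, ← mul_assoc]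
        rfl
    refine hasFE_of hR ((hP2.inv le_rfl).mul le_rfl hP1) (g := fun s =>
      (tateGamma ψ ϖ (μ * χ)⁻¹ (1 - s))⁻¹ * (((μ * χ)⁻¹ (-1) : ℂ) *
        ∫ u : Fˣ, bigCell φ u * (((ν * χ)⁻¹ * absPow F (1 - s)) u : ℂ) ∂haarFx F)) ?_ ?_ ?_
    · filter_upwards [ev_left hFE, ev_left hFE'] with s a b
      have h0 : tateGamma ψ ϖ (ν * χ) s ≠ 0 := fun h0 => sgn (ν * χ) (by grind)
      rw [e, ← mul_assoc _ ((μ * χ)⁻¹ (-1) : ℂ), hinv s a]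
      field_simp
    · filter_upwards [eventually_absAt_right (ν * χ)] with s hs
      rw [e]
      exact ps_mellin hψ hϖ h h0 hs (Or.inl h1)
    · filter_upwards [eventually_absAt_left (μ * χ)⁻¹] with s hs
      have := ps_mellin hψ hϖ (ps_translate h (J1 F)⁻¹) hs0 hs (Or.inl hs1)
      rwa [ps_mellin_J1_inv h, hc'] at this
  have hx : φ = (φ - bigCell φ 0 • psOrd μ ν - (φ 1 * ((μ * ν) (-1) : ℂ)) • φs) +
      (bigCell φ 0 • psOrd μ ν + (φ 1 * ((μ * ν) (-1) : ℂ)) • φs) := by abel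
  have hm1 := Submodule.smul_mem _ (bigCell φ 0) hO
  have hm2 := Submodule.smul_mem _ (φ 1 * ((μ * ν) (-1) : ℂ)) hOs
  have hm3 := sub_mem (sub_mem h hm1) hm2
  rw [hx]
  refine (F3 _ hm3 ?_ ?_).add hψ hm3 (add_mem hm1 hm2)
    ((F1.smul hψ hO _).add hψ hm1 hm2 (F2.smul hψ hOs _))
  · change bigCell φ 0 - bigCell φ 0 * bigCell (psOrd μ ν) 0 - _ * bigCell φs 0 = 0
    grind
  · change φ 1 - bigCell φ 0 * psOrd μ ν 1 - φ 1 * ((μ * ν) (-1) : ℂ) * φs 1 = 0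
    rw [psOrd_one, hOs1]
    linear_combination (-φ 1) * neg_one_mul_self (μ * ν)

end FunctionalEquation

section Models

variable {μ ν χ : QuasiChar F} {φ φ' : GL₂(F) → ℂ}

/-! ### Injectivity of the Kirillov model -/

theorem exists_lv_gt (N : ℤ) : ∃ u : Fˣ, N < lv u :=
  ⟨unif F ^ (-(N + 1)), by rw [lv_unif_zpow]; omega⟩

theorem ps_eq_zero (h : φ ∈ psMod μ ν) (h0 : ∀ x, bigCell φ x = 0) : φ = 0 := by
  obtain ⟨m, N, -, hA⟩ := ps_asymp h
  obtain ⟨u, hu⟩ := exists_lv_gt (F := F) N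
  have h1 := hA.asymp u hu
  rw [h0, eq_comm, mul_eq_zero, or_iff_left (etaChar μ ν u).ne_zero] at h1
  exact ps_ext h (zero_mem _) h1 h0

theorem bigCell_const_of_limFT (hψ : HasOrderZero ψ) (h : φ ∈ psMod μ ν)
    (h0 : ∀ a : Fˣ, limFT ψ (bigCell φ) a = 0) (t : F) : bigCell φ t = bigCell φ 0 := by
  set D := rightReg _ (nU t) φ - φ
  have hD : D ∈ psMod μ ν := sub_mem (ps_translate h _) h
  have hD1 : D 1 = 0 := by
    have := ps_apply h 1 1 t 1
    rw [map_one, map_one, val_one, one_mul, one_mul, mul_one] at this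
    change φ (1 * nU t) - φ 1 = 0
    rw [one_mul, nU, this, sub_self]
  obtain ⟨m, N, -, hA⟩ := ps_asymp hD
  rw [hD1] at hA
  have hB : BallFun (bigCell D) N m := ⟨fun x hx => by
    obtain ⟨u, rfl⟩ : ∃ u : Fˣ, (u : F) = x := ⟨mk0 x (by rintro rfl; simp_all), rfl⟩
    rw [hA.asymp u (not_le.1 (mt units_mem_ball.2 hx)), zero_mul], hA.inv⟩
  have hF : ∀ a : Fˣ, fourier ψ (bigCell D) a = 0 := fun a => by
    have h1 := hB.limFT_eq (ψ := ψ) ((-a : Fˣ) : F)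
    rw [limFT_sub hψ (ps_translate h _) h, limFT_nU hψ h, h0] at h1
    simp_all
  have h2 := fourier_inversion hψ hB 0
  have h3 : ∀ y, fourier ψ (bigCell D) y = 0 := fun y => by
    rcases eq_or_ne y 0 with rfl | hy
    · rw [← (hB.fourier hψ).inv 0 ((unif F ^ N : Fˣ) : F) (units_mem_ball.2 (by rw [lv_unif_zpow])),
        zero_add, hF]
    · exact hF (mk0 y hy)
  simp only [h3, zero_mul, integral_zero] at h2
  have h4 : bigCell D 0 = bigCell (rightReg _ (nU t) φ) 0 - bigCell φ 0 := rfl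
  rw [h4, bigCell_nU, zero_add] at h2
  grind

theorem ps_one_dim (h : φ ∈ psMod μ ν) (h0 : ∀ t, bigCell φ t = bigCell φ 0) :
    ∃ (κ : ℂ) (θ : 𝓧), ∀ g, φ g = κ * (θ (GeneralLinearGroup.det g) : ℂ) := by
  by_cases hc : bigCell φ 0 = 0
  · refine ⟨0, 1, fun g => ?_⟩
    rw [ps_eq_zero h fun x => (h0 x).trans hc]; simp
  obtain ⟨m, N, -, hA⟩ := ps_asymp h
  obtain ⟨u, hu⟩ := exists_lv_gt (F := F) N
  have h1 : ∀ u : Fˣ, N < lv u → bigCell φ 0 = φ 1 * (etaChar μ ν u : ℂ) := fun u hu =>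
    (h0 u).symm.trans (hA.asymp u hu)
  have hκ : φ 1 ≠ 0 := fun h2 => hc (by grind)
  have hη : ∀ w, etaChar μ ν w = 1 := fun w => by
    obtain ⟨v, hv⟩ := exists_lv_gt (F := F) (N + |lv w|)
    have e1 := h1 v (by grind)
    have e2 := h1 (v * w) (by rw [lv_mul]; grind)
    simp_all
  have hd : ∀ w, downHalf ν w = upHalf μ w := fun w => by
    have := hη w
    rwa [etaChar, mul_apply, qc_inv, inv_mul_eq_one, eq_comm] at this
  refine ⟨φ 1, upHalf μ, fun g => ?_⟩
  by_cases hg : g 1 0 = 0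
  · obtain ⟨a, d, e⟩ := eq_borel hg
    rw [e, ← mul_one (borel _ _ _), ps_apply h, hd, mul_one, det_borel, map_mul]
    push_cast; ring
  · have h2 : φ 1 = bigCell φ (g 1 1 * ((mk0 _ hg)⁻¹ : Fˣ)) := by
      rw [h0, h1 u hu, hη, val_one, mul_one]
    conv_lhs => rw [bruhat (c := mk0 _ hg) rfl]
    rw [ps_apply h, hd, ← val_mul, ← map_mul, inv_mul_cancel_right, mul_comm, h2]
    rfl

theorem whit_eq_zero_of_limFT (hψ : HasOrderZero ψ) (h : φ ∈ psMod μ ν)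
    (h0 : ∀ a : Fˣ, limFT ψ (bigCell φ) a = 0) (g : GL₂(F)) :
    whit ψ (rightReg _ g φ) = 0 := by
  obtain ⟨κ, θ, h1⟩ := ps_one_dim h (bigCell_const_of_limFT hψ h h0)
  obtain ⟨x, -, hx⟩ := hψ.exists_ne_one
  have h2 : rightReg _ (nU (x : F)) (rightReg _ g φ) = rightReg _ g φ := by
    ext g'
    simp only [rightReg_apply, h1, map_mul GeneralLinearGroup.det, nU, det_borel, mul_one]
  have h3 := whit_nU hψ (ps_translate h g) (x : F)
  grind

theorem whit_tT (hψ : HasOrderZero ψ) (h : φ ∈ psMod μ ν) (a : Fˣ) :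
    whit ψ (rightReg _ (tT a) φ) = (upHalf ν a : ℂ) * limFT ψ (bigCell φ) a := by
  rw [tT, whit_borel hψ h, map_one, val_one, one_mul, inv_one, mul_one]

theorem whit_psOrd (hψ : HasOrderZero ψ) : whit ψ (psOrd μ ν) = 1 := by
  have := limFT_psOrd (μ := μ) (ν := ν) hψ 1
  rwa [val_one, lv_one, if_pos le_rfl] at this

/-- A function in `I(μ, ν)` whose Whittaker function restricts to the ordinary Kirillov function
on the torus has the Whittaker function of the ordinary vector. -/
theorem whit_eq_whit_psOrd (hψ : HasOrderZero ψ) (h : φ ∈ psMod μ ν)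
    (h0 : ∀ a : Fˣ, whit ψ (rightReg _ (tT a) φ) = ordKirillov ν a) (g : GL₂(F)) :
    whit ψ (rightReg _ g φ) = whit ψ (rightReg _ g (psOrd μ ν)) := by
  have hO := psOrd_mem (F := F) μ ν
  have h1 := whit_eq_zero_of_limFT hψ (sub_mem h hO) (fun a => by
    have h2 := h0 a
    rw [limFT_sub hψ h hO, limFT_psOrd hψ]
    rw [whit_tT hψ h] at h2
    have h3 : ordKirillov ν a = (upHalf ν a : ℂ) * if lv a ≤ 0 then 1 else 0 := by
      rw [ordKirillov]
      by_cases ha : lv a ≤ 0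
      · rw [if_pos ha, mul_one, indicator_of_mem (show a ∈ {a : Fˣ | ‖(a : F)‖ ≤ 1} from
          (norm_le_one_iff a).2 ha)]; rfl
      · rw [if_neg ha, mul_zero, indicator_of_notMem (show a ∉ {a : Fˣ | ‖(a : F)‖ ≤ 1} from
          mt (norm_le_one_iff a).1 ha)]
    rw [h3] at h2
    exact sub_eq_zero.2 (mul_left_cancel₀ (upHalf ν a).ne_zero h2)) g
  rw [map_sub, whit, ← val_one, limFT_sub hψ (ps_translate h g) (ps_translate hO g)] at h1
  exact sub_eq_zero.1 h1

/-! ### Uniqueness of Whittaker functionals -/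

/-- A finite combination of unipotent translates. -/
def unipAvg {V : Type*} [AddCommGroup V] [Module ℂ V] (ψ : AddChar F Circle)
    (π : Representation ℂ (GL₂(F)) V) (R : Finset F) (v : V) : V :=
  ∑ r ∈ R, (ψ (-r) : ℂ) • π (nU r) v

theorem unipAvg_mem (h : φ ∈ psMod μ ν) (R : Finset F) : unipAvg ψ (rightReg _) R φ ∈ psMod μ ν :=
  sum_mem fun _ _ => Submodule.smul_mem _ _ (ps_translate h _)

theorem unipAvg_spec (hψ : HasOrderZero ψ) (h : φ ∈ psMod μ ν) :
    ∃ k₀ m₀ : ℤ, ∀ k m, k₀ ≤ k → m ≤ m₀ → m ≤ k → ∀ R : Finset F, (∀ r ∈ R, r ∈ ball F k) →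
      (∀ x ∈ ball F k, ∃! r, r ∈ R ∧ x - r ∈ ball F m) →
      unipAvg ψ (rightReg _) R φ 1 = 0 ∧
      ∀ y, bigCell (unipAvg ψ (rightReg _) R φ) y =
        (𝔮 ^ m)⁻¹ * whit ψ φ * (ball F k : Set F).indicator (fun y => (ψ y : ℂ)) y := by
  obtain ⟨m, N, -, hA⟩ := ps_asymp h
  obtain ⟨n, hn, hη⟩ := exists_trivialMod (etaChar μ ν)
  have hq := qC_ne_zero F
  refine ⟨max N n, min m 0, fun k m' hk hm hmk R hR hR' => ?_⟩
  have hsum : ∀ j : F → ℂ, (∀ x, ∀ t ∈ ball F m', j (x + t) = j x) →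
      ∑ r ∈ R, j r = (𝔮 ^ m')⁻¹ * ∫ x in (ball F k : Set F), j x ∂haarF F := by
    intro j hj
    rw [integral_ball_eq_sum hmk hR hR' fun x _ t ht => hj x t ht,
      inv_mul_cancel_left₀ (zpow_ne_zero _ hq)]
  have hψm : ∀ x, ∀ t ∈ ball F m', (ψ (-(x + t)) : ℂ) = ψ (-x) := fun x t ht => by
    rw [neg_add, hψ.add_ball _ ((ball F 0).neg_mem (ball_mono (by omega) ht))]
  constructor
  · have h1 : ∀ r : F, φ (1 * nU r) = φ 1 := fun r => by
      have := ps_apply h 1 1 r 1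
      rw [map_one, map_one, val_one, one_mul, one_mul, mul_one] at this
      rwa [one_mul]
    have h2 := hψ.integral_ball (-1) k
    rw [if_neg (by rw [neg_mem_iff, ← val_one, units_mem_ball, lv_one]; omega)] at h2
    simp only [mul_neg, mul_one] at h2
    simp only [unipAvg, Finset.sum_apply, Pi.smul_apply, rightReg_apply, h1, smul_eq_mul]
    rw [← Finset.sum_mul, hsum _ hψm, h2, mul_zero, zero_mul]
  · intro y
    have h1 : bigCell (unipAvg ψ (rightReg _) R φ) y = ∑ r ∈ R, (ψ (-r) : ℂ) *
        bigCell φ (y + r) := by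
      simp only [bigCell, unipAvg, Finset.sum_apply, Pi.smul_apply, smul_eq_mul, rightReg_apply,
        nU_add, mul_assoc]
    rw [h1, hsum _ fun x t ht => by rw [hψm x t ht, ← add_assoc,
        hA.inv _ t (ball_mono (by omega) ht)],
      mul_assoc]
    congr 1
    rw [← integral_indicator (measurableSet_ball _)]
    by_cases hy : y ∈ ball F k
    · rw [indicator_of_mem (show y ∈ (ball F k : Set F) from hy), whit, ← val_one,
        hA.limFT_eq hψ hn hη 1 (M := k) (by omega) (by rw [lv_one]; omega), ballFT,
        ← integral_mul_const, ← integral_indicator (measurableSet_ball _),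
        ← integral_sub_right_eq_self _ y]
      refine integral_congr_ae (.of_forall fun x => ?_)
      beta_reduce
      by_cases hx : x ∈ ball F k
      · rw [indicator_of_mem (show x ∈ (ball F k : Set F) from hx), indicator_of_mem
          (show x - y ∈ (ball F k : Set F) from (ball F k).sub_mem hx hy), add_sub_cancel,
          val_one, one_mul, neg_sub, sub_eq_neg_add, psi_add]
        ring
      · rw [indicator_of_notMem (show x ∉ (ball F k : Set F) from hx), indicator_of_notMem]
        intro h5
        apply hx
        have := (ball F k).add_mem h5 hy
        simp_all
    · rw [indicator_of_notMem (show y ∉ (ball F k : Set F) from hy), mul_zero]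
      obtain ⟨t, ht, hne⟩ := hψ.exists_ne_one
      have htk : (t : F) ∈ ball F k := units_mem_ball.2 (by omega)
      refine integral_eq_zero_of_add (t : F) (c := (ψ (-t) : ℂ)) (by rw [psi_neg]; grind)
        fun x => ?_
      by_cases hx : x ∈ ball F k
      · rw [indicator_of_mem (show x ∈ (ball F k : Set F) from hx), indicator_of_mem
          (show x + t ∈ (ball F k : Set F) from (ball F k).add_mem hx htk)]
        have hyx : ∀ z ∈ ball F k, y + z ∉ ball F k := fun z hz h6 => hy (by
          have := (ball F k).sub_mem h6 hz; simp_all)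
        have hu : ∀ z, z ∉ ball F k → ∃ u : Fˣ, (u : F) = z ∧ k < lv u := fun z hz => by
          have hz0 : z ≠ 0 := by rintro rfl; simp_all
          exact ⟨mk0 z hz0, rfl, not_le.1 (mt units_mem_ball.2 hz)⟩
        obtain ⟨u, hu1, hku⟩ := hu _ (hyx x hx)
        obtain ⟨u', hu2, hku'⟩ := hu _ (hyx (x + t) ((ball F k).add_mem hx htk))
        have h7 : bigCell φ (y + (x + t)) = bigCell φ (y + x) := by
          rw [← hu1, ← hu2, hA.asymp _ (by omega), hA.asymp _ (by omega), hη.eq_of_sub_mem hn]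
          rw [hu1, hu2, add_sub_add_left_eq_sub, add_sub_cancel_left, units_mem_ball]
          omega
        rw [h7, neg_add, psi_add]; ring
      · rw [indicator_of_notMem (show x ∉ (ball F k : Set F) from hx), indicator_of_notMem,
          mul_zero]
        intro h5
        apply hx
        have := (ball F k).sub_mem h5 htk
        simp_all

theorem unipAvg_proportional (hψ : HasOrderZero ψ) (h : φ ∈ psMod μ ν)
    (h' : φ' ∈ psMod μ ν) : ∃ R : Finset F, R.Nonempty ∧
      whit ψ φ' • unipAvg ψ (rightReg _) R φ = whit ψ φ • unipAvg ψ (rightReg _) R φ' := by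
  obtain ⟨k1, m1, h1⟩ := unipAvg_spec hψ h
  obtain ⟨k2, m2, h2⟩ := unipAvg_spec hψ h'
  set k := max k1 k2
  set m := min k (min m1 m2)
  obtain ⟨R, hR, hR'⟩ := exists_ball_reps (F := F) (show m ≤ k by omega)
  obtain ⟨h3, h3'⟩ := h1 k m (by omega) (by omega) (by omega) R hR hR'
  obtain ⟨h4, h4'⟩ := h2 k m (by omega) (by omega) (by omega) R hR hR'
  refine ⟨R, ⟨_, (hR' 0 (ball F k).zero_mem).choose_spec.1.1⟩, ?_⟩
  refine ps_ext (Submodule.smul_mem _ _ (unipAvg_mem h R)) (Submodule.smul_mem _ _ (unipAvg_mem h' R))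
    ?_ fun x => ?_
  · simp_all
  · change whit ψ φ' * bigCell (unipAvg ψ (rightReg _) R φ) x =
      whit ψ φ * bigCell (unipAvg ψ (rightReg _) R φ') x
    grind

/-- Whittaker functionals on a subspace of `I(μ, ν)` are proportional to the standard one. -/
theorem whittaker_functional_unique (hψ : HasOrderZero ψ) {V : Type*} [AddCommGroup V] [Module ℂ V]
    {π : Representation ℂ (GL₂(F)) V} {T : V →ₗ[ℂ] (GL₂(F) → ℂ)}
    (hT : ∀ v, T v ∈ psMod μ ν) (hTπ : ∀ g v, T (π g v) = rightReg _ g (T v))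
    (hinj : Function.Injective T) {l : V →ₗ[ℂ] ℂ}
    (hl : ∀ (x : F) (v : V), l (π (nU x) v) = (ψ x : ℂ) * l v) (v v' : V) :
    l v * whit ψ (T v') = l v' * whit ψ (T v) := by
  obtain ⟨R, hR, h⟩ := unipAvg_proportional hψ (hT v) (hT v')
  have hTE : ∀ v, T (unipAvg ψ π R v) = unipAvg ψ (rightReg _) R (T v) := fun v => by
    simp only [unipAvg, map_sum, map_smul, hTπ]
  have hlE : ∀ v, l (unipAvg ψ π R v) = R.card * l v := fun v => by
    have : ∀ r ∈ R, (ψ (-r) : ℂ) * ((ψ r : ℂ) * l v) = l v := fun r _ => by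
      rw [← mul_assoc, psi_neg, inv_mul_cancel₀ (psi_ne_zero ψ r), one_mul]
    simp only [unipAvg, map_sum, map_smul, hl, smul_eq_mul]
    simp_all
  rw [← hTE, ← hTE, ← map_smul, ← map_smul] at h
  have h1 := congrArg l (hinj h)
  rw [map_smul, map_smul, hlE, hlE, smul_eq_mul, smul_eq_mul] at h1
  have hc : (R.card : ℂ) ≠ 0 := Nat.cast_ne_zero.2 hR.card_pos.ne'
  grind

/-- The Whittaker model of a quotient of `I(μ, ν)`. -/
theorem whittakerModel_quotient (hψ : HasOrderZero ψ) {V : Type*} [AddCommGroup V] [Module ℂ V]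
    {π : Representation ℂ (GL₂(F)) V}
    (T : Representation.IntertwiningMap (principalSeries μ ν).toRepresentation π)
    {l : V →ₗ[ℂ] ℂ}
    (hl : ∀ (x : F) (v : V), l (π (nU x) v) = (ψ x : ℂ) * l v) :
    ∃ C : ℂ, ∀ φ : (psMod μ ν), ∀ g, l (π g (T φ)) = C * whit ψ (rightReg _ g φ) := by
  have hTg : ∀ g φ, T ((principalSeries μ ν).toRepresentation g φ) = π g (T φ) := fun g φ =>
    Representation.IntertwiningMap.isIntertwining _ _ T g φ
  refine ⟨l (T ⟨_, psOrd_mem μ ν⟩), fun φ g => ?_⟩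
  have h := whittaker_functional_unique hψ (π := (principalSeries μ ν).toRepresentation)
    (T := (psMod μ ν).subtype) (l := l ∘ₗ T.toLinearMap) (fun v => v.2)
    (fun g v => rfl) Subtype.val_injective (fun x v => by simp_all) ((principalSeries μ ν).toRepresentation g φ) ⟨_, psOrd_mem μ ν⟩
  change l (T ((principalSeries μ ν).toRepresentation g φ)) * whit ψ (psOrd μ ν) =
    l (T ⟨_, psOrd_mem μ ν⟩) * whit ψ (rightReg _ g φ) at h
  rwa [whit_psOrd hψ, mul_one, hTg] at h

/-- The ordinary vector in the Whittaker model of a quotient of `I(μ, ν)`. -/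
theorem ordinary_eq_whit (hψ : HasOrderZero ψ) {V : Type*} [AddCommGroup V] [Module ℂ V]
    {π : Representation ℂ (GL₂(F)) V}
    (T : Representation.IntertwiningMap (principalSeries μ ν).toRepresentation π)
    (hT : Function.Surjective T) {W : GL₂(F) → ℂ} (hW : W ∈ whittakerModel ψ π)
    (hW' : ∀ a, W (tT a) = ordKirillov ν a) (g : GL₂(F)) :
    W g = whit ψ (rightReg _ g (psOrd μ ν)) := by
  obtain ⟨l, hl, v, rfl⟩ := hW
  obtain ⟨C, hC⟩ := whittakerModel_quotient hψ T hl
  obtain ⟨φ, rfl⟩ := hT v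
  have hφ : C • (φ : GL₂(F) → ℂ) ∈ psMod μ ν := Submodule.smul_mem _ _ φ.2
  have h1 : ∀ g, l (π g (T φ)) = whit ψ (rightReg _ g (C • (φ : GL₂(F) → ℂ))) := fun g => by
    rw [hC, map_smul, whit, whit, ← val_one, limFT_smul hψ (ps_translate φ.2 g)]
  beta_reduce at hW' ⊢
  rw [h1, whit_eq_whit_psOrd hψ hφ fun a => by grind]

/-! ### The gamma factor -/

theorem isGammaGL2_of_ps (hψ : HasOrderZero ψ) (hϖ : IsUniformizer (ϖ : F)) {𝒲 : Set (GL₂(F) → ℂ)}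
    (h𝒲 : ∀ W ∈ 𝒲, ∃ φ ∈ psMod μ ν, ∀ g, W g = whit ψ (rightReg _ g φ))
    {R : RatFunc ℂ} (hR : Represents F (rightF ⊔ leftF)
      (fun s => tateGamma ψ ϖ (μ * χ) s * tateGamma ψ ϖ (ν * χ) s) R) :
    IsGammaGL2 𝒲 (μ * ν) χ R := by
  intro W hW
  obtain ⟨φ, hφ, hWφ⟩ := h𝒲 W hW
  obtain ⟨P, h1, h2⟩ := hasFE_of_mem hψ hϖ hR hφ
  refine ⟨P, R * P, rfl, eventually_rightF.1 ?_, eventually_leftF.1 ?_⟩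
  · filter_upwards [h1] with s hs
    have e : ∀ a : Fˣ, W (tT a) * ((χ * absPow F (s - 1 / 2)) a : ℂ) =
        limFT ψ (bigCell φ) a * ((ν * χ * absPow F s) a : ℂ) := fun a => by
      have e1 : absPow F s = absPow F (1 / 2) * absPow F (s - 1 / 2) := by
        rw [← absPow_add, add_sub_cancel]
      rw [hWφ, whit_tT hψ hφ, e1, upHalf]
      simp only [mul_apply, val_mul]
      ring
    simp only [e]
    exact ⟨hs.1, hs.2.symm⟩
  · filter_upwards [h2] with s hs
    have e : ∀ a : Fˣ, W (tT a * (J1 F)⁻¹) * (((χ * (μ * ν))⁻¹ * absPow F (1 / 2 - s)) a : ℂ) =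
        limFT ψ (bigCell (rightReg _ (J1 F)⁻¹ φ)) a * (((μ * χ)⁻¹ * absPow F (1 - s)) a : ℂ) :=
        fun a => by
      have e1 : absPow F (1 - s) = absPow F (1 / 2) * absPow F (1 / 2 - s) := by
        rw [← absPow_add]; grind
      rw [hWφ, rightReg_mul, whit_tT hψ (ps_translate hφ _), e1, upHalf]
      simp only [mul_apply, qc_inv, val_mul, val_inv_eq_inv_val, mul_inv]
      field_simp [(ν a).ne_zero]
    simp only [e]
    exact ⟨hs.1, hs.2.symm⟩

open Classical in
theorem exists_nonvanishing (hψ : HasOrderZero ψ) (h : φ ∈ psMod μ ν)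
    (h0 : whit ψ φ ≠ 0) (χ : 𝓧) : ∃ R : Finset F, ∀ s : ℂ,
      ∫ a : Fˣ, whit ψ (rightReg _ (tT a) (unipAvg ψ (rightReg _) R φ)) *
        ((χ * absPow F (s - 1 / 2)) a : ℂ) ∂haarFx F ≠ 0 := by
  obtain ⟨k1, m1, h1⟩ := unipAvg_spec hψ h
  obtain ⟨n, hn, hT⟩ := exists_trivialMod (upHalf ν * χ)
  obtain ⟨k, hk1, hk2⟩ : ∃ k : ℕ, k1 ≤ k ∧ n ≤ k := ⟨k1.toNat + n, by omega, by omega⟩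
  set m := min (k : ℤ) (min m1 0)
  obtain ⟨R, hR, hR'⟩ := exists_ball_reps (F := F) (show m ≤ k by omega)
  obtain ⟨-, h3⟩ := h1 k m (by omega) (by omega) (by omega) R hR hR'
  have hq := qC_ne_zero F
  refine ⟨R, fun s => ?_⟩
  set E := unipAvg ψ (rightReg _) R φ
  set c := (𝔮 ^ m)⁻¹ * whit ψ φ with hc
  have hc0 : c ≠ 0 := mul_ne_zero (inv_ne_zero (zpow_ne_zero _ hq)) h0
  have hB : BallFun (bigCell E) k m := by
    have := (ballFun_indicator (k := k) (m := m) (h := fun y : F => (ψ y : ℂ)) (by omega)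
      fun x _ t ht => hψ.add_ball x (ball_mono (by omega) ht)).const_mul c
    convert this using 2 with y
    exact h3 _
  have hFT : ∀ a : Fˣ, limFT ψ (bigCell E) a =
      c * if (a : F) - 1 ∈ ball F (-(k : ℤ)) then 𝔮 ^ (k : ℤ) else 0 := fun a => by
    have e := hψ.integral_ball (1 - (a : F)) k
    have e3 : ((1 - (a : F)) ∈ ball F (-(k : ℤ))) ↔ (a : F) - 1 ∈ ball F (-(k : ℤ)) := by
      rw [← neg_mem_iff, neg_sub]
    simp only [e3] at e
    rw [hB.limFT_eq, Garrett.fourier, ← e, ← integral_const_mul,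
      ← integral_indicator (measurableSet_ball _)]
    refine integral_congr_ae (.of_forall fun y => ?_)
    beta_reduce
    rw [h3]
    by_cases hy : y ∈ (ball F k : Set F)
    · rw [indicator_of_mem hy, indicator_of_mem hy, mul_assoc, ← psi_add]
      ring_nf
    simp_all
  set S : Set Fˣ := {a : Fˣ | (a : F) - 1 ∈ ball F (-(k : ℤ))} with hS
  have hSo : IsOpen S := (isClopen_ball (F := F) (-(k : ℤ))).2.preimage
    (show Continuous fun a : Fˣ => (a : F) - 1 from Units.continuous_val.sub continuous_const)
  have h1S : (1 : Fˣ) ∈ S := by simp_all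
  have hSl : S ⊆ {a : Fˣ | lv a = 0} := fun a ha => lv_eq_zero_of_sub_one_mem (by omega) ha
  have e : ∀ a : Fˣ, whit ψ (rightReg _ (tT a) E) * ((χ * absPow F (s - 1 / 2)) a : ℂ) =
      S.indicator (fun _ => c * 𝔮 ^ (k : ℤ)) a := fun a => by
    rw [whit_tT hψ (unipAvg_mem h R), hFT]
    by_cases ha : a ∈ S
    · have ha' : (a : F) - 1 ∈ ball F (-(k : ℤ)) := ha
      have e4 := congrArg Units.val ((hT.mono hk2) a (hSl ha) ha')
      rw [mul_apply, val_mul, val_one] at e4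
      rw [indicator_of_mem ha, if_pos ha', mul_absPow_unit χ _ a (hSl ha)]
      grind
    simp_all
  simp only [e]
  rw [integral_indicator hSo.measurableSet, setIntegral_const]
  have hv : 0 < haarFx F S := hSo.measure_pos _ ⟨1, h1S⟩
  have hv' : haarFx F S ≠ ⊤ := ((measure_mono hSl).trans_lt (by rw [haarFx_shell]; simp)).ne
  refine smul_ne_zero (ENNReal.toReal_pos hv.ne' hv').ne' (mul_ne_zero hc0 (zpow_ne_zero _ hq))

end Models

section GammaFactors

variable {μ ν ω χ : QuasiChar F} {φ φ' : GL₂(F) → ℂ} {V : Type*} [AddCommGroup V] [Module ℂ V]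
  {π : Representation ℂ (GL₂(F)) V}

/-! ### Gamma factors of quotients and subrepresentations -/

variable (ψ ϖ μ ν χ) in
/-- `R` represents the product of the gamma factors of `μχ` and `νχ`. -/
def RepresentsGamma (R : RatFunc ℂ) : Prop :=
  Represents F (rightF ⊔ leftF) (fun s => tateGamma ψ ϖ (μ * χ) s * tateGamma ψ ϖ (ν * χ) s) R

theorem gammaGL2_of_functional (hψ : HasOrderZero ψ) (hϖ : IsUniformizer (ϖ : F))
    (h𝒲 : ∀ W ∈ whittakerModel ψ π, ∃ φ ∈ psMod μ ν, ∀ g, W g = whit ψ (rightReg _ g φ))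
    (h : φ ∈ psMod μ ν) (h0 : whit ψ φ ≠ 0) {C : ℂ} (hC : C ≠ 0)
    (hE : ∀ R : Finset F, (fun g => C * whit ψ (rightReg _ g (unipAvg ψ (rightReg _) R φ))) ∈
      whittakerModel ψ π) :
    ∃ R, RepresentsGamma ψ ϖ μ ν χ R ∧ gammaGL2 ψ π (μ * ν) χ = evq F R := by
  obtain ⟨R1, h1⟩ := exists_represents_tateGamma (ψ := ψ) (ϖ := ϖ) (μ * χ)
  obtain ⟨R2, h2⟩ := exists_represents_tateGamma (ψ := ψ) (ϖ := ϖ) (ν * χ)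
  have hR := h1.mul le_rfl h2
  refine ⟨_, hR, gammaGL2_eq (isGammaGL2_of_ps hψ hϖ h𝒲 hR) ?_⟩
  obtain ⟨S, hS⟩ := exists_nonvanishing hψ h h0 χ
  refine ⟨_, hE S, Eventually.frequently (.of_forall fun s => ?_)⟩
  simp only [mul_assoc C]
  rw [integral_const_mul]
  simp_all

theorem centralChar_eq (hω : HasCentralChar π ω) {T : V → GL₂(F) → ℂ}
    (hT : ∀ v, T v ∈ psMod μ ν) (hTπ : ∀ g v, T (π g v) = rightReg _ g (T v))
    (hTs : ∀ (c : ℂ) v, T (c • v) = c • T v) {v : V} (hv : T v ≠ 0) : ω = μ * ν := by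
  ext z
  have h1 := hTπ (borel z z 0) v
  rw [hω, hTs] at h1
  have h2 : rightReg _ (borel z z 0) (T v) = ((μ * ν) z : ℂ) • T v := by
    ext g
    have e : g * borel z z 0 = borel z z 0 * g := by
      refine gl2_ext ?_ ?_ ?_ ?_ <;> simp [gl2_mul, mul_comm]
    rw [rightReg_apply, e, ps_apply (hT v), Pi.smul_apply, smul_eq_mul, mul_apply, val_mul]
    have h3 := halves_apply μ ν z z
    simp_all
  simp_all

theorem whit_add (hψ : HasOrderZero ψ) (h : φ ∈ psMod μ ν)
    (h' : φ' ∈ psMod μ ν) : whit ψ (φ + φ') = whit ψ φ + whit ψ φ' := by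
  have := limFT_add hψ h h' 1
  rwa [val_one] at this

theorem whit_smul (hψ : HasOrderZero ψ) (h : φ ∈ psMod μ ν) (c : ℂ) :
    whit ψ (c • φ) = c * whit ψ φ := by
  have := limFT_smul hψ h c 1
  rwa [val_one] at this

theorem IsQuotientOfPS.centralChar (h : IsQuotientOfPS π μ ν) (hω : HasCentralChar π ω) :
    ω = μ * ν := by
  obtain ⟨-, hinf, T, hT⟩ := h
  have : Nontrivial V := by
    by_contra hV
    rw [not_nontrivial_iff_subsingleton] at hV
    exact hinf inferInstance
  obtain ⟨v, hv⟩ := exists_ne (0 : V)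
  obtain ⟨φ, rfl⟩ := hT v
  ext z
  have h1 : T ((principalSeries μ ν).toRepresentation (borel z z 0) φ) = π (borel z z 0) (T φ) :=
    Representation.IntertwiningMap.isIntertwining _ _ T _ φ
  have h2 : (principalSeries μ ν).toRepresentation (borel z z 0) φ = ((μ * ν) z : ℂ) • φ := by
    refine Subtype.ext (funext fun g => ?_)
    change (φ : GL₂(F) → ℂ) (g * borel z z 0) = ((μ * ν) z : ℂ) * (φ : GL₂(F) → ℂ) g
    have e : g * borel z z 0 = borel z z 0 * g := by
      refine gl2_ext ?_ ?_ ?_ ?_ <;> simp [gl2_mul, mul_comm]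
    have h3 := halves_apply μ ν z z
    rw [div_self z.ne_zero] at h3
    simp only [norm_one, Real.one_rpow, Complex.ofReal_one, mul_one] at h3
    rw [e, ps_apply φ.2, ← h3, mul_apply, val_mul]
  rw [h2, hω] at h1
  simp_all

theorem IsQuotientOfPS.gammaGL2 (hψ : HasOrderZero ψ) (hϖ : IsUniformizer (ϖ : F))
    (h : IsQuotientOfPS π μ ν) {W : GL₂(F) → ℂ} (hW : W ∈ whittakerModel ψ π)
    {g : GL₂(F)} (hWg : W g ≠ 0) :
    ∃ R, RepresentsGamma ψ ϖ μ ν χ R ∧ gammaGL2 ψ π (μ * ν) χ = evq F R := by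
  obtain ⟨-, -, T, hT⟩ := h
  obtain ⟨l, hl, v, rfl⟩ := hW
  obtain ⟨φ, rfl⟩ := hT v
  obtain ⟨C, hC⟩ := whittakerModel_quotient hψ T hl
  refine gammaGL2_of_functional hψ hϖ ?_ (psOrd_mem μ ν) (by rw [whit_psOrd hψ]; simp)
    (C := C) ?_ fun R => ?_
  · rintro _ ⟨l', hl', v', rfl⟩
    obtain ⟨φ', rfl⟩ := hT v'
    obtain ⟨C', hC'⟩ := whittakerModel_quotient hψ T hl'
    refine ⟨C' • (φ' : GL₂(F) → ℂ), Submodule.smul_mem _ _ φ'.2, fun g => ?_⟩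
    rw [map_smul, whit_smul hψ (ps_translate φ'.2 g), ← hC']
  · grind
  · exact ⟨l, hl, T ⟨_, unipAvg_mem (psOrd_mem μ ν) R⟩,
      funext fun g => (hC ⟨_, unipAvg_mem (psOrd_mem μ ν) R⟩ g).symm⟩

theorem IsSubOfPS.centralChar (h : IsSubOfPS π μ ν) (hω : HasCentralChar π ω) : ω = μ * ν := by
  obtain ⟨-, hinf, T, hT⟩ := h
  have : Nontrivial V := by
    by_contra hV
    rw [not_nontrivial_iff_subsingleton] at hV
    exact hinf inferInstance
  obtain ⟨v, hv⟩ := exists_ne (0 : V)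
  refine centralChar_eq hω (T := fun v => (T v : GL₂(F) → ℂ)) (fun v => (T v).2)
    (fun g v => congrArg Subtype.val (Representation.IntertwiningMap.isIntertwining _ _ T g v))
    (fun c v => congrArg Subtype.val (map_smul T.toLinearMap c v)) (v := v) fun h0 => hv (hT ?_)
  simp_all

theorem IsSubOfPS.gammaGL2 (hψ : HasOrderZero ψ) (hϖ : IsUniformizer (ϖ : F))
    (h : IsSubOfPS π μ ν) :
    ∃ R, RepresentsGamma ψ ϖ μ ν χ R ∧ gammaGL2 ψ π (μ * ν) χ = evq F R := by
  obtain ⟨-, hinf, T, hT⟩ := h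
  set S : V →ₗ[ℂ] (GL₂(F) → ℂ) := (psMod μ ν).subtype ∘ₗ T.toLinearMap
  have hS : ∀ v, S v ∈ psMod μ ν := fun v => (T v).2
  have hSπ : ∀ g v, S (π g v) = rightReg _ g (S v) := fun g v =>
    congrArg Subtype.val (Representation.IntertwiningMap.isIntertwining _ _ T g v)
  have hSi : Function.Injective S := Subtype.val_injective.comp hT
  let l : V →ₗ[ℂ] ℂ :=
    { toFun := fun v => whit ψ (S v)
      map_add' := fun v w => by rw [map_add, whit_add hψ (hS v) (hS w)]
      map_smul' := fun c v => by rw [map_smul, whit_smul hψ (hS v)]; rfl }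
  have hl : ∀ (x : F) (v : V), l (π (nU x) v) = (ψ x : ℂ) * l v := fun x v => by
    change whit ψ (S _) = _ * whit ψ (S v)
    rw [hSπ, whit_nU hψ (hS v)]
  obtain ⟨v₀, hv₀⟩ : ∃ v, whit ψ (S v) ≠ 0 := by
    by_contra! h0
    apply hinf
    let e : V →ₗ[ℂ] ℂ :=
      { toFun := fun v => bigCell (S v) 0
        map_add' := fun v w => by rw [map_add]; rfl
        map_smul' := fun c v => by rw [map_smul]; rfl }
    refine FiniteDimensional.of_injective e ((injective_iff_map_eq_zero e).2 fun v hv => ?_)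
    have h1 : ∀ a : Fˣ, limFT ψ (bigCell (S v)) a = 0 := fun a => by
      have := h0 (π (tT a) v)
      rw [hSπ, whit_tT hψ (hS v)] at this
      simp_all
    refine hSi ?_
    rw [map_zero]
    exact ps_eq_zero (hS v) fun x => (bigCell_const_of_limFT hψ (hS v) h1 x).trans hv
  refine gammaGL2_of_functional hψ hϖ ?_ (hS v₀) hv₀ (C := 1) one_ne_zero fun R => ?_
  · rintro _ ⟨l', hl', v', rfl⟩
    refine ⟨(l' v₀ / whit ψ (S v₀)) • S v', Submodule.smul_mem _ _ (hS v'), fun g => ?_⟩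
    have := whittaker_functional_unique hψ hS hSπ hSi hl' (π g v') v₀
    rw [map_smul, whit_smul hψ (ps_translate (hS v') g), ← hSπ, div_mul_eq_mul_div, eq_div_iff hv₀,
      this]
  · refine ⟨l, hl, unipAvg ψ π R v₀, funext fun g => ?_⟩
    rw [one_mul]
    change _ = whit ψ (S _)
    rw [hSπ]
    congr 2
    simp only [unipAvg, map_sum, map_smul, hSπ]

end GammaFactors

section Averaging

/-! ### Averaging over compact open subgroups -/

theorem exists_average {G : Type*} [Group G] [TopologicalSpace G] [IsTopologicalGroup G]
    {V : Type*} [AddCommGroup V] [Module ℂ V] (ρ : Representation ℂ G V) {K : Subgroup G}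
    (hK : IsCompact (K : Set G)) {v : V} {U : Subgroup G} (hU : IsOpen (U : Set G))
    (hv : ∀ k ∈ U, ρ k v = v) : ∃ (n : ℕ) (k : Fin n → G), n ≠ 0 ∧ (∀ i, k i ∈ K) ∧
      ∀ g ∈ K, ρ g (∑ i, ρ (k i) v) = ∑ i, ρ (k i) v := by
  have : CompactSpace K := isCompact_iff_compactSpace.1 hK
  have hU' : IsOpen ((U.subgroupOf K : Subgroup K) : Set K) := hU.preimage continuous_subtype_val
  have : Finite (K ⧸ U.subgroupOf K) := Subgroup.quotient_finite_of_isOpen _ hU'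
  have := Fintype.ofFinite (K ⧸ U.subgroupOf K)
  let e := (Fintype.equivFin (K ⧸ U.subgroupOf K)).symm
  have hout : ∀ g : K, ρ ((Quotient.out (QuotientGroup.mk g : K ⧸ U.subgroupOf K) : K) : G) v =
      ρ (g : G) v := fun g => by
    obtain ⟨u, hu⟩ := QuotientGroup.mk_out_eq_mul (U.subgroupOf K) g
    rw [hu, Subgroup.coe_mul, map_mul, Module.End.mul_apply, hv _ (Subgroup.mem_subgroupOf.1 u.2)]
  refine ⟨_, fun i => ((Quotient.out (e i) : K) : G), Fintype.card_ne_zero, fun i => Subtype.prop _,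
    fun g hg => ?_⟩
  rw [Equiv.sum_comp e fun x => ρ ((Quotient.out x : K) : G) v, map_sum]
  refine Eq.trans ?_ (Equiv.sum_comp (MulAction.toPerm (⟨g, hg⟩ : K))
    fun x : K ⧸ U.subgroupOf K => ρ ((Quotient.out x : K) : G) v)
  refine sum_congr rfl fun x _ => ?_
  induction x using QuotientGroup.induction_on with
  | H x =>
    simp_all

end Averaging

section Contragredient

variable {μ ν ω χ : QuasiChar F} {φ φ' : GL₂(F) → ℂ} {V : Type*} [AddCommGroup V] [Module ℂ V]
  {π : Representation ℂ (GL₂(F)) V}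

theorem exists_compact_subgroup {U : Subgroup (GL₂(F))}
    (hU : IsOpen (U : Set (GL₂(F)))) : ∃ K : Subgroup (GL₂(F)), K ≤ U ∧
      IsOpen (K : Set (GL₂(F))) ∧ IsCompact (K : Set (GL₂(F))) := by
  let C : Set (M₂(F)) := Set.univ.pi fun _ => Set.univ.pi fun _ => (ball F 0 : Set F)
  have hCc : IsCompact C := isCompact_univ_pi fun _ => isCompact_univ_pi fun _ => isCompact_ball 0
  have hCo : IsOpen C := isOpen_set_pi Set.finite_univ fun _ _ =>
    isOpen_set_pi Set.finite_univ fun _ _ => (isClopen_ball (F := F) 0).2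
  have hC : ∀ M : M₂(F), M ∈ C ↔ ∀ i j, M i j ∈ ball F 0 := fun M =>
    ⟨fun h i j => h i trivial j trivial, fun h i _ j _ => h i j⟩
  have hCmul : ∀ M ∈ C, ∀ M' ∈ C, M * M' ∈ C := fun M hM M' hM' => by
    rw [hC] at *
    intro i j
    rw [Matrix.mul_apply]
    exact sum_mem fun k _ => by simpa using mul_mem_ball (hM i k) (hM' k j)
  have h1 : (1 : M₂(F)) ∈ C := by
    rw [hC]
    intro i j
    rw [Matrix.one_apply]
    split_ifs
    · rw [← val_one, units_mem_ball, lv_one]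
    simp
  let K₀ : Subgroup (GL₂(F)) :=
    { carrier := {k | (k : M₂(F)) ∈ C ∧ ((k⁻¹ : GL₂(F)) : M₂(F)) ∈ C}
      one_mem' := by simp_all
      mul_mem' := fun {a b} ha hb => ⟨hCmul _ ha.1 _ hb.1, by simp_all⟩
      inv_mem' := fun {a} ha => ⟨ha.2, by simp_all⟩ }
  have hK₀ : (K₀ : Set (GL₂(F))) =
      Units.embedProduct (M₂(F)) ⁻¹' (C ×ˢ (MulOpposite.unop ⁻¹' C)) := rfl
  have hK₀o : IsOpen (K₀ : Set (GL₂(F))) := by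
    rw [hK₀]
    exact (hCo.prod (hCo.preimage MulOpposite.continuous_unop)).preimage
      Units.continuous_embedProduct
  have : T1Space (M₂(F)) := inferInstanceAs (T1Space (Fin 2 → Fin 2 → F))
  have hK₀c : IsCompact (K₀ : Set (GL₂(F))) := by
    rw [hK₀]
    refine Units.isClosedEmbedding_embedProduct.isCompact_preimage (hCc.prod ?_)
    exact MulOpposite.opHomeomorph.symm.isClosedEmbedding.isCompact_preimage hCc
  exact ⟨U ⊓ K₀, inf_le_left, hU.inter hK₀o, hK₀c.inter_left (U.isClosed_of_isOpen hU)⟩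

/-! ### The invariant functional -/

variable (F) in
/-- The functions on which integration over the big cell is an invariant functional. -/
abbrev modularPS : Submodule ℂ (GL₂(F) → ℂ) := psMod (absPow F (1 / 2)) (absPow F (-(1 / 2)))

theorem modularPS_up (a : Fˣ) : (upHalf (absPow F (1 / 2)) a : ℂ) = ‖(a : F)‖ := by
  rw [upHalf, ← absPow_add, add_halves, absPow_one_apply]

theorem modularPS_down (a : Fˣ) : (downHalf (absPow F (-(1 / 2))) a : ℂ) = (‖(a : F)‖ : ℂ)⁻¹ := by
  have h : downHalf (absPow F (-(1 / 2))) = (absPow F 1)⁻¹ := by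
    rw [downHalf, ← absPow_add, ← absPow_neg]; grind
  rw [h, qc_inv, val_inv_eq_inv_val, absPow_one_apply]

theorem mul_mem_modularPS (h' : φ' ∈ psMod μ⁻¹ ν⁻¹) (h : φ ∈ psMod μ ν) : φ' * φ ∈ modularPS F := by
  obtain ⟨⟨U', hU', hf'⟩, he'⟩ := mem_ps_iff.1 h'
  obtain ⟨⟨U, hU, hf⟩, he⟩ := mem_ps_iff.1 h
  refine mem_ps_iff.2 ⟨⟨U' ⊓ U, hU'.inter hU, fun k hk g => ?_⟩, fun a d b g => ?_⟩
  · simp_all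
  · have h1 := (μ a).ne_zero
    have h2 := (ν d).ne_zero
    have h3 : ∀ (χ : 𝓧) (a : Fˣ), (upHalf χ⁻¹ a : ℂ) * upHalf χ a = ‖(a : F)‖ ∧
        (downHalf χ⁻¹ a : ℂ) * downHalf χ a = (‖(a : F)‖ : ℂ)⁻¹ := fun χ a => by
      have := (χ a).ne_zero
      have e := modularPS_up a
      have e' := modularPS_down a
      simp only [upHalf, downHalf, mul_apply, val_mul, qc_inv, val_inv_eq_inv_val] at e e' ⊢
      grind
    rw [Pi.mul_apply, Pi.mul_apply, he', he, modularPS_up, modularPS_down, ← (h3 μ a).1,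
      ← (h3 ν d).2]
    ring

theorem modularPS_eta (u : Fˣ) : (etaChar (absPow F (1 / 2)) (absPow F (-(1 / 2))) u : ℂ) =
    (‖(u : F)‖ : ℂ)⁻¹ * (‖(u : F)‖ : ℂ)⁻¹ := by
  rw [etaChar, mul_apply, val_mul, qc_inv, val_inv_eq_inv_val, modularPS_up, modularPS_down]

theorem integrable_modularPS (h : φ ∈ modularPS F) : Integrable (bigCell φ) (haarF F) := by
  obtain ⟨m, N, -, hA⟩ := ps_asymp h
  have h1 : Integrable ((ball F N : Set F).indicator (bigCell φ)) (haarF F) :=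
    (integrable_indicator_iff (measurableSet_ball N)).2
      (hA.continuous.continuousOn.integrableOn_compact (isCompact_ball N))
  have h2 : Integrable ((ball F N : Set F)ᶜ.indicator (bigCell φ)) (haarF F) := by
    rw [integrable_haarF]
    have h3 := (integrableOn_char_mul' (χ := absPow F (-1)) (by
      rw [absAt_absPow]; simp [one_lt_q F]) (N + 1) (g := fun _ => φ 1)
      measurable_const (C := ‖φ 1‖) fun _ => le_rfl)
    replace h3 := (integrable_indicator_iff (measurableSet_lv (Set.Ici (N + 1)))).2 h3
    refine h3.congr (.of_forall fun u => ?_)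
    beta_reduce
    by_cases hu : N < lv u
    · rw [indicator_of_mem (show u ∈ {a : Fˣ | lv a ∈ Set.Ici (N + 1)} by exact hu),
        indicator_of_mem (show (u : F) ∈ (ball F N : Set F)ᶜ by
          simpa [units_mem_ball] using hu), hA.asymp u hu, modularPS_eta, absPow_neg,
        qc_inv, val_inv_eq_inv_val, absPow_one_apply, real_smul]
      grind
    · rw [indicator_of_notMem (show u ∉ {a : Fˣ | lv a ∈ Set.Ici (N + 1)} by exact hu),
        indicator_of_notMem (show (u : F) ∉ (ball F N : Set F)ᶜ by
          simpa [units_mem_ball] using hu), smul_zero]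
  refine (h1.add h2).congr (.of_forall fun x => ?_)
  simp

theorem integral_bigCell_translate (h : φ ∈ modularPS F) (g : GL₂(F)) :
    ∫ x, bigCell (rightReg _ g φ) x ∂haarF F = ∫ x, bigCell φ x ∂haarF F := by
  have hB : ∀ φ ∈ modularPS F, ∀ (a d : Fˣ) (b : F),
      ∫ x, bigCell (rightReg _ (borel a d b) φ) x ∂haarF F = ∫ x, bigCell φ x ∂haarF F := by
    intro φ h a d b
    have e : ∀ y : F, (b + y * d) * ((a⁻¹ : Fˣ) : F) =
        ((d * a⁻¹ : Fˣ) : F) * (y + b * ((d⁻¹ : Fˣ) : F)) := fun y => by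
      rw [val_mul]
      have := d.mul_inv
      grind
    simp only [bigCell_borel h, modularPS_up, modularPS_down, e]
    rw [integral_const_mul, integral_add_right_eq_self
      (fun y => bigCell φ (((d * a⁻¹ : Fˣ) : F) * y)) (b * ((d⁻¹ : Fˣ) : F)),
      integral_mul_haarF (E := ℂ), real_smul]
    have h1 : (‖(a : F)‖ : ℂ) ≠ 0 := by simp
    have h2 : (‖(d : F)‖ : ℂ) ≠ 0 := by simp
    rw [val_mul, norm_mul, val_inv_eq_inv_val, norm_inv]
    push_cast
    field_simp
  have hJ : ∀ φ ∈ modularPS F,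
      ∫ x, bigCell (rightReg _ (J1 F)⁻¹ φ) x ∂haarF F = ∫ x, bigCell φ x ∂haarF F := by
    intro φ h
    rw [integral_haarF (E := ℂ), integral_haarF (E := ℂ)]
    congr 1
    refine Eq.trans ?_ (integral_inv_haarFx fun u : Fˣ => ‖(u : F)‖ • bigCell φ u)
    refine integral_congr_ae (.of_forall fun u => ?_)
    beta_reduce
    have h1 : (‖(u : F)‖ : ℂ) ≠ 0 := by simp
    rw [bigCell_J1_inv h, modularPS_eta, modularPS_up, modularPS_down, real_smul,
      real_smul, val_inv_eq_inv_val, norm_inv]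
    simp only [Units.val_neg, val_one, norm_neg, norm_one]
    push_cast
    field_simp
  have hJ' : ∀ φ ∈ modularPS F,
      ∫ x, bigCell (rightReg _ (J1 F) φ) x ∂haarF F = ∫ x, bigCell φ x ∂haarF F := by
    intro φ h
    rw [← hJ _ (ps_translate h _), ← rightReg_mul, inv_mul_cancel, map_one]; rfl
  by_cases hg : g 1 0 = 0
  · obtain ⟨a, d, e⟩ := eq_borel hg
    grind
  · rw [bruhat (c := mk0 _ hg) rfl, rightReg_mul, rightReg_mul,
      hB _ (ps_translate (ps_translate h _) _), hJ' _ (ps_translate h _), nU, hB φ h]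

/-! ### The contragredient of a subrepresentation -/

/-- The invariant pairing between `I(μ⁻¹, ν⁻¹)` and `I(μ, ν)`. -/
def psPairing (φ' φ : GL₂(F) → ℂ) : ℂ := ∫ x, bigCell φ' x * bigCell φ x ∂haarF F

theorem psPairing_translate (h' : φ' ∈ psMod μ⁻¹ ν⁻¹) (h : φ ∈ psMod μ ν) (g : GL₂(F)) :
    psPairing (rightReg _ g φ') φ = psPairing φ' (rightReg _ g⁻¹ φ) := by
  have := integral_bigCell_translate (mul_mem_modularPS h' (ps_translate h g⁻¹)) g
  have e : rightReg _ g (φ' * rightReg _ g⁻¹ φ) = rightReg _ g φ' * φ := by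
    ext x
    simp only [Pi.mul_apply, rightReg_apply, mul_inv_cancel_right]
  rw [e] at this
  simpa only [psPairing, bigCell, Pi.mul_apply] using this

theorem integrable_psPairing (h' : φ' ∈ psMod μ⁻¹ ν⁻¹) (h : φ ∈ psMod μ ν) :
    Integrable (fun x => bigCell φ' x * bigCell φ x) (haarF F) :=
  (integrable_modularPS (mul_mem_modularPS h' h)).congr (.of_forall fun _ => rfl)

theorem exists_psPairing_ne_zero (h : φ ∈ psMod μ ν) (h0 : φ ≠ 0) :
    ∃ φ' ∈ psMod μ⁻¹ ν⁻¹, psPairing φ' φ ≠ 0 := by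
  obtain ⟨x₀, hx₀⟩ : ∃ x, bigCell φ x ≠ 0 := by
    by_contra! h1
    exact h0 (ps_eq_zero h h1)
  obtain ⟨m, N, -, hA⟩ := ps_asymp h
  set a : Fˣ := unif F ^ (-m) with ha
  have hla : lv a = m := by rw [ha, lv_unif_zpow, neg_neg]
  refine ⟨_, ps_translate (psOrd_mem μ⁻¹ ν⁻¹) (borel a 1 (-x₀)), ?_⟩
  set c : ℂ := (upHalf μ⁻¹ 1 : ℂ) * (downHalf ν⁻¹ a : ℂ)
  have hc : c ≠ 0 := mul_ne_zero (Units.ne_zero _) (Units.ne_zero _)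
  have e : ∀ y, bigCell (rightReg _ (borel a 1 (-x₀)) (psOrd μ⁻¹ ν⁻¹)) (y + x₀) *
      bigCell φ (y + x₀) =
      (ball F m : Set F).indicator (fun _ => c * bigCell φ x₀) y := fun y => by
    rw [bigCell_borel (psOrd_mem _ _), bigCell_psOrd, val_one, mul_one, neg_add_cancel_comm_assoc]
    have h1 : y * ((a⁻¹ : Fˣ) : F) ∈ ball F 0 ↔ y ∈ ball F m := by
      rw [mul_comm, unit_mul_mem_ball, lv_inv, hla, sub_neg_eq_add, zero_add]
    by_cases hy : y ∈ ball F m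
    · rw [indicator_of_mem (h1.2 hy), indicator_of_mem (show y ∈ (ball F m : Set F) from hy),
        mul_one, add_comm y, hA.inv _ _ hy]
    simp_all
  rw [psPairing, ← integral_add_right_eq_self _ x₀]
  simp only [e]
  rw [integral_indicator (measurableSet_ball _), setIntegral_const, haarF_real_ball]
  exact smul_ne_zero (zpow_ne_zero _ (q_ne_zero F)) (mul_ne_zero hc hx₀)

theorem finiteDimensional_invariants {U : Subgroup (GL₂(F))}
    (hU : IsOpen (U : Set (GL₂(F)))) {X : Type*} [AddCommGroup X] [Module ℂ X]
    {S : X →ₗ[ℂ] (GL₂(F) → ℂ)} (hS : Function.Injective S)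
    (hps : ∀ x, S x ∈ psMod μ ν)
    (hinv : ∀ x, ∀ k ∈ U, ∀ g, S x (g * k) = S x g) : FiniteDimensional ℂ X := by
  obtain ⟨m, N, hmN, hA⟩ := exists_asymp μ ν hU
  obtain ⟨R, -, hR⟩ := exists_ball_reps (F := F) (show m ≤ N + 1 by omega)
  let e : X →ₗ[ℂ] (R → ℂ) :=
    { toFun := fun x r => bigCell (S x) r
      map_add' := fun x y => by ext r; rw [map_add]; rfl
      map_smul' := fun c x => by ext r; rw [map_smul]; rfl }
  refine FiniteDimensional.of_injective e ((injective_iff_map_eq_zero e).2 fun x hx => ?_)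
  have hx' := hA _ (hps x) (hinv x)
  have h1 : ∀ y ∈ ball F (N + 1), bigCell (S x) y = 0 := fun y hy => by
    obtain ⟨r, ⟨hr, hyr⟩, -⟩ := hR y hy
    rw [← add_sub_cancel r y, hx'.inv _ _ hyr]
    exact congrFun hx ⟨r, hr⟩
  have h2 : S x 1 = 0 := by
    have hl : lv (unif F ^ (-(N + 1))) = N + 1 := by rw [lv_unif_zpow, neg_neg]
    have h3 := hx'.asymp (unif F ^ (-(N + 1))) (by omega)
    rw [h1 _ (units_mem_ball.2 hl.le), eq_comm, mul_eq_zero] at h3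
    exact h3.resolve_right (Units.ne_zero _)
  apply hS
  rw [map_zero]
  refine ps_eq_zero (hps x) fun y => ?_
  by_cases hy : y ∈ ball F (N + 1)
  · grind
  · have hy0 : y ≠ 0 := by rintro rfl; simp_all
    have h4 := hx'.asymp (mk0 y hy0) (by
      have := mt (units_mem_ball (u := mk0 y hy0)).2 hy
      omega)
    simp_all

theorem IsSubOfPS.exists_contragredient_map (h : IsSubOfPS π μ ν) :
    ∃ T : Representation.IntertwiningMap (principalSeries μ⁻¹ ν⁻¹).toRepresentation
      (contragredient π).toRepresentation, Function.Surjective T := by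
  obtain ⟨-, -, T, hT⟩ := h
  set S : V →ₗ[ℂ] (GL₂(F) → ℂ) := (psMod μ ν).subtype ∘ₗ T.toLinearMap
  have hS : ∀ v, S v ∈ psMod μ ν := fun v => (T v).2
  have hSπ : ∀ g v, S (π g v) = rightReg _ g (S v) := fun g v =>
    congrArg Subtype.val (Representation.IntertwiningMap.isIntertwining _ _ T g v)
  have hSi : Function.Injective S := Subtype.val_injective.comp hT
  let P : (principalSeries (F := F) μ⁻¹ ν⁻¹).toSubmodule →ₗ[ℂ] Module.Dual ℂ V :=
    { toFun := fun φ' =>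
        { toFun := fun v => psPairing φ' (S v)
          map_add' := fun v w => by
            simp only [map_add, psPairing, ← integral_add (integrable_psPairing φ'.2 (hS v))
              (integrable_psPairing φ'.2 (hS w)), ← mul_add]
            rfl
          map_smul' := fun c v => by
            rw [map_smul, psPairing, psPairing, smul_eq_mul, ← integral_const_mul]
            exact integral_congr_ae (.of_forall fun x => mul_left_comm _ _ _) }
      map_add' := fun φ₁ φ₂ => by
        ext v
        change psPairing _ _ = psPairing _ _ + psPairing _ _
        simp only [psPairing, ← integral_add (integrable_psPairing φ₁.2 (hS v))
          (integrable_psPairing φ₂.2 (hS v)), ← add_mul]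
        rfl
      map_smul' := fun c φ₁ => by
        ext v
        change psPairing _ _ = c * psPairing _ _
        rw [psPairing, psPairing, ← integral_const_mul]
        exact integral_congr_ae (.of_forall fun x => mul_assoc _ _ _) }
  have hPπ : ∀ g φ', P ((principalSeries μ⁻¹ ν⁻¹).toRepresentation g φ') = π.dual g (P φ') := by
    intro g φ'
    ext v
    change psPairing (rightReg _ g φ') (S v) = psPairing φ' (S (π g⁻¹ v))
    rw [psPairing_translate φ'.2 (hS v), hSπ]
  have hPmem : ∀ φ', P φ' ∈ (contragredient π).toSubmodule := fun φ' => by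
    obtain ⟨U, hU, hinv⟩ := (mem_ps_iff.1 φ'.2).1
    refine ⟨U, hU, fun k hk => ?_⟩
    rw [← hPπ]
    congr 1
    exact Subtype.ext (funext fun g => hinv k hk g)
  refine ⟨⟨P.codRestrict _ hPmem, fun g => ?_⟩, ?_⟩
  · ext φ' : 1
    exact Subtype.ext (hPπ g φ')
  rintro ⟨l, U, hU, hl⟩
  obtain ⟨K, hKU, hKo, hKc⟩ := exists_compact_subgroup hU
  have hlK : ∀ k ∈ K, ∀ v, l (π k v) = l v := fun k hk v => by
    have := LinearMap.congr_fun (hl k⁻¹ (hKU (K.inv_mem hk))) v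
    change l (π (k⁻¹)⁻¹ v) = l v at this
    simp_all
  let X : Submodule ℂ V := ⨅ k : K, LinearMap.ker (π k - LinearMap.id)
  have hX : ∀ v, v ∈ X ↔ ∀ k ∈ K, π k v = v := fun v => by
    simp only [X, Submodule.mem_iInf, LinearMap.mem_ker, LinearMap.sub_apply, LinearMap.id_apply,
      sub_eq_zero, Subtype.forall]
  have : FiniteDimensional ℂ X := finiteDimensional_invariants hKo (S := S ∘ₗ X.subtype)
    (hSi.comp Subtype.val_injective) (fun x => hS x) fun x k hk g => by
      change S x (g * k) = S x g
      conv_rhs => rw [← (hX x).1 x.2 k hk, hSπ]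
      rfl
  let Y : Submodule ℂ (Module.Dual ℂ X) := LinearMap.range (X.subtype.dualMap ∘ₗ P)
  have hY : Y.dualCoannihilator = ⊥ := by
    rw [eq_bot_iff]
    intro x hx
    rw [Submodule.mem_dualCoannihilator] at hx
    by_contra hx0
    have hx0' : S x ≠ 0 := fun h0 => hx0 (by simp_all)
    obtain ⟨φ', hφ', hne⟩ := exists_psPairing_ne_zero (hS x) hx0'
    exact hne (hx _ ⟨⟨φ', hφ'⟩, rfl⟩)
  have hYtop : Y = ⊤ := by
    have := Subspace.dualCoannihilator_dualAnnihilator_eq (W := Y)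
    simp_all
  obtain ⟨φ₀, hφ₀⟩ : X.subtype.dualMap l ∈ Y := by simp_all
  have hφ₀' : ∀ v ∈ X, P φ₀ v = l v := fun v hv => LinearMap.congr_fun hφ₀ ⟨v, hv⟩
  obtain ⟨U', hU', hinv'⟩ := (mem_ps_iff.1 φ₀.2).1
  obtain ⟨n, k, hn, hkK, hk⟩ := exists_average (principalSeries μ⁻¹ ν⁻¹).toRepresentation hKc hU'
    (v := φ₀) fun k hk => Subtype.ext (funext fun g => hinv' k hk g)
  set φ₁ := ∑ i, (principalSeries μ⁻¹ ν⁻¹).toRepresentation (k i) φ₀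
  have hn' : (n : ℂ) ≠ 0 := Nat.cast_ne_zero.2 hn
  have h1 : ∀ v ∈ X, P φ₁ v = n * l v := fun v hv => by
    rw [map_sum, LinearMap.sum_apply]
    have : ∀ i, P ((principalSeries μ⁻¹ ν⁻¹).toRepresentation (k i) φ₀) v = l v := fun i => by
      rw [hPπ]
      change P φ₀ (π (k i)⁻¹ v) = l v
      rw [(hX v).1 hv _ (K.inv_mem (hkK i)), hφ₀' v hv]
    simp only [this, Finset.sum_const, Finset.card_univ, Fintype.card_fin, nsmul_eq_mul]
  have h2 : ∀ g ∈ K, ∀ v, P φ₁ (π g v) = P φ₁ v := fun g hg v => by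
    have := LinearMap.congr_fun (hPπ g⁻¹ φ₁) v
    change _ = P φ₁ (π (g⁻¹)⁻¹ v) at this
    rw [hk _ (K.inv_mem hg), inv_inv] at this
    exact this.symm
  refine ⟨(n : ℂ)⁻¹ • φ₁, Subtype.ext (LinearMap.ext fun v => ?_)⟩
  change P ((n : ℂ)⁻¹ • φ₁) v = l v
  obtain ⟨U₂, hU₂, hinv₂⟩ := (mem_ps_iff.1 (hS v)).1
  obtain ⟨n₂, k₂, hn₂, hkK₂, hk₂⟩ := exists_average π hKc hU₂ (v := v) fun k hk => hSi (by
    rw [hSπ]; exact funext fun g => hinv₂ k hk g)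
  have h3 := h1 _ ((hX _).2 hk₂)
  rw [map_sum (P φ₁), map_sum l, sum_congr rfl fun i _ => h2 _ (hkK₂ i) v,
    sum_congr rfl fun i _ => hlK _ (hkK₂ i) v] at h3
  simp only [Finset.sum_const, Finset.card_univ, Fintype.card_fin, nsmul_eq_mul] at h3
  have hn₂' : (n₂ : ℂ) ≠ 0 := Nat.cast_ne_zero.2 hn₂
  rw [map_smul, LinearMap.smul_apply, smul_eq_mul, inv_mul_eq_iff_eq_mul₀ hn']
  refine mul_left_cancel₀ hn₂' ?_
  linear_combination h3

/-- The ordinary vector in the Whittaker model of the contragredient of a subrepresentation. -/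
theorem IsSubOfPS.ordinary_eq_whit (hψ : HasOrderZero ψ) (h : IsSubOfPS π μ ν)
    {W : GL₂(F) → ℂ} (hW : W ∈ whittakerModel ψ (contragredient π).toRepresentation)
    (hW' : ∀ a, W (tT a) = ordKirillov ν⁻¹ a) (g : GL₂(F)) :
    W g = whit ψ (rightReg _ g (psOrd μ⁻¹ ν⁻¹)) := by
  obtain ⟨T, hT⟩ := h.exists_contragredient_map
  exact Garrett.ordinary_eq_whit hψ T hT hW hW' g

end Contragredient

section Automorphism

/-- An automorphism of a locally compact group which preserves a compact open set preserves the
Haar measure. -/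
theorem measurePreserving_mulEquiv {G : Type*} [Group G] [TopologicalSpace G]
    [IsTopologicalGroup G] [MeasurableSpace G] [BorelSpace G] [LocallyCompactSpace G]
    [SecondCountableTopology G] (m : Measure G) [m.IsHaarMeasure] (e : G ≃* G) (he : Continuous e)
    (he' : Continuous e.symm) {K : Set G} (hKo : IsOpen K) (hKc : IsCompact K) (hK1 : K.Nonempty)
    (heK : e ⁻¹' K = K) : MeasurePreserving e m m := by
  refine ⟨he.measurable, ?_⟩
  have := MulEquiv.isHaarMeasure_map m e he he'
  have h1 := Measure.isMulLeftInvariant_eq_smul (m.map e) m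
  set c := (m.map e).haarScalarFactor m
  have h2 : m.map e K = m K := by rw [Measure.map_apply he.measurable hKo.measurableSet, heK]
  rw [h1, Measure.smul_apply] at h2
  have h3 : (c : ENNReal) * m K = 1 * m K := by simp_all
  have h4 : (c : ENNReal) = 1 :=
    (ENNReal.mul_left_inj (hKo.measure_pos m hK1).ne' hKc.measure_lt_top.ne).1 h3
  simp_all

end Automorphism

section Kernel

variable {μ ν χ ξ : QuasiChar F} {n : ℕ}

/-! ### The Mellin transform of the Fourier transform of `φ_ξ` -/

theorem fourier_unitPart_ballFun (hψ : HasOrderZero ψ) (hn : 1 ≤ n) (hχ : TrivialMod χ n) :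
    BallFun (fourier ψ (unitPart χ)) n 0 := by
  have := (ballFun_unitPart hn hχ).fourier hψ
  simpa using this

theorem mellin_fourier_unitPart (hψ : HasOrderZero ψ) (hϖ : IsUniformizer (ϖ : F)) (hn : 1 ≤ n)
    (hT : TrivialMod χ n) (hχ : ∀ u : Fˣ, lv u = 0 → χ u = ξ u) (hξ : absAt ξ < 1) :
    Integrable (fun a : Fˣ => (ξ a : ℂ) * fourier ψ (unitPart χ) a) (haarFx F) ∧
    ∫ a : Fˣ, (ξ a : ℂ) * fourier ψ (unitPart χ) a ∂haarFx F =
      (ξ (-1) : ℂ) * (tateGamma ψ ϖ ξ 0)⁻¹ := by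
  have hB := ballFun_unitPart hn hT
  obtain ⟨h1, h2⟩ := (hB.asymp 1).mellin_limFT hψ hϖ (unitPart_zero χ) hξ (Or.inl rfl)
  have h3 : ∫ y : Fˣ, unitPart χ y * ((absPow F 1 * ξ⁻¹) y : ℂ) ∂haarFx F = 1 := by
    have e : ∀ y : Fˣ, unitPart χ y * ((absPow F 1 * ξ⁻¹) y : ℂ) =
        {y : Fˣ | lv y = 0}.indicator (fun _ => 1) y := fun y => by
      by_cases hy : lv y = 0
      · rw [indicator_of_mem (show y ∈ {y : Fˣ | lv y = 0} from hy), unitPart_units, if_pos hy,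
          hχ y hy, mul_apply, qc_inv, val_mul,
          absPow_one_apply, (norm_eq_one_iff y).2 hy, Complex.ofReal_one, one_mul, Units.mul_inv]
      · rw [indicator_of_notMem (show y ∉ {y : Fˣ | lv y = 0} from hy), unitPart_units,
          if_neg hy, zero_mul]
    simp only [e]
    rw [integral_indicator (measurableSet_lv_eq 0), setIntegral_const, Measure.real, haarFx_shell]
    simp
  have e : ∀ a : Fˣ, (ξ a : ℂ) * fourier ψ (unitPart χ) a =
      (ξ (-1) : ℂ) * (limFT ψ (unitPart χ) ((-1 * a : Fˣ) : F) * (ξ (-1 * a) : ℂ)) := fun a => by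
    rw [hB.limFT_eq, map_mul ξ, val_mul (ξ (-1))]
    have : -((-1 * a : Fˣ) : F) = a := by simp
    rw [this]
    linear_combination (-((ξ a : ℂ) * fourier ψ (unitPart χ) a)) * neg_one_mul_self ξ
  simp only [e]
  constructor
  · exact (h1.comp_mul_left (-1)).const_mul _
  · rw [integral_const_mul, integral_mul_left_eq_self
      (fun a : Fˣ => limFT ψ (unitPart χ) a * (ξ a : ℂ)) (-1), h2, h3, mul_one]

theorem gauss_integral_pos (hψ : HasOrderZero ψ) (hϖ : IsUniformizer (ϖ : F))
    (hχ : absAt χ < 1) (hn : 1 ≤ n) (hT : TrivialMod χ n) :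
    ∫ a in {a : Fˣ | lv a ≤ n}, (χ a : ℂ) * (ψ (a : F) : ℂ) ∂haarFx F =
      (χ (-1) : ℂ) * ((volUnits F : ℂ)⁻¹ * (tateGamma ψ ϖ χ 0)⁻¹) := by
  rw [← gauss_integral hψ hϖ hχ hn hT, ← integral_const_mul,
    ← setIntegral_mul_left (E := ℂ) (-1) (fun a : Fˣ => (χ a : ℂ) * (ψ (a : F) : ℂ))
      (measurableSet_lv_le n) (measurableSet_lv_le n) fun a => by
        simp only [neg_mul, one_mul, mem_ofPred_eq, lv_neg]]
  refine setIntegral_congr_fun (measurableSet_lv_le n) fun a _ => ?_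
  rw [map_mul χ, val_mul (χ (-1)), mul_assoc, neg_mul, one_mul, Units.val_neg]

/-! ### The ordinary Whittaker function on the lower unipotent elements -/

variable (ψ μ ν) in
/-- The values `W(𝐭(-Xv) 𝐧⁻(v))` of the ordinary Whittaker function, normalized. -/
def ordKernel (X v : Fˣ) : ℂ :=
  whit ψ (rightReg _ (tT (-(X * v)) * nL (v : F)) (psOrd μ ν)) * (upHalf ν (-(X * v)) : ℂ)⁻¹

theorem ordKernel_small (hψ : HasOrderZero ψ) (hn : 1 ≤ n) (hμ : TrivialMod μ n)
    (hν : TrivialMod ν n) (X : Fˣ) {v : Fˣ} (hv : lv v ≤ -(n : ℤ)) :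
    ordKernel ψ μ ν X v = if lv X + lv v ≤ 0 then 1 else 0 := by
  have e : rightReg _ (tT (-(X * v)) * nL (v : F)) (psOrd μ ν) =
      rightReg _ (tT (-(X * v))) (psOrd μ ν) := by
    ext g
    rw [rightReg_apply, rightReg_apply, ← mul_assoc, psOrd_mul_nL hn hμ hν (units_mem_ball.2 hv)]
  rw [ordKernel, e, whit_tT hψ (psOrd_mem μ ν), limFT_psOrd hψ, lv_neg, lv_mul, mul_right_comm,
    mul_inv_cancel₀ (Units.ne_zero _), one_mul]

open Classical in
theorem ordKernel_large (hψ : HasOrderZero ψ) (hn : 1 ≤ n) (hμ : TrivialMod μ n)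
    (hν : TrivialMod ν n) (X : Fˣ) {v : Fˣ} (hv : -(n : ℤ) < lv v) :
    (ψ (X : F) : ℂ) * ordKernel ψ μ ν X v =
      (volUnits F : ℂ) * (‖(v : F)‖ : ℂ)⁻¹ * ((μ * ν⁻¹) X : ℂ) *
        ∫ z in {z : Fˣ | lv z ≤ n}, if ((X * z⁻¹ : Fˣ) : F) - 1 ∈ ball F (lv v)
          then ((μ⁻¹ * ν) z : ℂ) * (ψ (z : F) : ℂ) else 0 ∂haarFx F := by
  set b : Fˣ := -(X * v) with hb
  obtain ⟨M₀, hM₀⟩ := ps_limFT hψ (ps_translate (psOrd_mem μ ν) (tT b * nL (v : F))) 1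
  set M := max M₀ (max n (lv X))
  have hXM : (X : F) ∈ ball F M := units_mem_ball.2 (by omega)
  set S : Set Fˣ := {z | ((X * z⁻¹ : Fˣ) : F) - 1 ∈ ball F (lv v)} with hS
  have hSm : MeasurableSet S := (measurableSet_ball (lv v)).preimage
    (show Measurable fun z : Fˣ => ((X * z⁻¹ : Fˣ) : F) - 1 from
      ((Units.continuous_val.comp (continuous_const.mul continuous_inv)).sub
        continuous_const).measurable)
  set f : Fˣ → ℂ := S.indicator fun z => ((μ⁻¹ * ν) z : ℂ) * (ψ (z : F) : ℂ) with hf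
  have hval : ∀ z : Fˣ, bigCell (rightReg _ (tT b * nL (v : F)) (psOrd μ ν)) ((X : F) - z) =
      if z ∈ S then (upHalf μ (X * z⁻¹) : ℂ) * (downHalf ν (-(z * v)) : ℂ) else 0 := by
    intro z
    have h10 : (J1 F * nU ((X : F) - z) * (tT b * nL (v : F))) 1 0 = ((-(z * v) : Fˣ) : F) := by
      simp only [gl2_mul, J1_10, J1_11, nU, tT, borel_00, borel_10, borel_01, borel_11, nL_00,
          nL_10,
        val_one, hb]
      push_cast; ring
    have h11 : (J1 F * nU ((X : F) - z) * (tT b * nL (v : F))) 1 1 = (X : F) - z := by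
      simp only [gl2_mul, J1_10, J1_11, nU, tT, borel_00, borel_10, borel_01, borel_11, nL_01,
          nL_11,
        val_one]
      ring
    have hl : GeneralLinearGroup.det (nL (v : F)) = 1 := Units.ext (by
      rw [GeneralLinearGroup.val_det_apply, Matrix.det_fin_two]; simp)
    have hdet : GeneralLinearGroup.det (J1 F * nU ((X : F) - z) * (tT b * nL (v : F))) = b := by
      rw [map_mul, map_mul, map_mul, det_J1, nU, det_borel, tT, det_borel, hl]; simp
    have hbz : b * (-(z * v))⁻¹ = X * z⁻¹ := by simp_all
    rw [bigCell, rightReg_apply, psOrd_of_eq μ ν h10, h11, hdet, hbz]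
    have hz : z ∈ S ↔ ‖(X : F) - z‖ ≤ ‖((-(z * v) : Fˣ) : F)‖ := by
      have e : (X : F) - z = (z : F) * (((X * z⁻¹ : Fˣ) : F) - 1) := by
        rw [val_mul, mul_sub, mul_one, mul_left_comm, Units.mul_inv, mul_one]
      rw [norm_eq_lv (-(z * v)), ← mem_ball, e, unit_mul_mem_ball, lv_neg, lv_mul,
          add_sub_cancel_left]
      rfl
    simp_all
  have h1 : (ψ (X : F) : ℂ) * whit ψ (rightReg _ (tT b * nL (v : F)) (psOrd μ ν)) =
      (volUnits F : ℂ) * ((upHalf μ X : ℂ) * (downHalf ν (-v) : ℂ) *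
        ∫ z in {z : Fˣ | lv z ≤ M}, f z ∂haarFx F) := by
    rw [whit, ← val_one, hM₀ M (le_max_left _ _), ballFT, ← integral_const_mul,
      ← integral_indicator (measurableSet_ball M), ← integral_sub_left_eq_self _ (haarF F) (X : F),
      integral_haarF (E := ℂ), real_smul, ← integral_const_mul (_ * _),
      ← integral_indicator (measurableSet_lv_le M)]
    congr 1
    refine integral_congr_ae (.of_forall fun z => ?_)
    beta_reduce
    have hm : (X : F) - z ∈ ball F M ↔ lv z ≤ M := by
      rw [← units_mem_ball]
      exact ⟨fun h => by simpa using (ball F M).sub_mem hXM h, fun h => (ball F M).sub_mem hXM h⟩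
    by_cases hz : lv z ≤ M
    · rw [indicator_of_mem (show (X : F) - z ∈ (ball F M : Set F) from hm.2 hz),
        indicator_of_mem (show z ∈ {z : Fˣ | lv z ≤ M} from hz), hval]
      by_cases hzS : z ∈ S
      · rw [if_pos hzS, hf, indicator_of_mem hzS, real_smul, ← absPow_one_apply]
        have e1 : (ψ (X : F) : ℂ) * (ψ (-((1 : Fˣ) * ((X : F) - z))) : ℂ) = ψ (z : F) := by
          rw [← psi_add]; simp
        have e2 : (absPow F 1 z : ℂ) * ((upHalf μ (X * z⁻¹) : ℂ) * (downHalf ν (-(z * v)) : ℂ)) =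
            (upHalf μ X : ℂ) * (downHalf ν (-v) : ℂ) * ((μ⁻¹ * ν) z : ℂ) := by
          have e3 : -(z * v) = z * -v := by simp
          have e4 : absPow F 1 = absPow F (1 / 2) * absPow F (1 / 2) := by
            rw [← absPow_add, add_halves]
          rw [e3, map_mul (upHalf μ), map_inv, map_mul (downHalf ν), e4]
          simp only [upHalf, downHalf, absPow_neg, mul_apply, qc_inv, val_mul, val_inv_eq_inv_val]
          have h1 := (μ z).ne_zero
          have h2 := (absPow F (1 / 2) z).ne_zero
          field_simp
        grind
      simp_all
    simp_all
  have hη : TrivialMod (μ⁻¹ * ν) n := hμ.inv.mul hν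
  have hSb : ∀ z ∈ S, ((X * z⁻¹ : Fˣ) : F) ∈ ball F (max 0 (lv v)) := fun z hz => by
    have h1 : (1 : F) ∈ ball F (max 0 (lv v)) := by
      rw [← val_one, units_mem_ball, lv_one]; omega
    simpa using (ball F _).add_mem (ball_mono (le_max_right 0 (lv v)) hz) h1
  have hcont : Continuous fun z : Fˣ => ((μ⁻¹ * ν) z : ℂ) * (ψ (z : F) : ℂ) :=
    (continuous_quasiChar _).mul (hψ.continuous.comp Units.continuous_val)
  have hfi : IntegrableOn f {z : Fˣ | lv z ≤ M} (haarFx F) := by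
    have h3 : IntegrableOn f {z : Fˣ | lv z ∈ Set.Ioc (lv X - max 0 (lv v) - 1) M} (haarFx F) :=
      (integrableOn_lv_Ioc hcont _ _).indicator hSm
    refine h3.of_forall_sdiff_eq_zero (measurableSet_lv_le M) fun z hz => indicator_of_notMem ?_ _
    intro hzS
    have h4 := units_mem_ball.1 (hSb z hzS)
    rw [lv_mul, lv_inv] at h4
    refine hz.2 ⟨by omega, hz.1⟩
  have h2 : ∫ z in {z : Fˣ | lv z ≤ M}, f z ∂haarFx F = ∫ z in {z : Fˣ | lv z ≤ n},
      f z ∂haarFx F := by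
    refine integral_le_eq_of_vanish (by omega) hfi ?_
    rw [setIntegral_indicator hSm]
    have h3 := integral_char_mul_psi_eq_zero hψ hn hη 1
      (S := {z : Fˣ | lv z ∈ Set.Ioc (n : ℤ) M} ∩ S) ((measurableSet_lv _).inter hSm) ?_ ?_
    · simp_all
    · rintro u ⟨hu, huS⟩ w hw
      have hw0 := lv_eq_zero_of_sub_one_mem hn hw
      refine ⟨by simpa only [mem_ofPred_eq, lv_mul, hw0, zero_add] using hu, ?_⟩
      have e1 : ((X * (w * u)⁻¹ : Fˣ) : F) - 1 = (((X * u⁻¹ : Fˣ) : F) - 1) +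
          ((X * u⁻¹ : Fˣ) : F) * (((w⁻¹ : Fˣ) : F) * -((w : F) - 1)) := by
        have := w.inv_mul
        rw [mul_inv, mul_comm w⁻¹, ← mul_assoc, val_mul _ w⁻¹]
        grind
      have e2 : ((w⁻¹ : Fˣ) : F) * -((w : F) - 1) ∈ ball F (-(n : ℤ)) := by
        rw [unit_mul_mem_ball, lv_inv, hw0, neg_zero, sub_zero]
        exact neg_mem hw
      change ((X * (w * u)⁻¹ : Fˣ) : F) - 1 ∈ ball F (lv v)
      rw [e1]
      exact (ball F _).add_mem huS (ball_mono (by omega) (mul_mem_ball (hSb u huS) e2))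
    · rintro u ⟨hu, -⟩
      rw [lv_one, add_zero]
      exact hu.1
  have h3 : (upHalf μ X : ℂ) * (downHalf ν (-v) : ℂ) * (upHalf ν (-(X * v)) : ℂ)⁻¹ =
      (‖(v : F)‖ : ℂ)⁻¹ * ((μ * ν⁻¹) X : ℂ) := by
    have e1 : -(X * v) = X * -v := by simp
    have e2 : (‖(v : F)‖ : ℂ) = (absPow F (1 / 2) (-v) : ℂ) * (absPow F (1 / 2) (-v) : ℂ) := by
      have e4 : absPow F 1 = absPow F (1 / 2) * absPow F (1 / 2) := by rw [← absPow_add, add_halves]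
      rw [← norm_neg, ← Units.val_neg, ← absPow_one_apply, e4, mul_apply, val_mul]
    rw [e1, map_mul (upHalf ν), e2]
    simp only [upHalf, downHalf, absPow_neg, mul_apply, qc_inv, val_mul, val_inv_eq_inv_val]
    have h1 := (ν (-v)).ne_zero
    have h2 := (absPow F (1 / 2) (-v)).ne_zero
    have h3 := (absPow F (1 / 2) X).ne_zero
    field_simp
  have h4 : ∀ z, (if ((X * z⁻¹ : Fˣ) : F) - 1 ∈ ball F (lv v) then
      ((μ⁻¹ * ν) z : ℂ) * (ψ (z : F) : ℂ) else 0) = f z := fun z => by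
    rw [hf, indicator_apply]; rfl
  simp only [h4]
  rw [ordKernel, ← mul_assoc, h1, h2]
  grind

end Kernel

section Core

variable {μ ν : Fin 3 → QuasiChar F} {θ : QuasiChar F} {ξ : Fin 3 → QuasiChar F} {Φ : Fin 3 → F → ℂ}
  {n : ℕ}

/-! ### The reduced integral -/

/-- The argument of the `i`-th lower unipotent element. -/
def vArg (ϖ : Fˣ) (n : ℕ) (y : Fin 3 → Fˣ) (i : Fin 3) : Fˣ :=
  ϖ ^ (2 * n) * (∏ j, y j) * (y i ^ 2)⁻¹

theorem lv_vArg (hϖ : lv ϖ = -1) (y : Fin 3 → Fˣ) (i : Fin 3) :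
    lv (vArg ϖ n y i) = -(2 * n : ℤ) + (lv (y 0) + lv (y 1) + lv (y 2)) - 2 * lv (y i) := by
  rw [vArg, prod_univ_three, ← zpow_natCast ϖ, ← zpow_natCast (y i)]
  simp only [lv_mul, lv_inv, lv_zpow, hϖ]
  grind

theorem vArg_mulSingle (y : Fin 3 → Fˣ) (i : Fin 3) (g : Fˣ) :
    vArg ϖ n (y * Pi.mulSingle i g) i = vArg ϖ n y i * g⁻¹ := by
  have h : ∏ j, (Pi.mulSingle i g : Fin 3 → Fˣ) j = g := by simp
  simp only [vArg, Pi.mul_apply, prod_mul_distrib, h, Pi.mulSingle_eq_same]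
  rw [mul_pow, mul_inv, sq g, mul_inv]
  have : g * (g⁻¹ * g⁻¹) = g⁻¹ := mul_inv_cancel_left _ _
  grind

theorem continuous_vArg (i : Fin 3) : Continuous fun y : Fin 3 → Fˣ => vArg ϖ n y i := by
  unfold vArg
  fun_prop

variable (ψ ϖ μ ν θ ξ Φ n) in
/-- The data entering the reduced integral. -/
structure CoreData : Prop where
  ord : HasOrderZero ψ
  unif : lv ϖ = -1
  pos : 1 ≤ n
  triv_mu : ∀ i, TrivialMod (μ i) n
  triv_nu : ∀ i, TrivialMod (ν i) n
  triv_theta : TrivialMod θ n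
  eq_theta : ∀ i, ξ i * ((μ i)⁻¹ * ν i) = θ
  ball : ∀ i, BallFun (Φ i) n 0
  abs_theta : absAt θ < 1
  abs_xi : ∀ i, absAt (ξ i) < 1
  abs_sq : ∀ i, absAt (ξ i) ^ 2 < absAt θ

variable (ξ Φ) in
/-- The product of the weights. -/
def coreWeight (y : Fin 3 → Fˣ) : ℂ := ∏ i, (ξ i (y i) : ℂ) * Φ i (y i)

variable (ψ ϖ μ ν θ ξ Φ n) in
/-- The integrand of the reduced integral. -/
def coreF (p : (Fin 3 → Fˣ) × Fˣ) : ℂ := coreWeight ξ Φ p.1 * ((θ p.2 : ℂ) * (ψ (p.2 : F) : ℂ) *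
    ∏ i, ordKernel ψ (μ i) (ν i) p.2 (vArg ϖ n p.1 i))

variable (ψ θ ξ Φ n) in
/-- The main part of the integrand of the reduced integral. -/
def coreMain (p : (Fin 3 → Fˣ) × Fˣ) : ℂ := coreWeight ξ Φ p.1 *
    {X : Fˣ | lv X ≤ n}.indicator (fun X => (θ X : ℂ) * (ψ (X : F) : ℂ)) p.2

variable (F) in
/-- The measure of the reduced integral. -/
abbrev coreMeasure : Measure ((Fin 3 → Fˣ) × Fˣ) := (Measure.pi fun _ => haarFx F).prod (haarFx F)

theorem integrable_char_ballFun {χ : 𝓧} (hχ : absAt χ < 1) {h : F → ℂ} {k m : ℤ}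
    (hh : BallFun h k m) : Integrable (fun a : Fˣ => (χ a : ℂ) * h a) (haarFx F) := by
  obtain ⟨C, hC⟩ := hh.hasCompactSupport.exists_bound_of_continuous hh.continuous
  have h1 := integrableOn_char_mul hχ k (g := fun a : Fˣ => h a)
    (hh.continuous.comp Units.continuous_val).measurable fun a => hC a
  refine (integrableOn_iff_integrable_of_support_subset fun a ha => ?_).1 h1
  by_contra hk
  exact ha (by beta_reduce; rw [hh.supp a (mt units_mem_ball.1 hk), mul_zero])

theorem CoreData.integrable_main (D : CoreData ψ ϖ μ ν θ ξ Φ n) :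
    Integrable (coreMain ψ θ ξ Φ n) (coreMeasure F) := by
  refine Integrable.mul_prod (f := coreWeight ξ Φ) ?_ ?_
  · exact Integrable.fintype_prod (f := fun i (a : Fˣ) => (ξ i a : ℂ) * Φ i a)
      fun i => integrable_char_ballFun (D.abs_xi i) (D.ball i)
  · rw [integrable_indicator_iff (measurableSet_lv_le _)]
    simpa using integrableOn_char_psi D.ord D.abs_theta 1 n

theorem CoreData.integral_main :
    ∫ p, coreMain ψ θ ξ Φ n p ∂coreMeasure F = (∏ i, ∫ a : Fˣ, (ξ i a : ℂ) * Φ i a ∂haarFx F) *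
      ∫ X in {X : Fˣ | lv X ≤ n}, (θ X : ℂ) * (ψ (X : F) : ℂ) ∂haarFx F := by
  rw [← integral_indicator (measurableSet_lv_le _),
    ← integral_fintype_prod_eq_prod (fun i (a : Fˣ) => (ξ i a : ℂ) * Φ i a)]
  exact integral_prod_mul (coreWeight ξ Φ) _

/-! ### The change of variables -/

theorem lv_mulSingle (i j : Fin 3) (g : Fˣ) :
    lv ((Pi.mulSingle i g : Fin 3 → Fˣ) j) = if j = i then lv g else 0 := by
  by_cases h : j = i
  · grind
  · simp [h, lv_one]

/-- The change of variables in the unfolded integral. -/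
def coreShift (i : Fin 3) : (((Fin 3 → Fˣ) × Fˣ) × Fˣ) ≃* (((Fin 3 → Fˣ) × Fˣ) × Fˣ) where
  toFun q := ((q.1.1 * Pi.mulSingle i (q.1.2 * q.2⁻¹), q.2), q.2 * q.1.2⁻¹)
  invFun q := ((q.1.1 * Pi.mulSingle i q.2, q.1.2 * q.2⁻¹), q.1.2)
  left_inv q := by
    refine Prod.ext (Prod.ext ?_ ?_) rfl
    · change q.1.1 * Pi.mulSingle i (q.1.2 * q.2⁻¹) * Pi.mulSingle i (q.2 * q.1.2⁻¹) = q.1.1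
      rw [mul_assoc, ← Pi.mulSingle_mul]; simp
    simp
  right_inv q := by
    refine Prod.ext (Prod.ext ?_ rfl) ?_
    · change q.1.1 * Pi.mulSingle i q.2 * Pi.mulSingle i (q.1.2 * q.2⁻¹ * q.1.2⁻¹) = q.1.1
      rw [mul_assoc, ← Pi.mulSingle_mul, mul_right_comm, mul_inv_cancel, one_mul, mul_inv_cancel]
      simp
    simp
  map_mul' q r := by
    refine Prod.ext (Prod.ext ?_ rfl) ?_
    · change q.1.1 * r.1.1 * Pi.mulSingle i (q.1.2 * r.1.2 * (q.2 * r.2)⁻¹) =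
        q.1.1 * Pi.mulSingle i (q.1.2 * q.2⁻¹) * (r.1.1 * Pi.mulSingle i (r.1.2 * r.2⁻¹))
      rw [mul_mul_mul_comm q.1.1, ← Pi.mulSingle_mul, mul_inv, mul_mul_mul_comm q.1.2]
    · change q.2 * r.2 * (q.1.2 * r.1.2)⁻¹ = q.2 * q.1.2⁻¹ * (r.2 * r.1.2⁻¹)
      rw [mul_inv, mul_mul_mul_comm]

theorem measurePreserving_coreShift (i : Fin 3) :
    MeasurePreserving (coreShift (F := F) i) ((coreMeasure F).prod (haarFx F))
      ((coreMeasure F).prod (haarFx F)) := by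
  have hs : ∀ i : Fin 3, Continuous fun g : Fˣ => (Pi.mulSingle i g : Fin 3 → Fˣ) :=
    fun i => continuous_mulSingle (A := fun _ : Fin 3 => Fˣ) i
  have : MeasurableMul (Fin 3 → Fˣ) := inferInstance
  have := Measure.pi.isHaarMeasure fun _ : Fin 3 => haarFx F
  have := Measure.prod.instIsHaarMeasure (Measure.pi fun _ : Fin 3 => haarFx F) (haarFx F)
  have : MeasurableMul ((Fin 3 → Fˣ) × Fˣ) := inferInstance
  have := Measure.prod.instIsHaarMeasure (coreMeasure F) (haarFx F)
  let K : Set (((Fin 3 → Fˣ) × Fˣ) × Fˣ) :=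
    ((Set.univ.pi fun _ => {u : Fˣ | lv u = 0}) ×ˢ {u | lv u = 0}) ×ˢ {u | lv u = 0}
  have h0 : IsOpen {u : Fˣ | lv u = 0} := isOpen_lv {0}
  have hc := isCompact_lv_zero (F := F)
  refine measurePreserving_mulEquiv _ (coreShift i) ?_ ?_ (K := K)
    (((isOpen_set_pi Set.finite_univ fun _ _ => h0).prod h0).prod h0)
    (((isCompact_univ_pi fun _ => hc).prod hc).prod hc) ⟨1, by simp [K, lv_one]⟩ ?_
  · change Continuous fun q : ((Fin 3 → Fˣ) × Fˣ) × Fˣ =>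
      ((q.1.1 * Pi.mulSingle i (q.1.2 * q.2⁻¹), q.2), q.2 * q.1.2⁻¹)
    exact ((((by fun_prop : Continuous fun q : ((Fin 3 → Fˣ) × Fˣ) × Fˣ => q.1.1)).mul
      ((hs i).comp (by fun_prop))).prodMk (by fun_prop)).prodMk (by fun_prop)
  · change Continuous fun q : ((Fin 3 → Fˣ) × Fˣ) × Fˣ =>
      ((q.1.1 * Pi.mulSingle i q.2, q.1.2 * q.2⁻¹), q.1.2)
    exact ((((by fun_prop : Continuous fun q : ((Fin 3 → Fˣ) × Fˣ) × Fˣ => q.1.1)).mul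
      ((hs i).comp (by fun_prop))).prodMk (by fun_prop)).prodMk (by fun_prop)
  · ext q
    simp only [K, coreShift, MulEquiv.coe_mk, Equiv.coe_fn_mk, Set.mem_preimage, Set.mem_prod,
      Set.mem_pi, Set.mem_univ, true_imp_iff, mem_ofPred_eq, Pi.mul_apply, lv_mul, lv_inv,
      lv_mulSingle]
    grind

/-! ### The decomposition of the integrand -/

variable (ϖ n) in
/-- The domain on which the `i`-th kernel is not elementary. -/
def coreS (i : Fin 3) : Set (Fin 3 → Fˣ) :=
  {y | (∀ j, lv (y j) ≤ n) ∧ -(n : ℤ) < lv (vArg ϖ n y i)}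

variable (ϖ n) in
/-- The domain on which all kernels are elementary. -/
def coreN : Set (Fin 3 → Fˣ) :=
  {y | (∀ j, lv (y j) ≤ n) ∧ ∀ i, lv (vArg ϖ n y i) ≤ -(n : ℤ)}

theorem measurable_lv_pi : Measurable fun y : Fin 3 → Fˣ => fun i => lv (y i) :=
  measurable_pi_lambda _ fun i => measurable_lv.comp (measurable_pi_apply i)

theorem measurable_vArg (i : Fin 3) : Measurable fun y : Fin 3 → Fˣ => vArg ϖ n y i :=
  (continuous_vArg i).measurable

theorem measurableSet_forall_lv_le : MeasurableSet {y : Fin 3 → Fˣ | ∀ j, lv (y j) ≤ n} :=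
  (MeasurableSet.of_discrete (s := {l : Fin 3 → ℤ | ∀ j, l j ≤ n})).preimage measurable_lv_pi

theorem measurableSet_coreS (i : Fin 3) : MeasurableSet (coreS (F := F) ϖ n i) :=
  measurableSet_forall_lv_le.inter
    ((MeasurableSet.of_discrete (s := {k : ℤ | -(n : ℤ) < k})).preimage
      (measurable_lv.comp (measurable_vArg i)))

theorem measurableSet_coreN : MeasurableSet (coreN (F := F) ϖ n) := measurableSet_forall_lv_le.inter
    ((MeasurableSet.of_discrete (s := {k : Fin 3 → ℤ | ∀ i, k i ≤ -(n : ℤ)})).preimage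
      (measurable_pi_lambda _ fun i => measurable_lv.comp (measurable_vArg i)))

theorem lv_vArg_other (hϖ : lv ϖ = -1) {y : Fin 3 → Fˣ} {i j : Fin 3}
    (hy : y ∈ coreS ϖ n i) (hj : j ≠ i) :
    lv (vArg ϖ n y j) ≤ -(n : ℤ) ∧ lv (vArg ϖ n y j) ≤ -(2 * n : ℤ) - lv (vArg ϖ n y i) := by
  obtain ⟨h1, h2⟩ := hy
  have a0 := h1 0
  have a1 := h1 1
  have a2 := h1 2
  rw [lv_vArg hϖ] at h2
  rw [lv_vArg hϖ, lv_vArg hϖ]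
  grind

theorem lv_vArg_add (hϖ : lv ϖ = -1) {y : Fin 3 → Fˣ} {i : Fin 3}
    (hy : ∀ j, lv (y j) ≤ n) : lv (vArg ϖ n y i) + lv (y i) ≤ 0 := by
  have a0 := hy 0
  have a1 := hy 1
  have a2 := hy 2
  rw [lv_vArg hϖ]
  fin_cases i <;> simp <;> omega

theorem lv_of_sub_one_mem {g : Fˣ} {k : ℤ} (hg : (g : F) - 1 ∈ ball F k) : lv g ≤ max 0 k := by
  have h : (g : F) ∈ ball F (max 0 k) := by
    have := (ball F (max 0 k)).add_mem (ball_mono (le_max_right 0 k) hg)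
      (ball_mono (le_max_left 0 k) (units_mem_ball.2 (lv_one (F := F)).le))
    simp_all
  exact units_mem_ball.1 h

theorem inv_sub_one_mem {g : Fˣ} {k : ℤ} (hg : (g : F) - 1 ∈ ball F k) :
    ((g⁻¹ : Fˣ) : F) - 1 ∈ ball F (k - lv g) := by
  have e : ((g⁻¹ : Fˣ) : F) - 1 = ((g⁻¹ : Fˣ) : F) * -((g : F) - 1) := by
    rw [neg_sub, mul_sub, mul_one, Units.inv_mul]
  rw [e, unit_mul_mem_ball, lv_inv]
  simpa using (ball F k).neg_mem hg

theorem coreS_shift (hϖ : lv ϖ = -1) (hn : 1 ≤ n) {y : Fin 3 → Fˣ} {i : Fin 3}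
    (hy : y ∈ coreS ϖ n i) {g : Fˣ} (hg : (g : F) - 1 ∈ ball F (lv (vArg ϖ n y i))) :
    y * Pi.mulSingle i g ∈ coreS ϖ n i := by
  have h3 := lv_vArg_add hϖ (i := i) hy.1
  obtain ⟨h1, h2⟩ := hy
  have hl := lv_of_sub_one_mem hg
  have hy0 := h1 i
  refine ⟨fun j => ?_, ?_⟩
  · rw [Pi.mul_apply, lv_mul, lv_mulSingle]
    grind
  · rw [vArg_mulSingle, lv_mul, lv_inv]
    grind

theorem coreS_shift_iff (hϖ : lv ϖ = -1) (hn : 1 ≤ n) {y : Fin 3 → Fˣ} {i : Fin 3} {g : Fˣ}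
    (hg : (g : F) - 1 ∈ ball F (lv (vArg ϖ n y i))) :
    y * Pi.mulSingle i g ∈ coreS ϖ n i ↔ y ∈ coreS ϖ n i := by
  refine ⟨fun h => ?_, fun h => coreS_shift hϖ hn h hg⟩
  have h2 := coreS_shift hϖ hn h (g := g⁻¹) (by
    rw [vArg_mulSingle, lv_mul, lv_inv]
    exact inv_sub_one_mem hg)
  rwa [mul_assoc, ← Pi.mulSingle_mul, mul_inv_cancel, Pi.mulSingle_one, mul_one] at h2

theorem coreWeight_eq_zero (D : CoreData ψ ϖ μ ν θ ξ Φ n) {y : Fin 3 → Fˣ} {j : Fin 3}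
    (hj : (n : ℤ) < lv (y j)) : coreWeight ξ Φ y = 0 :=
  Finset.prod_eq_zero (mem_univ j) (by
    rw [(D.ball j).supp (y j) (fun h => by have := units_mem_ball.1 h; omega), mul_zero])

theorem coreWeight_shift (D : CoreData ψ ϖ μ ν θ ξ Φ n) {y : Fin 3 → Fˣ} {i : Fin 3}
    (hy : y ∈ coreS ϖ n i) {g : Fˣ} (hg : (g : F) - 1 ∈ ball F (lv (vArg ϖ n y i))) :
    coreWeight ξ Φ (y * Pi.mulSingle i g) = coreWeight ξ Φ y * (ξ i g : ℂ) := by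
  have h3 := lv_vArg_add D.unif (i := i) hy.1
  have hΦ : Φ i ((y i * g : Fˣ) : F) = Φ i (y i) := by
    have e : ((y i * g : Fˣ) : F) = (y i : F) + (y i : F) * ((g : F) - 1) := by
      push_cast; ring
    rw [e, (D.ball i).inv _ _]
    rw [unit_mul_mem_ball]
    exact ball_mono (by omega) hg
  rw [coreWeight, coreWeight, ← Finset.mul_prod_erase _ _ (mem_univ i),
    ← Finset.mul_prod_erase _ (fun j => (ξ j (y j) : ℂ) * Φ j (y j)) (mem_univ i)]
  have h : ∏ j ∈ Finset.univ.erase i, (ξ j ((y * Pi.mulSingle i g : Fin 3 → Fˣ) j) : ℂ) *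
      Φ j ((y * Pi.mulSingle i g : Fin 3 → Fˣ) j) =
      ∏ j ∈ Finset.univ.erase i, (ξ j (y j) : ℂ) * Φ j (y j) := by
    refine prod_congr rfl fun j hj => ?_
    simp_all
  rw [h, Pi.mul_apply, Pi.mulSingle_eq_same, hΦ, map_mul (ξ i), val_mul]
  ring

open Classical in
variable (ϖ n) in
/-- The averaging weight. -/
def coreRho (i : Fin 3) (q : ((Fin 3 → Fˣ) × Fˣ) × Fˣ) : ℂ :=
  if ‖(q.2 : F) - 1‖ ≤ ‖(vArg ϖ n q.1.1 i : F)‖ then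
    ((‖(vArg ϖ n q.1.1 i : F)‖⁻¹ * ‖(q.2 : F)‖ : ℝ) : ℂ) else 0

theorem measurable_coreRho (i : Fin 3) : Measurable (coreRho (F := F) ϖ n i) := by
  have h1 : Continuous fun q : ((Fin 3 → Fˣ) × Fˣ) × Fˣ => (vArg ϖ n q.1.1 i : F) :=
    Units.continuous_val.comp ((continuous_vArg i).comp (continuous_fst.comp continuous_fst))
  have h2 : Continuous fun q : ((Fin 3 → Fˣ) × Fˣ) × Fˣ => (q.2 : F) :=
    Units.continuous_val.comp continuous_snd
  refine Measurable.ite ?_ ?_ measurable_const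
  · exact (isClosed_le (h2.sub continuous_const).norm h1.norm).measurableSet
  · exact (Complex.continuous_ofReal.comp ((h1.norm.inv₀ fun q => by simp).mul h2.norm)).measurable

open Classical in
theorem integral_coreRho (v : Fˣ) : Integrable (fun r : Fˣ => if ‖(r : F) - 1‖ ≤ ‖(v : F)‖ then
      (((‖(v : F)‖⁻¹ * ‖(r : F)‖ : ℝ)) : ℂ) else 0) (haarFx F) ∧
    ∫ r : Fˣ, (if ‖(r : F) - 1‖ ≤ ‖(v : F)‖ then (((‖(v : F)‖⁻¹ * ‖(r : F)‖ : ℝ)) : ℂ) else 0)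
      ∂haarFx F = (volUnits F : ℂ)⁻¹ := by
  set h : F → ℂ := fun x => (ball F (lv v) : Set F).indicator (fun _ => ((‖(v : F)‖⁻¹ : ℝ) : ℂ))
    (x + -1) with hh
  have e : (fun r : Fˣ => if ‖(r : F) - 1‖ ≤ ‖(v : F)‖ then
      (((‖(v : F)‖⁻¹ * ‖(r : F)‖ : ℝ)) : ℂ) else 0) = fun r : Fˣ => ‖(r : F)‖ • h r := by
    ext r
    by_cases hr : ‖(r : F) - 1‖ ≤ ‖(v : F)‖
    · rw [if_pos hr, hh]
      beta_reduce
      rw [indicator_of_mem (by rw [← sub_eq_add_neg]; exact mem_ball.2 (by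
        rwa [← norm_eq_lv])), real_smul]
      push_cast; ring
    · rw [if_neg hr, hh]
      beta_reduce
      rw [indicator_of_notMem (by
        rw [← sub_eq_add_neg]; intro hm; exact hr (by rw [norm_eq_lv v]; exact mem_ball.1 hm)),
        smul_zero]
  have hi : Integrable h (haarF F) := by
    refine Integrable.comp_add_right
      (f := (ball F (lv v) : Set F).indicator fun _ => ((‖(v : F)‖⁻¹ : ℝ) : ℂ)) ?_ (-1)
    rw [integrable_indicator_iff (measurableSet_ball _)]
    exact integrableOn_const ((isCompact_ball (lv v)).measure_lt_top.ne)
  have hI : ∫ x, h x ∂haarF F = 1 := by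
    rw [hh, integral_add_right_eq_self
      (fun x => (ball F (lv v) : Set F).indicator (fun _ => ((‖(v : F)‖⁻¹ : ℝ) : ℂ)) x),
      integral_indicator (measurableSet_ball _), setIntegral_const, haarF_real_ball, norm_eq_lv v,
      real_smul, ← Complex.ofReal_mul, mul_inv_cancel₀ (zpow_q_pos F _).ne',
      Complex.ofReal_one]
  rw [integral_haarF, real_smul] at hI
  rw [e]
  exact ⟨(integrable_haarF h).1 hi, (eq_inv_of_mul_eq_one_right hI)⟩

end Core

section Core

variable {μ ν : Fin 3 → QuasiChar F} {θ : QuasiChar F} {ξ : Fin 3 → QuasiChar F} {Φ : Fin 3 → F → ℂ}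
  {n : ℕ}

variable (ψ ϖ θ ξ Φ n) in
/-- The part of `coreMain` over `coreS`. -/
def coreMainS (i : Fin 3) : (Fin 3 → Fˣ) × Fˣ → ℂ :=
  (Prod.fst ⁻¹' coreS ϖ n i).indicator (coreMain ψ θ ξ Φ n)

theorem CoreData.integrable_mainS (D : CoreData ψ ϖ μ ν θ ξ Φ n) (i : Fin 3) :
    Integrable (coreMainS ψ ϖ θ ξ Φ n i) (coreMeasure F) :=
  D.integrable_main.indicator (measurable_fst (measurableSet_coreS i))

variable (ψ ϖ θ ξ Φ n) in
/-- The unfolded integrand. -/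
def coreH (i : Fin 3) (q : ((Fin 3 → Fˣ) × Fˣ) × Fˣ) : ℂ :=
  coreMainS ψ ϖ θ ξ Φ n i q.1 * coreRho ϖ n i q

theorem CoreData.integrable_H (D : CoreData ψ ϖ μ ν θ ξ Φ n) (i : Fin 3) :
    Integrable (coreH ψ ϖ θ ξ Φ n i) ((coreMeasure F).prod (haarFx F)) := by
  have hM := D.integrable_mainS i
  refine (integrable_prod_iff ?_).2 ⟨ae_of_all _ fun p => ?_, ?_⟩
  · exact hM.aestronglyMeasurable.comp_fst.mul (measurable_coreRho i).aestronglyMeasurable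
  · exact (integral_coreRho (vArg ϖ n p.1 i)).1.const_mul (coreMainS ψ ϖ θ ξ Φ n i p)
  · have e : (fun p => ∫ r : Fˣ, ‖coreH ψ ϖ θ ξ Φ n i (p, r)‖ ∂haarFx F) =
        fun p => ‖coreMainS ψ ϖ θ ξ Φ n i p‖ * (volUnits F)⁻¹ := by
      ext p
      simp only [coreH, norm_mul]
      rw [integral_const_mul]
      congr 1
      have h1 := (integral_coreRho (vArg ϖ n p.1 i)).2
      have h2 : ∀ r : Fˣ, coreRho ϖ n i (p, r) = ((‖coreRho ϖ n i (p, r)‖ : ℝ) : ℂ) := by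
        intro r
        rw [coreRho]
        split_ifs
        · simp
        · simp
      have h3 : ∫ r : Fˣ, coreRho ϖ n i (p, r) ∂haarFx F = (volUnits F : ℂ)⁻¹ := h1
      rw [integral_congr_ae (ae_of_all _ h2), integral_complex_ofReal, ← Complex.ofReal_inv] at h3
      exact_mod_cast h3
    rw [e]
    exact hM.norm.mul_const _

theorem CoreData.integral_H (D : CoreData ψ ϖ μ ν θ ξ Φ n) (i : Fin 3) :
    ∫ q, coreH ψ ϖ θ ξ Φ n i q ∂(coreMeasure F).prod (haarFx F) =
      (∫ p, coreMainS ψ ϖ θ ξ Φ n i p ∂coreMeasure F) * (volUnits F : ℂ)⁻¹ := by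
  rw [integral_prod _ (D.integrable_H i), ← integral_mul_const]
  refine integral_congr_ae (ae_of_all _ fun p => ?_)
  refine Eq.trans (integral_const_mul (coreMainS ψ ϖ θ ξ Φ n i p)
    fun r : Fˣ => coreRho ϖ n i (p, r)) ?_
  exact congrArg _ (integral_coreRho (vArg ϖ n p.1 i)).2

theorem ordKernel_prod (D : CoreData ψ ϖ μ ν θ ξ Φ n) {y : Fin 3 → Fˣ} {i : Fin 3}
    (hy : y ∈ coreS ϖ n i) (X : Fˣ) :
    ∏ j, ordKernel ψ (μ j) (ν j) X (vArg ϖ n y j) = ordKernel ψ (μ i) (ν i) X (vArg ϖ n y i) := by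
  classical
  rw [← Finset.mul_prod_erase _ _ (mem_univ i)]
  have hn := D.pos
  by_cases hX : lv X ≤ n + max 0 (lv (vArg ϖ n y i))
  · rw [Finset.prod_eq_one fun j hj => ?_, mul_one]
    obtain ⟨h1, h2⟩ := lv_vArg_other D.unif hy (Finset.ne_of_mem_erase hj)
    have := hy.2
    rw [ordKernel_small D.ord D.pos (D.triv_mu j) (D.triv_nu j) X h1, if_pos (by omega)]
  · have h0 : ordKernel ψ (μ i) (ν i) X (vArg ϖ n y i) = 0 := by
      have h := ordKernel_large D.ord D.pos (D.triv_mu i) (D.triv_nu i) X hy.2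
      rw [setIntegral_eq_zero_of_forall_eq_zero
        (fun z (hz : z ∈ {z : Fˣ | lv z ≤ n}) => if_neg fun hm => ?_), mul_zero] at h
      · simp_all
      · have := lv_of_sub_one_mem hm
        rw [lv_mul, lv_inv] at this
        grind
    grind

open Classical in
theorem coreH_shift (i : Fin 3) (y : Fin 3 → Fˣ) (X z : Fˣ) :
    coreH ψ ϖ θ ξ Φ n i (coreShift i ((y, X), z)) =
      coreMainS ψ ϖ θ ξ Φ n i (y * Pi.mulSingle i (X * z⁻¹), z) *
        if ((X * z⁻¹ : Fˣ) : F) - 1 ∈ ball F (lv (vArg ϖ n y i)) then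
          (‖(vArg ϖ n y i : F)‖ : ℂ)⁻¹ else 0 := by
  have e : coreShift i ((y, X), z) = ((y * Pi.mulSingle i (X * z⁻¹), z), z * X⁻¹) := rfl
  rw [e, coreH]
  congr 1
  have hg : X * z⁻¹ = (z * X⁻¹)⁻¹ := by simp
  rw [hg]
  generalize z * X⁻¹ = r
  simp only [coreRho, vArg_mulSingle, inv_inv]
  generalize vArg ϖ n y i = v
  have hr : (‖(r : F) - 1‖ ≤ ‖((v * r : Fˣ) : F)‖) ↔ ((r⁻¹ : Fˣ) : F) - 1 ∈ ball F (lv v) := by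
    rw [norm_eq_lv (v * r), ← mem_ball]
    constructor
    · intro h
      have := inv_sub_one_mem h
      rwa [lv_mul, add_sub_cancel_right] at this
    · intro h
      have := inv_sub_one_mem h
      rwa [inv_inv, lv_inv, sub_neg_eq_add, ← lv_mul] at this
  simp only [hr]
  split_ifs
  · have h1 : ‖(r : F)‖ ≠ 0 := by simp
    rw [val_mul, norm_mul, mul_inv, mul_assoc, inv_mul_cancel₀ h1, mul_one, Complex.ofReal_inv]
  · rfl

theorem CoreData.char_identity (D : CoreData ψ ϖ μ ν θ ξ Φ n) (i : Fin 3) (X z : Fˣ) :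
    (θ X : ℂ) * ((μ i * (ν i)⁻¹) X : ℂ) * (((μ i)⁻¹ * ν i) z : ℂ) =
      (ξ i (X * z⁻¹) : ℂ) * (θ z : ℂ) := by
  rw [← D.eq_theta i]
  simp only [mul_apply, qc_inv, val_mul, map_mul, map_inv, val_inv_eq_inv_val]
  have := (ξ i z).ne_zero
  have := (μ i X).ne_zero
  have := (ν i X).ne_zero
  field_simp

open Classical in
theorem coreH_shift_of_mem (D : CoreData ψ ϖ μ ν θ ξ Φ n) {i : Fin 3} {y : Fin 3 → Fˣ}
    (hy : y ∈ coreS ϖ n i) (X z : Fˣ) :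
    coreH ψ ϖ θ ξ Φ n i (coreShift i ((y, X), z)) = {z : Fˣ | lv z ≤ n}.indicator (fun z =>
      coreWeight ξ Φ y * (θ X : ℂ) * ((‖(vArg ϖ n y i : F)‖ : ℂ)⁻¹ * ((μ i * (ν i)⁻¹) X : ℂ)) *
            (if ((X * z⁻¹ : Fˣ) : F) - 1 ∈ ball F (lv (vArg ϖ n y i))
              then (((μ i)⁻¹ * ν i) z : ℂ) * (ψ (z : F) : ℂ) else 0)) z := by
  rw [coreH_shift]
  by_cases hm : ((X * z⁻¹ : Fˣ) : F) - 1 ∈ ball F (lv (vArg ϖ n y i))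
  · rw [coreMainS, indicator_of_mem
      (show (y * Pi.mulSingle i (X * z⁻¹), z) ∈ Prod.fst ⁻¹' coreS ϖ n i from
        coreS_shift D.unif D.pos hy hm), coreMain, if_pos hm]
    rw [coreWeight_shift D hy hm]
    by_cases hz : lv z ≤ n
    · rw [indicator_of_mem (show z ∈ {z : Fˣ | lv z ≤ n} from hz),
        indicator_of_mem (show z ∈ {z : Fˣ | lv z ≤ n} from hz), if_pos hm]
      linear_combination (-(coreWeight ξ Φ y * (‖(vArg ϖ n y i : F)‖ : ℂ)⁻¹ * (ψ (z : F) : ℂ))) *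
        D.char_identity i X z
    simp_all
  · rw [if_neg hm, mul_zero]
    by_cases hz : z ∈ {z : Fˣ | lv z ≤ n}
    · simp_all
    simp_all

theorem coreF_eq_integral (D : CoreData ψ ϖ μ ν θ ξ Φ n) (i : Fin 3) (p : (Fin 3 → Fˣ) × Fˣ) :
    (Prod.fst ⁻¹' coreS ϖ n i).indicator (coreF ψ ϖ μ ν θ ξ Φ n) p = (volUnits F : ℂ) *
      ∫ z : Fˣ, coreH ψ ϖ θ ξ Φ n i (coreShift i (p, z)) ∂haarFx F := by
  classical
  obtain ⟨y, X⟩ := p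
  by_cases hy : y ∈ coreS ϖ n i
  · have h1 := ordKernel_large D.ord D.pos (D.triv_mu i) (D.triv_nu i) X hy.2
    simp only [coreH_shift_of_mem D hy]
    rw [indicator_of_mem (show (y, X) ∈ Prod.fst ⁻¹' coreS ϖ n i from hy), coreF,
      integral_indicator (measurableSet_lv_le _), integral_const_mul]
    rw [ordKernel_prod D hy X]
    grind
  · rw [indicator_of_notMem (show (y, X) ∉ Prod.fst ⁻¹' coreS ϖ n i from hy)]
    rw [integral_eq_zero_of_ae (ae_of_all _ fun z => ?_), mul_zero]
    rw [coreH_shift]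
    by_cases hm : ((X * z⁻¹ : Fˣ) : F) - 1 ∈ ball F (lv (vArg ϖ n y i))
    · rw [coreMainS, indicator_of_notMem
        (show (y * Pi.mulSingle i (X * z⁻¹), z) ∉ Prod.fst ⁻¹' coreS ϖ n i from fun h =>
          hy ((coreS_shift_iff D.unif D.pos hm).1 h)), zero_mul]
      rfl
    simp_all

theorem CoreData.shell (D : CoreData ψ ϖ μ ν θ ξ Φ n) (i : Fin 3) :
    Integrable ((Prod.fst ⁻¹' coreS ϖ n i).indicator (coreF ψ ϖ μ ν θ ξ Φ n)) (coreMeasure F) ∧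
    ∫ p, (Prod.fst ⁻¹' coreS ϖ n i).indicator (coreF ψ ϖ μ ν θ ξ Φ n) p ∂coreMeasure F =
      ∫ p, coreMainS ψ ϖ θ ξ Φ n i p ∂coreMeasure F := by
  have hP := measurePreserving_coreShift (F := F) i
  have hI := hP.integrable_comp_of_integrable (D.integrable_H i)
  have hE : ∫ q, (coreH ψ ϖ θ ξ Φ n i ∘ coreShift i) q ∂(coreMeasure F).prod (haarFx F) = _ :=
    (integral_map (f := coreH ψ ϖ θ ξ Φ n i) hP.measurable.aemeasurable
      (by rw [hP.map_eq]; exact (D.integrable_H i).aestronglyMeasurable)).symm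
  rw [hP.map_eq, D.integral_H i, integral_prod _ hI] at hE
  rw [funext (coreF_eq_integral D i)]
  refine ⟨hI.integral_prod_left.const_mul _, ?_⟩
  rw [integral_const_mul]
  refine Eq.trans (congrArg _ hE) ?_
  rw [mul_comm, mul_assoc, inv_mul_cancel₀, mul_one]
  exact_mod_cast (volUnits_pos F).ne'

/-! ### The elementary part -/

variable (ψ ϖ θ ξ Φ n) in
/-- The difference of the integrand and its main part on `coreN`. -/
def coreE (p : (Fin 3 → Fˣ) × Fˣ) : ℂ := (coreN ϖ n).indicator (coreWeight ξ Φ) p.1 *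
    {X : Fˣ | lv X ∈ {k : ℤ | (n : ℤ) < k ∧ ∀ i, k + lv (vArg ϖ n p.1 i) ≤ 0}}.indicator
      (fun X => (θ X : ℂ) * (ψ (X : F) : ℂ)) p.2

theorem indicator_decomp (D : CoreData ψ ϖ μ ν θ ξ Φ n) {g : (Fin 3 → Fˣ) × Fˣ → ℂ}
    (hg : ∀ p, coreWeight ξ Φ p.1 = 0 → g p = 0) (p : (Fin 3 → Fˣ) × Fˣ) :
    g p = ∑ i, (Prod.fst ⁻¹' coreS ϖ n i).indicator g p +
      (Prod.fst ⁻¹' coreN ϖ n).indicator g p := by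
  obtain ⟨y, X⟩ := p
  by_cases hy : ∀ j, lv (y j) ≤ n
  · by_cases hv : ∀ i, lv (vArg ϖ n y i) ≤ -(n : ℤ)
    · rw [indicator_of_mem (show (y, X) ∈ Prod.fst ⁻¹' coreN ϖ n from ⟨hy, hv⟩),
        Finset.sum_eq_zero fun i _ => indicator_of_notMem (fun h => ?_) _, zero_add]
      exact absurd (hv i) (not_le.2 h.2)
    · obtain ⟨i, hi⟩ := not_forall.1 hv
      rw [not_le] at hi
      have hm : y ∈ coreS ϖ n i := ⟨hy, hi⟩
      rw [indicator_of_notMem (show (y, X) ∉ Prod.fst ⁻¹' coreN ϖ n from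
        fun h => hv h.2), add_zero, Finset.sum_eq_single i (fun j _ hj =>
          indicator_of_notMem (fun h => ?_) _) (fun h => absurd (mem_univ i) h),
        indicator_of_mem (show (y, X) ∈ Prod.fst ⁻¹' coreS ϖ n i from hm)]
      exact absurd (lv_vArg_other D.unif hm hj).1 (not_le.2 h.2)
  · rw [indicator_of_notMem (show (y, X) ∉ Prod.fst ⁻¹' coreN ϖ n from fun h => hy h.1),
      Finset.sum_eq_zero fun i _ => indicator_of_notMem (fun h => hy h.1) _, add_zero]
    obtain ⟨j, hj⟩ := not_forall.1 hy
    exact hg _ (coreWeight_eq_zero D (not_le.1 hj))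

theorem coreF_decomp (D : CoreData ψ ϖ μ ν θ ξ Φ n) (p : (Fin 3 → Fˣ) × Fˣ) :
    coreF ψ ϖ μ ν θ ξ Φ n p = ∑ i, (Prod.fst ⁻¹' coreS ϖ n i).indicator (coreF ψ ϖ μ ν θ ξ Φ n) p +
      (Prod.fst ⁻¹' coreN ϖ n).indicator (coreMain ψ θ ξ Φ n) p + coreE ψ ϖ θ ξ Φ n p := by
  refine (indicator_decomp D (fun p hp => by rw [coreF, hp, zero_mul]) p).trans ?_
  rw [add_assoc]
  congr 1
  obtain ⟨y, X⟩ := p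
  have hn := D.pos
  by_cases hy : y ∈ coreN ϖ n
  · rw [indicator_of_mem (show (y, X) ∈ Prod.fst ⁻¹' coreN ϖ n from hy),
      indicator_of_mem (show (y, X) ∈ Prod.fst ⁻¹' coreN ϖ n from hy), coreE,
      indicator_of_mem hy, coreF, coreMain, ← mul_add]
    simp only [ordKernel_small D.ord D.pos (D.triv_mu _) (D.triv_nu _) X (hy.2 _),
      Finset.prod_ite_zero, Finset.prod_const_one, mem_univ, true_imp_iff]
    congr 1
    by_cases hX : lv X ≤ n
    · rw [indicator_of_mem (show X ∈ {X : Fˣ | lv X ≤ n} from hX), indicator_of_notMem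
        (show X ∉ {X : Fˣ | lv X ∈ {k : ℤ | (n : ℤ) < k ∧ ∀ i, k + lv (vArg ϖ n y i) ≤ 0}} from
          fun h => absurd hX (not_le.2 h.1)), add_zero, if_pos, mul_one]
      intro i
      have := hy.2 i
      omega
    · rw [indicator_of_notMem (show X ∉ {X : Fˣ | lv X ≤ n} from hX), zero_add]
      by_cases h : ∀ i, lv X + lv (vArg ϖ n y i) ≤ 0
      · simp_all
      simp_all
  · rw [indicator_of_notMem (show (y, X) ∉ Prod.fst ⁻¹' coreN ϖ n from hy),
      indicator_of_notMem (show (y, X) ∉ Prod.fst ⁻¹' coreN ϖ n from hy), coreE,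
      indicator_of_notMem hy, zero_mul, zero_add]

theorem coreMain_decomp (D : CoreData ψ ϖ μ ν θ ξ Φ n) (p : (Fin 3 → Fˣ) × Fˣ) :
    coreMain ψ θ ξ Φ n p = ∑ i, coreMainS ψ ϖ θ ξ Φ n i p +
      (Prod.fst ⁻¹' coreN ϖ n).indicator (coreMain ψ θ ξ Φ n) p :=
  indicator_decomp D (fun p hp => by rw [coreMain, hp, zero_mul]) p

theorem measurableSet_E : MeasurableSet {p : (Fin 3 → Fˣ) × Fˣ |
    lv p.2 ∈ {k : ℤ | (n : ℤ) < k ∧ ∀ i, k + lv (vArg ϖ n p.1 i) ≤ 0}} :=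
  (MeasurableSet.of_discrete
    (s := {k : (Fin 3 → ℤ) × ℤ | (n : ℤ) < k.2 ∧ ∀ i, k.2 + k.1 i ≤ 0})).preimage
    ((measurable_pi_lambda _ fun i => measurable_lv.comp
      ((measurable_vArg i).comp measurable_fst)).prodMk (measurable_lv.comp measurable_snd))

theorem CoreData.measurable_E (D : CoreData ψ ϖ μ ν θ ξ Φ n) : Measurable (coreE ψ ϖ θ ξ Φ n) := by
  have h1 : Measurable (coreWeight ξ Φ) := Finset.measurable_prod _ fun i _ =>
    ((continuous_quasiChar (ξ i)).measurable.comp (measurable_pi_apply i)).mul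
      (((D.ball i).continuous.comp Units.continuous_val).measurable.comp (measurable_pi_apply i))
  have h2 : Measurable fun X : Fˣ => (θ X : ℂ) * (ψ (X : F) : ℂ) :=
    (continuous_quasiChar θ).measurable.mul
      (D.ord.measurable.comp Units.continuous_val.measurable)
  exact ((h1.indicator measurableSet_coreN).comp measurable_fst).mul
    ((h2.comp measurable_snd).indicator measurableSet_E)

theorem integrable_pow_lv_above {r : ℝ} (hr : 1 < r) (N : ℤ) :
    Integrable ({X : Fˣ | N < lv X}.indicator fun X => r ^ (-lv X)) (haarFx F) := by
  have h := integrableOn_pow_lv (F := F) (inv_pos.2 (one_pos.trans hr)) (inv_lt_one_of_one_lt₀ hr)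
    (-N - 1)
  rw [← integrable_indicator_iff (measurableSet_lv_le _)] at h
  refine h.comp_inv.congr (ae_of_all _ fun X => ?_)
  beta_reduce
  by_cases hX : N < lv X
  · rw [indicator_of_mem (show X ∈ {X : Fˣ | N < lv X} from hX), indicator_of_mem
      (show X⁻¹ ∈ {a : Fˣ | lv a ≤ -N - 1} from by rw [mem_ofPred_eq, lv_inv]; omega), lv_inv,
      inv_zpow, ← zpow_neg, neg_neg]
  · rw [indicator_of_notMem (show X ∉ {X : Fˣ | N < lv X} from hX), indicator_of_notMem
      (show X⁻¹ ∉ {a : Fˣ | lv a ≤ -N - 1} from by rw [mem_ofPred_eq, lv_inv]; omega)]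

theorem CoreData.integrable_E (D : CoreData ψ ϖ μ ν θ ξ Φ n) :
    Integrable (coreE ψ ϖ θ ξ Φ n) (coreMeasure F) := by
  have hb := absAt_pos θ
  set β : ℝ := Real.sqrt (absAt θ)⁻¹ with hβ
  have hβ2 : β ^ 2 = (absAt θ)⁻¹ := Real.sq_sqrt (inv_pos.2 hb).le
  have hβ1 : 1 < β := Real.lt_sqrt_of_sq_lt (by rw [one_pow]; exact (one_lt_inv₀ hb).2 D.abs_theta)
  have hβ0 : 0 < β := one_pos.trans hβ1
  have hr : ∀ k, absAt (ξ k) * β < 1 := fun k => by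
    refine lt_of_pow_lt_pow_left₀ 2 zero_le_one ?_
    rw [mul_pow, hβ2, one_pow, ← div_eq_mul_inv, div_lt_one hb]
    exact D.abs_sq k
  choose C hC using fun k =>
    (D.ball k).hasCompactSupport.exists_bound_of_continuous (D.ball k).continuous
  have hG : ∀ k, Integrable ({a : Fˣ | lv a ≤ n}.indicator fun a =>
      (absAt (ξ k) * β) ^ (-lv a) * C k) (haarFx F) := fun k => by
    rw [integrable_indicator_iff (measurableSet_lv_le _)]
    exact (integrableOn_pow_lv (mul_pos (absAt_pos _) hβ0) (hr k) n).mul_const (C k)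
  have hM := (Integrable.mul_prod (Integrable.fintype_prod hG)
    (integrable_pow_lv_above (F := F) hβ1 n)).const_mul (β ^ (6 * n : ℤ))
  refine hM.mono' D.measurable_E.aestronglyMeasurable (ae_of_all _ ?_)
  rintro ⟨y, X⟩
  have hC0 : ∀ k, 0 ≤ C k := fun k => (norm_nonneg _).trans (hC k 0)
  have hnn : 0 ≤ β ^ (6 * n : ℤ) * ((∏ k, {a : Fˣ | lv a ≤ n}.indicator (fun a =>
      (absAt (ξ k) * β) ^ (-lv a) * C k) (y k)) *
        {X : Fˣ | (n : ℤ) < lv X}.indicator (fun X => β ^ (-lv X)) X) := by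
    refine mul_nonneg (zpow_nonneg hβ0.le _) (mul_nonneg (Finset.prod_nonneg fun k _ =>
      Set.indicator_nonneg (fun a _ => mul_nonneg (zpow_nonneg
        (mul_pos (absAt_pos _) hβ0).le _) (hC0 k)) _)
      (Set.indicator_nonneg (fun a _ => zpow_nonneg hβ0.le _) _))
  by_cases hy : y ∈ coreN ϖ n
  · by_cases hX : X ∈ {X : Fˣ | lv X ∈ {k : ℤ | (n : ℤ) < k ∧ ∀ i, k + lv (vArg ϖ n y i) ≤ 0}}
    · have e1 : ‖coreE ψ ϖ θ ξ Φ n (y, X)‖ = ‖coreWeight ξ Φ y‖ * absAt θ ^ (-lv X) := by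
        rw [coreE, indicator_of_mem hy, indicator_of_mem hX, norm_mul, norm_mul,
          norm_quasiChar, norm_psi, mul_one]
      have e2 : ‖coreWeight ξ Φ y‖ ≤ ∏ k, (absAt (ξ k) ^ (-lv (y k)) * C k) := by
        rw [coreWeight, norm_prod]
        refine Finset.prod_le_prod (fun k _ => norm_nonneg _) fun k _ => ?_
        rw [norm_mul, norm_quasiChar]
        exact mul_le_mul_of_nonneg_left (hC k _) (zpow_nonneg (absAt_pos _).le _)
      have e3 : absAt θ ^ (-lv X) ≤
          β ^ (6 * n : ℤ) * ((∏ k, β ^ (-lv (y k))) * β ^ (-lv X)) := by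
        have hl : ∀ i, lv X + lv (vArg ϖ n y i) ≤ 0 := hX.2
        have h0 := hl 0
        have h1 := hl 1
        have h2 := hl 2
        rw [lv_vArg D.unif] at h0 h1 h2
        rw [← inv_inv (absAt θ), ← hβ2, prod_univ_three, inv_zpow, ← zpow_neg, neg_neg,
          ← zpow_natCast β 2, ← zpow_mul, ← zpow_add₀ hβ0.ne', ← zpow_add₀ hβ0.ne',
          ← zpow_add₀ hβ0.ne', ← zpow_add₀ hβ0.ne']
        refine zpow_le_zpow_right₀ hβ1.le ?_
        grind
      rw [e1, indicator_of_mem (show X ∈ {X : Fˣ | (n : ℤ) < lv X} from hX.1)]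
      refine (mul_le_mul e2 e3 (zpow_nonneg hb.le _) (Finset.prod_nonneg fun k _ =>
        mul_nonneg (zpow_nonneg (absAt_pos _).le _) (hC0 k))).trans (le_of_eq ?_)
      have e4 : ∀ k, {a : Fˣ | lv a ≤ n}.indicator (fun a =>
          (absAt (ξ k) * β) ^ (-lv a) * C k) (y k) =
          absAt (ξ k) ^ (-lv (y k)) * C k * β ^ (-lv (y k)) := fun k => by
        rw [indicator_of_mem (show y k ∈ {a : Fˣ | lv a ≤ n} from hy.1 k), mul_zpow]
        ring
      simp only [e4, prod_mul_distrib]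
      ring
    · refine le_trans (le_of_eq ?_) hnn
      rw [coreE, indicator_of_notMem hX, mul_zero, norm_zero]
  · refine le_trans (le_of_eq ?_) hnn
    rw [coreE, indicator_of_notMem hy, zero_mul, norm_zero]

theorem CoreData.integral_E (D : CoreData ψ ϖ μ ν θ ξ Φ n) :
    ∫ p, coreE ψ ϖ θ ξ Φ n p ∂coreMeasure F = 0 := by
  rw [integral_prod _ D.integrable_E]
  refine integral_eq_zero_of_ae (ae_of_all _ fun y => ?_)
  simp only [coreE]
  rw [integral_const_mul, integral_indicator (measurableSet_lv _)]
  have h := integral_char_psi_above D.ord D.pos D.triv_theta 1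
    (S := {k : ℤ | (n : ℤ) < k ∧ ∀ i, k + lv (vArg ϖ n y i) ≤ 0})
    (fun k hk => by rw [lv_one, add_zero]; exact hk.1)
  simp_all

theorem CoreData.main (D : CoreData ψ ϖ μ ν θ ξ Φ n) :
    Integrable (coreF ψ ϖ μ ν θ ξ Φ n) (coreMeasure F) ∧
    ∫ p, coreF ψ ϖ μ ν θ ξ Φ n p ∂coreMeasure F = (∏ i, ∫ a : Fˣ, (ξ i a : ℂ) * Φ i a ∂haarFx F) *
        ∫ X in {X : Fˣ | lv X ≤ n}, (θ X : ℂ) * (ψ (X : F) : ℂ) ∂haarFx F := by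
  have hN := D.integrable_main.indicator (measurable_fst (measurableSet_coreN (F := F) (ϖ :=
      ϖ) (n := n)))
  have hS : Integrable (fun p => ∑ i, (Prod.fst ⁻¹' coreS ϖ n i).indicator
      (coreF ψ ϖ μ ν θ ξ Φ n) p) (coreMeasure F) :=
    integrable_finsetSum _ fun i _ => (D.shell i).1
  have hM : Integrable (fun p => ∑ i, coreMainS ψ ϖ θ ξ Φ n i p) (coreMeasure F) :=
    integrable_finsetSum _ fun i _ => D.integrable_mainS i
  have e1 : coreF ψ ϖ μ ν θ ξ Φ n = (fun p => ∑ i, (Prod.fst ⁻¹' coreS ϖ n i).indicator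
      (coreF ψ ϖ μ ν θ ξ Φ n) p) + (Prod.fst ⁻¹' coreN ϖ n).indicator (coreMain ψ θ ξ Φ n) +
      coreE ψ ϖ θ ξ Φ n := funext (coreF_decomp D)
  have e2 : coreMain ψ θ ξ Φ n = (fun p => ∑ i, coreMainS ψ ϖ θ ξ Φ n i p) +
      (Prod.fst ⁻¹' coreN ϖ n).indicator (coreMain ψ θ ξ Φ n) := funext (coreMain_decomp D)
  constructor
  · rw [e1]
    exact (hS.add hN).add D.integrable_E
  · rw [← CoreData.integral_main (n := n)]
    refine (congrArg (fun g => ∫ p, g p ∂coreMeasure F) e1).trans (Eq.trans ?_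
      (congrArg (fun g => ∫ p, g p ∂coreMeasure F) e2).symm)
    rw [integral_add' (hS.add hN) D.integrable_E, D.integral_E, add_zero, integral_add' hS hN,
      integral_add' hM hN, integral_finsetSum _ fun i _ => (D.shell i).1,
      integral_finsetSum _ fun i _ => D.integrable_mainS i]
    simp only [fun i => (D.shell i).2]

end Core

section Coordinates

/-! ### A measure preserving change of coordinates -/

open Classical in
/-- The unit given by a nonzero element. -/
def toUnits (x : F) : Fˣ := if h : x ≠ 0 then mk0 x h else 1

theorem val_toUnits {x : F} (h : x ≠ 0) : (toUnits x : F) = x := by rw [toUnits, dif_pos h]; rfl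

theorem toUnits_val (u : Fˣ) : toUnits (u : F) = u := Units.ext (val_toUnits u.ne_zero)

theorem measurable_toUnits : Measurable (toUnits : F → Fˣ) := by
  classical
  rw [← measurableEmbedding_unitsVal.measurable_comp_iff]
  have e : Units.val ∘ (toUnits : F → Fˣ) = fun x => if x = 0 then 1 else x := by
    ext x
    by_cases h : x = 0
    · simp [toUnits, h]
    · rw [if_neg h]; exact val_toUnits h
  rw [e]
  exact Measurable.ite (measurableSet_singleton 0) measurable_const measurable_id

variable (F) in
/-- The density of the additive Haar measure on `Fˣ`. -/
def unitsDensity (X : Fˣ) : NNReal := (volUnits F).toNNReal * ‖(X : F)‖₊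

theorem measurable_unitsDensity : Measurable (unitsDensity F) := by
  unfold unitsDensity
  exact (Units.continuous_val.nnnorm.measurable).const_mul _

variable (F) in
/-- The additive Haar measure on `Fˣ`. -/
def addUnits : Measure Fˣ := (haarFx F).withDensity fun X => (unitsDensity F X : ENNReal)

theorem map_toUnits : (haarF F).map toUnits = addUnits F := by
  refine Measure.ext_of_lintegral _ fun f hf => ?_
  have hv := volUnits_pos F
  rw [lintegral_map hf measurable_toUnits, addUnits, lintegral_withDensity_eq_lintegral_mul _
    measurable_unitsDensity.coe_nnreal_ennreal hf]
  have e : ∀ X : Fˣ, ((fun X => (unitsDensity F X : ENNReal)) * f) X =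
      ENNReal.ofReal (volUnits F) * (fun x : F => ENNReal.ofReal ‖x‖ * f (toUnits x)) X :=
          fun X => by
    beta_reduce
    rw [Pi.mul_apply, unitsDensity, ENNReal.coe_mul, mul_assoc, toUnits_val]
    congr 2
    exact (ofReal_norm _).symm
  rw [lintegral_congr e, lintegral_const_mul, lintegral_haarFx (fun x => ENNReal.ofReal ‖x‖ *
    f (toUnits x)), ← mul_assoc, ← ENNReal.ofReal_mul hv.le,
    mul_inv_cancel₀ hv.ne', ENNReal.ofReal_one, one_mul]
  · refine lintegral_congr_ae ?_
    filter_upwards [ae_ne_zero] with x hx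
    rw [← mul_assoc, ← ENNReal.ofReal_mul (by simp), inv_mul_cancel₀ (norm_ne_zero_iff.2 hx),
      ENNReal.ofReal_one, one_mul]
  · exact (ENNReal.measurable_ofReal.comp measurable_norm).mul (hf.comp measurable_toUnits)
  · exact ((ENNReal.measurable_ofReal.comp measurable_norm).mul
      (hf.comp measurable_toUnits)).comp Units.continuous_val.measurable

theorem measurePreserving_toUnits : MeasurePreserving toUnits (haarF F) (addUnits F) :=
  ⟨measurable_toUnits, map_toUnits⟩

instance : SFinite (addUnits F) := by unfold addUnits; infer_instance

/-- The torus coordinates with first entry `1`. -/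
def torus (a : Fin 3 → Fˣ) : Fin 3 → Fˣ := ![1, a 1, a 2]

/-- The translation in the first coordinate. -/
def shiftX (a : Fin 3 → Fˣ) (u : Fin 3 → F) : F := ∑ i, ((a 0 * torus a i ^ 2 : Fˣ) : F) * (u i)⁻¹

/-- The monomial change of torus coordinates. -/
def torusEquiv : (Fin 3 → Fˣ) ≃* (Fin 3 → Fˣ) where
  toFun a := ![a 0 * a 1 * a 2, a 0 * a 2, a 0 * a 1]
  invFun y := ![y 1 * y 2 * (y 0)⁻¹, y 0 * (y 1)⁻¹, y 0 * (y 2)⁻¹]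
  left_inv a := by
    funext i
    fin_cases i <;> refine Units.ext ?_ <;> simp <;> try field_simp
  right_inv a := by
    funext i
    fin_cases i <;> simp
  map_mul' a b := by
    funext i
    fin_cases i <;> refine Units.ext ?_ <;> simp <;> ring

theorem measurePreserving_torusEquiv : MeasurePreserving (torusEquiv (F := F))
    (Measure.pi fun _ => haarFx F) (Measure.pi fun _ => haarFx F) := by
  have : MeasurableMul (Fin 3 → Fˣ) := inferInstance
  have := Measure.pi.isHaarMeasure fun _ : Fin 3 => haarFx F
  have h0 : IsOpen {u : Fˣ | lv u = 0} := isOpen_lv {0}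
  have hc := isCompact_lv_zero (F := F)
  refine measurePreserving_mulEquiv _ torusEquiv ?_ ?_ (K :=
      Set.univ.pi fun _ => {u : Fˣ | lv u = 0})
    (isOpen_set_pi Set.finite_univ fun _ _ => h0) (isCompact_univ_pi fun _ => hc)
    ⟨1, by simp [lv_one]⟩ ?_
  · refine continuous_pi fun i => ?_
    change Continuous fun a : Fin 3 → Fˣ =>
      (![a 0 * a 1 * a 2, a 0 * a 2, a 0 * a 1] : Fin 3 → Fˣ) i
    fin_cases i <;> simp <;> fun_prop
  · refine continuous_pi fun i => ?_
    change Continuous fun y : Fin 3 → Fˣ =>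
      (![y 1 * y 2 * (y 0)⁻¹, y 0 * (y 1)⁻¹, y 0 * (y 2)⁻¹] : Fin 3 → Fˣ) i
    fin_cases i <;> simp <;> fun_prop
  · ext a
    simp only [torusEquiv, MulEquiv.coe_mk, Equiv.coe_fn_mk, Set.mem_preimage, Set.mem_pi,
      Set.mem_univ, true_imp_iff, mem_ofPred_eq, Fin.forall_fin_succ, Matrix.cons_val_zero,
      Matrix.cons_val_succ, Fin.succ_zero_eq_one,
      Fin.succ_one_eq_two, lv_mul, IsEmpty.forall_iff, and_true]
    grind

/-- The scaling of the torus coordinates. -/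
def torusScale (u : Fin 3 → F) (X : Fˣ) (i : Fin 3) : Fˣ :=
  -(X⁻¹ * toUnits (u i) * (∏ j, toUnits (u j))⁻¹)

/-- The new coordinates `((y, X), u)`. -/
def newCoords (p : F × (Fin 3 → Fˣ) × (Fin 3 → F)) : ((Fin 3 → Fˣ) × Fˣ) × (Fin 3 → F) :=
  ((torusScale p.2.2 (toUnits (p.1 + shiftX p.2.1 p.2.2)) * torusEquiv p.2.1,
    toUnits (p.1 + shiftX p.2.1 p.2.2)), p.2.2)

theorem measurable_shiftX : Measurable fun q : (Fin 3 → Fˣ) × (Fin 3 → F) => shiftX q.1 q.2 := by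
  refine Finset.measurable_sum _ fun i _ => Measurable.mul ?_
    ((measurable_pi_apply i).comp measurable_snd).inv
  have : Continuous fun a : Fin 3 → Fˣ => ((a 0 * torus a i ^ 2 : Fˣ) : F) := by
    refine Units.continuous_val.comp ?_
    unfold torus
    fin_cases i <;> simp <;> fun_prop
  exact this.measurable.comp measurable_fst

theorem measurable_torusScale : Measurable fun q : (Fin 3 → F) × Fˣ => torusScale q.1 q.2 := by
  have h : ∀ i, Measurable fun q : (Fin 3 → F) × Fˣ => toUnits (q.1 i) := fun i =>
    measurable_toUnits.comp ((measurable_pi_apply i).comp measurable_fst)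
  have hn : Measurable fun u : Fˣ => -u := by
    have : Continuous fun u : Fˣ => (-1) * u := continuous_const.mul continuous_id
    simpa using this.measurable
  refine measurable_pi_lambda _ fun i => hn.comp ?_
  exact ((measurable_snd.inv).mul (h i)).mul
    (Finset.measurable_prod _ fun j _ => h j).inv

theorem measurePreserving_newCoords : MeasurePreserving (newCoords (F := F)) (coordMeasure F)
    (((Measure.pi fun _ => haarFx F).prod (addUnits F)).prod (Measure.pi fun _ => haarF F)) := by
  set α : Measure (Fin 3 → Fˣ) := Measure.pi fun _ => haarFx F
  set υ : Measure (Fin 3 → F) := Measure.pi fun _ => haarF F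
  have : MeasurableMul (Fin 3 → Fˣ) := inferInstance
  have : SFinite α := inferInstanceAs (SFinite (Measure.pi fun _ => haarFx F))
  have : SFinite υ := inferInstanceAs (SFinite (Measure.pi fun _ => haarF F))
  have hα : α.IsHaarMeasure := Measure.pi.isHaarMeasure fun _ : Fin 3 => haarFx F
  have hs1 : MeasurePreserving Prod.swap ((haarF F).prod (α.prod υ)) ((α.prod υ).prod (haarF F)) :=
    Measure.measurePreserving_swap
  have hs2 : MeasurePreserving (fun q : ((Fin 3 → Fˣ) × (Fin 3 → F)) × F =>
      (q.1, toUnits (q.2 + shiftX q.1.1 q.1.2))) ((α.prod υ).prod (haarF F))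
      ((α.prod υ).prod (addUnits F)) := by
    refine (MeasurePreserving.id (α.prod υ)).skew_product
      (g := fun q x => toUnits (x + shiftX q.1 q.2)) ?_ (ae_of_all _ fun q => ?_)
    · exact measurable_toUnits.comp (measurable_snd.add (measurable_shiftX.comp measurable_fst))
    · exact (measurePreserving_toUnits.comp (measurePreserving_add_right (haarF F)
        (shiftX q.1 q.2))).map_eq
  have hs3 : MeasurePreserving (MeasurableEquiv.prodAssoc) ((α.prod υ).prod (addUnits F))
    (α.prod (υ.prod (addUnits F))) := measurePreserving_prodAssoc _ _ _
  have hs4 : MeasurePreserving Prod.swap (α.prod (υ.prod (addUnits F)))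
    ((υ.prod (addUnits F)).prod α) := Measure.measurePreserving_swap
  have hs5 : MeasurePreserving (fun q : ((Fin 3 → F) × Fˣ) × (Fin 3 → Fˣ) =>
      (q.1, torusScale q.1.1 q.1.2 * torusEquiv q.2)) ((υ.prod (addUnits F)).prod α)
      ((υ.prod (addUnits F)).prod α) := by
    refine (MeasurePreserving.id (υ.prod (addUnits F))).skew_product
      (g := fun q a => torusScale q.1 q.2 * torusEquiv a) ?_ (ae_of_all _ fun q => ?_)
    · exact (measurable_torusScale.comp measurable_fst).mul
        (measurePreserving_torusEquiv.measurable.comp measurable_snd)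
    · exact ((measurePreserving_mul_left α (torusScale q.1 q.2)).comp
        measurePreserving_torusEquiv).map_eq
  have hs6 : MeasurePreserving (MeasurableEquiv.prodAssoc) ((υ.prod (addUnits F)).prod α)
    (υ.prod ((addUnits F).prod α)) := measurePreserving_prodAssoc _ _ _
  have hs7 : MeasurePreserving Prod.swap (υ.prod ((addUnits F).prod α))
    (((addUnits F).prod α).prod υ) := Measure.measurePreserving_swap
  have hs8 : MeasurePreserving (Prod.map Prod.swap id) (((addUnits F).prod α).prod υ)
    ((α.prod (addUnits F)).prod υ) :=
    (Measure.measurePreserving_swap).prod (MeasurePreserving.id υ)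
  exact hs8.comp (hs7.comp (hs6.comp (hs5.comp (hs4.comp (hs3.comp (hs2.comp hs1))))))

end Coordinates

section Unfolding

/-! ### The Whittaker functions on the open cell -/

section GL2

variable {μ ν : QuasiChar F} {φ : GL₂(F) → ℂ} {n : ℕ}

theorem upHalf_mul_downHalf (z : Fˣ) : (upHalf μ z : ℂ) * (downHalf ν z : ℂ) = ((μ * ν) z : ℂ) := by
  rw [← halves_apply, div_self z.ne_zero, norm_one, Real.one_rpow, Complex.ofReal_one, mul_one,
    mul_apply, val_mul]

theorem ps_central (h : φ ∈ psMod μ ν) (z : Fˣ) (k : GL₂(F)) :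
    rightReg _ (borel z z 0 * k) φ = ((μ * ν) z : ℂ) • rightReg _ k φ := by
  ext g
  have e : g * (borel z z 0 * k) = borel z z 0 * (g * k) := by
    rw [← mul_assoc, ← mul_assoc]
    congr 1
    apply gl2_ext <;> simp [gl2_mul, mul_comm]
  rw [rightReg_apply, e, ps_apply h, upHalf_mul_downHalf]
  rfl

theorem whit_openCell (hψ : HasOrderZero ψ) (h : φ ∈ psMod μ ν) (x : F) (b d u p : Fˣ) :
    whit ψ (rightReg _ (nU x * borel b d 0 * nL (u : F) * ((J1 F)⁻¹ * mT p)) φ) =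
      (ψ (x + ((b * d⁻¹ * u⁻¹ : Fˣ) : F)) : ℂ) * ((μ * ν) (d * u * p⁻¹) : ℂ) *
        whit ψ (rightReg _ (tT (b * d⁻¹ * p ^ 2 * (u ^ 2)⁻¹) *
          nL (-((p ^ 2 * u⁻¹ : Fˣ) : F))) φ) := by
  have e : nU x * borel b d 0 * nL (u : F) * ((J1 F)⁻¹ * mT p) =
      nU (x + ((b * d⁻¹ * u⁻¹ : Fˣ) : F)) * (borel (d * u * p⁻¹) (d * u * p⁻¹) 0 *
        (tT (b * d⁻¹ * p ^ 2 * (u ^ 2)⁻¹) * nL (-((p ^ 2 * u⁻¹ : Fˣ) : F)))) := by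
    rw [J1_inv]
    apply gl2_ext <;> simp [gl2_mul, nU, tT, mT] <;> field_simp <;> ring
  rw [e, map_mul, Module.End.mul_apply, whit_nU hψ (ps_translate h _), ps_central h,
    whit_smul hψ (ps_translate h _)]
  ring

theorem whit_psOrd_nL (hn : 1 ≤ n) (hμ : TrivialMod μ n)
    (hν : TrivialMod ν n) (g : GL₂(F)) {v w : F} (hvw : v - w ∈ ball F (-(n : ℤ))) :
    rightReg _ (g * nL v) (psOrd μ ν) = rightReg _ (g * nL w) (psOrd μ ν) := by
  ext k
  have e : nL v = nL w * nL (v - w) := by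
    apply gl2_ext <;> simp [gl2_mul]
  rw [rightReg_apply, rightReg_apply, e, ← mul_assoc, ← mul_assoc, psOrd_mul_nL hn hμ hν hvw,
    mul_assoc]

end GL2

theorem pointH_apply (x : F) (a : Fin 3 → Fˣ) (u : Fin 3 → F) (i : Fin 3) : (pointH x a u).1 i =
      nU (if i = 0 then x else 0) * borel (a 0 * torus a i) (torus a i)⁻¹ 0 * nL (u i) := by
  have h0 : nU (0 : F) = 1 := by apply gl2_ext <;> simp [nU]
  fin_cases i
  · simp [pointH, torus, tT]
  · simp [pointH, torus, tT, mT, h0, borel_mul]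
  · simp [pointH, torus, tT, mT, h0, borel_mul]

/-! ### The section on the open cell -/

theorem det_nL (u : F) : GeneralLinearGroup.det (nL u) = 1 := Units.ext (by
  rw [GeneralLinearGroup.val_det_apply, Matrix.det_fin_two]; simp)

theorem similitude_eta_iota (x : F) (a : Fin 3 → Fˣ) (u : Fin 3 → F) :
    similitude (eta F * iota (pointH x a u)) = a 0 := by
  rw [similitude_mul, eta, iota, similitude_ofMatrix, similitude_ofMatrix, one_mul]
  simp [pointH, nU, tT, det_borel, det_nL]

/-- The determinant of the lower left block. -/
def cellDet (a : Fin 3 → Fˣ) (U : Fin 3 → Fˣ) (X : Fˣ) : Fˣ := (∏ i, U i) * X * (∏ i, torus a i)⁻¹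

theorem blkC_eta_iota (x : F) (a : Fin 3 → Fˣ) (u : Fin 3 → F) :
    blkC (eta F * iota (pointH x a u)) = !![(a 0 : F) + x * u 0, (a 0 : F) * a 1, (a 0 : F) * a 2;
        -u 0, u 1 * (a 1 : F)⁻¹, 0; -u 0, 0, u 2 * (a 2 : F)⁻¹] := by
  rw [blkC_mul]
  ext i j
  fin_cases i <;> fin_cases j <;>
    simp [blkC, blkD, blkA, eta, iota, GSp6.ofMatrix, pointH, gl2_mul, nU, tT, mT,
      Matrix.vecMul_diagonal] <;> ring

theorem blkD_eta_iota (x : F) (a : Fin 3 → Fˣ) (u : Fin 3 → F) :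
    blkD (eta F * iota (pointH x a u)) = !![x, 0, 0; -1, (a 1 : F)⁻¹, 0; -1, 0, (a 2 : F)⁻¹] := by
  rw [blkD_mul]
  ext i j
  fin_cases i <;> fin_cases j <;>
    simp [blkC, blkD, blkB, eta, iota, GSp6.ofMatrix, pointH, gl2_mul, nU, tT, mT,
      Matrix.vecMul_diagonal]

theorem bigCellSection_pointH (ω χ : 𝓧) (Φ : M₃(F) → ℂ) (x : F)
    (a U : Fin 3 → Fˣ) (X : Fˣ) (hX : (X : F) = x + shiftX a fun i => (U i : F))
    (y : Fin 3 → Fˣ) (hy : ∀ i, y i = -(X⁻¹ * U i * (∏ j, U j)⁻¹) * torusEquiv a i) :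
    bigCellSection ω χ Φ (eta F * iota (pointH x a fun i => (U i : F))) =
      cellFactor ω χ (a 0) (cellDet a U X) *
        Φ (symMat (fun i => (U i : F)⁻¹ + ((∏ j, y j) * (y i ^ 2)⁻¹ : Fˣ)) fun i => y i) := by
  have hX' : (X : F) = x + ((a 0 : F) * (U 0 : F)⁻¹ + (a 0 : F) * (a 1 : F) ^ 2 * (U 1 : F)⁻¹ +
      (a 0 : F) * (a 2 : F) ^ 2 * (U 2 : F)⁻¹) := by
    rw [hX, shiftX, Fin.sum_univ_three]
    simp [torus]
  have hx : x = (X : F) - ((a 0 : F) * (U 0 : F)⁻¹ + (a 0 : F) * (a 1 : F) ^ 2 * (U 1 : F)⁻¹ +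
      (a 0 : F) * (a 2 : F) ^ 2 * (U 2 : F)⁻¹) := by grind
  have hdet : (blkC (eta F * iota (pointH x a fun i => (U i : F)))).det = cellDet a U X := by
    rw [blkC_eta_iota, Matrix.det_fin_three, hx, cellDet, prod_univ_three, prod_univ_three]
    simp [torus]
    field_simp
    ring
  rw [bigCellSection_eq, similitude_eta_iota, bigCellValue_of_det _ _ _ _ _ _ hdet]
  congr 2
  have hu : IsUnit (blkC (eta F * iota (pointH x a fun i => (U i : F)))).det := by
    rw [hdet]; simp
  refine Eq.trans ?_ (Matrix.nonsing_inv_mul_cancel_left _ _ hu)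
  congr 1
  rw [blkC_eta_iota, blkD_eta_iota, hx]
  have h0 := hy 0
  have h1 := hy 1
  have h2 := hy 2
  simp only [torusEquiv, MulEquiv.coe_mk, Equiv.coe_fn_mk, Matrix.cons_val_zero,
    Matrix.cons_val_one, Matrix.cons_val] at h0 h1 h2
  ext i j
  fin_cases i <;> fin_cases j <;>
    simp [Matrix.mul_apply, Fin.sum_univ_three, symMat, prod_univ_three, h0, h1, h2] <;>
    field_simp <;> ring

end Unfolding

section Zeta

variable {χ : QuasiChar F} {μ ν : Fin 3 → QuasiChar F} {n : ℕ}

/-! ### The integrand in the new coordinates -/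

variable (χ ν) in
/-- The quasi-character of the variable `X`. -/
def zetaTheta : 𝓧 := χ * (∏ i, ν i) * absPow F (1 / 2)

variable (χ μ ν) in
/-- The quasi-characters of the variables `y i`. -/
def zetaXi (i : Fin 3) : 𝓧 := zetaTheta χ ν * (μ i * (ν i)⁻¹)

variable (χ μ ν ϖ n) in
/-- The constant in the zeta integral. -/
def zetaConst : ℂ := (χ (-1) : ℂ) * ∏ i, ((μ i (-1) : ℂ) * ((ν i ϖ : ℂ) / (𝔮 * (μ i ϖ : ℂ))) ^ n)

theorem qc_prod_apply (f : Fin 3 → 𝓧) (u : Fˣ) : ((∏ i, f i : 𝓧) u : ℂ) = ∏ i, (f i u : ℂ) := by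
  simp [prod_univ_three]

section Identities

variable {a U y : Fin 3 → Fˣ} {X : Fˣ}

theorem central_unit (hy : ∀ i, y i = -(X⁻¹ * U i * (∏ j, U j)⁻¹) * torusEquiv a i) (i : Fin 3)
    (p : Fˣ) : (torus a i)⁻¹ * U i * p⁻¹ * (a 0 * (cellDet a U X)⁻¹) = -1 * y i * p⁻¹ := by
  rw [hy i, cellDet]
  refine Units.ext ?_
  simp only [torusEquiv, MulEquiv.coe_mk, Equiv.coe_fn_mk, torus, prod_univ_three]
  fin_cases i <;> simp <;> field_simp

theorem factor_unit (hy : ∀ i, y i = -(X⁻¹ * U i * (∏ j, U j)⁻¹) * torusEquiv a i) :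
    a 0 ^ 3 * (cellDet a U X)⁻¹ ^ 2 = -1 * (X * ∏ j, y j) := by
  simp only [hy, cellDet]
  refine Units.ext ?_
  simp only [torusEquiv, MulEquiv.coe_mk, Equiv.coe_fn_mk, torus, prod_univ_three]
  simp
  field_simp

theorem vArg_unit (hy : ∀ i, y i = -(X⁻¹ * U i * (∏ j, U j)⁻¹) * torusEquiv a i) (i : Fin 3) :
    a 0 * torus a i * (torus a i)⁻¹⁻¹ * (ϖ ^ n) ^ 2 * (U i ^ 2)⁻¹ = -(X * vArg ϖ n y i) := by
  simp only [hy, vArg]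
  refine Units.ext ?_
  simp only [torusEquiv, MulEquiv.coe_mk, Equiv.coe_fn_mk, torus, prod_univ_three]
  fin_cases i <;> simp <;> field_simp <;> ring

theorem vArg_mul_unit (i : Fin 3) : (-1 * y i * (ϖ ^ n)⁻¹) * -(X * vArg ϖ n y i) =
    (X * ∏ j, y j) * ϖ ^ n * (y i)⁻¹ := by
  rw [vArg]
  refine Units.ext ?_
  simp
  field_simp
  ring

theorem prod_half (hϖ : lv ϖ = -1) : ∏ i, (absPow F (1 / 2) (-(X * vArg ϖ n y i)) : ℂ) =
    (absPow F (1 / 2) (X * ∏ j, y j) : ℂ) * (‖(X : F)‖ : ℂ) * (𝔮⁻¹) ^ (3 * n) := by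
  have h1 : ∀ z : Fˣ, (absPow F (1 / 2) z : ℂ) * (absPow F (1 / 2) z : ℂ) = (‖(z : F)‖ : ℂ) :=
    fun z => by
      rw [← absPow_one_apply, ← val_mul, ← mul_apply, ← absPow_add]
      norm_num
  have h2 : ∏ i, -(X * vArg ϖ n y i) =
      (-1 * (X * ∏ j, y j)) * ((X * ϖ ^ (3 * n)) * (X * ϖ ^ (3 * n))) := by
    simp only [vArg, prod_univ_three]
    refine Units.ext ?_
    simp
    field_simp
    ring
  have h3 : (absPow F (1 / 2) (-1 : Fˣ) : ℂ) = 1 := by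
    rw [absPow_apply]; simp
  have h4 : ‖(ϖ : F)‖ = 𝔮ᵣ⁻¹ := by rw [norm_eq_lv, hϖ, zpow_neg_one]
  calc ∏ i, (absPow F (1 / 2) (-(X * vArg ϖ n y i)) : ℂ)
      = (absPow F (1 / 2) (∏ i, -(X * vArg ϖ n y i)) : ℂ) := by simp
    _ = _ := by
        rw [h2, map_mul, map_mul (absPow F (1 / 2)) (-1), map_mul (absPow F (1 / 2)) (X * _),
          val_mul, val_mul, val_mul, h3, h1, one_mul, mul_assoc, val_mul,
          Units.val_pow_eq_pow_val, norm_mul, norm_pow, h4]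
        simp

theorem density_unit : ‖((a 0 ^ 3 * (cellDet a U X)⁻¹ ^ 2 : Fˣ) : F)‖ *
    (‖(a 0 : F)‖ ^ 3 * ‖(a 1 : F)‖ ^ 2 * ‖(a 2 : F)‖ ^ 2)⁻¹ * ‖(X : F)‖ =
      ‖(X : F)‖⁻¹ * ∏ i, (‖(U i : F)‖ ^ 2)⁻¹ := by
  have h : ∀ z : Fˣ, ‖(z : F)‖ ≠ 0 := fun z => by simp
  have := h X; have := h (a 0); have := h (a 1); have := h (a 2)
  have := h (U 0); have := h (U 1); have := h (U 2)
  simp only [cellDet, torus, prod_univ_three]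
  simp
  field_simp

theorem char_identity (hϖ : lv ϖ = -1)
    (hy : ∀ i, y i = -(X⁻¹ * U i * (∏ j, U j)⁻¹) * torusEquiv a i) :
    (∏ i, (((μ i * ν i) ((torus a i)⁻¹ * U i * (ϖ ^ n)⁻¹) : ℂ) *
      (upHalf (ν i) (-(X * vArg ϖ n y i)) : ℂ))) *
      cellFactor (∏ i, μ i * ν i) χ (a 0) (cellDet a U X) *
      (((‖(a 0 : F)‖ ^ 3 * ‖(a 1 : F)‖ ^ 2 * ‖(a 2 : F)‖ ^ 2)⁻¹ : ℝ) : ℂ) =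
    zetaConst ϖ χ μ ν n * ((‖(X : F)‖ : ℂ)⁻¹ * ((∏ i, (zetaXi χ μ ν i (y i) : ℂ)) *
      (zetaTheta χ ν X : ℂ)) * ∏ i, ((‖(U i : F)‖ : ℂ) ^ 2)⁻¹) := by
  set c := a 0 * (cellDet a U X)⁻¹ with hc
  set P := X * ∏ j, y j with hP
  have hi : ∀ i, ((μ i * ν i) ((torus a i)⁻¹ * U i * (ϖ ^ n)⁻¹) : ℂ) *
      (upHalf (ν i) (-(X * vArg ϖ n y i)) : ℂ) * ((μ i * ν i) c : ℂ) =
      ((μ i (-1) : ℂ) * ((ν i ϖ : ℂ) / (𝔮 * (μ i ϖ : ℂ))) ^ n) *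
        (𝔮 ^ n * ((ν i P : ℂ) * ((μ i (y i) : ℂ) * (ν i (y i) : ℂ)⁻¹))) *
        (absPow F (1 / 2) (-(X * vArg ϖ n y i)) : ℂ) := fun i => by
    have e1 : ∀ η : 𝓧, (η ((torus a i)⁻¹ * U i * (ϖ ^ n)⁻¹) : ℂ) * (η c : ℂ) =
        (η (-1) : ℂ) * (η (y i) : ℂ) * ((η ϖ : ℂ) ^ n)⁻¹ := fun η => by
      rw [← val_mul, ← map_mul, hc, central_unit hy i (ϖ ^ n), map_mul, map_mul, map_inv,
        map_pow, val_mul, val_mul, val_inv_eq_inv_val, Units.val_pow_eq_pow_val]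
    have e2 : (ν i (-1) : ℂ) * (ν i (y i) : ℂ) * ((ν i ϖ : ℂ) ^ n)⁻¹ *
        (ν i (-(X * vArg ϖ n y i)) : ℂ) = (ν i P : ℂ) * (ν i ϖ : ℂ) ^ n * (ν i (y i) : ℂ)⁻¹ := by
      have := congrArg (fun z => (ν i z : ℂ)) (vArg_mul_unit (ϖ := ϖ) (n := n) (X := X) (y := y) i)
      simpa only [map_mul (ν i) (-1 * y i * (ϖ ^ n)⁻¹), map_mul (ν i) (-1 * y i),
        map_mul (ν i) (-1), ← hP, map_mul (ν i) (P * ϖ ^ n), map_mul (ν i) P, map_inv, map_pow,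
        val_mul, val_inv_eq_inv_val, Units.val_pow_eq_pow_val] using this
    have hq := qC_ne_zero F
    have h1 := (μ i ϖ).ne_zero
    have h2 := (ν i ϖ).ne_zero
    have e3 := e1 (μ i)
    have e4 := e1 (ν i)
    simp only [mul_apply, upHalf, val_mul (μ i _), val_mul (ν i _)] at e3 e4 ⊢
    generalize (μ i ((torus a i)⁻¹ * U i * (ϖ ^ n)⁻¹) : ℂ) = A1 at *
    generalize (ν i ((torus a i)⁻¹ * U i * (ϖ ^ n)⁻¹) : ℂ) = A2 at *
    generalize (absPow F (1 / 2) (-(X * vArg ϖ n y i)) : ℂ) = A3 at *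
    generalize (ν i (-(X * vArg ϖ n y i)) : ℂ) = A4 at *
    rw [show A1 * A2 * (A4 * A3) * ((μ i c : ℂ) * (ν i c : ℂ)) =
      (A1 * (μ i c : ℂ)) * (A2 * (ν i c : ℂ) * A4) * A3 by ring, e3, e4, e2, div_pow, mul_pow]
    field_simp
  have hden := congrArg (fun r : ℝ => (r : ℂ)) (density_unit (a := a) (U := U) (X := X))
  have hN := prod_half (n := n) (y := y) (X := X) hϖ
  have hprod := prod_congr rfl fun i (_ : i ∈ Finset.univ) => hi i
  have hq := qC_ne_zero F
  have hX0 : (‖(X : F)‖ : ℂ) ≠ 0 := by simp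
  have hθ : (∏ i, (zetaXi χ μ ν i (y i) : ℂ)) * (zetaTheta χ ν X : ℂ) =
      (χ P : ℂ) * (∏ i, (ν i P : ℂ)) * (absPow F (1 / 2) P : ℂ) *
        ∏ i, ((μ i (y i) : ℂ) * (ν i (y i) : ℂ)⁻¹) := by
    have e1 : ∏ i, (zetaXi χ μ ν i (y i) : ℂ) = (zetaTheta χ ν (∏ i, y i) : ℂ) *
        ∏ i, ((μ i (y i) : ℂ) * (ν i (y i) : ℂ)⁻¹) := by
      rw [map_prod, Units.coe_prod, ← prod_mul_distrib]
      refine prod_congr rfl fun i _ => ?_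
      simp only [zetaXi, mul_apply, qc_inv, val_mul, val_inv_eq_inv_val]
    have e2 : (zetaTheta χ ν P : ℂ) =
        (χ P : ℂ) * (∏ i, (ν i P : ℂ)) * (absPow F (1 / 2) P : ℂ) := by
      rw [zetaTheta, mul_apply, mul_apply, val_mul, val_mul, qc_prod_apply]
    rw [← e2, e1, hP, map_mul (zetaTheta χ ν) X, val_mul]
    ring
  have hf : a 0 ^ 3 * (cellDet a U X)⁻¹ ^ 2 = -1 * P := factor_unit hy
  rw [cellFactor, hθ, ← hc, qc_prod_apply, zetaConst]
  have hχ : (χ (a 0 ^ 3 * (cellDet a U X)⁻¹ ^ 2) : ℂ) = (χ (-1) : ℂ) * (χ P : ℂ) := by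
    rw [hf, map_mul, val_mul]
  rw [hχ]
  have hqq : (𝔮 ^ n) ^ 3 * (𝔮⁻¹) ^ (3 * n) = 1 := by
    rw [← pow_mul, mul_comm n 3, ← mul_pow, mul_inv_cancel₀ hq, one_pow]
  simp only [prod_mul_distrib] at hprod hden ⊢
  rw [hN, ← hP] at hprod
  simp only [Finset.prod_const, Finset.card_univ, Fintype.card_fin] at hprod
  rw [Complex.ofReal_mul, Complex.ofReal_mul, Complex.ofReal_mul, Complex.ofReal_inv] at hden
  have hU : ((∏ i, (‖(U i : F)‖ ^ 2)⁻¹ : ℝ) : ℂ) = ∏ i, ((‖(U i : F)‖ : ℂ) ^ 2)⁻¹ := by simp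
  rw [hU, Complex.ofReal_inv ‖(X : F)‖] at hden
  set nd : ℂ := (‖((a 0 ^ 3 * (cellDet a U X)⁻¹ ^ 2 : Fˣ) : F)‖ : ℂ)
  rw [Complex.ofReal_inv]
  grind

end Identities

variable (ψ) in
/-- The kernel of the integral over the lower unipotent elements. -/
def cellKernel (c u : F) : ℂ :=
  ((‖u‖ : ℂ) ^ 2)⁻¹ * fourier ψ (Set.indicator {x | ‖x‖ < 1} 1) (u⁻¹ + c)

theorem zetaIntegrand_eq (hψ : HasOrderZero ψ) (hϖ : lv ϖ = -1) (hn : 1 ≤ n)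
    (hμ : ∀ i, TrivialMod (μ i) n) (hν : ∀ i, TrivialMod (ν i) n) {W : Fin 3 → GL₂(F) → ℂ}
    (hW : ∀ i g, W i g = whit ψ (rightReg _ g (psOrd (μ i) (ν i)))) (ξ : Fin 3 → 𝓧)
    (x : F) (a U y : Fin 3 → Fˣ) (X : Fˣ) (hX : (X : F) = x + shiftX a fun i => (U i : F))
    (hy : ∀ i, y i = -(X⁻¹ * U i * (∏ j, U j)⁻¹) * torusEquiv a i) :
    zetaIntegrand (fun i => ordTranslate ϖ n (W i))
      (bigCellSection (∏ i, μ i * ν i) χ (schwartzPhi ψ ξ)) (x, a, fun i => (U i : F)) =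
    zetaConst ϖ χ μ ν n * ((‖(X : F)‖ : ℂ)⁻¹ *
      coreF ψ ϖ μ ν (zetaTheta χ ν) (zetaXi χ μ ν) (fun i => fourier ψ (unitPart (ξ i))) n (y, X) *
        ∏ i, cellKernel ψ (((∏ j, y j) * (y i ^ 2)⁻¹ : Fˣ) : F) (U i)) := by
  have hS := bigCellSection_pointH (∏ i, μ i * ν i) χ (schwartzPhi ψ ξ) x a U X hX y hy
  have hc := char_identity (χ := χ) (μ := μ) (ν := ν) (n := n) hϖ hy
  generalize (∏ i, μ i * ν i : 𝓧) = ω at hS hc ⊢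
  rw [zetaIntegrand, hS, schwartzPhi_symMat]
  simp only [cellKernel]
  set f : F → ℂ := fourier ψ (Set.indicator {x | ‖x‖ < 1} 1) with hf
  rw [prod_mul_distrib (f := fun i => ((‖(U i : F)‖ : ℂ) ^ 2)⁻¹)]
  by_cases h0 : ∏ i, f ((U i : F)⁻¹ + (((∏ j, y j) * (y i ^ 2)⁻¹ : Fˣ) : F)) = 0
  · grind
  have hw : ∀ i, ordTranslate ϖ n (W i) ((pointH x a fun i => (U i : F)).1 i) =
      (ψ ((if i = 0 then x else 0) + ((a 0 * torus a i ^ 2 : Fˣ) : F) * (U i : F)⁻¹) : ℂ) *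
        (((μ i * ν i) ((torus a i)⁻¹ * U i * (ϖ ^ n)⁻¹) : ℂ) *
          (upHalf (ν i) (-(X * vArg ϖ n y i)) : ℂ)) *
          ordKernel ψ (μ i) (ν i) X (vArg ϖ n y i) := fun i => by
    have hm : (U i : F)⁻¹ + (((∏ j, y j) * (y i ^ 2)⁻¹ : Fˣ) : F) ∈ ball F 1 := by
      by_contra hm
      exact h0 (Finset.prod_eq_zero (mem_univ i)
        ((ballFun_maximalIdeal.fourier hψ).supp _ (by grind)))
    have hd : -(((ϖ ^ n) ^ 2 * (U i)⁻¹ : Fˣ) : F) - (vArg ϖ n y i : F) ∈ ball F (-(n : ℤ)) := by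
      have e : -(((ϖ ^ n) ^ 2 * (U i)⁻¹ : Fˣ) : F) - (vArg ϖ n y i : F) = ((ϖ ^ (2 * n) : Fˣ) : F) *
            -((U i : F)⁻¹ + (((∏ j, y j) * (y i ^ 2)⁻¹ : Fˣ) : F)) := by
        rw [vArg]
        push_cast
        ring
      rw [e, unit_mul_mem_ball, ← zpow_natCast, lv_zpow, hϖ]
      exact ball_mono (by grind) ((ball F 1).neg_mem hm)
    have hk : whit ψ (rightReg _ (tT (-(X * vArg ϖ n y i)) * nL (vArg ϖ n y i : F))
        (psOrd (μ i) (ν i))) =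
        ordKernel ψ (μ i) (ν i) X (vArg ϖ n y i) * (upHalf (ν i) (-(X * vArg ϖ n y i)) : ℂ) := by
      rw [ordKernel, mul_assoc, inv_mul_cancel₀ (Units.ne_zero _), mul_one]
    have hs : a 0 * torus a i * (torus a i)⁻¹⁻¹ * (U i)⁻¹ = a 0 * torus a i ^ 2 * (U i)⁻¹ := by
      rw [inv_inv, sq, mul_assoc (a 0)]
    rw [ordTranslate, rightReg_apply, hW, pointH_apply, whit_openCell hψ (psOrd_mem _ _),
      vArg_unit hy i, whit_psOrd_nL hn (hμ i) (hν i) _ hd, hk, hs, val_mul,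
      val_inv_eq_inv_val]
    ring
  have hψX : ∏ i : Fin 3, (ψ ((if i = 0 then x else 0) +
      ((a 0 * torus a i ^ 2 : Fˣ) : F) * (U i : F)⁻¹) : ℂ) = (ψ (X : F) : ℂ) := by
    rw [← psi_sum, Finset.sum_add_distrib, hX, shiftX]
    simp
  simp only [hw]
  rw [prod_mul_distrib (g := fun i => ordKernel ψ (μ i) (ν i) X (vArg ϖ n y i)),
    prod_mul_distrib (g := fun i => ((μ i * ν i) ((torus a i)⁻¹ * U i * (ϖ ^ n)⁻¹) : ℂ) *
      (upHalf (ν i) (-(X * vArg ϖ n y i)) : ℂ)), hψX, coreF, coreWeight,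
    prod_mul_distrib (f := fun i => (zetaXi χ μ ν i (y i) : ℂ))]
  grind

end Zeta

section Zeta

variable {χ : QuasiChar F} {μ ν : Fin 3 → QuasiChar F} {n : ℕ}

/-! ### The integral over the lower unipotent elements -/

theorem fourier_maximalIdeal (hψ : HasOrderZero ψ) (w : F) :
    fourier ψ (Set.indicator {x : F | ‖x‖ < 1} 1) w =
      (ball F 1 : Set F).indicator (fun _ => 𝔮⁻¹) w := by
  have h : {x : F | ‖x‖ < 1} = (ball F (-1) : Set F) := by
    ext x; exact mem_ball_neg_one.symm
  have e : fourier ψ (Set.indicator {x : F | ‖x‖ < 1} 1) w =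
      ∫ x in (ball F (-1) : Set F), (ψ (x * w) : ℂ) ∂haarF F := by
    rw [fourier, h, ← integral_indicator (measurableSet_ball _)]
    refine integral_congr_ae (ae_of_all _ fun x => ?_)
    by_cases hx : x ∈ (ball F (-1) : Set F)
    · simp_all
    simp_all
  rw [e, hψ.integral_ball, zpow_neg_one, neg_neg]
  rfl

theorem cellKernel_eq (hψ : HasOrderZero ψ) (c u : F) : cellKernel ψ c u =
    (((‖u‖ ^ 2)⁻¹ * (ball F 1 : Set F).indicator (fun _ => 𝔮ᵣ⁻¹) (u⁻¹ + c) : ℝ) : ℂ) := by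
  rw [cellKernel, fourier_maximalIdeal hψ]
  by_cases h : u⁻¹ + c ∈ (ball F 1 : Set F)
  · simp_all
  simp_all

theorem integral_cellKernel (hψ : HasOrderZero ψ) (c : F) :
    Integrable (cellKernel ψ c) (haarF F) ∧ ∫ u, cellKernel ψ c u ∂haarF F = 1 := by
  set h : F → ℂ := fun x => (ball F 1 : Set F).indicator (fun _ => 𝔮⁻¹) (x + c) with hh
  have e : (fun u : Fˣ => ‖(u : F)‖ • cellKernel ψ c u) =
      fun u : Fˣ => (fun v : Fˣ => ‖(v : F)‖ • h v) u⁻¹ := by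
    ext u
    have hu : (‖(u : F)‖ : ℂ) ≠ 0 := by simp
    change ‖(u : F)‖ • cellKernel ψ c u = ‖((u⁻¹ : Fˣ) : F)‖ • h ((u⁻¹ : Fˣ) : F)
    rw [cellKernel, fourier_maximalIdeal hψ, hh, val_inv_eq_inv_val, norm_inv,
      real_smul, real_smul, Complex.ofReal_inv]
    field_simp
  have hi : Integrable h (haarF F) := by
    refine Integrable.comp_add_right
      (f := (ball F 1 : Set F).indicator fun _ => 𝔮⁻¹) ?_ c
    rw [integrable_indicator_iff (measurableSet_ball _)]
    exact integrableOn_const ((isCompact_ball 1).measure_lt_top.ne)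
  have hI : ∫ x, h x ∂haarF F = 1 := by
    rw [hh, integral_add_right_eq_self
      (fun x => (ball F 1 : Set F).indicator (fun _ => 𝔮⁻¹) x),
      integral_indicator (measurableSet_ball _), setIntegral_const, haarF_real_ball,
      real_smul, zpow_one]
    push_cast
    exact mul_inv_cancel₀ (qC_ne_zero F)
  constructor
  · rw [integrable_haarF, e]
    exact ((integrable_haarF h).1 hi).comp_inv
  · rw [integral_haarF] at hI ⊢
    rw [e, integral_inv_eq_self (fun v : Fˣ => ‖(v : F)‖ • h v) (haarFx F), hI]

/-- The argument of the kernels. -/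
def cellArg (y : Fin 3 → Fˣ) (i : Fin 3) : F := (((∏ j, y j) * (y i ^ 2)⁻¹ : Fˣ) : F)

theorem measurable_prod_cellKernel (hψ : HasOrderZero ψ) :
    Measurable fun q : (Fin 3 → Fˣ) × (Fin 3 → F) => ∏ i, cellKernel ψ (cellArg q.1 i) (q.2 i) := by
  refine Finset.measurable_prod _ fun i _ => ?_
  have hu : Measurable fun q : (Fin 3 → Fˣ) × (Fin 3 → F) => q.2 i :=
    (measurable_pi_apply i).comp measurable_snd
  have hc : Continuous fun y : Fin 3 → Fˣ => cellArg y i := by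
    unfold cellArg
    exact Units.continuous_val.comp (by fun_prop)
  have hf := (ballFun_maximalIdeal.fourier hψ).continuous.measurable
  exact (((Complex.measurable_ofReal.comp hu.norm).pow_const 2).inv).mul
    (hf.comp (hu.inv.add (hc.measurable.comp measurable_fst)))

theorem integral_prod_cellKernel (hψ : HasOrderZero ψ) (y : Fin 3 → Fˣ) :
    Integrable (fun u : Fin 3 → F => ∏ i, cellKernel ψ (cellArg y i) (u i))
      (Measure.pi fun _ => haarF F) ∧
    ∫ u : Fin 3 → F, ∏ i, cellKernel ψ (cellArg y i) (u i) ∂(Measure.pi fun _ => haarF F) = 1 ∧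
    ∫ u : Fin 3 → F, ‖∏ i, cellKernel ψ (cellArg y i) (u i)‖ ∂(Measure.pi fun _ => haarF F) =
        1 := by
  have h1 : ∫ u : Fin 3 → F, ∏ i, cellKernel ψ (cellArg y i) (u i) ∂(Measure.pi fun _ => haarF F) =
      1 := by
    rw [integral_fintype_prod_eq_prod (fun i => cellKernel ψ (cellArg y i))]
    exact Finset.prod_eq_one fun i _ => (integral_cellKernel hψ _).2
  refine ⟨Integrable.fintype_prod (f := fun i => cellKernel ψ (cellArg y i))
    fun i => (integral_cellKernel hψ _).1, h1, ?_⟩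
  have h2 : ∀ u : Fin 3 → F, ∏ i, cellKernel ψ (cellArg y i) (u i) =
      ((‖∏ i, cellKernel ψ (cellArg y i) (u i)‖ : ℝ) : ℂ) := fun u => by
    rw [norm_prod, Complex.ofReal_prod]
    refine prod_congr rfl fun i _ => ?_
    have := q_pos F
    rw [cellKernel_eq hψ, Complex.norm_real, Real.norm_of_nonneg]
    exact mul_nonneg (by simp) (Set.indicator_nonneg (fun _ _ => by simp) _)
  rw [integral_congr_ae (ae_of_all _ h2), integral_complex_ofReal] at h1
  exact_mod_cast h1

/-! ### The zeta integral -/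

theorem ae_coordMeasure : ∀ᵐ p ∂coordMeasure F,
    (∀ i, p.2.2 i ≠ 0) ∧ p.1 + shiftX p.2.1 p.2.2 ≠ 0 := by
  have h1 : ∀ᵐ p ∂coordMeasure F, ∀ i, p.2.2 i ≠ 0 := by
    rw [ae_all_iff]
    intro i
    have h := (Measure.quasiMeasurePreserving_eval (fun _ : Fin 3 => haarF F) i).ae
      (ae_ne_zero (F := F))
    have h' := (Measure.quasiMeasurePreserving_snd
      (μ := Measure.pi fun _ : Fin 3 => haarFx F)).ae h
    exact (Measure.quasiMeasurePreserving_snd (μ := haarF F)).ae h'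
  have h2 : ∀ᵐ p ∂coordMeasure F, p.1 + shiftX p.2.1 p.2.2 ≠ 0 := by
    have hm : Measurable fun p : F × (Fin 3 → Fˣ) × (Fin 3 → F) => p.1 + shiftX p.2.1 p.2.2 :=
      measurable_fst.add (measurable_shiftX.comp measurable_snd)
    rw [ae_iff]
    simp only [ne_eq, not_not]
    have hs : MeasurableSet {p : F × (Fin 3 → Fˣ) × (Fin 3 → F) | p.1 + shiftX p.2.1 p.2.2 = 0} :=
      hm (measurableSet_singleton 0)
    have h3 : SFinite (Measure.pi fun _ => haarFx F : Measure (Fin 3 → Fˣ)) := inferInstance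
    have h4 : SFinite (Measure.pi fun _ => haarF F : Measure (Fin 3 → F)) := inferInstance
    rw [coordMeasure, Measure.prod_apply_symm hs]
    refine (lintegral_congr fun q => ?_).trans lintegral_zero
    have h := (measurePreserving_add_right (haarF F) (shiftX q.1 q.2)).quasiMeasurePreserving.ae
      (ae_ne_zero (F := F))
    rw [ae_iff] at h
    simp_all
  simp_all

variable (ψ ϖ χ μ ν n) in
/-- The integrand in the new coordinates. -/
def zetaNew (Φ : Fin 3 → F → ℂ) (q : ((Fin 3 → Fˣ) × Fˣ) × (Fin 3 → F)) : ℂ :=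
  zetaConst ϖ χ μ ν n * ((‖(q.1.2 : F)‖ : ℂ)⁻¹ *
    coreF ψ ϖ μ ν (zetaTheta χ ν) (zetaXi χ μ ν) Φ n q.1) *
      ∏ i, cellKernel ψ (cellArg q.1.1 i) (q.2 i)

theorem zetaIntegrand_ae (hψ : HasOrderZero ψ) (hϖ : lv ϖ = -1) (hn : 1 ≤ n)
    (hμ : ∀ i, TrivialMod (μ i) n) (hν : ∀ i, TrivialMod (ν i) n) {W : Fin 3 → GL₂(F) → ℂ}
    (hW : ∀ i g, W i g = whit ψ (rightReg _ g (psOrd (μ i) (ν i)))) (ξ : Fin 3 → 𝓧) :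
    zetaIntegrand (fun i => ordTranslate ϖ n (W i))
      (bigCellSection (∏ i, μ i * ν i) χ (schwartzPhi ψ ξ)) =ᵐ[coordMeasure F]
    zetaNew ψ ϖ χ μ ν n (fun i => fourier ψ (unitPart (ξ i))) ∘ newCoords := by
  filter_upwards [ae_coordMeasure] with p hp
  obtain ⟨x, a, u⟩ := p
  obtain ⟨hu, hX⟩ := hp
  have hu' : u = fun i => ((toUnits (u i) : Fˣ) : F) := funext fun i => (val_toUnits (hu i)).symm
  have h := zetaIntegrand_eq (χ := χ) hψ hϖ hn hμ hν hW ξ x a (fun i => toUnits (u i))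
    (torusScale u (toUnits (x + shiftX a u)) * torusEquiv a) (toUnits (x + shiftX a u))
    (by rw [val_toUnits hX, ← hu']) (fun i => rfl)
  rw [← hu'] at h
  rw [h, Function.comp_apply, zetaNew, mul_assoc (zetaConst ϖ χ μ ν n)]
  simp only [val_toUnits (hu _)]
  rfl

theorem zetaNew_integral {Φ : Fin 3 → F → ℂ}
    (D : CoreData ψ ϖ μ ν (zetaTheta χ ν) (zetaXi χ μ ν) Φ n) :
    Integrable (zetaNew ψ ϖ χ μ ν n Φ)
      (((Measure.pi fun _ => haarFx F).prod (addUnits F)).prod (Measure.pi fun _ => haarF F)) ∧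
    ∫ q, zetaNew ψ ϖ χ μ ν n Φ q
      ∂(((Measure.pi fun _ => haarFx F).prod (addUnits F)).prod (Measure.pi fun _ => haarF F)) =
    zetaConst ϖ χ μ ν n * ((volUnits F : ℂ) *
      ∫ p, coreF ψ ϖ μ ν (zetaTheta χ ν) (zetaXi χ μ ν) Φ n p ∂coreMeasure F) := by
  set g : (Fin 3 → Fˣ) × Fˣ → ℂ := fun p => (‖(p.2 : F)‖ : ℂ)⁻¹ *
    coreF ψ ϖ μ ν (zetaTheta χ ν) (zetaXi χ μ ν) Φ n p with hg
  have hm : (Measure.pi fun _ => haarFx F).prod (addUnits F) = (coreMeasure F).withDensity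
      fun p : (Fin 3 → Fˣ) × Fˣ => (unitsDensity F p.2 : ENNReal) := by
    rw [addUnits, prod_withDensity_right measurable_unitsDensity.coe_nnreal_ennreal]
  have hd : Measurable fun p : (Fin 3 → Fˣ) × Fˣ => unitsDensity F p.2 :=
    measurable_unitsDensity.comp measurable_snd
  have hv := volUnits_pos F
  have e : ∀ p : (Fin 3 → Fˣ) × Fˣ, unitsDensity F p.2 • g p = (volUnits F : ℂ) *
      coreF ψ ϖ μ ν (zetaTheta χ ν) (zetaXi χ μ ν) Φ n p := fun p => by
    have hX : (‖(p.2 : F)‖ : ℂ) ≠ 0 := by simp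
    rw [NNReal.smul_def, unitsDensity, NNReal.coe_mul, Real.coe_toNNReal _ hv.le, coe_nnnorm,
      real_smul, hg]
    push_cast
    field_simp
  have hgi : Integrable g ((Measure.pi fun _ => haarFx F).prod (addUnits F)) := by
    rw [hm, integrable_withDensity_iff_integrable_smul hd]
    simp only [e]
    exact D.main.1.const_mul _
  have hgI : ∫ p, g p ∂((Measure.pi fun _ => haarFx F).prod (addUnits F)) = (volUnits F : ℂ) *
      ∫ p, coreF ψ ϖ μ ν (zetaTheta χ ν) (zetaXi χ μ ν) Φ n p ∂coreMeasure F := by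
    rw [hm, integral_withDensity_eq_integral_smul hd]
    simp only [e]
    rw [integral_const_mul]
  have hi : Integrable (zetaNew ψ ϖ χ μ ν n Φ)
      (((Measure.pi fun _ => haarFx F).prod (addUnits F)).prod (Measure.pi fun _ => haarF F)) := by
    refine (integrable_prod_iff ?_).2 ⟨ae_of_all _ fun p => ?_, ?_⟩
    · refine ((hgi.aestronglyMeasurable.const_mul (zetaConst ϖ χ μ ν n)).comp_fst).mul ?_
      exact ((measurable_prod_cellKernel D.ord).comp
        ((measurable_fst.comp measurable_fst).prodMk measurable_snd)).aestronglyMeasurable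
    · exact (integral_prod_cellKernel D.ord p.1).1.const_mul (zetaConst ϖ χ μ ν n * g p)
    · have e1 : (fun p => ∫ u : Fin 3 → F, ‖zetaNew ψ ϖ χ μ ν n Φ (p, u)‖
          ∂(Measure.pi fun _ => haarF F)) = fun p => ‖zetaConst ϖ χ μ ν n * g p‖ := by
        ext p
        have h := (integral_prod_cellKernel D.ord p.1).2.2
        simp only [zetaNew, norm_mul (zetaConst ϖ χ μ ν n * _)]
        rw [integral_const_mul, h, mul_one]
      rw [e1]
      exact (hgi.const_mul _).norm
  refine ⟨hi, ?_⟩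
  rw [integral_prod _ hi, ← hgI, ← integral_const_mul]
  refine integral_congr_ae (ae_of_all _ fun p => ?_)
  refine Eq.trans (integral_const_mul (zetaConst ϖ χ μ ν n * g p) _) ?_
  rw [(integral_prod_cellKernel D.ord p.1).2.1, mul_one]

theorem zetaIntegral_eq {ξ : Fin 3 → 𝓧}
    (D : CoreData ψ ϖ μ ν (zetaTheta χ ν) (zetaXi χ μ ν) (fun i => fourier ψ (unitPart (ξ i))) n)
    {W : Fin 3 → GL₂(F) → ℂ}
    (hW : ∀ i g, W i g = whit ψ (rightReg _ g (psOrd (μ i) (ν i)))) :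
    Integrable (zetaIntegrand (fun i => ordTranslate ϖ n (W i))
      (bigCellSection (∏ i, μ i * ν i) χ (schwartzPhi ψ ξ))) (coordMeasure F) ∧
    zetaIntegral (fun i => ordTranslate ϖ n (W i))
      (bigCellSection (∏ i, μ i * ν i) χ (schwartzPhi ψ ξ)) =
    ((1 + 𝔮⁻¹) ^ 3)⁻¹ * (zetaConst ϖ χ μ ν n * ((volUnits F : ℂ) *
      ((∏ i, ∫ a : Fˣ, (zetaXi χ μ ν i a : ℂ) * fourier ψ (unitPart (ξ i)) a ∂haarFx F) *
        ∫ X in {X : Fˣ | lv X ≤ n}, (zetaTheta χ ν X : ℂ) * (ψ (X : F) : ℂ) ∂haarFx F))) := by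
  have hP := measurePreserving_newCoords (F := F)
  obtain ⟨h1, h2⟩ := zetaNew_integral D
  have hae := zetaIntegrand_ae (χ := χ) D.ord D.unif D.pos D.triv_mu D.triv_nu hW ξ
  have hI := hP.integrable_comp_of_integrable h1
  refine ⟨hI.congr hae.symm, ?_⟩
  rw [zetaIntegral, integral_congr_ae hae, ← D.main.2, ← h2, ← hP.map_eq,
    integral_map hP.measurable.aemeasurable (by rw [hP.map_eq]; exact h1.aestronglyMeasurable)]
  rfl

end Zeta

section Zeta

variable {χ : QuasiChar F} {μ ν : Fin 3 → QuasiChar F} {n : ℕ}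

/-! ### The zeta integral as a product of gamma factors -/

theorem zetaTheta_mul (χ' : 𝓧) : zetaTheta (χ * χ') ν = zetaTheta χ ν * χ' := by
  ext u
  simp only [zetaTheta, mul_apply, val_mul]
  ring

theorem zetaXi_mul (χ' : 𝓧) (i : Fin 3) : zetaXi (χ * χ') μ ν i = zetaXi χ μ ν i * χ' := by
  ext u
  simp only [zetaXi, zetaTheta_mul, mul_apply, val_mul]
  ring

theorem trivialMod_zetaTheta (hχ : TrivialMod χ n) (hν : ∀ i, TrivialMod (ν i) n) :
    TrivialMod (zetaTheta χ ν) n := by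
  refine (hχ.mul ?_).mul (.absPow _ n)
  rw [prod_univ_three]
  exact ((hν 0).mul (hν 1)).mul (hν 2)

theorem eventually_coreData (hψ : HasOrderZero ψ) (hϖ : lv ϖ = -1) (hn : 1 ≤ n)
    (hχ : TrivialMod χ n) (hμ : ∀ i, TrivialMod (μ i) n) (hν : ∀ i, TrivialMod (ν i) n)
    {ξ : Fin 3 → 𝓧} (hξ : ∀ i, TrivialMod (ξ i) n) :
    ∀ᶠ s in rightF, CoreData ψ ϖ μ ν (zetaTheta (χ * absPow F s) ν) (zetaXi (χ * absPow F s) μ ν)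
      (fun i => fourier ψ (unitPart (ξ i))) n := by
  have h1 := eventually_absAt_right (zetaTheta χ ν)
  have h2 := eventually_all.2 fun i => eventually_absAt_right (zetaXi χ μ ν i)
  have h3 := eventually_all.2 fun i =>
    eventually_absAt_right (zetaXi χ μ ν i * zetaXi χ μ ν i * (zetaTheta χ ν)⁻¹)
  filter_upwards [h1, h2, h3] with s h1 h2 h3
  refine ⟨hψ, hϖ, hn, hμ, hν, trivialMod_zetaTheta (hχ.mul (.absPow s n)) hν, fun i => ?_,
    fun i => fourier_unitPart_ballFun hψ hn (hξ i), ?_, fun i => ?_, fun i => ?_⟩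
  · ext u
    simp only [zetaXi, mul_apply, qc_inv, val_mul, val_inv_eq_inv_val]
    field_simp
  · rwa [zetaTheta_mul]
  · rw [zetaXi_mul]; exact h2 i
  · have h := h3 i
    have hA := absAt_pos (absPow F s)
    have hT := absAt_pos (zetaTheta χ ν)
    rw [absAt_mul, absAt_mul, absAt_mul, absAt_inv] at h
    rw [zetaXi_mul, zetaTheta_mul, absAt_mul, absAt_mul]
    calc (absAt (zetaXi χ μ ν i) * absAt (absPow F s)) ^ 2 =
        absAt (zetaXi χ μ ν i) * absAt (zetaXi χ μ ν i) * (absAt (zetaTheta χ ν))⁻¹ *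
          absAt (absPow F s) * (absAt (zetaTheta χ ν) * absAt (absPow F s)) := by field_simp
      _ < 1 * (absAt (zetaTheta χ ν) * absAt (absPow F s)) :=
        mul_lt_mul_of_pos_right h (mul_pos hT hA)
      _ = _ := one_mul _

theorem zeta_sign (χ : 𝓧) (μ ν : Fin 3 → 𝓧) : (χ (-1) : ℂ) * (∏ i, (μ i (-1) : ℂ)) *
      ((∏ i, (zetaXi χ μ ν i (-1) : ℂ)) * (zetaTheta χ ν (-1) : ℂ)) =
    ((χ * ∏ i, ν i) (-1) : ℂ) := by
  have hs : ∀ χ : 𝓧, ((χ (-1) : ℂˣ) : ℂ)⁻¹ = (χ (-1) : ℂ) := fun χ =>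
    inv_eq_of_mul_eq_one_left (neg_one_mul_self χ)
  have ha : ((absPow F (1 / 2) (-1) : ℂˣ) : ℂ) = 1 := by rw [absPow_apply]; simp
  have hc := neg_one_mul_self χ
  have h := fun i => neg_one_mul_self (μ i)
  have h' := fun i => neg_one_mul_self (ν i)
  simp only [zetaXi, zetaTheta, mul_apply, qc_inv, val_mul,
    val_inv_eq_inv_val, prod_univ_three, hs, ha]
  grind

theorem eventually_zetaIntegral (hψ : HasOrderZero ψ) (hϖ : IsUniformizer (ϖ : F)) (hn : 1 ≤ n)
    (hχ : TrivialMod χ n) (hμ : ∀ i, TrivialMod (μ i) n) (hν : ∀ i, TrivialMod (ν i) n)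
    {ξ : Fin 3 → 𝓧} (hξ : ∀ i, ∀ u : Fˣ, lv u = 0 → ξ i u = zetaXi χ μ ν i u)
    {W : Fin 3 → GL₂(F) → ℂ}
    (hW : ∀ i g, W i g = whit ψ (rightReg _ g (psOrd (μ i) (ν i)))) :
    ∀ᶠ s in rightF, Integrable (zetaIntegrand (fun i => ordTranslate ϖ n (W i))
        (bigCellSection (∏ i, μ i * ν i) (χ * absPow F s) (schwartzPhi ψ ξ))) (coordMeasure F) ∧
      zetaIntegral (fun i => ordTranslate ϖ n (W i))
        (bigCellSection (∏ i, μ i * ν i) (χ * absPow F s) (schwartzPhi ψ ξ)) =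
      ((1 + 𝔮⁻¹) ^ 3)⁻¹ * (∏ j, ((ν j ϖ : ℂ) / (𝔮 * (μ j ϖ : ℂ))) ^ n) * ((χ * ∏ i, ν i) (-1) : ℂ) *
        ((tateGamma ψ ϖ (χ * ∏ i, ν i) (s + 1 / 2))⁻¹ *
          ∏ i, (tateGamma ψ ϖ (χ * (∏ i, ν i) * (μ i * (ν i)⁻¹)) (s + 1 / 2))⁻¹) := by
  have hv : (volUnits F : ℂ) ≠ 0 := by exact_mod_cast (volUnits_pos F).ne'
  have hT : ∀ i, TrivialMod (ξ i) n := fun i u hu hu1 => by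
    rw [hξ i u hu]
    exact ((trivialMod_zetaTheta hχ hν).mul ((hμ i).mul (hν i).inv)) u hu hu1
  filter_upwards [eventually_coreData hψ (lv_of_isUniformizer hϖ) hn hχ hμ hν hT] with s D
  obtain ⟨h1, h2⟩ := zetaIntegral_eq D hW
  refine ⟨h1, h2.trans ?_⟩
  have e1 : ∀ i, ∫ a : Fˣ, (zetaXi (χ * absPow F s) μ ν i a : ℂ) *
      fourier ψ (unitPart (ξ i)) a ∂haarFx F = (zetaXi (χ * absPow F s) μ ν i (-1) : ℂ) *
        (tateGamma ψ ϖ (χ * (∏ i, ν i) * (μ i * (ν i)⁻¹)) (s + 1 / 2))⁻¹ := fun i => by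
    rw [(mellin_fourier_unitPart hψ hϖ hn (hT i)
      (fun u hu => by rw [hξ i u hu, zetaXi_mul, mul_absPow_unit _ _ _ hu]) (D.abs_xi i)).2,
      zetaXi_mul, tateGamma_absPow hϖ, zero_add]
    have : zetaXi χ μ ν i = χ * (∏ i, ν i) * (μ i * (ν i)⁻¹) * absPow F (1 / 2) := by
      ext u
      simp only [zetaXi, zetaTheta, mul_apply, val_mul]
      ring
    rw [this, tateGamma_absPow hϖ]
  have e2 : tateGamma ψ ϖ (zetaTheta (χ * absPow F s) ν) 0 =
      tateGamma ψ ϖ (χ * ∏ i, ν i) (s + 1 / 2) := by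
    rw [zetaTheta_mul, tateGamma_absPow hϖ, zero_add, zetaTheta, tateGamma_absPow hϖ]
  have e3 : ((χ * ∏ i, ν i) (-1) : ℂ) = (((χ * absPow F s) * ∏ i, ν i) (-1) : ℂ) := by
    have : absPow F s (-1) = 1 := absPow_unit (by rw [lv_neg]; exact (norm_eq_one_iff 1).1 (by simp)) s
    simp_all
  rw [prod_congr rfl fun i _ => e1 i, gauss_integral_pos hψ hϖ D.abs_theta hn D.triv_theta,
    e2, e3, ← zeta_sign (χ * absPow F s) μ ν, zetaConst, prod_mul_distrib,
    prod_mul_distrib]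
  field_simp

end Zeta

section Final

variable {χ : QuasiChar F} {μ ν : Fin 3 → QuasiChar F} {n : ℕ}

/-! ### Gamma factors and `L`-factors on the line -/

theorem eventually_rightF_add_half {p : ℂ → Prop} (h : ∀ᶠ s in rightF, p s) :
    ∀ᶠ s in rightF, p (s + 1 / 2) := by
  rw [eventually_rightF] at h ⊢
  obtain ⟨σ, h⟩ := h
  refine ⟨σ, fun s hs => h _ ?_⟩
  have : (s + 1 / 2).re = s.re + 1 / 2 := by simp
  grind

theorem RepresentsGamma.eventually {μ ν : 𝓧} {R : RatFunc ℂ}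
    (h : RepresentsGamma ψ ϖ μ ν χ R) : ∀ᶠ s in rightF, evq F R (s + 1 / 2) =
      tateGamma ψ ϖ (μ * χ) (s + 1 / 2) * tateGamma ψ ϖ (ν * χ) (s + 1 / 2) :=
  eventually_rightF_add_half (ev_right h)

theorem differentiable_det_one_sub_smul {V : Type*} [AddCommGroup V] [Module ℂ V]
    [FiniteDimensional ℂ V] (A : V →ₗ[ℂ] V) {f : ℂ → ℂ} (hf : Differentiable ℂ f) :
    Differentiable ℂ fun s => LinearMap.det (LinearMap.id - f s • A) := by
  set b := Module.finBasis ℂ V with hb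
  have e : ∀ s : ℂ, LinearMap.det (LinearMap.id - f s • A) =
      (1 - f s • LinearMap.toMatrix b b A).det := fun s => by
    rw [← LinearMap.det_toMatrix b, map_sub, map_smul, LinearMap.toMatrix_id]
  simp only [e, Matrix.det_apply]
  refine Differentiable.fun_sum fun σ _ => Differentiable.const_smul ?_ _
  refine Differentiable.fun_finsetProd fun i _ => ?_
  simp_all

theorem meromorphic_tripleL (ϖ : Fˣ) (χ : 𝓧) (μ ν : Fin 3 → 𝓧) (c : ℂ) :
    Meromorphic fun s => tripleL ϖ χ μ ν (s + c) := by
  have hq : Differentiable ℂ fun s : ℂ => 𝔮 ^ (-(s + c)) := fun s =>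
    ((differentiable_id.add_const c).neg s).const_cpow (Or.inl (qC_ne_zero F))
  have h := differentiable_det_one_sub_smul
    ((wdFrob ϖ χ μ ν).restrict (wdFrob_mem ϖ χ μ ν)) hq
  exact fun x => ((h.analyticAt x).meromorphicAt).inv

theorem localZeta_quotient : localZeta F 1 / localZeta F 2 = 1 + 𝔮⁻¹ := by
  have hq := qC_ne_zero F
  have h1 : (1 : ℂ) - 𝔮⁻¹ ≠ 0 := fun h => by
    have h2 : 𝔮 = 1 := by grind
    have h3 : 𝔮ᵣ = 1 := by simp_all
    exact (one_lt_q F).ne' h3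
  have e : (𝔮 ^ (-2 : ℂ)) = 𝔮⁻¹ * 𝔮⁻¹ := by
    rw [cpow_neg, ← mul_inv, ← sq]
    simp
  rw [localZeta, localZeta, Complex.cpow_neg_one, e, div_inv_eq_mul, inv_mul_eq_iff_eq_mul₀ h1]
  ring

/-! ### The degenerate Whittaker function -/

theorem mem_XiSet_iff {B : M₃(F)} (hB : B.IsSymm) :
    B ∈ XiSet F ↔ (∀ i, ‖B i i‖ < 1) ∧ ∀ i, ‖2 * offDiag B i‖ = 1 := by
  have h01 : B 1 0 = B 0 1 := hB.apply 0 1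
  have h02 : B 2 0 = B 0 2 := hB.apply 0 2
  have h12 : B 2 1 = B 1 2 := hB.apply 1 2
  constructor
  · rintro ⟨-, h1, h2⟩
    refine ⟨h1, fun i => ?_⟩
    fin_cases i
    · exact h2 1 2 (by decide)
    · exact h2 0 2 (by decide)
    · exact h2 0 1 (by decide)
  · rintro ⟨h1, h2⟩
    refine ⟨hB, h1, fun i j hij => ?_⟩
    have e0 : ‖2 * B 1 2‖ = 1 := h2 0
    have e1 : ‖2 * B 0 2‖ = 1 := h2 1
    have e2 : ‖2 * B 0 1‖ = 1 := h2 2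
    grind

theorem unitPart_eq (χ : 𝓧) (x : F) :
    unitPart χ x = ext0 χ x * Set.indicator {x : F | ‖x‖ = 1} 1 x := by
  by_cases hx : x ∈ {x : F | ‖x‖ = 1}
  · rw [unitPart, indicator_of_mem hx, indicator_of_mem hx, Pi.one_apply, mul_one]
  · rw [unitPart, indicator_of_notMem hx, indicator_of_notMem hx, mul_zero]

theorem ext0_ne_zero (χ : 𝓧) {x : F} (hx : x ≠ 0) : ext0 χ x ≠ 0 := by
  rw [ext0, dif_pos hx]; simp

theorem degWhittaker_ne_zero_iff (ξ : Fin 3 → 𝓧) {B : M₃(F)}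
    (hB : B.IsSymm) : (∏ i, Set.indicator {x : F | ‖x‖ < 1} (1 : F → ℂ) (B i i)) *
      ∏ i, unitPart (ξ i) (2 * offDiag B i) ≠ 0 ↔ B ∈ XiSet F := by
  rw [mem_XiSet_iff hB, mul_ne_zero_iff, Finset.prod_ne_zero_iff, Finset.prod_ne_zero_iff]
  refine and_congr (forall_congr' fun i => ?_) (forall_congr' fun i => ?_)
  · simp
  · have h0 : ‖2 * offDiag B i‖ = 1 → 2 * offDiag B i ≠ 0 := fun h h' => by simp_all
    rw [unitPart, indicator_apply]
    simp only [mem_univ, mem_ofPred_eq, true_implies, ne_eq, ite_eq_right_iff,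
      Classical.not_imp, and_iff_left_iff_imp]
    exact fun h => ext0_ne_zero _ (h0 h)

theorem ext0_eight (χ : 𝓧) (y : Fin 3 → F) :
    ext0 χ (8 * y 0 * y 1 * y 2) = ∏ i, ext0 χ (2 * y i) := by
  rw [prod_univ_three, ← ext0_mul, ← ext0_mul]
  congr 1
  ring

theorem degWhittaker_ordinary (χ : 𝓧) (μ ν : Fin 3 → 𝓧)
    (B : M₃(F)) : (∏ i, Set.indicator {x : F | ‖x‖ < 1} (1 : F → ℂ) (B i i)) *
      ∏ i, unitPart (![χ * μ 0 * ν 1 * ν 2, χ * ν 0 * μ 1 * ν 2, χ * ν 0 * ν 1 * μ 2] i)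
        (2 * offDiag B i) =
    ext0 χ (8 * offDiag B 0 * offDiag B 1 * offDiag B 2) * ∏ i, (ext0 (μ i) (2 * offDiag B i) *
        Set.indicator {x : F | ‖x‖ = 1} 1 (2 * offDiag B i) *
        Set.indicator {x : F | ‖x‖ < 1} 1 (B i i) *
        ∏ j ∈ Finset.univ.erase i, ext0 (ν j) (2 * offDiag B i)) := by
  have h0 : (Finset.univ.erase 0 : Finset (Fin 3)) = {1, 2} := by decide
  have h1 : (Finset.univ.erase 1 : Finset (Fin 3)) = {0, 2} := by decide
  have h2 : (Finset.univ.erase 2 : Finset (Fin 3)) = {0, 1} := by decide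
  have d0 : (0 : Fin 3) ≠ 1 := by decide
  have d1 : (0 : Fin 3) ≠ 2 := by decide
  have d2 : (1 : Fin 3) ≠ 2 := by decide
  rw [ext0_eight]
  simp only [prod_univ_three, unitPart_eq, h0, h1, h2, Finset.prod_pair d0,
    Finset.prod_pair d1, Finset.prod_pair d2, Matrix.cons_val, ext0_mul_char]
  ring

theorem degWhittaker_twisted (χ : 𝓧) (ω : Fin 3 → 𝓧) {B : M₃(F)} (hB : B.IsSymm) :
    (∏ i, Set.indicator {x : F | ‖x‖ < 1} (1 : F → ℂ) (B i i)) *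
      ∏ i, unitPart (χ * ω i) (2 * offDiag B i) = QB B χ ω := by
  by_cases h : B ∈ XiSet F
  · obtain ⟨h1, h2⟩ := (mem_XiSet_iff hB).1 h
    have e1 : ∀ i, Set.indicator {x : F | ‖x‖ < 1} (1 : F → ℂ) (B i i) = 1 := fun i =>
      indicator_of_mem (show B i i ∈ {x : F | ‖x‖ < 1} from h1 i) _
    have e2 : ∀ i, Set.indicator {x : F | ‖x‖ = 1} (1 : F → ℂ) (2 * offDiag B i) = 1 := fun i =>
      indicator_of_mem (show 2 * offDiag B i ∈ {x : F | ‖x‖ = 1} from h2 i) _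
    have e3 := ext0_eight χ (offDiag B)
    have e4 : 8 * offDiag B 0 * offDiag B 1 * offDiag B 2 = 8 * B 0 1 * B 1 2 * B 0 2 := by
      simp only [offDiag, Matrix.cons_val]; ring
    rw [e4] at e3
    rw [QB, indicator_of_mem h, e3]
    simp only [unitPart_eq, e1, e2, prod_univ_three, ext0_mul_char, mul_one, one_mul]
    simp only [offDiag, Matrix.cons_val]
    ring
  · rw [QB, indicator_of_notMem h]
    exact not_not.1 fun h' => h ((degWhittaker_ne_zero_iff (fun i => χ * ω i) hB).1 h')

end Final

section Final

variable {V : Fin 3 → Type*} [∀ i, AddCommGroup (V i)] [∀ i, Module ℂ (V i)]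
  {π : ∀ i, Representation ℂ (GL₂(F)) (V i)} {χ : QuasiChar F} {μ ν ω : Fin 3 → QuasiChar F}
  {n : ℕ}

/-! ### The zeta integrals of ordinary vectors -/

theorem zetaIntegral_quotient (hψ : HasOrderZero ψ) (hϖ : IsUniformizer (ϖ : F))
    (hω : ∀ i, HasCentralChar (π i) (ω i)) (hπ : ∀ i, IsQuotientOfPS (π i) (μ i) (ν i))
    (hn : 1 ≤ n) (hχ : TrivialMod χ n) (hμ : ∀ i, TrivialMod (μ i) n)
    (hν : ∀ i, TrivialMod (ν i) n) {W : Fin 3 → GL₂(F) → ℂ}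
    (hW : ∀ i, W i ∈ whittakerModel ψ (π i) ∧ ∀ a, W i (tT a) = ordKirillov (ν i) a)
    {R : ℂ → ℂ} (hR : R = fun s => ((1 + 𝔮⁻¹) ^ 3)⁻¹ *
      (∏ j, ((ν j ϖ : ℂ) / (𝔮 * (μ j ϖ : ℂ))) ^ n) *
      ((χ * ν 0 * ν 1 * ν 2) (-1) : ℂ) *
      (gammaGL2 ψ (π 0) (ω 0) (χ * ν 1 * ν 2) (s + 1 / 2))⁻¹ *
      ((tateGamma ψ ϖ (χ * ν 0 * ν 1 * μ 2) (s + 1 / 2))⁻¹ *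
        (tateGamma ψ ϖ (χ * ν 0 * ν 2 * μ 1) (s + 1 / 2))⁻¹)) :
    Meromorphic R ∧ ∃ σ : ℝ, ∀ s : ℂ, σ < s.re →
      Integrable (zetaIntegrand (fun i => ordTranslate ϖ n (W i))
        (bigCellSection (∏ i, ω i) (χ * absPow F s) (schwartzPhi ψ
          ![χ * μ 0 * ν 1 * ν 2, χ * ν 0 * μ 1 * ν 2, χ * ν 0 * ν 1 * μ 2]))) (coordMeasure F) ∧
      zetaIntegral (fun i => ordTranslate ϖ n (W i))
        (bigCellSection (∏ i, ω i) (χ * absPow F s) (schwartzPhi ψ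
          ![χ * μ 0 * ν 1 * ν 2, χ * ν 0 * μ 1 * ν 2, χ * ν 0 * ν 1 * μ 2])) = R s := by
  have hω' : ∀ i, ω i = μ i * ν i := fun i => (hπ i).centralChar (hω i)
  have h1 : W 0 (tT 1) ≠ 0 := by
    rw [(hW 0).2, ordKirillov, indicator_of_mem (show (1 : Fˣ) ∈ {a : Fˣ | ‖(a : F)‖ ≤ 1} by simp)]
    simp
  obtain ⟨Q, hQ, hγ⟩ := (hπ 0).gammaGL2 (χ := χ * ν 1 * ν 2) hψ hϖ (hW 0).1 h1
  rw [← hω' 0] at hγ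
  rw [hγ] at hR
  refine ⟨?_, ?_⟩
  · rw [hR]
    intro x
    exact ((MeromorphicAt.const _ x).mul ((meromorphic_evq F Q (1 / 2)).inv x)).mul
      (((meromorphic_tateGamma (χ * ν 0 * ν 1 * μ 2) (1 / 2)).inv x).mul
        ((meromorphic_tateGamma (χ * ν 0 * ν 2 * μ 1) (1 / 2)).inv x))
  rw [← eventually_rightF]
  have hWw : ∀ i g, W i g = whit ψ (rightReg _ g (psOrd (μ i) (ν i))) := fun i g => by
    obtain ⟨-, -, T, hT⟩ := hπ i
    exact ordinary_eq_whit hψ T hT (hW i).1 (hW i).2 g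
  have hξ : ∀ i, ∀ u : Fˣ, lv u = 0 →
      (![χ * μ 0 * ν 1 * ν 2, χ * ν 0 * μ 1 * ν 2, χ * ν 0 * ν 1 * μ 2] : Fin 3 → 𝓧) i u =
        zetaXi χ μ ν i u := fun i u hu => by
    ext
    rw [zetaXi, zetaTheta]
    fin_cases i <;>
    · simp only [Fin.zero_eta, Fin.mk_one, Fin.reduceFinMk, Matrix.cons_val, prod_univ_three,
        mul_apply, absPow_unit hu, qc_inv, val_mul,
        val_inv_eq_inv_val, val_one]
      field_simp
  filter_upwards [eventually_zetaIntegral hψ hϖ hn hχ hμ hν hξ hWw, hQ.eventually] with s hs hE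
  rw [funext hω']
  refine ⟨hs.1, hs.2.trans ?_⟩
  have c0 : χ * ∏ i, ν i = χ * ν 0 * ν 1 * ν 2 := by
    ext u; simp only [prod_univ_three, mul_apply, val_mul]; ring
  have c1 : ν 0 * (χ * ν 1 * ν 2) = χ * ν 0 * ν 1 * ν 2 := by
    ext u; simp only [mul_apply, val_mul]; ring
  have c2 : χ * ν 0 * ν 1 * ν 2 * (μ 0 * (ν 0)⁻¹) = μ 0 * (χ * ν 1 * ν 2) := by
    ext u
    simp only [mul_apply, qc_inv, val_mul, val_inv_eq_inv_val]
    field_simp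
  have c3 : χ * ν 0 * ν 1 * ν 2 * (μ 1 * (ν 1)⁻¹) = χ * ν 0 * ν 2 * μ 1 := by
    ext u
    simp only [mul_apply, qc_inv, val_mul, val_inv_eq_inv_val]
    field_simp
  have c4 : χ * ν 0 * ν 1 * ν 2 * (μ 2 * (ν 2)⁻¹) = χ * ν 0 * ν 1 * μ 2 := by
    ext u
    simp only [mul_apply, qc_inv, val_mul, val_inv_eq_inv_val]
    field_simp
  rw [hR, prod_univ_three (fun i => (tateGamma ψ ϖ _ (s + 1 / 2))⁻¹), c0, c2, c3, c4]
  beta_reduce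
  rw [hE, c1, mul_inv]
  ring

theorem zetaStar_sub (hψ : HasOrderZero ψ) (hϖ : IsUniformizer (ϖ : F))
    (hω : ∀ i, HasCentralChar (π i) (ω i)) (hπ : ∀ i, IsSubOfPS (π i) (μ i) (ν i))
    (hμ : ∀ i, IsUnramified (μ i)) (hn : 1 ≤ n) (hχ : TrivialMod χ n)
    (hω₁ : ∀ i, TrivialMod (ω i) n) {W : Fin 3 → GL₂(F) → ℂ}
    (hW : ∀ i, W i ∈ whittakerModel ψ (contragredient (π i)).toRepresentation ∧
      ∀ a, W i (tT a) = ordKirillov (ν i)⁻¹ a) :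
    Meromorphic (fun s => modifiedEuler ψ ϖ (π 0) (ω 0) χ μ ν (s + 1 / 2)) ∧
    ∃ σ : ℝ, ∀ s : ℂ, σ < s.re → Integrable (zetaIntegrand (fun i => ordTranslate ϖ n (W i))
        (bigCellSection (∏ i, ω i)⁻¹ (χ * (∏ i, ω i) * absPow F s)
          (schwartzPhi ψ fun i => χ * ω i))) (coordMeasure F) ∧
      zetaStar ϖ n χ μ ν ω W (bigCellSection (∏ i, ω i)⁻¹ (χ * (∏ i, ω i) * absPow F s)
          (schwartzPhi ψ fun i => χ * ω i)) s =
        (χ (-1) : ℂ) * modifiedEuler ψ ϖ (π 0) (ω 0) χ μ ν (s + 1 / 2) := by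
  have hω' : ∀ i, ω i = μ i * ν i := fun i => (hπ i).centralChar (hω i)
  obtain ⟨Q, hQ, hγ⟩ := (hπ 0).gammaGL2 (χ := χ * μ 1 * μ 2) hψ hϖ
  rw [← hω' 0] at hγ
  refine ⟨?_, ?_⟩
  · simp only [modifiedEuler, hγ]
    intro x
    exact (((meromorphic_tripleL ϖ χ μ ν (1 / 2) x).mul (meromorphic_evq F Q (1 / 2) x)).mul
      ((meromorphic_tateGamma (χ * μ 0 * μ 1 * ν 2) (1 / 2) x).mul
        (meromorphic_tateGamma (χ * μ 0 * μ 2 * ν 1) (1 / 2) x))).inv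
  rw [← eventually_rightF]
  have hWw : ∀ i g, W i g = whit ψ (rightReg _ g (psOrd (μ i)⁻¹ (ν i)⁻¹)) := fun i g =>
    (hπ i).ordinary_eq_whit hψ (hW i).1 (hW i).2 g
  have hμ1 : ∀ i (u : Fˣ), lv u = 0 → ((μ i u : ℂˣ) : ℂ) = 1 := fun i u hu => by
    rw [isUnramified_iff.1 (hμ i) u hu, val_one]
  have hμT : ∀ i, TrivialMod (μ i)⁻¹ n := fun i => ((hμ i).trivialMod n).inv
  have hνT : ∀ i, TrivialMod (ν i)⁻¹ n := fun i => by
    have e : ν i = ω i * (μ i)⁻¹ := by simp_all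
    rw [e]
    exact ((hω₁ i).mul (hμT i)).inv
  have hχT : TrivialMod (χ * ∏ i, ω i) n := by
    refine hχ.mul ?_
    rw [prod_univ_three]
    exact ((hω₁ 0).mul (hω₁ 1)).mul (hω₁ 2)
  have hξ : ∀ i, ∀ u : Fˣ, lv u = 0 → (χ * ω i) u =
      zetaXi (χ * ∏ i, ω i) (fun i => (μ i)⁻¹) (fun i => (ν i)⁻¹) i u := fun i u hu => by
    ext
    rw [zetaXi, zetaTheta, funext hω']
    simp only [prod_univ_three, mul_apply, absPow_unit hu,
      qc_inv, val_mul, val_inv_eq_inv_val, val_one, hμ1 _ u hu]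
    field_simp
  have hc : ∏ i, ((μ i)⁻¹ * (ν i)⁻¹) = (∏ i, ω i)⁻¹ := by
    rw [funext hω', prod_univ_three, prod_univ_three]
    ext u
    simp only [mul_apply, qc_inv, val_mul, val_inv_eq_inv_val, mul_inv]
  filter_upwards [eventually_zetaIntegral hψ hϖ hn hχT hμT hνT hξ hWw, hQ.eventually] with s hs hE
  rw [hc] at hs
  refine ⟨hs.1, ?_⟩
  have hc0 : (χ * ∏ i, ω i) * ∏ i, (ν i)⁻¹ = χ * μ 0 * μ 1 * μ 2 := by
    rw [funext hω', prod_univ_three, prod_univ_three]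
    ext u
    simp only [mul_apply, qc_inv, val_mul, val_inv_eq_inv_val]
    field_simp
  have c1 : μ 0 * (χ * μ 1 * μ 2) = χ * μ 0 * μ 1 * μ 2 := by
    ext u; simp only [mul_apply, val_mul]; ring
  have c2 : χ * μ 0 * μ 1 * μ 2 * ((μ 0)⁻¹ * (ν 0)⁻¹⁻¹) = ν 0 * (χ * μ 1 * μ 2) := by
    ext u
    simp only [mul_apply, qc_inv, val_mul, val_inv_eq_inv_val, inv_inv]
    field_simp
  have c3 : χ * μ 0 * μ 1 * μ 2 * ((μ 1)⁻¹ * (ν 1)⁻¹⁻¹) = χ * μ 0 * μ 2 * ν 1 := by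
    ext u
    simp only [mul_apply, qc_inv, val_mul, val_inv_eq_inv_val, inv_inv]
    field_simp
  have c4 : χ * μ 0 * μ 1 * μ 2 * ((μ 2)⁻¹ * (ν 2)⁻¹⁻¹) = χ * μ 0 * μ 1 * ν 2 := by
    ext u
    simp only [mul_apply, qc_inv, val_mul, val_inv_eq_inv_val, inv_inv]
    field_simp
  have c5 : ((χ * μ 0 * μ 1 * μ 2) (-1) : ℂ) = (χ (-1) : ℂ) := by
    have h1 : lv (-1 : Fˣ) = 0 := (norm_eq_one_iff (-1 : Fˣ)).1 (by simp)
    simp only [mul_apply, val_mul, hμ1 _ _ h1, mul_one]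
  have hq := qC_ne_zero F
  have hq1 : (1 + 𝔮⁻¹) ≠ 0 := by
    have h : (0 : ℝ) < 1 + 𝔮ᵣ⁻¹ := by have := q_pos F; positivity
    have h' := Complex.ofReal_ne_zero.2 h.ne'
    simp_all
  have c6 : ∀ j, ((ω j ϖ : ℂ) * 𝔮 / (μ j ϖ : ℂ) ^ 2) ^ n *
      ((((ν j)⁻¹ : 𝓧) ϖ : ℂ) / (𝔮 * (((μ j)⁻¹ : 𝓧) ϖ : ℂ))) ^ n =
      1 := fun j => by
    rw [← mul_pow, hω' j]
    simp only [mul_apply, qc_inv, val_mul, val_inv_eq_inv_val]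
    rw [← one_pow n]
    congr 1
    field_simp
  have c7 : (∏ j, ((((ν j)⁻¹ : 𝓧) ϖ : ℂ) /
      (𝔮 * (((μ j)⁻¹ : 𝓧) ϖ : ℂ))) ^ n) *
      ∏ j, ((1 + 𝔮⁻¹) * ((ω j ϖ : ℂ) * 𝔮 / (μ j ϖ : ℂ) ^ 2) ^ n) =
      (1 + 𝔮⁻¹) ^ 3 := by
    rw [← prod_mul_distrib]
    have e : ∀ j, ((((ν j)⁻¹ : 𝓧) ϖ : ℂ) /
        (𝔮 * (((μ j)⁻¹ : 𝓧) ϖ : ℂ))) ^ n * ((1 + 𝔮⁻¹) *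
        ((ω j ϖ : ℂ) * 𝔮 / (μ j ϖ : ℂ) ^ 2) ^ n) = 1 + 𝔮⁻¹ :=
      fun j => by linear_combination (1 + 𝔮⁻¹) * c6 j
    rw [prod_congr rfl fun j _ => e j]
    simp
  rw [zetaStar, hs.2, modifiedEuler, hγ, hE,
    prod_univ_three (fun i => (tateGamma ψ ϖ _ (s + 1 / 2))⁻¹), hc0, c1, c2, c3, c4, c5,
    localZeta_quotient]
  have key : ∀ a b P S G : ℂ, a ≠ 0 → b * P = a ^ 3 →
      (a ^ 3)⁻¹ * b * S * G * P = S * G := fun a b P S G ha h => by grind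
  rw [div_eq_mul_inv, mul_assoc (_ * _ * _) _ (_)⁻¹, key _ _ _ _ _ hq1 c7]
  simp only [mul_inv]
  ring

end Final

end LocalField

end Garrett

end

theorem mainTheorem7 {F : Type*} [NontriviallyNormedField F] [IsUltrametricDist F]
    [ProperSpace F] [CharZero F] [MeasurableSpace F] [BorelSpace F]
    (ϖ : Fˣ) (hϖ : IsUniformizer (ϖ : F)) (hnorm : ‖(ϖ : F)‖ = (resCard F : ℝ)⁻¹)
    (ψ : AddChar F Circle) (hψ : HasOrderZero ψ)
    {V : Fin 3 → Type*} [∀ i, AddCommGroup (V i)] [∀ i, Module ℂ (V i)]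
    (π : ∀ i, Representation ℂ (GL (Fin 2) F) (V i))
    (χ : QuasiChar F) (μ ν ω : Fin 3 → QuasiChar F)
    (hω : ∀ i, HasCentralChar (π i) (ω i)) :
    -- first part: `πᵢ` is a quotient of `I(μᵢ, νᵢ)`
    ((∀ i, IsQuotientOfPS (π i) (μ i) (ν i)) →
      let Φ : Matrix (Fin 3) (Fin 3) F → ℂ :=
        schwartzPhi ψ ![χ * μ 0 * ν 1 * ν 2, χ * ν 0 * μ 1 * ν 2, χ * ν 0 * ν 1 * μ 2]
      let f : ℂ → GSp6 F → ℂ := fun s => bigCellSection (∏ i, ω i) (χ * absPow F s) Φ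
      IsHolomorphicSection (∏ i, ω i) χ f ∧
      (∀ (s : ℂ) (z : Matrix (Fin 3) (Fin 3) F) (hz : z.IsSymm),
        f s (J3 F * siegelN z hz) = Φ z) ∧
      (∀ n : ℕ, 1 ≤ n → charConductor χ ≤ n → (∀ i, charConductor (μ i) ≤ n ∧ charConductor (ν i) ≤ n) →
        ∀ W : Fin 3 → GL (Fin 2) F → ℂ,
        (∀ i, W i ∈ whittakerModel ψ (π i) ∧ ∀ a, W i (tT a) = ordKirillov (ν i) a) →
        let R : ℂ → ℂ := fun s =>
          ((1 + (resCard F : ℂ)⁻¹) ^ 3)⁻¹ *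
            (∏ j, ((ν j ϖ : ℂ) / ((resCard F : ℂ) * (μ j ϖ : ℂ))) ^ n) *
            ((χ * ν 0 * ν 1 * ν 2) (-1) : ℂ) *
            (gammaGL2 ψ (π 0) (ω 0) (χ * ν 1 * ν 2) (s + 1 / 2))⁻¹ *
            ((tateGamma ψ ϖ (χ * ν 0 * ν 1 * μ 2) (s + 1 / 2))⁻¹ *
              (tateGamma ψ ϖ (χ * ν 0 * ν 2 * μ 1) (s + 1 / 2))⁻¹)
        Meromorphic R ∧ ∃ σ : ℝ, ∀ s : ℂ, σ < s.re →
          Integrable (zetaIntegrand (fun i => ordTranslate ϖ n (W i)) (f s)) (coordMeasure F) ∧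
          zetaIntegral (fun i => ordTranslate ϖ n (W i)) (f s) = R s) ∧
      (∀ (s : ℂ) (B : Matrix (Fin 3) (Fin 3) F), B.IsSymm →
        Integrable (degWhittakerIntegrand ψ B (f s)) (haarSym F) ∧
        degWhittaker ψ B (f s) =
          ext0 χ (8 * offDiag B 0 * offDiag B 1 * offDiag B 2) *
            ∏ i, (ext0 (μ i) (2 * offDiag B i) *
              Set.indicator {x : F | ‖x‖ = 1} 1 (2 * offDiag B i) *
              Set.indicator {x : F | ‖x‖ < 1} 1 (B i i) *
              ∏ j ∈ Finset.univ.erase i, ext0 (ν j) (2 * offDiag B i)) ∧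
        (degWhittaker ψ B (f s) ≠ 0 ↔ B ∈ XiSet F))) ∧
    -- second part: `πᵢ` is a subrepresentation of `I(μᵢ, νᵢ)` with `μᵢ` unramified
    ((∀ i, IsSubOfPS (π i) (μ i) (ν i)) → (∀ i, IsUnramified (μ i)) →
      let f : ℂ → GSp6 F → ℂ := fun s =>
        bigCellSection (∏ i, ω i)⁻¹ (χ * (∏ i, ω i) * absPow F s)
          (schwartzPhi ψ fun i => χ * ω i)
      IsHolomorphicSection (∏ i, ω i)⁻¹ (χ * ∏ i, ω i) f ∧
      (∀ (s : ℂ) (z : Matrix (Fin 3) (Fin 3) F) (hz : z.IsSymm),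
        f s (J3 F * siegelN z hz) = schwartzPhi ψ (fun i => χ * ω i) z) ∧
      (∀ n : ℕ, 1 ≤ n → charConductor χ ≤ n → (∀ i, charConductor (ω i) ≤ n) →
        (∀ (s : ℂ) (h : groupH F), (∀ i, h.1 i ∈ K0 F (2 * n)) → ∀ g : GSp6 F,
          f s (g * iota h) = f s g * ∏ i, ext0 (ω i) (h.1 i 1 1)) ∧
        ∀ W : Fin 3 → GL (Fin 2) F → ℂ,
        (∀ i, W i ∈ whittakerModel ψ (contragredient (π i)).toRepresentation ∧
          ∀ a, W i (tT a) = ordKirillov (ν i)⁻¹ a) →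
        Meromorphic (fun s => modifiedEuler ψ ϖ (π 0) (ω 0) χ μ ν (s + 1 / 2)) ∧
        ∃ σ : ℝ, ∀ s : ℂ, σ < s.re →
          Integrable (zetaIntegrand (fun i => ordTranslate ϖ n (W i)) (f s)) (coordMeasure F) ∧
          zetaStar ϖ n χ μ ν ω W (f s) s =
            (χ (-1) : ℂ) * modifiedEuler ψ ϖ (π 0) (ω 0) χ μ ν (s + 1 / 2)) ∧
      (∀ (s : ℂ) (B : Matrix (Fin 3) (Fin 3) F), B.IsSymm →
        Integrable (degWhittakerIntegrand ψ B (f s)) (haarSym F) ∧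
        degWhittaker ψ B (f s) = QB B χ ω)) := by
  have : NormalizedField F := ⟨ϖ, hϖ, hnorm⟩
  refine ⟨fun hπ => ?_, fun hπ hμ => ?_⟩
  · refine ⟨isHolomorphicSection_bigCellSection hψ _ χ _,
      fun s z hz => bigCellSection_J3_mul _ _ _ z hz, fun n hn hχ hc W hW => ?_,
      fun s B hB => ?_⟩
    · exact zetaIntegral_quotient hψ hϖ hω hπ hn (trivialMod_of_charConductor_le hχ)
        (fun i => trivialMod_of_charConductor_le (hc i).1)
        (fun i => trivialMod_of_charConductor_le (hc i).2) hW rfl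
    · obtain ⟨h1, h2⟩ := degWhittaker_eq hψ _ (fun z hz =>
        bigCellSection_J3_mul (∏ i, ω i) (χ * absPow F s) _ z hz) hB
      exact ⟨h1, h2.trans (degWhittaker_ordinary χ μ ν B), by
        rw [h2]; exact degWhittaker_ne_zero_iff _ hB⟩
  · refine ⟨isHolomorphicSection_bigCellSection hψ _ _ _,
      fun s z hz => bigCellSection_J3_mul _ _ _ z hz, fun n hn hχ hc => ⟨fun s h hh g => ?_,
        fun W hW => ?_⟩, fun s B hB => ?_⟩
    · exact bigCellSection_mul_iota hψ hn (trivialMod_of_charConductor_le hχ)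
        (fun i => trivialMod_of_charConductor_le (hc i)) s hh g
    · exact zetaStar_sub hψ hϖ hω hπ hμ hn (trivialMod_of_charConductor_le hχ)
        (fun i => trivialMod_of_charConductor_le (hc i)) hW
    · obtain ⟨h1, h2⟩ := degWhittaker_eq hψ _ (fun z hz =>
        bigCellSection_J3_mul (∏ i, ω i)⁻¹ (χ * (∏ i, ω i) * absPow F s) _ z hz) hB
      exact ⟨h1, h2.trans (degWhittaker_twisted χ ω hB)⟩
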